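/- Let $n\ge 1$ and let $G=\mathrm{SU}(n,1)=\{A\in \mathrm{SL}(n+1,\mathbb C): AJA^*=J\}$, $J=\mathrm{diag}(-1,\dots,-1,1)$, act on the unit ball $\mathbb B^n$ by $\begin{pmatrix}a&v\\ w^t&d\end{pmatrix}\cdot z=\frac{az+v}{w^tz+d}$. Let $p:\widetilde G\to G$ be the universal covering group and let $j_\lambda(g,z)=(w^tz+d)^{-\lambda}$, lifted to $\widetilde G\times\mathbb B^n$. Let $\lambda>n$, let $\mathcal H^2_\lambda$ be the weighted Bergman space of holomorphic functions in $L^2(\mathbb B^n,\mu_\lambda)$, $d\mu_\lambda=\frac{\Gamma(\lambda)}{n!\,\Gamma(\lambda-n)}(1-|z|^2)^{\lambda-n-1}dv$ ($v$ = normalized Lebesgue measure), and let $\pi_\lambda(g)f(z)=j_\lambda(g^{-1},z)f(g^{-1}\cdot z)$ be the holomorphic discrete series representation of $\widetilde G$ on $\mathcal H^2_\lambda$. For a subgroup $H\le G$ and $z_0\in\mathbb B^n$ put $\widetilde H=p^{-1}(H)$, $M=H\cdot z_0$, $D_\nu(h)=j_\nu(h,z_0)$ and $\chi_\nu(k)=j_\nu(k,z_0)^{-1}$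 on the isotropy group $\widetilde H_{z_0}$; let $L^2_{\chi_\nu}(M)$ be the space of measurable $f:\widetilde H\to\mathbb C$ with $f(hk)=\chi_\nu(k)^{-1}f(h)$ for $k\in \widetilde H_{z_0}$ and $\int_M|f|^2<\infty$ for an invariant measure on $M$. Let $(RF)(h)=D_\lambda(h)F(h\cdot z_0)$ for $F\in\mathcal H_\lambda^2$. Write $\mathbb T$ for the unit circle with Haar measure of mass one. Consider the following subgroups of $G$ (up to a permutation of the coordinates of $\mathbb C^n$), points $z_0$, groups $Q$ and functions $d:Q\to\mathbb C$, $\varphi_\lambda:Q\to\mathbb C$ (principal branches; empty sums are $0$, and $0^0=1$). (E) Quasi-elliptic: $H=\{a\,\mathrm{diag}(t_1,\dots,t_n,1)\}\cap G$ with $a,t_i\in\mathbb T$; $z_0=(2n)^{-1/2}(1,\dots,1)$, $Q=\mathbb T^n$, $d=1$, $\varphi_\lambda(t)=\bigl(1-\frac1{2n}\sum_i t_i\bigr)^{-\lambda}$. (H) Quasi-hyperbolic, $m=n-1$: $H=\Bigl\{a\,\mathrm{diag}\Bigl(t_1,\dots,t_m,\begin{pmatrix}\cosh s&\sinh s\\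 \sinh s&\cosh s\end{pmatrix}\Bigr)\Bigr\}\cap G$ with $a,t_i\in\mathbb T$, $s\in\mathbb R$; $z_0$ has first $m$ coordinates $(2m)^{-1/2}$ and last coordinate $0$; $Q=\mathbb T^m\times\mathbb R$, $d=\cosh s$, $\varphi_\lambda(t,s)=\bigl(\cosh s-\frac1{2m}\sum_i t_i\bigr)^{-\lambda}$. (N) $n=k+l+1$ with $k,l\ge0$ (quasi-parabolic if $l=0$, nilpotent if $k=0$, quasi-nilpotent otherwise): $H=\Bigl\{a\,\mathrm{diag}\Bigl(t_1,\dots,t_k,\begin{pmatrix}I_l&-ib&-ib\\ -ib^t&1-c&-c\\ ib^t&c&1+c\end{pmatrix}\Bigr)\Bigr\}\cap G$ with $a,t_i\in\mathbb T$, $s\in\mathbb R$, $b\in\mathbb R^l$, $c=\frac12(|b|^2-is)$; $z_0$ has first $k$ coordinates $(2k)^{-1/2}$ and the others $0$; $Q=\mathbb T^k\times\mathbb R\times\mathbb R^l$, $d=1+c$, $\varphi_\lambda(t,s,b)=2^\lambda\bigl(-is+|b|^2+2-\frac1k\sum_i t_i\bigr)^{-\lambda}$. Then the following hold. 1. All these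 groups are maximal abelian in $G$, and every maximal abelian subgroup of $G$ is conjugate in $G$ to one of them. 2. In each case $\widetilde H$ is isomorphic, as a topological group, to the group of all $(q,x)\in Q\times\mathbb R$ with $e^{2\pi i(n+1)x}\prod_i t_i=1$, where $(q,x)$ lies over the matrix with parameters $q$ and $a=e^{2\pi ix}$, and $D_\nu(q,x)=e^{-2\pi i\nu x}d(q)^{-\nu}$ for all $\nu\in\mathbb R$. The map $(q,x)\mapsto q$ induces a continuous bijection of $Q$ onto $M$, and the image on $M$ of the Haar measure of $Q$ (Haar probability on the circle factors, Lebesgue measure on the others) is $H$-invariant; this measure is used below. Moreover $D_\lambda\in L^2_{\chi_\lambda}(M)$ and $\varphi_\lambda\in L^1(Q)$. More precisely, for real $\nu$: $D_\nu\in L^2_{\chi_\nu}(M)$ always in case (E), if and only if $\nu>0$ in case (H), and if and only if $\nu>\frac{l+2}4$ in case (N); and $\varphi_\nu\in L^1(Q)$ always in case (E), for $\nu>0$ in case (H), and for $\nu>\frac{l+2}2$ in case (N). 3. $R$ is an injective bounded operator $\mathcal H_\lambda^2\to L^2_{\chi_\lambda}(M)$, and for every $f\in L^2_{\chi_\lambda}(M)$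 the function $f(q,x)e^{2\pi i\lambda x}$ depends only on $q$, defines $\widetilde f\in L^2(Q)$, and $$(RR^*f)(q,x)=e^{-2\pi i\lambda x}\,(\widetilde f*\varphi_\lambda)(q)\qquad\text{for all }(q,x)\in\widetilde H .$$ 4. With $\widehat\varphi(\alpha)=\int\varphi(t)t^{-\alpha}dt$ on tori and $\widehat\varphi(\xi)=(2\pi)^{-r/2}\int_{\mathbb R^r}\varphi(x)e^{-i\langle x,\xi\rangle}dx$ on $\mathbb R^r$, for $\alpha$ with all $\alpha_i\ge0$, $|\alpha|=\sum_i\alpha_i$ and $\alpha!=\prod_i\alpha_i!$: (E) $\widehat{\varphi_\lambda}(\alpha)=(2n)^{-|\alpha|}\dfrac{\Gamma(\lambda+|\alpha|)}{\Gamma(\lambda)\,\alpha!}$; (H) $\widehat{\varphi_\lambda}(\alpha,\xi)=\dfrac{2^{\lambda-1}}{\sqrt{2\pi}\,m^{|\alpha|}}\,\dfrac{\Gamma\bigl(\frac{\lambda+|\alpha|+i\xi}2\bigr)\Gamma\bigl(\frac{\lambda+|\alpha|-i\xi}2\bigr)}{\Gamma(\lambda)\,\alpha!}$ for all $\xi\in\mathbb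 R$; (N) $\widehat{\varphi_\lambda}(\alpha,y,\xi)=\dfrac{\sqrt{2\pi}\,2^\lambda}{\Gamma(\lambda)\,k^{|\alpha|}\,\alpha!}\;y^{\lambda+|\alpha|-1}(2y)^{-l/2}e^{-2y}e^{-|\xi|^2/(4y)}$ for $y>0$, $\xi\in\mathbb R^l$. All these transforms vanish if some $\alpha_i<0$, and in case (N) also if $y\le0$. 5. $\pi_\lambda$ is a unitary representation of $\widetilde G$ on $\mathcal H^2_\lambda$, and its restriction to $\widetilde H$ is multiplicity free (i.e. the algebra of bounded operators on $\mathcal H^2_\lambda$ commuting with $\pi_\lambda(\widetilde H)$ is commutative) for every maximal abelian subgroup $H$ of $G$. -/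

import Mathlib

open MeasureTheory Complex
open scoped ENNReal ComplexConjugate ComplexInnerProductSpace Convolution

noncomputable section

namespace BallRestriction

/-! ## The group `SU(n,1)` and its action on the unit ball -/

/-- The open unit ball of `ℂⁿ` (with the Hermitian norm). -/
abbrev Ball (n : ℕ) : Type := Metric.ball (0 : EuclideanSpace ℂ (Fin n)) 1

/-- Matrices of size `n + 1`; the last row and column carry the index `Sum.inr ()`. -/
abbrev Mat (n : ℕ) : Type := Matrix (Fin n ⊕ Unit) (Fin n ⊕ Unit) ℂ

/-- `J = diag(-1, …, -1, 1)`. -/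
def J (n : ℕ) : Mat n := Matrix.diagonal (Sum.elim (fun _ => -1) (fun _ => 1))

lemma J_mul_J (n : ℕ) : J n * J n = 1 := by
  rw [J, Matrix.diagonal_mul_diagonal, ← Matrix.diagonal_one]
  congr 1
  ext (i | i) <;> simp

/-- `SU(n,1)`: the matrices `A` with `det A = 1` and `A J A* = J`. -/
def SU (n : ℕ) : Subgroup (Matrix.SpecialLinearGroup (Fin n ⊕ Unit) ℂ) where
  carrier := {A | (A : Mat n) * J n * (A : Mat n).conjTranspose = J n}
  one_mem' := by simp
  mul_mem' := by
    intro A B hA hB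
    simp only [Set.mem_ofPred_eq, Matrix.SpecialLinearGroup.coe_mul,
      Matrix.conjTranspose_mul] at *
    calc (A : Mat n) * B * J n * (B.1.conjTranspose * A.1.conjTranspose)
        = A * ((B : Mat n) * J n * B.1.conjTranspose) * A.1.conjTranspose := by
          simp only [Matrix.mul_assoc]
      _ = J n := by rw [hB, hA]
  inv_mem' := by
    intro A hA
    simp only [Set.mem_ofPred_eq] at *
    have h1 : ((A⁻¹ : Matrix.SpecialLinearGroup (Fin n ⊕ Unit) ℂ) : Mat n) * A = 1 := by
      rw [← Matrix.SpecialLinearGroup.coe_mul, inv_mul_cancel,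
        Matrix.SpecialLinearGroup.coe_one]
    have h2 : (A : Mat n).conjTranspose *
        ((A⁻¹ : Matrix.SpecialLinearGroup (Fin n ⊕ Unit) ℂ) : Mat n).conjTranspose = 1 := by
      rw [← Matrix.conjTranspose_mul, h1, Matrix.conjTranspose_one]
    conv_lhs => rw [← hA]
    calc _ = (((A⁻¹ : Matrix.SpecialLinearGroup (Fin n ⊕ Unit) ℂ) : Mat n) * A) * J n *
          ((A : Mat n).conjTranspose *
            ((A⁻¹ : Matrix.SpecialLinearGroup (Fin n ⊕ Unit) ℂ) : Mat n).conjTranspose) := by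
          simp only [Matrix.mul_assoc]
      _ = J n := by rw [h1, h2, Matrix.one_mul, Matrix.mul_one]

/-- The underlying matrix of an element of `SU(n,1)`. -/
def toMat {n : ℕ} (g : SU n) : Mat n := ((g : Matrix.SpecialLinearGroup (Fin n ⊕ Unit) ℂ) : Mat n)

lemma toMat_mul {n : ℕ} (g h : SU n) : toMat (g * h) = toMat g * toMat h := by simp [toMat]

lemma toMat_one {n : ℕ} : toMat (1 : SU n) = 1 := by simp [toMat]

lemma toMat_ext {n : ℕ} {g h : SU n} (H : toMat g = toMat h) : g = h :=
  Subtype.ext (Subtype.ext H)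

/-- The column `(z, 1)`. -/
def homog {n : ℕ} (z : EuclideanSpace ℂ (Fin n)) : Fin n ⊕ Unit → ℂ :=
  Sum.elim (fun i => z i) (fun _ => 1)

/-- For `g = (a v; wᵗ d)` this is the vector `a z + v`. -/
def num {n : ℕ} (g : SU n) (z : EuclideanSpace ℂ (Fin n)) : EuclideanSpace ℂ (Fin n) :=
  WithLp.toLp 2 fun i => ((toMat g).mulVec (homog z)) (Sum.inl i)

/-- For `g = (a v; wᵗ d)` this is the number `wᵗ z + d`. -/
def den {n : ℕ} (g : SU n) (z : EuclideanSpace ℂ (Fin n)) : ℂ :=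
  ((toMat g).mulVec (homog z)) (Sum.inr ())

lemma mulVec_homog {n : ℕ} (g : SU n) (z : EuclideanSpace ℂ (Fin n)) :
    (toMat g).mulVec (homog z) = Sum.elim (fun i => num g z i) (fun _ => den g z) := by
  ext (i | i) <;> simp [num, den]

/-- `A J A* = J` implies `A* J A = J`. -/
lemma SU.conj_left {n : ℕ} (g : SU n) : (toMat g).conjTranspose * J n * toMat g = J n := by
  have h : toMat g * J n * (toMat g).conjTranspose = J n := g.2
  have h1 : toMat g * (J n * (toMat g).conjTranspose * J n) = 1 := by
    calc _ = (toMat g * J n * (toMat g).conjTranspose) * J n := by simp only [Matrix.mul_assoc]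
      _ = 1 := by rw [h, J_mul_J]
  have h2 := mul_eq_one_comm.mp h1
  calc _ = J n * (J n * (toMat g).conjTranspose * J n * toMat g) := by
        simp only [← Matrix.mul_assoc, J_mul_J, Matrix.one_mul]
    _ = J n := by rw [h2, Matrix.mul_one]

lemma form_eq {n : ℕ} (v : Fin n ⊕ Unit → ℂ) :
    star v ⬝ᵥ ((J n).mulVec v) =
      ((‖v (Sum.inr ())‖ ^ 2 - ∑ i, ‖v (Sum.inl i)‖ ^ 2 : ℝ) : ℂ) := by
  have hc : ∀ w : ℂ, (starRingEnd ℂ) w * w = ((‖w‖ ^ 2 : ℝ) : ℂ) := by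
    intro w; rw [mul_comm, Complex.mul_conj, Complex.normSq_eq_norm_sq]
  simp only [J, Matrix.mulVec_diagonal, dotProduct, Fintype.sum_sum_type, Pi.star_apply,
    Sum.elim_inl, Sum.elim_inr, Finset.univ_unique, Finset.sum_singleton, RCLike.star_def]
  have h1 : ∀ i : Fin n, (starRingEnd ℂ) (v (Sum.inl i)) * (-1 * v (Sum.inl i)) =
      -((‖v (Sum.inl i)‖ ^ 2 : ℝ) : ℂ) := by
    intro i; rw [← hc]; ring
  simp only [h1, one_mul, PUnit.default_eq_unit, hc]
  push_cast
  rw [Finset.sum_neg_distrib]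
  ring

lemma norm_identity {n : ℕ} (g : SU n) (z : EuclideanSpace ℂ (Fin n)) :
    ‖den g z‖ ^ 2 - ‖num g z‖ ^ 2 = 1 - ‖z‖ ^ 2 := by
  have h : star ((toMat g).mulVec (homog z)) ⬝ᵥ ((J n).mulVec ((toMat g).mulVec (homog z))) =
      star (homog z) ⬝ᵥ ((J n).mulVec (homog z)) := by
    rw [Matrix.star_mulVec, Matrix.mulVec_mulVec, ← Matrix.dotProduct_mulVec,
      Matrix.mulVec_mulVec, ← Matrix.mul_assoc, SU.conj_left]
  rw [form_eq, form_eq, mulVec_homog] at h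
  have h' := Complex.ofReal_injective h
  rw [EuclideanSpace.norm_sq_eq, EuclideanSpace.norm_sq_eq]
  simpa [homog] using h'

lemma ball_sq {n : ℕ} (z : Ball n) : ‖(z : EuclideanSpace ℂ (Fin n))‖ ^ 2 < 1 := by
  have h : ‖(z : EuclideanSpace ℂ (Fin n))‖ < 1 := by exact mem_ball_zero_iff.mp z.2
  have := norm_nonneg (z : EuclideanSpace ℂ (Fin n))
  nlinarith

lemma den_ne_zero {n : ℕ} (g : SU n) (z : Ball n) : den g z ≠ 0 := by
  intro h
  have h1 := norm_identity g z
  have h2 := ball_sq z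
  rw [h] at h1
  have := sq_nonneg ‖num g (z : EuclideanSpace ℂ (Fin n))‖
  simp at h1
  linarith

/-- The fractional linear action `g · z = (a z + v) / (wᵗ z + d)` on the ball. -/
def act {n : ℕ} (g : SU n) (z : Ball n) : Ball n :=
  ⟨(den g z)⁻¹ • num g z, by
    have h1 := norm_identity g z
    have h2 := ball_sq z
    have h3 : 0 < ‖den g z‖ := norm_pos_iff.mpr (den_ne_zero g z)
    rw [mem_ball_zero_iff, norm_smul, norm_inv, inv_mul_lt_iff₀ h3, mul_one]
    have := norm_nonneg (num g (z : EuclideanSpace ℂ (Fin n)))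
    nlinarith⟩

lemma mulVec_act {n : ℕ} (g : SU n) (z : Ball n) :
    (toMat g).mulVec (homog z) = den g z • homog (act g z : EuclideanSpace ℂ (Fin n)) := by
  rw [mulVec_homog]
  ext (i | i)
  · simp [homog, act, mul_inv_cancel_left₀ (den_ne_zero g z)]
  · simp [homog]

lemma mulVec_mul_act {n : ℕ} (g h : SU n) (z : Ball n) :
    (toMat (g * h)).mulVec (homog z) =
      (den h z * den g (act h z)) • homog (act g (act h z) : EuclideanSpace ℂ (Fin n)) := by
  rw [toMat_mul, ← Matrix.mulVec_mulVec, mulVec_act h z, Matrix.mulVec_smul, mulVec_act g,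
    smul_smul]

/-- The cocycle identity for `wᵗ z + d`. -/
lemma den_mul {n : ℕ} (g h : SU n) (z : Ball n) :
    den (g * h) z = den g (act h z) * den h z := by
  have := congrFun (mulVec_mul_act g h z) (Sum.inr ())
  simpa [den, homog, mul_comm] using this

lemma den_one {n : ℕ} (z : Ball n) : den (1 : SU n) z = 1 := by
  simp [den, toMat_one, homog]

lemma act_one {n : ℕ} (z : Ball n) : act (1 : SU n) z = z := by
  apply Subtype.ext
  ext i
  simp [act, den_one, num, toMat_one, homog]

lemma act_mul {n : ℕ} (g h : SU n) (z : Ball n) : act (g * h) z = act g (act h z) := by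
  apply Subtype.ext
  ext i
  have h1 := congrFun (mulVec_mul_act g h z) (Sum.inl i)
  rw [mulVec_act, den_mul, mul_comm (den h z)] at h1
  have hne : den g (act h z) * den h z ≠ 0 :=
    mul_ne_zero (den_ne_zero g _) (den_ne_zero h _)
  simpa [homog, hne, den_ne_zero] using h1

instance {n : ℕ} : MulAction (SU n) (Ball n) where
  smul := act
  one_smul := act_one
  mul_smul := act_mul

lemma continuous_mulVec {n : ℕ} (g : SU n) :
    Continuous fun z : Ball n => (toMat g).mulVec (homog (z : EuclideanSpace ℂ (Fin n))) := by
  apply Continuous.matrix_mulVec continuous_const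
  apply continuous_pi
  rintro (i | i)
  · simp only [homog, Sum.elim_inl]; fun_prop
  · simp only [homog, Sum.elim_inr]; fun_prop

lemma continuous_den {n : ℕ} (g : SU n) :
    Continuous fun z : Ball n => den g (z : EuclideanSpace ℂ (Fin n)) :=
  (continuous_apply (Sum.inr ())).comp (continuous_mulVec g)

lemma continuous_act {n : ℕ} (g : SU n) : Continuous (act g) := by
  apply Continuous.subtype_mk
  refine Continuous.fun_smul ((continuous_den g).inv₀ (den_ne_zero g)) ?_
  · apply (PiLp.continuous_toLp 2 _).comp
    apply continuous_pi
    intro i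
    exact (continuous_apply (Sum.inl i)).comp (continuous_mulVec g)

/-! ## The universal covering group -/

/-- The universal covering group of `SU(n,1)`, realised as the group of pairs of an element
`g = (a v; wᵗ d)` of `SU(n,1)` and a continuous logarithm of `z ↦ wᵗ z + d` on the ball.
(It is the pull-back of the covering `exp : ℂ → ℂˣ` along `g ↦ d`; on the maximal compact subgroup
`U(n)` this is `a ↦ (det a)⁻¹`, which induces an isomorphism of fundamental groups.) -/
@[ext]
structure Gtilde (n : ℕ) where
  /-- the element of `SU(n,1)` -/
  base : SU n
  /-- the logarithm of the automorphy factor -/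
  log : Ball n → ℂ
  log_continuous : Continuous log
  exp_log : ∀ z, exp (log z) = den base z

namespace Gtilde

variable {n : ℕ}

instance : Mul (Gtilde n) where
  mul g h :=
    { base := g.base * h.base
      log := fun z => g.log (h.base • z) + h.log z
      log_continuous :=
        (g.log_continuous.comp (continuous_act h.base)).add h.log_continuous
      exp_log := fun z => by
        rw [exp_add, g.exp_log, h.exp_log, den_mul]; rfl }

instance : One (Gtilde n) where
  one :=
    { base := 1
      log := fun _ => 0
      log_continuous := continuous_const
      exp_log := fun z => by rw [exp_zero, den_one] }

instance : Inv (Gtilde n) where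
  inv g :=
    { base := g.base⁻¹
      log := fun z => -g.log (g.base⁻¹ • z)
      log_continuous := (g.log_continuous.comp (continuous_act g.base⁻¹)).neg
      exp_log := fun z => by
        rw [exp_neg, g.exp_log]
        have h := den_mul g.base g.base⁻¹ z
        rw [mul_inv_cancel, den_one] at h
        exact inv_eq_of_mul_eq_one_right h.symm }

lemma base_mul (g h : Gtilde n) : (g * h).base = g.base * h.base := rfl
lemma log_mul (g h : Gtilde n) (z : Ball n) :
    (g * h).log z = g.log (h.base • z) + h.log z := rfl
lemma base_one : (1 : Gtilde n).base = 1 := rfl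
lemma log_one (z : Ball n) : (1 : Gtilde n).log z = 0 := rfl
lemma base_inv (g : Gtilde n) : (g⁻¹).base = g.base⁻¹ := rfl
lemma log_inv (g : Gtilde n) (z : Ball n) : (g⁻¹).log z = -g.log (g.base⁻¹ • z) := rfl

instance : Group (Gtilde n) :=
  Group.ofLeftAxioms
    (fun a b c => by
      ext1
      · simp only [base_mul, mul_assoc]
      · funext z
        simp only [log_mul, base_mul, mul_smul, add_assoc])
    (fun a => by
      ext1
      · simp only [base_mul, base_one, one_mul]
      · funext z
        simp only [log_mul, log_one, zero_add])
    (fun a => by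
      ext1
      · simp only [base_mul, base_inv, base_one, inv_mul_cancel]
      · funext z
        simp only [log_mul, log_inv, log_one, inv_smul_smul, neg_add_cancel])

/-- The covering map onto `SU(n,1)`. -/
def proj (n : ℕ) : Gtilde n →* SU n where
  toFun := Gtilde.base
  map_one' := rfl
  map_mul' _ _ := rfl

instance : MulAction (Gtilde n) (Ball n) := MulAction.compHom (Ball n) (proj n)

/-- The topology of the covering: that of the pairs `(g, τ)` with `exp τ = d`. -/
instance : TopologicalSpace (Gtilde n) :=
  TopologicalSpace.induced
    (fun g => ((toMat g.base, g.log ⟨0, Metric.mem_ball_self one_pos⟩) : Mat n × ℂ)) inferInstance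

instance : MeasurableSpace (Gtilde n) := borel _

/-- The automorphy factor `j_λ(g, z) = (wᵗ z + d)^{-λ}`, lifted to the universal covering. -/
def j (lam : ℝ) (g : Gtilde n) (z : Ball n) : ℂ := exp (-lam * g.log z)

end Gtilde

/-! ## Weighted Bergman spaces and the holomorphic discrete series -/

/-- Lebesgue measure on the ball, normalised to a probability measure. -/
def ballMeasure (n : ℕ) : Measure (EuclideanSpace ℂ (Fin n)) :=
  (volume (Metric.ball (0 : EuclideanSpace ℂ (Fin n)) 1))⁻¹ •
    volume.restrict (Metric.ball (0 : EuclideanSpace ℂ (Fin n)) 1)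

/-- `dμ_λ = Γ(λ) / (n! Γ(λ - n)) (1 - |z|²)^{λ - n - 1} dv` on the ball. -/
def bergmanMeasure (n : ℕ) (lam : ℝ) : Measure (EuclideanSpace ℂ (Fin n)) :=
  (ballMeasure n).withDensity fun z => ENNReal.ofReal
    (Real.Gamma lam / (n.factorial * Real.Gamma (lam - n)) * (1 - ‖z‖ ^ 2) ^ (lam - n - 1))

/-- The weighted Bergman space: the classes in `L²(μ_λ)` with a representative that is holomorphic
on the ball. -/
def Bergman (n : ℕ) (lam : ℝ) : Submodule ℂ (Lp ℂ 2 (bergmanMeasure n lam)) where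
  carrier := {F | ∃ f : EuclideanSpace ℂ (Fin n) → ℂ,
    DifferentiableOn ℂ f (Metric.ball 0 1) ∧ F =ᵐ[bergmanMeasure n lam] f}
  add_mem' := by
    rintro F G ⟨f, hf, hF⟩ ⟨g, hg, hG⟩
    exact ⟨f + g, hf.add hg, (Lp.coeFn_add F G).trans (hF.add hG)⟩
  zero_mem' := ⟨0, differentiableOn_const 0, Lp.coeFn_zero _ _ _⟩
  smul_mem' := by
    rintro c F ⟨f, hf, hF⟩
    exact ⟨c • f, hf.const_smul c, (Lp.coeFn_smul c F).trans (hF.const_smul c)⟩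

/-- The value at a point of the ball of (the holomorphic representative of) an element of the
Bergman space. -/
def Bergman.eval {n : ℕ} {lam : ℝ} (F : Bergman n lam) (z : Ball n) : ℂ :=
  Classical.choose F.2 (z : EuclideanSpace ℂ (Fin n))

/-- A unitary representation is multiplicity free if its intertwining algebra is commutative. -/
def MultiplicityFree {Γ E : Type*} [Group Γ] [NormedAddCommGroup E] [InnerProductSpace ℂ E]
    (π : Γ →* (E ≃ₗᵢ[ℂ] E)) : Prop :=
  ∀ S T : E →L[ℂ] E, (∀ γ v, S (π γ v) = π γ (S v)) → (∀ γ v, T (π γ v) = π γ (T v)) →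
    ∀ v, S (T v) = T (S v)

/-- Maximal among the abelian subgroups. -/
def IsMaximalAbelian {G : Type*} [Group G] (H : Subgroup G) : Prop :=
  Maximal (fun K : Subgroup G => ∀ x ∈ K, ∀ y ∈ K, x * y = y * x) H

/-! ## The restriction principle for the orbit of a subgroup -/

section Restriction

variable {n : ℕ}

/-- The inverse image of `H` in the universal covering group. -/
abbrev Htilde (H : Subgroup (SU n)) : Subgroup (Gtilde n) := H.comap (Gtilde.proj n)

/-- `D_λ(h) = j_λ(h, z₀)`. -/
def D (H : Subgroup (SU n)) (z₀ : Ball n) (lam : ℝ) (h : Htilde H) : ℂ :=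
  Gtilde.j lam (h : Gtilde n) z₀

/-- `χ_λ(h) = j_λ(h, z₀)⁻¹`, a character of the isotropy group of `z₀`. -/
def chi (H : Subgroup (SU n)) (z₀ : Ball n) (lam : ℝ) (h : Htilde H) : ℂ :=
  (Gtilde.j lam (h : Gtilde n) z₀)⁻¹

/-- A function on the covering group of `H` which is invariant on the right under the isotropy
group of `z₀`, considered as a function on the orbit of `z₀` (and extended by `0`). -/
def descend {H : Subgroup (SU n)} (z₀ : Ball n) (g : Htilde H → ℂ) (m : Ball n) : ℂ :=
  open Classical in if hm : ∃ h : Htilde H, h • z₀ = m then g hm.choose else 0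

/-- The space `L²_{χ_λ}(M, μ)` on the orbit `M` of `z₀`: measurable functions on the covering group
of `H` with `f(h k) = χ_λ(k)⁻¹ f(h)` for `k` in the isotropy group, and `∫_M |f|² dμ < ∞`. -/
def MemL2 {H : Subgroup (SU n)} (z₀ : Ball n) (μ : Measure (Ball n)) (lam : ℝ)
    (f : Htilde H → ℂ) : Prop :=
  Measurable f ∧
  (∀ h, ∀ k ∈ MulAction.stabilizer (Htilde H) z₀, f (h * k) = (chi H z₀ lam k)⁻¹ * f h) ∧
  ∫⁻ m, ‖descend z₀ (H := H) f m‖ₑ ^ 2 ∂μ < ∞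

/-- The restriction operator `(R F)(h) = D_λ(h) F(h · z₀)`. -/
def R (H : Subgroup (SU n)) (z₀ : Ball n) {lam : ℝ} (F : Bergman n lam) (h : Htilde H) : ℂ :=
  D H z₀ lam h * Bergman.eval F (h • z₀)

/-- `F` is the value `R* f` of the adjoint of the restriction operator:
`⟨F, F'⟩_λ = ∫_M conj(f) · R F' dμ` for all `F'` (the inner product is linear in the second
variable). -/
def IsAdjointValue {H : Subgroup (SU n)} (z₀ : Ball n) (μ : Measure (Ball n)) {lam : ℝ}
    (f : Htilde H → ℂ) (F : Bergman n lam) : Prop :=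
  ∀ F' : Bergman n lam,
    inner ℂ F F' = ∫ m, descend z₀ (fun h => conj (f h) * R H z₀ F' h) m ∂μ

/-- Coordinates on the covering group of `H`, for which it becomes a group `L` of pairs `(q, x)`
with `q` in an abelian group `Q` and `x` real; `mat q a` is the general matrix of `H`, where
`a ∈ ℝ/ℤ` stands for `exp(2πia)`, and `exp(2πix) d(q)` is the automorphy factor at `z₀`. The first
coordinate identifies the orbit of `z₀` with `Q`. -/
structure OrbitCoordinates (H : Subgroup (SU n)) (z₀ : Ball n) {Q : Type} [AddCommGroup Q]
    [TopologicalSpace Q] (L : AddSubgroup (Q × ℝ)) (mat : Q → UnitAddCircle → Mat n)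
    (d : Q → ℂ) where
  /-- the isomorphism of topological groups of the covering group with `L` -/
  iso : Htilde H ≃ₜ* Multiplicative L
  /-- the parametrisation of the orbit -/
  orb : Q → Ball n
  mat_eq : ∀ h : Htilde H, toMat (h : Gtilde n).base =
    mat ((iso h).toAdd : Q × ℝ).1 (((iso h).toAdd : Q × ℝ).2 : ℝ)
  log_eq : ∀ h : Htilde H, (h : Gtilde n).log z₀ =
    2 * Real.pi * I * ((iso h).toAdd : Q × ℝ).2 + Complex.log (d ((iso h).toAdd : Q × ℝ).1)
  surjective : ∀ q : Q, ∃ h : Htilde H, ((iso h).toAdd : Q × ℝ).1 = q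
  orb_eq : ∀ h : Htilde H, orb ((iso h).toAdd : Q × ℝ).1 = h • z₀
  orb_continuous : Continuous orb
  orb_injective : Function.Injective orb

namespace OrbitCoordinates

variable {H : Subgroup (SU n)} {z₀ : Ball n} {Q : Type} [AddCommGroup Q]
  [TopologicalSpace Q] {L : AddSubgroup (Q × ℝ)} {mat : Q → UnitAddCircle → Mat n} {d : Q → ℂ}

/-- The projection of the covering group onto `Q`. -/
def pt (c : OrbitCoordinates H z₀ L mat d) (h : Htilde H) : Q := ((c.iso h).toAdd : Q × ℝ).1

/-- The real coordinate on the covering group. -/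
def ht (c : OrbitCoordinates H z₀ L mat d) (h : Htilde H) : ℝ := ((c.iso h).toAdd : Q × ℝ).2

/-- The invariant measure on the orbit: the image of the Haar measure of `Q`. -/
def orbitMeasure [MeasureSpace Q] (c : OrbitCoordinates H z₀ L mat d) : Measure (Ball n) :=
  (volume : Measure Q).map c.orb

end OrbitCoordinates

/-- `f` times the extended character `(q, x) ↦ exp(2πiλx)` is the pull-back of `ft` under
the projection to `Q`. -/
def IsTilde {H : Subgroup (SU n)} {z₀ : Ball n} {Q : Type} [AddCommGroup Q]
    [TopologicalSpace Q] {L : AddSubgroup (Q × ℝ)} {mat : Q → UnitAddCircle → Mat n} {d : Q → ℂ}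
    (c : OrbitCoordinates H z₀ L mat d) (lam : ℝ) (f : Htilde H → ℂ) (ft : Q → ℂ) : Prop :=
  ∀ h, ft (c.pt h) = f h * exp (2 * Real.pi * I * lam * c.ht h)

/-- The restriction principle for the orbit of `z₀` under `H`, made explicit:
in suitable coordinates, the image of the Haar measure of `Q` is an invariant measure on the
orbit, `D_ν` is the explicit function `exp(-2πiνx) d(q)^{-ν}` and belongs to `L²_{χ_ν}` exactly for
`ν ∈ SD`, and `φ_ν` is integrable for `ν ∈ SL`; furthermore `φ_λ` is integrable, `R` is an
injective bounded operator from the Bergman space to `L²_{χ_λ}`, and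
`R R* f = χ_{-λ} · (f~ * φ_λ)` for all `f` in `L²_{χ_λ}`. -/
def ExplicitRestriction (lam : ℝ) (H : Subgroup (SU n)) (z₀ : Ball n) {Q : Type}
    [AddCommGroup Q] [TopologicalSpace Q] [MeasureSpace Q] (L : AddSubgroup (Q × ℝ))
    (mat : Q → UnitAddCircle → Mat n) (d : Q → ℂ) (φ : ℝ → Q → ℂ) (SD SL : Set ℝ) : Prop :=
  ∃ c : OrbitCoordinates H z₀ L mat d,
    (∀ g ∈ H, c.orbitMeasure.map (fun z => g • z) = c.orbitMeasure) ∧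
    (∀ (ν : ℝ) (h : Htilde H), D H z₀ ν h =
      exp (-2 * Real.pi * I * ν * c.ht h) * d (c.pt h) ^ (-ν : ℂ)) ∧
    (∀ ν : ℝ, MemL2 z₀ c.orbitMeasure ν (D H z₀ ν) ↔ ν ∈ SD) ∧
    (∀ ν ∈ SL, Integrable (φ ν)) ∧
    MemL2 z₀ c.orbitMeasure lam (D H z₀ lam) ∧
    Integrable (φ lam) ∧
    (∀ F : Bergman n lam, MemL2 z₀ c.orbitMeasure lam (R H z₀ F)) ∧
    (∃ C : ℝ, ∀ F : Bergman n lam,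
      ∫⁻ m, ‖descend z₀ (R H z₀ F) m‖ₑ ^ 2 ∂c.orbitMeasure ≤ ENNReal.ofReal (C * ‖F‖ ^ 2)) ∧
    (∀ F : Bergman n lam, (∀ h, R H z₀ F h = 0) → F = 0) ∧
    ∀ f : Htilde H → ℂ, MemL2 z₀ c.orbitMeasure lam f →
      ∃ ft : Q → ℂ, IsTilde c lam f ft ∧ MemLp ft 2 ∧
        ∃ F : Bergman n lam, IsAdjointValue z₀ c.orbitMeasure f F ∧
          ∀ h, ConvolutionExistsAt ft (φ lam) (c.pt h) (ContinuousLinearMap.mul ℂ ℂ) volume ∧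
            R H z₀ F h = exp (-2 * Real.pi * I * lam * c.ht h) *
              (ft ⋆[ContinuousLinearMap.mul ℂ ℂ, volume] φ lam) (c.pt h)

end Restriction

/-! ## The maximal abelian subgroups -/

/-- `exp(2πiθ)` for `θ ∈ ℝ/ℤ`. -/
def expc (θ : UnitAddCircle) : ℂ := (AddCircle.toCircle θ : ℂ)

lemma expc_add (θ η : UnitAddCircle) : expc (θ + η) = expc θ * expc η := by
  simp [expc, AddCircle.toCircle_add]

lemma expc_zero : expc 0 = 1 := by simp [expc]

/-- The subgroup of all elements of `SU(n,1)` of the form `M p`, for a multiplicative family `M` of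
matrices. -/
def paramSubgroup {n : ℕ} {P : Type*} [AddCommGroup P] (M : P → Mat n) (h0 : M 0 = 1)
    (hadd : ∀ p q, M (p + q) = M p * M q) : Subgroup (SU n) where
  carrier := {g | ∃ p, toMat g = M p}
  one_mem' := ⟨0, by rw [toMat_one, h0]⟩
  mul_mem' := by
    rintro a b ⟨p, hp⟩ ⟨q, hq⟩
    exact ⟨p + q, by rw [toMat_mul, hp, hq, hadd]⟩
  inv_mem' := by
    rintro a ⟨p, hp⟩
    refine ⟨-p, ?_⟩
    have h1 : toMat a⁻¹ * toMat a = 1 := by rw [← toMat_mul, inv_mul_cancel, toMat_one]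
    have h2 : toMat a * M (-p) = 1 := by rw [hp, ← hadd, add_neg_cancel, h0]
    calc toMat a⁻¹ = toMat a⁻¹ * (toMat a * M (-p)) := by rw [h2, Matrix.mul_one]
      _ = M (-p) := by rw [← Matrix.mul_assoc, h1, Matrix.one_mul]

/-- The base point all of whose first `k` coordinates (in the numbering `ε`) are `1/√(2k)` and
whose other coordinates vanish. -/
def basePoint {n k : ℕ} {β : Type} [Fintype β] (ε : Fin k ⊕ β ≃ Fin n) : Ball n :=
  ⟨WithLp.toLp 2 fun i => Sum.elim (fun _ => ((1 / √(2 * k) : ℝ) : ℂ)) (fun _ => 0) (ε.symm i), by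
    rw [mem_ball_zero_iff, ← sq_lt_one_iff₀ (norm_nonneg _), EuclideanSpace.norm_sq_eq,
      ← ε.sum_comp]
    simp only [Equiv.symm_apply_apply, Fintype.sum_sum_type, Sum.elim_inl, Sum.elim_inr,
      Complex.norm_real, Finset.sum_const, Finset.card_univ, Fintype.card_fin, nsmul_eq_mul,
      norm_zero, Real.norm_eq_abs, sq_abs, div_pow, one_pow]
    rw [Real.sq_sqrt (by positivity)]
    rcases Nat.eq_zero_or_pos k with rfl | hk
    · norm_num
    · have : (0 : ℝ) < k := by exact_mod_cast hk
      field_simp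
      norm_num⟩

/-! ### The quasi-elliptic group -/

/-- The matrix `diag(a t₁, …, a tₙ, a)`. -/
def matE {n : ℕ} (t : Fin n → UnitAddCircle) (a : UnitAddCircle) : Mat n :=
  expc a • Matrix.diagonal (Sum.elim (fun i => expc (t i)) (fun _ => 1))

/-- The quasi-elliptic group `E(n)`. -/
def ellipticGroup (n : ℕ) : Subgroup (SU n) :=
  paramSubgroup (fun p : (Fin n → UnitAddCircle) × UnitAddCircle => matE p.1 p.2)
    (by
      ext (i | i) (j | j) <;> simp [matE, expc_zero, Matrix.one_apply])
    (by
      intro p q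
      simp only [matE, Prod.fst_add, Prod.snd_add, Pi.add_apply, expc_add, Matrix.smul_mul,
        Matrix.mul_smul, Matrix.diagonal_mul_diagonal, smul_smul]
      rw [mul_comm (expc p.2)]
      congr 2
      funext i
      rcases i with i | i <;> simp)

/-- `z₀ = (1/√(2n), …, 1/√(2n))`. -/
def ellipticPoint (n : ℕ) : Ball n := basePoint (Equiv.sumEmpty (Fin n) Empty)

/-- The covering group of `E(n)`: pairs `(t, x)` with `exp(2πi(n+1)x) t₁ ⋯ tₙ = 1`. -/
def ellipticCover (n : ℕ) : AddSubgroup ((Fin n → UnitAddCircle) × ℝ) where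
  carrier := {p | (((n + 1) * p.2 : ℝ) : UnitAddCircle) + ∑ i, p.1 i = 0}
  zero_mem' := by simp
  add_mem' := by
    intro p q hp hq
    simp only [Set.mem_ofPred_eq, Prod.fst_add, Prod.snd_add, Pi.add_apply, mul_add,
      AddCircle.coe_add, Finset.sum_add_distrib] at *
    rw [add_add_add_comm, hp, hq, add_zero]
  neg_mem' := by
    intro p hp
    simp only [Set.mem_ofPred_eq, Prod.fst_neg, Prod.snd_neg, Pi.neg_apply, mul_neg,
      AddCircle.coe_neg, Finset.sum_neg_distrib] at *
    rw [← neg_add, hp, neg_zero]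

/-- `φ_λ(t) = (1 - (1/2n) ∑ tᵢ)^{-λ}`. -/
def ellipticKernel (n : ℕ) (lam : ℝ) (t : Fin n → UnitAddCircle) : ℂ :=
  (1 - 1 / (2 * n) * ∑ i, expc (t i)) ^ (-lam : ℂ)

/-- The Fourier transform on `𝕋ⁿ` (`fourier m θ = exp(2πimθ)`). -/
def fourierE {n : ℕ} (φ : (Fin n → UnitAddCircle) → ℂ) (α : Fin n → ℤ) : ℂ :=
  ∫ t, φ t * ∏ i, fourier (-α i) (t i)

/-! ### The quasi-hyperbolic group

The coordinates of `ℂⁿ` are numbered by `Fin m ⊕ Unit` with `m = n - 1`, the last one being the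
distinguished coordinate `zₙ`. -/

/-- The group `𝕋ᵐ × ℝ`. -/
abbrev QH (m : ℕ) : Type := (Fin m → UnitAddCircle) × ℝ

/-- The matrix with diagonal block `diag(t₁, …, t_m)` and hyperbolic block
`(cosh s, sinh s; sinh s, cosh s)`. -/
def coreH {m : ℕ} (q : QH m) : Matrix ((Fin m ⊕ Unit) ⊕ Unit) ((Fin m ⊕ Unit) ⊕ Unit) ℂ
  | .inl (.inl i), .inl (.inl i') => if i = i' then expc (q.1 i) else 0
  | .inl (.inr _), .inl (.inr _) => Real.cosh q.2
  | .inl (.inr _), .inr _ => Real.sinh q.2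
  | .inr _, .inl (.inr _) => Real.sinh q.2
  | .inr _, .inr _ => Real.cosh q.2
  | _, _ => 0

/-- The general matrix of the quasi-hyperbolic group. -/
def matH {n m : ℕ} (ε : Fin m ⊕ Unit ≃ Fin n) (q : QH m) (a : UnitAddCircle) : Mat n :=
  expc a • (coreH q).submatrix (Sum.map ε.symm id) (Sum.map ε.symm id)

lemma coreH_zero (m : ℕ) : coreH (0 : QH m) = 1 := by
  ext ((i | i) | i) ((j | j) | j) <;> simp [coreH, Matrix.one_apply, expc_zero]

lemma coreH_add {m : ℕ} (p q : QH m) : coreH (p + q) = coreH p * coreH q := by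
  ext ((i | i) | i) ((j | j) | j) <;>
    simp [coreH, Matrix.mul_apply, Fintype.sum_sum_type, expc_add, Complex.cosh_add,
      Complex.sinh_add] <;> try ring1
  split_ifs <;> simp_all

/-- The quasi-hyperbolic group `H(n)`. -/
def hyperbolicGroup {n m : ℕ} (ε : Fin m ⊕ Unit ≃ Fin n) : Subgroup (SU n) :=
  paramSubgroup (fun p : QH m × UnitAddCircle => matH ε p.1 p.2)
    (by
      simp only [matH, Prod.fst_zero, Prod.snd_zero, coreH_zero, expc_zero, one_smul]
      exact Matrix.submatrix_one _ (Sum.map_injective.mpr ⟨ε.symm.injective, fun _ _ h => h⟩))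
    (by
      intro p q
      simp only [matH, Prod.fst_add, Prod.snd_add, coreH_add, expc_add, Matrix.smul_mul,
        Matrix.mul_smul, smul_smul]
      rw [← Matrix.submatrix_mul _ _ _ _ _
        (show Function.Bijective (Sum.map ε.symm (id : Unit → Unit)) from
          (Equiv.sumCongr ε.symm (Equiv.refl Unit)).bijective), mul_comm (expc p.2)])

/-- The covering group of `H(n)`: triples `(t, s, x)` with `exp(2πi(n+1)x) t₁ ⋯ t_m = 1`. -/
def hyperbolicCover (n m : ℕ) : AddSubgroup (QH m × ℝ) where
  carrier := {p | (((n + 1) * p.2 : ℝ) : UnitAddCircle) + ∑ i, p.1.1 i = 0}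
  zero_mem' := by simp
  add_mem' := by
    intro p q hp hq
    simp only [Set.mem_ofPred_eq, Prod.fst_add, Prod.snd_add, Pi.add_apply, mul_add,
      AddCircle.coe_add, Finset.sum_add_distrib] at *
    rw [add_add_add_comm, hp, hq, add_zero]
  neg_mem' := by
    intro p hp
    simp only [Set.mem_ofPred_eq, Prod.fst_neg, Prod.snd_neg, Pi.neg_apply, mul_neg,
      AddCircle.coe_neg, Finset.sum_neg_distrib] at *
    rw [← neg_add, hp, neg_zero]

/-- `φ_λ(t, s) = (cosh s - (1/2m) ∑ tᵢ)^{-λ}`; the sum is empty if `m = 0`. -/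
def hyperbolicKernel (m : ℕ) (lam : ℝ) (q : QH m) : ℂ :=
  (Real.cosh q.2 - 1 / (2 * m) * ∑ i, expc (q.1 i)) ^ (-lam : ℂ)

/-- The Fourier transform on `𝕋ᵐ × ℝ`. -/
def fourierH {m : ℕ} (φ : QH m → ℂ) (α : Fin m → ℤ) (ξ : ℝ) : ℂ :=
  ((1 / √(2 * Real.pi) : ℝ) : ℂ) *
    ∫ q : QH m, φ q * ((∏ i, fourier (-α i) (q.1 i)) * exp (-I * (q.2 * ξ : ℝ)))

/-! ### The quasi-parabolic, nilpotent and quasi-nilpotent groups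

They form one family, with `n = k + l + 1`; the coordinates of `ℂⁿ` are numbered by
`Fin k ⊕ Fin l ⊕ Unit`, the last one being the distinguished coordinate `zₙ`. The case `l = 0` is
the quasi-parabolic one, `k = 0` is the nilpotent one (together with the centre of `SU(n,1)`), and
the remaining cases are quasi-nilpotent. -/

/-- The group `𝕋ᵏ × ℝ × ℝˡ`. -/
abbrev QN (k l : ℕ) : Type := (Fin k → UnitAddCircle) × ℝ × EuclideanSpace ℝ (Fin l)

/-- `(|b|² - i s) / 2` for `q = (t, s, b)`. -/
def shift {k l : ℕ} (q : QN k l) : ℂ := (((‖q.2.2‖ ^ 2 : ℝ) : ℂ) - I * (q.2.1 : ℂ)) / 2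

/-- The matrix `n_{t,s,b}` without the scalar factor. -/
def coreN {k l : ℕ} (q : QN k l) :
    Matrix ((Fin k ⊕ Fin l ⊕ Unit) ⊕ Unit) ((Fin k ⊕ Fin l ⊕ Unit) ⊕ Unit) ℂ
  | .inl (.inl i), .inl (.inl i') => if i = i' then expc (q.1 i) else 0
  | .inl (.inr (.inl i)), .inl (.inr (.inl i')) => if i = i' then 1 else 0
  | .inl (.inr (.inl i)), .inl (.inr (.inr _)) => -I * q.2.2 i
  | .inl (.inr (.inl i)), .inr _ => -I * q.2.2 i
  | .inl (.inr (.inr _)), .inl (.inr (.inl i')) => -I * q.2.2 i'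
  | .inl (.inr (.inr _)), .inl (.inr (.inr _)) => 1 - shift q
  | .inl (.inr (.inr _)), .inr _ => -shift q
  | .inr _, .inl (.inr (.inl i')) => I * q.2.2 i'
  | .inr _, .inl (.inr (.inr _)) => shift q
  | .inr _, .inr _ => 1 + shift q
  | _, _ => 0

/-- The general matrix `n_{t,s,b,a}`. -/
def matN {n k l : ℕ} (ε : Fin k ⊕ Fin l ⊕ Unit ≃ Fin n) (q : QN k l) (a : UnitAddCircle) : Mat n :=
  expc a • (coreN q).submatrix (Sum.map ε.symm id) (Sum.map ε.symm id)

lemma coreN_zero (k l : ℕ) : coreN (0 : QN k l) = 1 := by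
  ext ((i | i | i) | i) ((j | j | j) | j) <;>
    simp [coreN, Matrix.one_apply, expc_zero, shift]

lemma shift_add {k l : ℕ} (p q : QN k l) :
    shift (p + q) = shift p + shift q + ∑ i, (p.2.2 i : ℂ) * (q.2.2 i : ℂ) := by
  simp only [shift, Prod.snd_add, Prod.fst_add, EuclideanSpace.real_norm_sq_eq, PiLp.add_apply]
  push_cast
  simp only [add_sq, Finset.sum_add_distrib, mul_assoc, ← Finset.mul_sum]
  ring

lemma coreN_add {k l : ℕ} (p q : QN k l) : coreN (p + q) = coreN p * coreN q := by
  have hI : ∀ x y : ℂ, I * x * (I * y) = -(x * y) := by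
    intro x y; rw [mul_mul_mul_comm, I_mul_I]; ring
  ext ((i | i | i) | i) ((j | j | j) | j) <;>
    simp [coreN, Matrix.mul_apply, Fintype.sum_sum_type, expc_add, shift_add, hI,
      Finset.sum_neg_distrib] <;> try ring1
  split_ifs <;> simp_all

/-- The group `N(k, n)` with `n = k + l + 1`. -/
def nilpotentGroup {n k l : ℕ} (ε : Fin k ⊕ Fin l ⊕ Unit ≃ Fin n) : Subgroup (SU n) :=
  paramSubgroup (fun p : QN k l × UnitAddCircle => matN ε p.1 p.2)
    (by
      simp only [matN, Prod.fst_zero, Prod.snd_zero, coreN_zero, expc_zero, one_smul]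
      exact Matrix.submatrix_one _ (Sum.map_injective.mpr ⟨ε.symm.injective, fun _ _ h => h⟩))
    (by
      intro p q
      simp only [matN, Prod.fst_add, Prod.snd_add, coreN_add, expc_add, Matrix.smul_mul,
        Matrix.mul_smul, smul_smul]
      rw [← Matrix.submatrix_mul _ _ _ _ _
        (show Function.Bijective (Sum.map ε.symm (id : Unit → Unit)) from
          (Equiv.sumCongr ε.symm (Equiv.refl Unit)).bijective), mul_comm (expc p.2)])

/-- The covering group of `N(k, n)`: all `(t, s, b, x)` with `exp(2πi(n+1)x) t₁ ⋯ t_k = 1`. -/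
def nilpotentCover (n k l : ℕ) : AddSubgroup (QN k l × ℝ) where
  carrier := {p | (((n + 1) * p.2 : ℝ) : UnitAddCircle) + ∑ i, p.1.1 i = 0}
  zero_mem' := by simp
  add_mem' := by
    intro p q hp hq
    simp only [Set.mem_ofPred_eq, Prod.fst_add, Prod.snd_add, Pi.add_apply, mul_add,
      AddCircle.coe_add, Finset.sum_add_distrib] at *
    rw [add_add_add_comm, hp, hq, add_zero]
  neg_mem' := by
    intro p hp
    simp only [Set.mem_ofPred_eq, Prod.fst_neg, Prod.snd_neg, Pi.neg_apply, mul_neg,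
      AddCircle.coe_neg, Finset.sum_neg_distrib] at *
    rw [← neg_add, hp, neg_zero]

/-- `φ_λ(t, s, b) = 2^λ (-is + |b|² + 2 - (1/k) ∑ tᵢ)^{-λ}`; the sum is empty if `k = 0`. -/
def nilpotentKernel (k l : ℕ) (lam : ℝ) (q : QN k l) : ℂ :=
  ((2 ^ lam : ℝ) : ℂ) *
    (-I * q.2.1 + ((‖q.2.2‖ ^ 2 : ℝ) : ℂ) + 2 - 1 / k * ∑ i, expc (q.1 i)) ^ (-lam : ℂ)

/-- The Fourier transform on `𝕋ᵏ × ℝ × ℝˡ`. -/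
def fourierN {k l : ℕ} (φ : QN k l → ℂ) (α : Fin k → ℤ) (y : ℝ) (ξ : EuclideanSpace ℝ (Fin l)) :
    ℂ :=
  (((2 * Real.pi) ^ (-((l : ℝ) + 1) / 2) : ℝ) : ℂ) *
    ∫ q : QN k l, φ q * ((∏ i, fourier (-α i) (q.1 i)) *
      exp (-I * (q.2.1 * y + inner ℝ q.2.2 ξ : ℝ)))

end BallRestriction

end

open BallRestriction

/-! An element of the covering group is an element of SU(n,1) together with a continuous logarithm
of its automorphy factor, so real powers of that factor are defined and satisfy the cocycle
identity. A change of variables on the ball makes π_λ unitary (`lintegral_bergmanMeasure_comp_act`).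
By the mean value property, evaluation at the origin is the inner product with the constant 1. Since
the group acts transitively, unitarity carries this to every point: evaluation at z is the inner
product with K_z, where K_z(w) = (1 - ⟨z, w⟩)^{-λ} (`exists_reproducing`).

For a model group with coordinates (q, x), one has RF(q, x) = e^{-2πiλx} ⟨k_q, F⟩, where k_q is the
kernel vector at the orbit point of q times the conjugate of d(q)^{-λ}. Invariance of the kernel
gives ⟨k_q, k_q'⟩ = φ_λ(q - q') (`inner_frame_frame`). So R is the analysis operator of a family
whose Gram kernel is a convolution kernel: Schur's test with φ_λ in L¹ bounds it, and RR* is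
convolution with φ_λ (`norm_synthesis_sq_le`, `exists_synthesis`). R is injective because at each
point of the orbit the tangent vectors span ℂⁿ over ℂ: vanishing on the orbit is inherited by all
derivatives, and the identity theorem applies (`IsKernelIntegral.eq_zero`).

For the Fourier transforms, A^{-λ} is written as a Gamma integral, which turns the sum of the circle
coordinates into a product of exponentials, each integrated by its power series. What remains is a
higher power of cosh, treated by the Beta integral, or of the Heisenberg factor, treated by Fourier
inversion of the Gamma density followed by a Gaussian integral.

Injectivity of R says that K_{z₀} is a cyclic vector for the abelian group over H, and an abelian
unitary group with a cyclic vector has a commutative commutant (`multiplicityFree_of_cyclic`).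

For the classification, an abelian group acts on ℂ^{n+1} with its form of signature (n,1). Take a
maximal orthonormal family of negative joint eigenvectors. In its complement there is a positive
joint eigenvector (elliptic case), or there are two independent null ones (hyperbolic case), or just
one null line (parabolic case). In the last case the group acts by scalars times Heisenberg
translations, and commutativity forces the form to be real on the translation parts
(`IsParabolic.exists_conj_le`). Thus every abelian subgroup can be conjugated into a model. Each
model contains everything that commutes with it, so it is maximal, and for a maximal abelian
subgroup the inclusion is an equality. -/

noncomputable section

namespace BallRestriction

/-! ## Lifting to the universal covering group -/

/-- The origin of the ball. -/
def origin (n : ℕ) : Ball n := ⟨0, Metric.mem_ball_self one_pos⟩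

lemma ball_norm_lt {n : ℕ} (z : Ball n) : ‖(z : EuclideanSpace ℂ (Fin n))‖ < 1 :=
  mem_ball_zero_iff.mp z.2

lemma den_eq {n : ℕ} (g : SU n) (z : EuclideanSpace ℂ (Fin n)) :
    den g z = (∑ i, toMat g (Sum.inr ()) (Sum.inl i) * z i) + toMat g (Sum.inr ()) (Sum.inr ()) := by
  simp [den, Matrix.mulVec, dotProduct, homog]

lemma num_apply {n : ℕ} (g : SU n) (z : EuclideanSpace ℂ (Fin n)) (i : Fin n) :
    num g z i =
      (∑ j, toMat g (Sum.inl i) (Sum.inl j) * z j) + toMat g (Sum.inl i) (Sum.inr ()) := by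
  simp [num, Matrix.mulVec, dotProduct, homog]

lemma den_zero {n : ℕ} (g : SU n) : den g 0 = toMat g (Sum.inr ()) (Sum.inr ()) := by
  simp [den_eq]

lemma den_smul_sub {n : ℕ} (g : SU n) (c : ℂ) (z : EuclideanSpace ℂ (Fin n)) :
    den g (c • z) - den g 0 = c * (den g z - den g 0) := by
  simp [den_eq, Finset.mul_sum, mul_left_comm]

lemma den_zero_ne_zero {n : ℕ} (g : SU n) : den g 0 ≠ 0 := den_ne_zero g (origin n)

/-- The denominator is affine in z without zeros in the ball. If its increment at z were too large,
a multiple of z by a scalar of modulus at most 1 would be a zero. -/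
lemma norm_den_sub_lt {n : ℕ} (g : SU n) (z : Ball n) :
    ‖den g z - den g 0‖ < ‖den g 0‖ := by
  by_contra! h
  set u := den g z - den g 0 with hu
  have hu0 : u ≠ 0 := by
    intro h0
    rw [h0, norm_zero, norm_le_zero_iff] at h
    exact den_zero_ne_zero g h
  have hmem : (-den g 0 / u) • (z : EuclideanSpace ℂ (Fin n)) ∈ Metric.ball 0 1 := by
    rw [mem_ball_zero_iff, norm_smul, norm_div, norm_neg]
    have h1 : ‖den g 0‖ / ‖u‖ ≤ 1 := div_le_one_of_le₀ h (norm_nonneg _)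
    have h2 := ball_norm_lt z
    nlinarith [norm_nonneg (z : EuclideanSpace ℂ (Fin n))]
  apply den_ne_zero g ⟨_, hmem⟩
  have := den_smul_sub g (-den g 0 / u) z
  rw [← hu, div_mul_cancel₀ _ hu0] at this
  linear_combination this

/-- The quotient lies in the unit disc about 1. Hence its principal logarithm is continuous on the
ball, and all branch questions reduce to the value at the origin. -/
lemma den_div_re_pos {n : ℕ} (g : SU n) (z : Ball n) : 0 < (den g z / den g 0).re := by
  have h := norm_den_sub_lt g z
  have h0 := den_zero_ne_zero g
  have h1 : ‖den g z / den g 0 - 1‖ < 1 := by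
    rw [div_sub_one h0, norm_div, div_lt_one (norm_pos_iff.mpr h0)]
    exact h
  have h2 := (abs_re_le_norm (den g z / den g 0 - 1)).trans_lt h1
  rw [abs_lt] at h2
  simp only [sub_re, one_re] at h2
  linarith

lemma den_div_mem_slitPlane {n : ℕ} (g : SU n) (z : Ball n) :
    den g z / den g 0 ∈ slitPlane := Or.inl (den_div_re_pos g z)

/-- A continuous function into `ℂ` on a preconnected space whose exponential is constant is
constant. -/
lemma eq_of_exp_eq {X : Type*} [TopologicalSpace X] [PreconnectedSpace X] {f : X → ℂ}
    (hf : Continuous f) (h : ∀ x, exp (f x) = 1) (x y : X) : f x = f y := by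
  have key : ∀ x, ∃ m : ℤ, f x = m * (2 * Real.pi * I) := fun x => exp_eq_one_iff.mp (h x)
  choose m hm using key
  have hre : ∀ x, (f x / (2 * Real.pi * I)) = m x := by
    intro x
    rw [hm x, mul_div_cancel_right₀ _ two_pi_I_ne_zero]
  -- Continuity of `m` may be tested in ℝ, since ℤ embeds there; a continuous integer-valued
  -- function on a preconnected space is constant.
  have hmc : Continuous m := by
    have h1 : Continuous fun x => ((m x : ℝ)) := by
      have : (fun x => (m x : ℝ)) = fun x => (f x / (2 * Real.pi * I)).re := by
        funext x; rw [hre x]; simp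
      rw [this]
      exact continuous_re.comp (hf.div_const _)
    exact Int.isClosedEmbedding_coe_real.isInducing.continuous_iff.mpr h1
  rw [hm x, hm y, PreconnectedSpace.constant ‹_› hmc (x := x) (y := y)]

instance {n : ℕ} : PreconnectedSpace (Ball n) :=
  Subtype.preconnectedSpace (convex_ball _ _).isPreconnected

namespace Gtilde

variable {n : ℕ}

/-- Both sides are continuous logarithms of the same function and agree at the origin. So an element
of the covering group is determined by its matrix and one complex number, which is what the topology
on it uses. -/
lemma log_eq_log_zero_add (g : Gtilde n) (z : Ball n) :
    g.log z = g.log (origin n) + Complex.log (den g.base z / den g.base 0) := by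
  have hc : Continuous fun z : Ball n =>
      g.log z - (g.log (origin n) + Complex.log (den g.base z / den g.base 0)) := by
    refine g.log_continuous.sub (continuous_const.add ?_)
    refine continuous_iff_continuousAt.mpr fun z => ?_
    exact (((continuous_den g.base).div_const _).continuousAt).clog
      (den_div_mem_slitPlane g.base z)
  have h := eq_of_exp_eq hc (fun z => by
    rw [exp_sub, exp_add, g.exp_log, g.exp_log, Complex.exp_log
      (div_ne_zero (den_ne_zero _ _) (den_zero_ne_zero _))]
    change _ / (den g.base 0 * _) = 1
    rw [mul_div_cancel₀ _ (den_zero_ne_zero _), div_self (den_ne_zero _ _)]) z (origin n)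
  have h0 : den g.base (origin n : EuclideanSpace ℂ (Fin n)) / den g.base 0 = 1 :=
    div_self (den_zero_ne_zero _)
  simp only [h0, Complex.log_one, add_zero, sub_self] at h
  simpa [sub_eq_zero] using h

/-- The element of the covering group over `g` with a given logarithm at the origin. -/
def lift (g : SU n) (τ : ℂ) (h : exp τ = den g 0) : Gtilde n where
  base := g
  log z := τ + Complex.log (den g z / den g 0)
  log_continuous := by
    refine continuous_const.add (continuous_iff_continuousAt.mpr fun z => ?_)
    exact (((continuous_den g).div_const _).continuousAt).clog (den_div_mem_slitPlane g z)
  exp_log z := by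
    rw [exp_add, Complex.exp_log (div_ne_zero (den_ne_zero _ _) (den_zero_ne_zero _)), h,
      mul_div_cancel₀ _ (den_zero_ne_zero _)]

lemma lift_log_zero (g : SU n) (τ : ℂ) (h : exp τ = den g 0) :
    (lift g τ h).log (origin n) = τ := by
  have h0 : den g (origin n : EuclideanSpace ℂ (Fin n)) / den g 0 = 1 :=
    div_self (den_zero_ne_zero _)
  simp only [lift, h0, Complex.log_one, add_zero]

lemma ext_of_log_zero {g h : Gtilde n} (h1 : g.base = h.base)
    (h2 : g.log (origin n) = h.log (origin n)) : g = h := by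
  ext1
  · exact h1
  · funext z
    rw [log_eq_log_zero_add, log_eq_log_zero_add h, h1, h2]

lemma exists_lift (g : SU n) : ∃ h : Gtilde n, h.base = g :=
  ⟨lift g (Complex.log (den g 0)) (Complex.exp_log (den_zero_ne_zero g)), rfl⟩

lemma smul_def (g : Gtilde n) (z : Ball n) : g • z = act g.base z := rfl

lemma j_mul (lam : ℝ) (g h : Gtilde n) (z : Ball n) :
    j lam (g * h) z = j lam g (h • z) * j lam h z := by
  simp only [j, log_mul, mul_add, exp_add]; rfl

lemma j_one (lam : ℝ) (z : Ball n) : j lam (1 : Gtilde n) z = 1 := by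
  simp [j, log_one]

lemma norm_j (lam : ℝ) (g : Gtilde n) (z : Ball n) :
    ‖j lam g z‖ = ‖den g.base z‖ ^ (-lam) := by
  rw [← g.exp_log z, Complex.norm_exp, ← Real.exp_mul, j, Complex.norm_exp]
  congr 1
  simp [mul_comm]

lemma continuous_base_log_zero : Continuous fun g : Gtilde n =>
    ((toMat g.base, g.log (origin n)) : Mat n × ℂ) := continuous_induced_dom

lemma continuous_iff {X : Type*} [TopologicalSpace X] {f : X → Gtilde n} :
    Continuous f ↔ (Continuous fun x => toMat (f x).base) ∧
      Continuous fun x => (f x).log (origin n) := by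
  rw [continuous_induced_rng, continuous_prodMk.symm]
  rfl

end Gtilde

/-- The norm form at the origin: `1 - ⟨w, z⟩` transforms with the automorphy factors. -/
lemma den_mul_conj_den {n : ℕ} (g : SU n) (z w : Ball n) :
    conj (den g w) * den g z *
      (1 - inner ℂ (act g w : EuclideanSpace ℂ (Fin n)) (act g z : EuclideanSpace ℂ (Fin n))) =
      1 - inner ℂ (w : EuclideanSpace ℂ (Fin n)) (z : EuclideanSpace ℂ (Fin n)) := by
  have form : ∀ x y : EuclideanSpace ℂ (Fin n),
      star (homog x) ⬝ᵥ ((J n).mulVec (homog y)) = 1 - inner ℂ x y := by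
    intro x y
    simp only [J, Matrix.mulVec_diagonal, dotProduct, Fintype.sum_sum_type, Pi.star_apply,
      Sum.elim_inl, Sum.elim_inr, homog, PiLp.inner_apply, RCLike.inner_apply]
    simp
    rw [sub_eq_add_neg, add_comm, add_right_inj, neg_inj]
    exact Finset.sum_congr rfl fun i _ => mul_comm _ _
  have h : star ((toMat g).mulVec (homog w)) ⬝ᵥ ((J n).mulVec ((toMat g).mulVec (homog z))) =
      star (homog w) ⬝ᵥ ((J n).mulVec (homog z)) := by
    rw [Matrix.star_mulVec, Matrix.mulVec_mulVec, ← Matrix.dotProduct_mulVec,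
      Matrix.mulVec_mulVec, ← Matrix.mul_assoc, SU.conj_left]
  rw [mulVec_act, mulVec_act, star_smul, smul_dotProduct, Matrix.mulVec_smul, dotProduct_smul,
    form, form] at h
  rw [← h]
  simp only [smul_eq_mul, RCLike.star_def]
  ring

end BallRestriction
end

noncomputable section

namespace BallRestriction

/-! ## The weighted measures on the ball -/

lemma beta_integral_real {a b : ℝ} (ha : 0 < a) (hb : 0 < b) :
    ∫ x in (0 : ℝ)..1, x ^ (a - 1) * (1 - x) ^ (b - 1) =
      Real.Gamma a * Real.Gamma b / Real.Gamma (a + b) := by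
  have h := Complex.betaIntegral_eq_Gamma_mul_div (a : ℂ) b (by simpa) (by simpa)
  have h2 : Complex.betaIntegral a b =
      ((∫ x in (0 : ℝ)..1, x ^ (a - 1) * (1 - x) ^ (b - 1) : ℝ) : ℂ) := by
    rw [← intervalIntegral.integral_ofReal, Complex.betaIntegral]
    refine intervalIntegral.integral_congr fun x hx => ?_
    rw [Set.uIcc_of_le zero_le_one] at hx
    simp only [ofReal_mul]
    rw [ofReal_cpow hx.1, ofReal_cpow (sub_nonneg.mpr hx.2)]
    push_cast
    rfl
  rw [h2, ← ofReal_add, Complex.Gamma_ofReal, Complex.Gamma_ofReal, Complex.Gamma_ofReal] at h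
  exact_mod_cast h

section Measure

variable {n : ℕ} {lam : ℝ}

lemma measurable_bergman_density : Measurable fun z : EuclideanSpace ℂ (Fin n) => ENNReal.ofReal
    (Real.Gamma lam / (n.factorial * Real.Gamma (lam - n)) * (1 - ‖z‖ ^ 2) ^ (lam - n - 1)) := by
  fun_prop

lemma lintegral_bergmanMeasure (G : EuclideanSpace ℂ (Fin n) → ℝ≥0∞) :
    ∫⁻ z, G z ∂bergmanMeasure n lam =
      (volume (Metric.ball (0 : EuclideanSpace ℂ (Fin n)) 1))⁻¹ *
      ∫⁻ z in Metric.ball 0 1, ENNReal.ofReal (Real.Gamma lam / (n.factorial * Real.Gamma (lam - n))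
        * (1 - ‖z‖ ^ 2) ^ (lam - n - 1)) * G z := by
  rw [bergmanMeasure, lintegral_withDensity_eq_lintegral_mul_non_measurable₀ _
    measurable_bergman_density.aemeasurable (by simp), ballMeasure, lintegral_smul_measure]
  rfl

lemma bergmanMeasure_ac : bergmanMeasure n lam ≪ volume.restrict (Metric.ball 0 1) :=
  (withDensity_absolutelyContinuous _ _).trans Measure.smul_absolutelyContinuous

lemma bergman_const_pos (hn : 1 ≤ n) (hlam : (n : ℝ) < lam) :
    0 < Real.Gamma lam / (n.factorial * Real.Gamma (lam - n)) := by
  have h1 : (1 : ℝ) ≤ n := by exact_mod_cast hn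
  have := Real.Gamma_pos_of_pos (show 0 < lam by linarith)
  have := Real.Gamma_pos_of_pos (show 0 < lam - n by linarith)
  positivity

/-- The density is strictly positive on the ball. This is what allows almost everywhere identities
between holomorphic representatives to be read pointwise. -/
lemma ac_bergmanMeasure (hn : 1 ≤ n) (hlam : (n : ℝ) < lam) :
    volume.restrict (Metric.ball 0 1) ≪ bergmanMeasure n lam := by
  have h1 : volume.restrict (Metric.ball 0 1) ≪ ballMeasure n := by
    refine Measure.absolutelyContinuous_smul ?_
    exact ENNReal.inv_ne_zero.mpr measure_ball_lt_top.ne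
  refine h1.trans (withDensity_absolutelyContinuous' measurable_bergman_density.aemeasurable ?_)
  have h2 : ∀ᵐ z ∂(volume.restrict (Metric.ball (0 : EuclideanSpace ℂ (Fin n)) 1)),
      z ∈ Metric.ball (0 : EuclideanSpace ℂ (Fin n)) 1 :=
    ae_restrict_mem measurableSet_ball
  have h3 : ballMeasure n ≪ volume.restrict (Metric.ball (0 : EuclideanSpace ℂ (Fin n)) 1) :=
    Measure.smul_absolutelyContinuous
  filter_upwards [h3.ae_le h2] with z hz
  have := ball_sq ⟨z, hz⟩
  rw [Ne, ENNReal.ofReal_eq_zero, not_le]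
  exact mul_pos (bergman_const_pos hn hlam) (Real.rpow_pos_of_pos (by simpa using this) _)

lemma ae_bergmanMeasure_mem_ball : ∀ᵐ z ∂bergmanMeasure n lam,
    z ∈ Metric.ball (0 : EuclideanSpace ℂ (Fin n)) 1 :=
  bergmanMeasure_ac.ae_le (ae_restrict_mem measurableSet_ball)

/-- This is the weight in polar coordinates of a space of real dimension 2n; the substitution u = y²
turns it into half a Beta integral. -/
lemma integral_radial_weight (hn : 1 ≤ n) {b : ℝ} (hb : 0 < b) :
    ∫ y in Set.Ioi (0 : ℝ), y ^ (2 * n - 1) • (Set.Iio 1).indicator (fun r => (1 - r ^ 2) ^ (b - 1)) y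
      = 1 / 2 * (Real.Gamma n * Real.Gamma b / Real.Gamma (n + b)) := by
  have hn' : (0 : ℝ) < n := by exact_mod_cast hn
  rw [← beta_integral_real hn' hb, intervalIntegral.integral_of_le zero_le_one,
    integral_Ioc_eq_integral_Ioo]
  have h1 := integral_comp_rpow_Ioi
    ((Set.Iio 1).indicator fun u : ℝ => u ^ ((n : ℝ) - 1) * (1 - u) ^ (b - 1)) (two_ne_zero)
  have h2 : ∫ y in Set.Ioi (0 : ℝ), (Set.Iio 1).indicator
      (fun u : ℝ => u ^ ((n : ℝ) - 1) * (1 - u) ^ (b - 1)) y =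
      ∫ y in Set.Ioo (0 : ℝ) 1, y ^ ((n : ℝ) - 1) * (1 - y) ^ (b - 1) := by
    rw [setIntegral_indicator measurableSet_Iio]
    rfl
  rw [← h2, ← h1, ← integral_const_mul]
  refine setIntegral_congr_fun measurableSet_Ioi fun y hy => ?_
  have hy : 0 < y := hy
  simp only [smul_eq_mul, Real.rpow_two, Set.indicator, Set.mem_Iio, abs_two]
  have hiff : y ^ 2 < 1 ↔ y < 1 := by
    rw [sq_lt_one_iff₀ hy.le]
  simp only [hiff]
  split_ifs with h
  · have h3 : y ^ ((2 : ℝ) - 1) = y := by norm_num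
    have h4 : (y ^ 2) ^ ((n : ℝ) - 1) = y ^ (2 * (n : ℝ) - 2) := by
      rw [← Real.rpow_natCast, ← Real.rpow_mul hy.le]; congr 1; push_cast; ring
    have h5 : y ^ (2 * n - 1) = y * y ^ (2 * (n : ℝ) - 2) := by
      rw [← Real.rpow_natCast, ← Real.rpow_one_add' hy.le]
      · congr 1
        rw [Nat.cast_sub (by omega)]; push_cast; ring
      · have h1n : (1 : ℝ) ≤ n := by exact_mod_cast hn
        linarith
    rw [h3, h4, h5]; ring
  · simp

/-- The normalising constant inverts the Beta value of the radial integral; the factor 1/2 there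
cancels against the dimension 2n, and n Γ(n) = n!. -/
lemma isProbabilityMeasure_bergmanMeasure (hn : 1 ≤ n) (hlam : (n : ℝ) < lam) :
    IsProbabilityMeasure (bergmanMeasure n lam) := by
  constructor
  have hn' : (0 : ℝ) < n := by exact_mod_cast hn
  have : Nonempty (Fin n) := ⟨⟨0, hn⟩⟩
  have : Nontrivial (EuclideanSpace ℂ (Fin n)) := inferInstance
  have hC := bergman_const_pos hn hlam
  set C := Real.Gamma lam / (n.factorial * Real.Gamma (lam - n)) with hCdef
  have hfin : Module.finrank ℝ (EuclideanSpace ℂ (Fin n)) = 2 * n := by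
    rw [← Module.finrank_mul_finrank ℝ ℂ, Complex.finrank_real_complex, finrank_euclideanSpace_fin]
  set V := volume (Metric.ball (0 : EuclideanSpace ℂ (Fin n)) 1) with hV
  have hV0 : V ≠ 0 := (Metric.measure_ball_pos _ _ one_pos).ne'
  have hVt : V ≠ ⊤ := measure_ball_lt_top.ne
  have hG1 := Real.Gamma_pos_of_pos (show 0 < lam by linarith)
  have hG2 := Real.Gamma_pos_of_pos (show 0 < lam - n by linarith)
  have hI := integral_fun_norm_addHaar (volume : Measure (EuclideanSpace ℂ (Fin n)))
    ((Set.Iio 1).indicator fun r : ℝ => (1 - r ^ 2) ^ ((lam - n) - 1))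
  rw [hfin, integral_radial_weight hn (show 0 < lam - n by linarith)] at hI
  have hI2 : ∫ z in Metric.ball (0 : EuclideanSpace ℂ (Fin n)) 1, (1 - ‖z‖ ^ 2) ^ (lam - n - 1) =
      V.toReal / C := by
    rw [← integral_indicator measurableSet_ball]
    have e : (Metric.ball (0 : EuclideanSpace ℂ (Fin n)) 1).indicator
        (fun z => (1 - ‖z‖ ^ 2) ^ (lam - n - 1)) = fun z =>
        (Set.Iio 1).indicator (fun r : ℝ => (1 - r ^ 2) ^ ((lam - n) - 1)) ‖z‖ := by
      funext z
      simp [Set.indicator]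
    rw [e, hI, Measure.real, ← hV]
    have hfac : (n.factorial : ℝ) = n * Real.Gamma n := by
      rw [← Real.Gamma_nat_eq_factorial, Real.Gamma_add_one hn'.ne']
    have hGn := Real.Gamma_pos_of_pos hn'
    rw [hCdef, hfac, nsmul_eq_mul, smul_eq_mul, show (n : ℝ) + (lam - n) = lam by ring]
    push_cast
    field_simp
  have hint : IntegrableOn (fun z : EuclideanSpace ℂ (Fin n) => (1 - ‖z‖ ^ 2) ^ (lam - n - 1))
      (Metric.ball 0 1) := by
    -- A non-integrable function has integral 0 by convention, so the nonzero value just computed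
    -- proves integrability.
    refine Integrable.of_integral_ne_zero ?_
    rw [hI2]
    exact div_ne_zero (ENNReal.toReal_ne_zero.mpr ⟨hV0, hVt⟩) hC.ne'
  have := lintegral_bergmanMeasure (n := n) (lam := lam) (fun _ => 1)
  simp only [lintegral_one, mul_one] at this
  rw [this, ← ofReal_integral_eq_lintegral_ofReal (hint.const_mul C), integral_const_mul, hI2,
    mul_div_cancel₀ _ hC.ne', ENNReal.ofReal_toReal hVt, ENNReal.inv_mul_cancel hV0 hVt]
  filter_upwards [ae_restrict_mem measurableSet_ball] with z hz
  have := ball_sq ⟨z, hz⟩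
  exact mul_nonneg hC.le (Real.rpow_nonneg (by simpa using this.le) _)

end Measure

/-! ## Change of variables -/

section Change

variable {n : ℕ}

/-- The matrix of the complex derivative of the action of `g` at `z`. -/
def jacobian (g : SU n) (z : EuclideanSpace ℂ (Fin n)) : Matrix (Fin n) (Fin n) ℂ :=
  (den g z)⁻¹ • ((toMat g).toBlocks₁₁ -
    (den g z)⁻¹ • Matrix.vecMulVec (num g z) (fun j => toMat g (Sum.inr ()) (Sum.inl j)))

/-- The Jacobian is 1/d times the Schur complement of the corner d = `den g z` in a matrix of
determinant one; the complement has determinant 1/d, and the scalar contributes n further factors.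
-/
lemma det_jacobian (g : SU n) (z : Ball n) :
    (jacobian g z).det = (den g z)⁻¹ ^ (n + 1) := by
  have hd := den_ne_zero g z
  set A := (toMat g).toBlocks₁₁
  set v : Matrix (Fin n) Unit ℂ := Matrix.of fun i _ => num g z i
  set w : Matrix Unit (Fin n) ℂ := (toMat g).toBlocks₂₁
  set D : Matrix Unit Unit ℂ := Matrix.of fun _ _ => den g z
  -- A unipotent column operation replaces the last column of `g` by its value on (z, 1), without
  -- changing the determinant.
  have hprod : toMat g * Matrix.fromBlocks 1 (Matrix.of fun i (_ : Unit) =>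
      (z : EuclideanSpace ℂ (Fin n)) i) 0 1 = Matrix.fromBlocks A v w D := by
    rw [← Matrix.fromBlocks_toBlocks (toMat g), Matrix.fromBlocks_multiply]
    congr 1
    · simp [A]
    · ext i j
      simp [v, num_apply, Matrix.mul_apply, Matrix.toBlocks₁₁, Matrix.toBlocks₁₂]
    · simp [w]
    · ext i j
      simp [D, den_eq, Matrix.mul_apply, Matrix.toBlocks₂₁, Matrix.toBlocks₂₂]
  have hdet : (Matrix.fromBlocks A v w D).det = 1 := by
    rw [← hprod, Matrix.det_mul, Matrix.det_fromBlocks_zero₂₁]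
    rw [Matrix.det_one, Matrix.det_one, mul_one, mul_one]
    exact (g : Matrix.SpecialLinearGroup (Fin n ⊕ Unit) ℂ).2
  let _ : Invertible D := ⟨Matrix.of fun _ _ => (den g z)⁻¹, by
    ext; simp [D, Matrix.mul_apply, hd], by ext; simp [D, Matrix.mul_apply, hd]⟩
  rw [Matrix.det_fromBlocks₂₂] at hdet
  have hD : D.det = den g z := by simp [D]
  have hS : A - v * ⅟D * w = A - (den g z)⁻¹ • Matrix.vecMulVec (num g z)
      (fun j => toMat g (Sum.inr ()) (Sum.inl j)) := by
    congr 1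
    ext i j
    change (∑ x, (∑ y, v i y * (den g z)⁻¹) * w x j) = _
    simp [v, w, Matrix.vecMulVec, Matrix.toBlocks₂₁]
    ring
  rw [hD, hS] at hdet
  rw [jacobian, Matrix.det_smul, Fintype.card_fin, pow_succ, eq_inv_of_mul_eq_one_right hdet]

/-- The action of `g` as a map on the whole space. -/
def actE (g : SU n) (z : EuclideanSpace ℂ (Fin n)) : EuclideanSpace ℂ (Fin n) :=
  (den g z)⁻¹ • num g z

lemma coe_act (g : SU n) (z : Ball n) :
    (act g z : EuclideanSpace ℂ (Fin n)) = actE g z := rfl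

lemma actE_mem (g : SU n) {z : EuclideanSpace ℂ (Fin n)} (hz : z ∈ Metric.ball 0 1) :
    actE g z ∈ Metric.ball 0 1 := (act g ⟨z, hz⟩).2

/-- The linear form in the denominator. -/
def denLin (g : SU n) : EuclideanSpace ℂ (Fin n) →L[ℂ] ℂ :=
  ∑ j, toMat g (Sum.inr ()) (Sum.inl j) • EuclideanSpace.proj j

lemma den_eq_denLin (g : SU n) (z : EuclideanSpace ℂ (Fin n)) :
    den g z = denLin g z + den g 0 := by
  simp [den_eq, denLin]

lemma hasFDerivAt_den (g : SU n) (z : EuclideanSpace ℂ (Fin n)) :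
    HasFDerivAt (𝕜 := ℂ) (den g) (denLin g) z := by
  have : den g = fun z => denLin g z + den g 0 := funext (den_eq_denLin g)
  rw [this]
  exact (denLin g).hasFDerivAt.add_const _

lemma euclideanCLM_apply (M : Matrix (Fin n) (Fin n) ℂ) (v : EuclideanSpace ℂ (Fin n))
    (i : Fin n) : Matrix.toEuclideanCLM (𝕜 := ℂ) M v i = ∑ j, M i j * v j := by
  rw [Matrix.ofLp_toEuclideanCLM]
  rfl

lemma hasFDerivAt_num (g : SU n) (z : EuclideanSpace ℂ (Fin n)) :
    HasFDerivAt (𝕜 := ℂ) (num g) (Matrix.toEuclideanCLM (𝕜 := ℂ) (toMat g).toBlocks₁₁) z := by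
  have : num g = fun z => Matrix.toEuclideanCLM (𝕜 := ℂ) (toMat g).toBlocks₁₁ z + num g 0 := by
    funext z
    ext i
    simp [num_apply, euclideanCLM_apply, Matrix.toBlocks₁₁]
  rw [this]
  exact (Matrix.toEuclideanCLM (𝕜 := ℂ) (toMat g).toBlocks₁₁).hasFDerivAt.add_const _

lemma hasFDerivAt_actE (g : SU n) {z : EuclideanSpace ℂ (Fin n)} (hz : z ∈ Metric.ball 0 1) :
    HasFDerivAt (𝕜 := ℂ) (actE g) (Matrix.toEuclideanCLM (𝕜 := ℂ) (jacobian g z)) z := by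
  have hd : den g z ≠ 0 := den_ne_zero g ⟨z, hz⟩
  have h := (((hasDerivAt_inv hd).comp_hasFDerivAt z (hasFDerivAt_den g z))).smul
    (hasFDerivAt_num g z)
  refine h.congr_fderiv ?_
  ext v i
  simp only [euclideanCLM_apply, jacobian, denLin, Matrix.smul_apply, Matrix.sub_apply,
    Matrix.vecMulVec_apply, Matrix.toBlocks₁₁, Matrix.of_apply, smul_eq_mul, 
    add_apply, smul_apply, PiLp.add_apply, PiLp.smul_apply,
    ContinuousLinearMap.smulRight_apply, sum_apply, PiLp.proj_apply, Function.comp]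
  rw [Finset.mul_sum, neg_mul, Finset.mul_sum, neg_mul, Finset.sum_mul, ← sub_eq_add_neg,
    ← Finset.sum_sub_distrib]
  exact Finset.sum_congr rfl fun j _ => by field_simp

lemma differentiableOn_actE (g : SU n) :
    DifferentiableOn ℂ (actE g) (Metric.ball 0 1) := fun _ hz =>
  (hasFDerivAt_actE g hz).differentiableAt.differentiableWithinAt

lemma actE_inv_actE (g : SU n) {z : EuclideanSpace ℂ (Fin n)} (hz : z ∈ Metric.ball 0 1) :
    actE g⁻¹ (actE g z) = z := by
  have h := act_mul g⁻¹ g ⟨z, hz⟩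
  rw [inv_mul_cancel, act_one] at h
  exact (congrArg Subtype.val h).symm

lemma one_sub_norm_actE_sq (g : SU n) {z : EuclideanSpace ℂ (Fin n)} (hz : z ∈ Metric.ball 0 1) :
    1 - ‖actE g z‖ ^ 2 = (1 - ‖z‖ ^ 2) / ‖den g z‖ ^ 2 := by
  have h3 : 0 < ‖den g z‖ := norm_pos_iff.mpr (den_ne_zero g ⟨z, hz⟩)
  rw [← norm_identity g z, actE, norm_smul, norm_inv]
  field_simp

/-- The source of unitarity: the real Jacobian contributes the exponent -2(n+1) of |den|, the factor
1 - |z|² raised to λ-n-1 contributes -2(λ-n-1), and the sum is -2λ. -/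
lemma lintegral_bergmanMeasure_comp_act {lam : ℝ} (g : SU n)
    (G : EuclideanSpace ℂ (Fin n) → ℝ≥0∞) :
    ∫⁻ z, ENNReal.ofReal (‖den g z‖ ^ (-2 * lam)) * G (actE g z) ∂bergmanMeasure n lam =
      ∫⁻ z, G z ∂bergmanMeasure n lam := by
  have himg : actE g '' Metric.ball 0 1 = Metric.ball 0 1 := by
    apply Set.Subset.antisymm
    · rintro _ ⟨z, hz, rfl⟩; exact actE_mem g hz
    · intro z hz
      refine ⟨actE g⁻¹ z, actE_mem _ hz, ?_⟩
      simpa using actE_inv_actE g⁻¹ hz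
  rw [lintegral_bergmanMeasure, lintegral_bergmanMeasure]
  congr 1
  have hcv := lintegral_image_eq_lintegral_abs_det_fderiv_mul
    (volume : Measure (EuclideanSpace ℂ (Fin n))) measurableSet_ball
    (fun z hz => ((hasFDerivAt_actE g hz).restrictScalars ℝ).hasFDerivWithinAt)
    (fun x hx y hy hxy => by
      rw [← actE_inv_actE g hx, ← actE_inv_actE g hy, hxy])
    (fun z => ENNReal.ofReal (Real.Gamma lam / (n.factorial * Real.Gamma (lam - n))
        * (1 - ‖z‖ ^ 2) ^ (lam - n - 1)) * G z)
  rw [himg] at hcv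
  rw [hcv]
  refine setLIntegral_congr_fun measurableSet_ball fun z hz => ?_
  have h3 : 0 < ‖den g z‖ := norm_pos_iff.mpr (den_ne_zero g ⟨z, hz⟩)
  have h1 : 0 < 1 - ‖z‖ ^ 2 := by have := ball_sq ⟨z, hz⟩; simpa using this
  -- The real determinant of a complex linear map is the squared modulus of its complex determinant.
  have hdet : |((Matrix.toEuclideanCLM (𝕜 := ℂ) (jacobian g z)).restrictScalars ℝ).det| =
      ‖den g z‖ ^ (-2 * ((n : ℝ) + 1)) := by
    have e1 : ((Matrix.toEuclideanCLM (𝕜 := ℂ) (jacobian g z)).restrictScalars ℝ).det =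
        Algebra.norm ℝ (jacobian g z).det := by
      rw [ContinuousLinearMap.det]
      have : (((Matrix.toEuclideanCLM (𝕜 := ℂ) (jacobian g z)).restrictScalars ℝ :
          EuclideanSpace ℂ (Fin n) →L[ℝ] EuclideanSpace ℂ (Fin n)) :
          EuclideanSpace ℂ (Fin n) →ₗ[ℝ] EuclideanSpace ℂ (Fin n)) =
          ((Matrix.toLin (EuclideanSpace.basisFun (Fin n) ℂ).toBasis
            (EuclideanSpace.basisFun (Fin n) ℂ).toBasis (jacobian g z)).restrictScalars ℝ) := by
        ext v i
        simp [Matrix.toEuclideanCLM, Matrix.toLin_apply, Matrix.mulVec, dotProduct]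
      rw [this, LinearMap.det_restrictScalars, LinearMap.det_toLin]
    rw [e1, Algebra.norm_complex_apply, det_jacobian g ⟨z, hz⟩, Complex.normSq_eq_norm_sq,
      abs_of_nonneg (by positivity), norm_pow, norm_inv, ← pow_mul, inv_pow,
      ← Real.rpow_natCast, ← Real.rpow_neg h3.le]
    congr 1
    push_cast
    ring
  rw [hdet, one_sub_norm_actE_sq g hz, ← mul_assoc, ← mul_assoc,
    ← ENNReal.ofReal_mul' (Real.rpow_nonneg h3.le _),
    ← ENNReal.ofReal_mul (Real.rpow_nonneg h3.le _)]
  congr 2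
  rw [Real.div_rpow h1.le (by positivity), ← Real.rpow_natCast ‖den g z‖,
    ← Real.rpow_mul h3.le, div_eq_mul_inv (_ ^ _), ← Real.rpow_neg h3.le]
  have : ‖den g z‖ ^ (-2 * lam) = ‖den g z‖ ^ (-2 * ((n : ℝ) + 1)) *
      ‖den g z‖ ^ (-(((2 : ℕ) : ℝ) * (lam - n - 1))) := by
    rw [← Real.rpow_add h3]; congr 1; push_cast; ring
  rw [this]
  ring

end Change

end BallRestriction
end

noncomputable section

namespace BallRestriction

/-! ## Elements of the Bergman space as holomorphic functions -/

namespace Bergman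

variable {n : ℕ} {lam : ℝ}

lemma aestronglyMeasurable_of_continuousOn {X : Type*} [TopologicalSpace X]
    [TopologicalSpace.PseudoMetrizableSpace X] [SecondCountableTopology X]
    {f : EuclideanSpace ℂ (Fin n) → X}
    (hf : ContinuousOn f (Metric.ball 0 1)) : AEStronglyMeasurable f (bergmanMeasure n lam) := by
  borelize X
  exact (AEMeasurable.aestronglyMeasurable (hf.aemeasurable measurableSet_ball)).mono_ac
    bergmanMeasure_ac

/-- The holomorphic representative. -/
def hol (F : Bergman n lam) : EuclideanSpace ℂ (Fin n) → ℂ := Classical.choose F.2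

lemma differentiableOn_hol (F : Bergman n lam) :
    DifferentiableOn ℂ (hol F) (Metric.ball 0 1) := (Classical.choose_spec F.2).1

lemma coeFn_ae_eq_hol (F : Bergman n lam) :
    (F : Lp ℂ 2 (bergmanMeasure n lam)) =ᵐ[bergmanMeasure n lam] hol F :=
  (Classical.choose_spec F.2).2

lemma eval_eq_hol (F : Bergman n lam) (z : Ball n) : eval F z = hol F z := rfl

lemma memLp_hol (F : Bergman n lam) : MemLp (hol F) 2 (bergmanMeasure n lam) :=
  (memLp_congr_ae (coeFn_ae_eq_hol F)).mp (Lp.memLp _)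

/-- The element of the Bergman space with a given holomorphic representative. -/
def ofFun (f : EuclideanSpace ℂ (Fin n) → ℂ) (hd : DifferentiableOn ℂ f (Metric.ball 0 1))
    (hm : MemLp f 2 (bergmanMeasure n lam)) : Bergman n lam :=
  ⟨hm.toLp f, f, hd, hm.coeFn_toLp⟩

lemma coeFn_ofFun (f : EuclideanSpace ℂ (Fin n) → ℂ) (hd : DifferentiableOn ℂ f (Metric.ball 0 1))
    (hm : MemLp f 2 (bergmanMeasure n lam)) :
    (ofFun f hd hm : Lp ℂ 2 (bergmanMeasure n lam)) =ᵐ[bergmanMeasure n lam] f :=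
  hm.coeFn_toLp

lemma inner_eq_integral (F G : Bergman n lam) :
    inner ℂ F G = ∫ z, conj (hol F z) * hol G z ∂bergmanMeasure n lam := by
  rw [Submodule.coe_inner, L2.inner_def]
  refine integral_congr_ae ?_
  filter_upwards [coeFn_ae_eq_hol F, coeFn_ae_eq_hol G] with z h1 h2
  rw [h1, h2, RCLike.inner_apply, mul_comm]

lemma norm_eq_eLpNorm_hol (F : Bergman n lam) :
    ‖F‖ = (eLpNorm (hol F) 2 (bergmanMeasure n lam)).toReal := by
  rw [Submodule.coe_norm, Lp.norm_def, eLpNorm_congr_ae (coeFn_ae_eq_hol F)]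

lemma ext_eval {F G : Bergman n lam} (h : ∀ z, eval F z = eval G z) : F = G := by
  refine Subtype.ext (Lp.ext ?_)
  filter_upwards [coeFn_ae_eq_hol F, coeFn_ae_eq_hol G, ae_bergmanMeasure_mem_ball] with z h1 h2 h3
  rw [h1, h2]
  exact h ⟨z, h3⟩

/-- The automorphy factor, as a function on the whole space. -/
def autE (lam : ℝ) (g : Gtilde n) (z : EuclideanSpace ℂ (Fin n)) : ℂ :=
  exp (-lam * (g.log (origin n) + Complex.log (den g.base z / den g.base 0)))

lemma autE_eq_j (g : Gtilde n) (z : Ball n) : autE lam g z = Gtilde.j lam g z := by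
  rw [autE, Gtilde.j, Gtilde.log_eq_log_zero_add g z]

lemma differentiableOn_autE (g : Gtilde n) :
    DifferentiableOn ℂ (autE lam g) (Metric.ball 0 1) := by
  intro z hz
  have h1 : DifferentiableAt ℂ (den g.base) z := (hasFDerivAt_den g.base z).differentiableAt
  have h2 : DifferentiableAt ℂ (fun z => den g.base z / den g.base 0) z := by
    simpa only [div_eq_mul_inv] using h1.mul_const (den g.base 0)⁻¹
  exact (((h2.clog (den_div_mem_slitPlane g.base ⟨z, hz⟩)).const_add _).const_mul
    _).cexp.differentiableWithinAt

/-- The function `π(g) f`. -/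
def translate (lam : ℝ) (g : Gtilde n) (f : EuclideanSpace ℂ (Fin n) → ℂ)
    (z : EuclideanSpace ℂ (Fin n)) : ℂ := autE lam g⁻¹ z * f (actE g.base⁻¹ z)

lemma differentiableOn_translate (g : Gtilde n) {f : EuclideanSpace ℂ (Fin n) → ℂ}
    (hf : DifferentiableOn ℂ f (Metric.ball 0 1)) :
    DifferentiableOn ℂ (translate lam g f) (Metric.ball 0 1) :=
  (differentiableOn_autE _).mul (hf.comp (differentiableOn_actE _) fun _ hz => actE_mem _ hz)

lemma eLpNorm_translate (g : Gtilde n) (f : EuclideanSpace ℂ (Fin n) → ℂ) :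
    eLpNorm (translate lam g f) 2 (bergmanMeasure n lam) =
      eLpNorm f 2 (bergmanMeasure n lam) := by
  rw [eLpNorm_eq_lintegral_rpow_enorm_toReal two_ne_zero (by simp),
    eLpNorm_eq_lintegral_rpow_enorm_toReal two_ne_zero (by simp),
    ← lintegral_bergmanMeasure_comp_act g.base⁻¹ (fun z => ‖f z‖ₑ ^ (2 : ℝ≥0∞).toReal)]
  congr 1
  refine lintegral_congr_ae ?_
  filter_upwards [ae_bergmanMeasure_mem_ball] with z hz
  rw [translate, enorm_mul, ENNReal.mul_rpow_of_nonneg _ _ (by simp)]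
  congr 1
  rw [autE_eq_j g⁻¹ ⟨z, hz⟩, ← ofReal_norm, Gtilde.norm_j, ENNReal.ofReal_rpow_of_nonneg
    (Real.rpow_nonneg (norm_nonneg _) _) (by simp), ← Real.rpow_mul (norm_nonneg _)]
  simp [Gtilde.base_inv, mul_comm]

lemma memLp_translate (g : Gtilde n) {f : EuclideanSpace ℂ (Fin n) → ℂ}
    (hf : DifferentiableOn ℂ f (Metric.ball 0 1)) (hm : MemLp f 2 (bergmanMeasure n lam)) :
    MemLp (translate lam g f) 2 (bergmanMeasure n lam) :=
  ⟨aestronglyMeasurable_of_continuousOn (differentiableOn_translate g hf).continuousOn,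
    (eLpNorm_translate g f).trans_lt hm.2⟩

/-- The one-variable mean value property for t ↦ f(tz), which is holomorphic on the closed unit disc
because |z| < 1. -/
lemma circle_mean {f : EuclideanSpace ℂ (Fin n) → ℂ} (hf : DifferentiableOn ℂ f (Metric.ball 0 1))
    {z : EuclideanSpace ℂ (Fin n)} (hz : z ∈ Metric.ball 0 1) :
    ∫ θ in (0 : ℝ)..2 * Real.pi, f (exp (θ * I) • z) = 2 * Real.pi * f 0 := by
  have hmem : ∀ t ∈ Metric.closedBall (0 : ℂ) 1, t • z ∈ Metric.ball 0 1 := by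
    intro t ht
    rw [mem_closedBall_zero_iff] at ht
    rw [mem_ball_zero_iff] at *
    rw [norm_smul]
    nlinarith [norm_nonneg z]
  have hd : DifferentiableOn ℂ (fun t : ℂ => f (t • z)) (Metric.closedBall 0 1) :=
    hf.comp (differentiable_id.smul_const z).differentiableOn hmem
  have h := DiffContOnCl.circleAverage (f := fun t : ℂ => f (t • z)) (c := 0) (R := 1)
    (by rw [abs_one]; exact hd.diffContOnCl_ball subset_rfl)
  rw [Real.circleAverage] at h
  simp only [circleMap, ofReal_one, one_mul, zero_add, zero_smul] at h
  rw [← h, Complex.real_smul]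
  push_cast
  rw [mul_inv_cancel_left₀]
  exact_mod_cast Real.two_pi_pos.ne'

lemma measurePreserving_smul_volume {c : ℂ} (hc : ‖c‖ = 1) :
    MeasurePreserving (fun z : EuclideanSpace ℂ (Fin n) => c • z) volume volume := by
  refine ⟨(continuous_const_smul _).measurable, ?_⟩
  have hdet : LinearMap.det ((c • LinearMap.id : EuclideanSpace ℂ (Fin n) →ₗ[ℂ]
      EuclideanSpace ℂ (Fin n)).restrictScalars ℝ) = 1 := by
    rw [LinearMap.det_restrictScalars, LinearMap.det_smul, LinearMap.det_id, mul_one,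
      Algebra.norm_complex_apply, normSq_eq_norm_sq, norm_pow, hc, one_pow, one_pow]
  have h := Measure.map_linearMap_addHaar_eq_smul_addHaar
    (volume : Measure (EuclideanSpace ℂ (Fin n))) (by rw [hdet]; exact one_ne_zero)
  rw [hdet, inv_one, abs_one, ENNReal.ofReal_one, one_smul] at h
  exact h

/-- The rotations preserve the weighted measure. -/
lemma measurePreserving_smul {c : ℂ} (hc : ‖c‖ = 1) :
    MeasurePreserving (fun z : EuclideanSpace ℂ (Fin n) => c • z)
      (bergmanMeasure n lam) (bergmanMeasure n lam) := by
  have hm : Measurable (fun z : EuclideanSpace ℂ (Fin n) => c • z) :=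
    (continuous_const_smul _).measurable
  refine ⟨hm, Measure.ext fun s hs => ?_⟩
  rw [← lintegral_indicator_one hs, ← lintegral_indicator_one hs,
    lintegral_map (measurable_one.indicator hs) hm, lintegral_bergmanMeasure,
    lintegral_bergmanMeasure]
  congr 1
  rw [← lintegral_indicator measurableSet_ball, ← lintegral_indicator measurableSet_ball]
  have hmeas := ((measurable_bergman_density (n := n) (lam := lam)).mul
    (measurable_one.indicator hs)).indicator
      (measurableSet_ball (x := (0 : EuclideanSpace ℂ (Fin n))) (ε := 1))
  refine (lintegral_congr fun z => ?_).trans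
    ((measurePreserving_smul_volume hc).lintegral_comp hmeas)
  have : c • z ∈ Metric.ball (0 : EuclideanSpace ℂ (Fin n)) 1 ↔ z ∈ Metric.ball 0 1 := by
    simp [norm_smul, hc]
  by_cases hz : z ∈ Metric.ball (0 : EuclideanSpace ℂ (Fin n)) 1
  · rw [Set.indicator_of_mem hz, Set.indicator_of_mem (this.mpr hz)]
    simp only [norm_smul, hc, one_mul]
  · rw [Set.indicator_of_notMem hz, Set.indicator_of_notMem (mt this.mp hz)]

variable [hn : Fact (1 ≤ n)] [hl : Fact ((n : ℝ) < lam)]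

instance : IsProbabilityMeasure (bergmanMeasure n lam) :=
  isProbabilityMeasure_bergmanMeasure hn.out hl.out

/-- Makes evaluation independent of the chosen representative, hence linear and compatible with the
group action. -/
lemma eqOn_of_ae_eq {f g : EuclideanSpace ℂ (Fin n) → ℂ} (h : f =ᵐ[bergmanMeasure n lam] g)
    (hf : ContinuousOn f (Metric.ball 0 1)) (hg : ContinuousOn g (Metric.ball 0 1)) :
    Set.EqOn f g (Metric.ball 0 1) :=
  Measure.eqOn_open_of_ae_eq ((ac_bergmanMeasure hn.out hl.out).ae_le h) Metric.isOpen_ball hf hg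

lemma hol_eqOn (F : Bergman n lam) {f : EuclideanSpace ℂ (Fin n) → ℂ}
    (hf : ContinuousOn f (Metric.ball 0 1))
    (h : (F : Lp ℂ 2 (bergmanMeasure n lam)) =ᵐ[bergmanMeasure n lam] f) :
    Set.EqOn (hol F) f (Metric.ball 0 1) :=
  eqOn_of_ae_eq ((coeFn_ae_eq_hol F).symm.trans h) (differentiableOn_hol F).continuousOn hf

lemma eval_ofFun (f : EuclideanSpace ℂ (Fin n) → ℂ) (hd : DifferentiableOn ℂ f (Metric.ball 0 1))
    (hm : MemLp f 2 (bergmanMeasure n lam)) (z : Ball n) : eval (ofFun f hd hm) z = f z :=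
  hol_eqOn _ hd.continuousOn (coeFn_ofFun f hd hm) z.2

lemma eval_add (F G : Bergman n lam) (z : Ball n) : eval (F + G) z = eval F z + eval G z := by
  refine hol_eqOn (F + G) (f := hol F + hol G)
    ((differentiableOn_hol F).add (differentiableOn_hol G)).continuousOn ?_ z.2
  exact (Lp.coeFn_add _ _).trans ((coeFn_ae_eq_hol F).add (coeFn_ae_eq_hol G))

lemma eval_smul (c : ℂ) (F : Bergman n lam) (z : Ball n) : eval (c • F) z = c * eval F z := by
  refine hol_eqOn (c • F) (f := c • hol F)
    ((differentiableOn_hol F).const_smul c).continuousOn ?_ z.2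
  exact (Lp.coeFn_smul _ _).trans ((coeFn_ae_eq_hol F).const_smul c)

/-! ### The holomorphic discrete series -/

/-- The operator `π(g)`. -/
def piFun (g : Gtilde n) (F : Bergman n lam) : Bergman n lam :=
  ofFun (translate lam g (hol F)) (differentiableOn_translate g (differentiableOn_hol F))
    (memLp_translate g (differentiableOn_hol F) (memLp_hol F))

lemma eval_piFun (g : Gtilde n) (F : Bergman n lam) (z : Ball n) :
    eval (piFun g F) z = Gtilde.j lam g⁻¹ z * eval F (g⁻¹ • z) := by
  rw [piFun, eval_ofFun, translate, autE_eq_j]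
  rfl

lemma norm_piFun (g : Gtilde n) (F : Bergman n lam) : ‖piFun g F‖ = ‖F‖ := by
  rw [Submodule.coe_norm, Lp.norm_def, piFun, eLpNorm_congr_ae (coeFn_ofFun _ _ _),
    eLpNorm_translate, norm_eq_eLpNorm_hol]

lemma piFun_mul (g h : Gtilde n) (F : Bergman n lam) :
    piFun (g * h) F = piFun g (piFun h F) := by
  refine ext_eval fun z => ?_
  rw [eval_piFun, eval_piFun, eval_piFun, mul_inv_rev, Gtilde.j_mul, mul_smul]
  ring

lemma piFun_one (F : Bergman n lam) : piFun (1 : Gtilde n) F = F := by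
  refine ext_eval fun z => ?_
  rw [eval_piFun, inv_one, Gtilde.j_one, one_mul, one_smul]

/-- The operator `π(g)` as a unitary operator. -/
def piEquiv (g : Gtilde n) : Bergman n lam ≃ₗᵢ[ℂ] Bergman n lam where
  toFun := piFun g
  map_add' F G := ext_eval fun z => by
    rw [eval_add, eval_piFun, eval_piFun, eval_piFun, eval_add, mul_add]
  map_smul' c F := ext_eval fun z => by
    rw [RingHom.id_apply, eval_smul, eval_piFun, eval_piFun, eval_smul, mul_left_comm]
  invFun := piFun g⁻¹
  left_inv F := by rw [← piFun_mul, inv_mul_cancel, piFun_one]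
  right_inv F := by rw [← piFun_mul, mul_inv_cancel, piFun_one]
  norm_map' := norm_piFun g

/-- The holomorphic discrete series representation. -/
def discreteSeries (n : ℕ) (lam : ℝ) [Fact (1 ≤ n)] [Fact ((n : ℝ) < lam)] :
    Gtilde n →* (Bergman n lam ≃ₗᵢ[ℂ] Bergman n lam) where
  toFun := piEquiv
  map_one' := LinearIsometryEquiv.ext piFun_one
  map_mul' g h := LinearIsometryEquiv.ext (piFun_mul g h)

lemma eval_discreteSeries (g : Gtilde n) (F : Bergman n lam) (z : Ball n) :
    eval (discreteSeries n lam g F) z = Gtilde.j lam g⁻¹ z * eval F (g⁻¹ • z) :=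
  eval_piFun g F z

/-! ### The mean value property -/

lemma integrable_hol (F : Bergman n lam) : Integrable (hol F) (bergmanMeasure n lam) :=
  (memLp_hol F).integrable one_le_two

/-- The mean value property. -/
lemma eval_origin (F : Bergman n lam) :
    eval F (origin n) = ∫ z, hol F z ∂bergmanMeasure n lam := by
  set μ := bergmanMeasure n lam with hμ
  -- The representative is arbitrary outside the ball; cutting it off there gives a function
  -- measurable on the whole space, as Fubini requires.
  set f : EuclideanSpace ℂ (Fin n) → ℂ := (Metric.ball 0 1).indicator (hol F) with hf
  have hfm : Measurable f := by
    classical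
    have := (differentiableOn_hol F).continuousOn.measurable_piecewise
      (g := fun _ => 0) continuousOn_const measurableSet_ball
    exact this
  have hfF : f =ᵐ[μ] hol F := by
    filter_upwards [ae_bergmanMeasure_mem_ball] with z hz
    rw [hf, Set.indicator_of_mem hz]
  have hfi : Integrable f μ := (integrable_hol F).congr hfF.symm
  have hc : Continuous fun θ : ℝ => exp (θ * I) := by fun_prop
  have hrm : Measurable fun p : EuclideanSpace ℂ (Fin n) × ℝ => f (exp (p.2 * I) • p.1) :=
    hfm.comp ((hc.comp continuous_snd).smul continuous_fst).measurable
  have hrot : ∀ θ : ℝ, ∫ z, f (exp (θ * I) • z) ∂μ = ∫ z, f z ∂μ := fun θ =>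
    ((measurePreserving_smul (norm_exp_ofReal_mul_I θ)).integral_comp
      (measurableEmbedding_const_smul₀ (exp_ne_zero _)) f)
  have hroti : ∀ θ : ℝ, ∫ z, ‖f (exp (θ * I) • z)‖ ∂μ = ∫ z, ‖f z‖ ∂μ := fun θ =>
    ((measurePreserving_smul (norm_exp_ofReal_mul_I θ)).integral_comp
      (measurableEmbedding_const_smul₀ (exp_ne_zero _)) fun z => ‖f z‖)
  have hi : ∀ θ : ℝ, Integrable (fun z => f (exp (θ * I) • z)) μ := fun θ =>
    ((measurePreserving_smul (norm_exp_ofReal_mul_I θ)).integrable_comp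
      hfi.aestronglyMeasurable).mpr hfi
  -- The measure is rotation invariant, so averaging over θ does not change the integral over z.
  -- Exchanging the integrals leaves circle means, each of which is a multiple of the value at 0.
  have hint : Integrable (fun p : EuclideanSpace ℂ (Fin n) × ℝ => f (exp (p.2 * I) • p.1))
      (μ.prod (volume.restrict (Set.Ioc 0 (2 * Real.pi)))) := by
    rw [integrable_prod_iff' hrm.aestronglyMeasurable]
    refine ⟨Filter.Eventually.of_forall hi, ?_⟩
    simp only [hroti]
    exact integrable_const _
  have h1 := integral_integral_swap
    (f := fun (z : EuclideanSpace ℂ (Fin n)) (θ : ℝ) => f (exp (θ * I) • z)) hint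
  have h2 : ∀ᵐ z ∂μ, ∫ θ in Set.Ioc 0 (2 * Real.pi), f (exp (θ * I) • z) =
      2 * Real.pi * hol F 0 := by
    filter_upwards [ae_bergmanMeasure_mem_ball] with z hz
    rw [← circle_mean (differentiableOn_hol F) hz, intervalIntegral.integral_of_le
      Real.two_pi_pos.le]
    refine integral_congr_ae (Filter.Eventually.of_forall fun θ => ?_)
    have : exp (θ * I) • z ∈ Metric.ball (0 : EuclideanSpace ℂ (Fin n)) 1 := by
      simpa [norm_smul, norm_exp_ofReal_mul_I] using hz
    simp only [hf, Set.indicator_of_mem this]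
  rw [integral_congr_ae h2] at h1
  simp only [hrot, integral_const] at h1
  rw [integral_congr_ae hfF] at h1
  simp only [Measure.real, measure_univ, ENNReal.toReal_one, one_smul, Measure.restrict_apply_univ,
    Real.volume_Ioc, sub_zero, ENNReal.toReal_ofReal Real.two_pi_pos.le, Complex.real_smul] at h1
  have hpi : (2 * Real.pi : ℂ) ≠ 0 := by exact_mod_cast Real.two_pi_pos.ne'
  refine mul_left_cancel₀ hpi ?_
  push_cast at h1
  exact h1

end Bergman

end BallRestriction
end

noncomputable section

namespace BallRestriction

/-! ## The reproducing kernel -/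

/-! ### Transitivity of the action on the ball -/

section Transitive

variable {n : ℕ}

lemma J_eq_fromBlocks : J n = Matrix.fromBlocks (-1) 0 0 1 := by
  ext (i | i) (j | j) <;> simp [J, Matrix.diagonal_apply, Matrix.one_apply]
  split_ifs <;> simp

/-- A column vector as a matrix. -/
def colMat (z : EuclideanSpace ℂ (Fin n)) : Matrix (Fin n) Unit ℂ := Matrix.of fun i _ => z i

lemma colMat_conjTranspose_mul (z : EuclideanSpace ℂ (Fin n)) :
    (colMat z).conjTranspose * colMat z = ((‖z‖ ^ 2 : ℝ) : ℂ) • (1 : Matrix Unit Unit ℂ) := by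
  ext
  rw [EuclideanSpace.norm_sq_eq]
  simp only [Matrix.mul_apply, Matrix.conjTranspose_apply, colMat, Matrix.of_apply,
    Matrix.smul_apply, Matrix.one_apply_eq, smul_eq_mul, mul_one, ofReal_sum, RCLike.star_def]
  exact Finset.sum_congr rfl fun i _ => by
    rw [mul_comm, mul_conj, normSq_eq_norm_sq]

/-- An element of `SU(n,1)` moving the origin to `z`, as a matrix. -/
def boostMat (z : EuclideanSpace ℂ (Fin n)) (γ : ℝ) : Mat n :=
  Matrix.fromBlocks (1 + ((γ ^ 2 / (γ + 1) : ℝ) : ℂ) • (colMat z * (colMat z).conjTranspose))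
    ((γ : ℂ) • colMat z) ((γ : ℂ) • (colMat z).conjTranspose) ((γ : ℂ) • 1)

lemma boostMat_mem (z : EuclideanSpace ℂ (Fin n)) {γ : ℝ} (hγ : 0 < γ)
    (h : γ ^ 2 * (1 - ‖z‖ ^ 2) = 1) :
    boostMat z γ * J n * (boostMat z γ).conjTranspose = J n := by
  have hV := colMat_conjTranspose_mul z
  have h1 : γ + 1 ≠ 0 := by positivity
  rw [boostMat, J_eq_fromBlocks, Matrix.fromBlocks_conjTranspose, Matrix.fromBlocks_multiply,
    Matrix.fromBlocks_multiply]
  set c : ℝ := γ ^ 2 / (γ + 1) with hcdef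
  set r : ℝ := ‖z‖ ^ 2 with hr
  -- With r = |z|² expressed through γ, the block equations reduce to three scalar identities: `k1`
  -- for the upper left block, `k2` for the off-diagonal ones, `k3` for the corner.
  have hrv : r = 1 - 1 / γ ^ 2 := by field_simp; linarith
  have k1 : 2 * c + c ^ 2 * r = γ ^ 2 := by rw [hcdef, hrv]; field_simp; ring
  have k2 : 1 + c * r = γ := by rw [hcdef, hrv]; field_simp; ring
  have k3 : γ ^ 2 - γ ^ 2 * r = 1 := by rw [← h]; ring
  have k1' : (2 * c + c ^ 2 * r : ℂ) = γ ^ 2 := by exact_mod_cast k1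
  have k2' : (1 + c * r : ℂ) = γ := by exact_mod_cast k2
  have k3' : (γ ^ 2 - γ ^ 2 * r : ℂ) = 1 := by exact_mod_cast k3
  clear_value c r
  set V := colMat z
  have hPP : V * V.conjTranspose * (V * V.conjTranspose) = (r : ℂ) • (V * V.conjTranspose) := by
    rw [Matrix.mul_assoc, ← Matrix.mul_assoc V.conjTranspose, hV, Matrix.smul_mul, Matrix.one_mul,
      Matrix.mul_smul]
  have hPV : V * V.conjTranspose * V = (r : ℂ) • V := by
    rw [Matrix.mul_assoc, hV, Matrix.mul_smul, Matrix.mul_one]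
  have hVP : V.conjTranspose * (V * V.conjTranspose) = (r : ℂ) • V.conjTranspose := by
    rw [← Matrix.mul_assoc, hV, Matrix.smul_mul, Matrix.one_mul]
  congr 1
  · simp only [Matrix.conjTranspose_add, Matrix.conjTranspose_one, Matrix.conjTranspose_smul,
      Matrix.conjTranspose_mul, Matrix.conjTranspose_conjTranspose, RCLike.star_def, conj_ofReal,
      Matrix.mul_add, Matrix.add_mul, Matrix.mul_one, Matrix.one_mul, Matrix.mul_neg,
      Matrix.neg_mul, Matrix.smul_mul, Matrix.mul_smul, smul_smul, hPP, Matrix.mul_zero, zero_add,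
      add_zero]
    linear_combination (norm := module) (-k1') • (V * V.conjTranspose)
  · simp only [Matrix.conjTranspose_smul, Matrix.conjTranspose_conjTranspose, RCLike.star_def,
      conj_ofReal, Matrix.conjTranspose_one,
      Matrix.add_mul, Matrix.mul_one, Matrix.one_mul, Matrix.mul_neg,
      Matrix.neg_mul, Matrix.smul_mul, Matrix.mul_smul, smul_smul, hPV, Matrix.mul_zero, zero_add,
      add_zero]
    linear_combination (norm := module) (-γ * k2') • V
  · simp only [Matrix.conjTranspose_smul, Matrix.conjTranspose_conjTranspose, RCLike.star_def,
      conj_ofReal, Matrix.conjTranspose_one, Matrix.conjTranspose_add, Matrix.conjTranspose_mul,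
      Matrix.mul_add, Matrix.mul_one, Matrix.one_mul, Matrix.mul_neg,
      Matrix.neg_mul, Matrix.smul_mul, Matrix.mul_smul, smul_smul, hVP, Matrix.mul_zero, zero_add,
      add_zero]
    linear_combination (norm := module) (-γ * k2') • V.conjTranspose
  · simp only [Matrix.conjTranspose_smul, Matrix.conjTranspose_conjTranspose, RCLike.star_def,
      conj_ofReal, Matrix.conjTranspose_one, Matrix.mul_one, Matrix.mul_neg,
      Matrix.neg_mul, Matrix.smul_mul, Matrix.mul_smul, smul_smul, hV, Matrix.mul_zero, zero_add,
      add_zero]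
    linear_combination (norm := module) k3' • (1 : Matrix Unit Unit ℂ)

/-- The Schur complement of the corner is a rank one perturbation of the identity, so its
determinant is that of a one-by-one matrix. -/
lemma det_boostMat (z : EuclideanSpace ℂ (Fin n)) {γ : ℝ} (hγ : 0 < γ)
    (h : γ ^ 2 * (1 - ‖z‖ ^ 2) = 1) : (boostMat z γ).det = 1 := by
  have hV := colMat_conjTranspose_mul z
  have hg : (γ : ℂ) ≠ 0 := by exact_mod_cast hγ.ne'
  let _ : Invertible ((γ : ℂ) • (1 : Matrix Unit Unit ℂ)) :=
    ⟨(γ : ℂ)⁻¹ • 1, by rw [Matrix.smul_mul, Matrix.one_mul, smul_smul, inv_mul_cancel₀ hg, one_smul],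
      by rw [Matrix.smul_mul, Matrix.one_mul, smul_smul, mul_inv_cancel₀ hg, one_smul]⟩
  have h1 : γ + 1 ≠ 0 := by positivity
  set c : ℝ := γ ^ 2 / (γ + 1) with hcdef
  set r : ℝ := ‖z‖ ^ 2 with hr
  have hrv : r = 1 - 1 / γ ^ 2 := by field_simp; linarith
  have k : γ * (1 + (c - γ) * r) = 1 := by rw [hcdef, hrv]; field_simp; ring
  have k' : (γ * (1 + (c - γ) * r) : ℂ) = 1 := by exact_mod_cast k
  clear_value c r
  rw [boostMat, ← hcdef, Matrix.det_fromBlocks₂₂]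
  have e : 1 + (c : ℂ) • (colMat z * (colMat z).conjTranspose) - (γ : ℂ) • colMat z *
      ⅟((γ : ℂ) • (1 : Matrix Unit Unit ℂ)) * (γ : ℂ) • (colMat z).conjTranspose =
      1 + colMat z * (((c : ℂ) - γ) • (colMat z).conjTranspose) := by
    have : ⅟((γ : ℂ) • (1 : Matrix Unit Unit ℂ)) = (γ : ℂ)⁻¹ • 1 := rfl
    rw [this]
    simp only [Matrix.mul_smul, Matrix.smul_mul, Matrix.mul_one, smul_smul, sub_smul]
    rw [inv_mul_cancel₀ hg, mul_one, Matrix.mul_sub, Matrix.mul_smul, Matrix.mul_smul]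
    abel
  rw [e, Matrix.det_one_add_mul_comm, Matrix.smul_mul, hV]
  simp only [Matrix.det_unique, Matrix.smul_apply, Matrix.add_apply, Matrix.one_apply_eq,
    smul_eq_mul, mul_one]
  exact k'

/-- `SU(n,1)` acts transitively on the ball. -/
lemma exists_act_origin_eq (z : Ball n) : ∃ g : SU n, act g (origin n) = z := by
  have hz := ball_sq z
  set γ : ℝ := 1 / √(1 - ‖(z : EuclideanSpace ℂ (Fin n))‖ ^ 2) with hγ
  have h0 : 0 < √(1 - ‖(z : EuclideanSpace ℂ (Fin n))‖ ^ 2) := Real.sqrt_pos.mpr (by linarith)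
  have hpos : 0 < γ := by positivity
  have h : γ ^ 2 * (1 - ‖(z : EuclideanSpace ℂ (Fin n))‖ ^ 2) = 1 := by
    rw [hγ, div_pow, Real.sq_sqrt (by linarith), one_pow, one_div, inv_mul_cancel₀ (by linarith)]
  refine ⟨⟨⟨boostMat z γ, det_boostMat _ hpos h⟩, boostMat_mem _ hpos h⟩, ?_⟩
  apply Subtype.ext
  ext i
  have hg : (γ : ℂ) ≠ 0 := by exact_mod_cast hpos.ne'
  rw [coe_act, actE, PiLp.smul_apply]
  change (den _ 0)⁻¹ • (num _ 0) i = _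
  simp [den_zero, num_apply, toMat, boostMat, colMat, hg]

end Transitive

/-! ### The kernel (1 - ⟨w, z⟩)^{-β} and its invariance -/

section Kernel

variable {n : ℕ}

lemma norm_inner_lt_one (z w : Ball n) :
    ‖inner ℂ (w : EuclideanSpace ℂ (Fin n)) (z : EuclideanSpace ℂ (Fin n))‖ < 1 := by
  refine (norm_inner_le_norm _ _).trans_lt ?_
  have := ball_norm_lt z
  have := ball_norm_lt w
  nlinarith [norm_nonneg (w : EuclideanSpace ℂ (Fin n)), norm_nonneg (z : EuclideanSpace ℂ (Fin n))]

lemma one_sub_inner_re_pos (z w : Ball n) :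
    0 < (1 - inner ℂ (w : EuclideanSpace ℂ (Fin n)) (z : EuclideanSpace ℂ (Fin n))).re := by
  have h := (re_le_norm _).trans_lt (norm_inner_lt_one z w)
  rw [sub_re, one_re]
  linarith

lemma one_sub_inner_mem_slitPlane (z w : Ball n) :
    1 - inner ℂ (w : EuclideanSpace ℂ (Fin n)) (z : EuclideanSpace ℂ (Fin n)) ∈ slitPlane :=
  Or.inl (one_sub_inner_re_pos z w)

lemma one_sub_inner_ne_zero (z w : Ball n) :
    1 - inner ℂ (w : EuclideanSpace ℂ (Fin n)) (z : EuclideanSpace ℂ (Fin n)) ≠ 0 :=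
  slitPlane_ne_zero (one_sub_inner_mem_slitPlane z w)

lemma log_one_sub_inner_self_im (z : Ball n) : (Complex.log (1 - inner ℂ
    (z : EuclideanSpace ℂ (Fin n)) (z : EuclideanSpace ℂ (Fin n)))).im = 0 := by
  have : (1 - inner ℂ (z : EuclideanSpace ℂ (Fin n)) (z : EuclideanSpace ℂ (Fin n)) : ℂ) =
      ((1 - ‖(z : EuclideanSpace ℂ (Fin n))‖ ^ 2 : ℝ) : ℂ) := by
    rw [inner_self_eq_norm_sq_to_K]; push_cast; rfl
  rw [this, log_im, arg_ofReal_of_nonneg (by have := ball_sq z; linarith)]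

lemma eq_zero_of_exp_eq_one_of_im {x : ℂ} (h : exp x = 1) (h2 : x.im = 0) : x = 0 := by
  obtain ⟨m, hm⟩ := exp_eq_one_iff.mp h
  rw [hm] at h2 ⊢
  simp [Real.pi_ne_zero] at h2
  simp [h2]

/-- The invariance of the logarithm of `1 - ⟨w, z⟩`. -/
lemma log_one_sub_inner_smul (g : Gtilde n) (z w : Ball n) :
    Complex.log (1 - inner ℂ ((g • w : Ball n) : EuclideanSpace ℂ (Fin n))
      ((g • z : Ball n) : EuclideanSpace ℂ (Fin n))) + g.log z + conj (g.log w) =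
    Complex.log (1 - inner ℂ (w : EuclideanSpace ℂ (Fin n)) (z : EuclideanSpace ℂ (Fin n))) := by
  -- Both sides are continuous logarithms of one function on the connected space of pairs, so their
  -- difference is constant.
  let f : Ball n × Ball n → ℂ := fun p =>
    Complex.log (1 - inner ℂ (act g.base p.2 : EuclideanSpace ℂ (Fin n))
      (act g.base p.1 : EuclideanSpace ℂ (Fin n))) + g.log p.1 + conj (g.log p.2) -
    Complex.log (1 - inner ℂ (p.2 : EuclideanSpace ℂ (Fin n)) (p.1 : EuclideanSpace ℂ (Fin n)))
  have hsub : Continuous fun p : Ball n × Ball n => (1 - inner ℂ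
      (p.2 : EuclideanSpace ℂ (Fin n)) (p.1 : EuclideanSpace ℂ (Fin n)) : ℂ) := by fun_prop
  have hact := continuous_act g.base
  have hlog : Continuous fun p : Ball n × Ball n => Complex.log (1 - inner ℂ
      (p.2 : EuclideanSpace ℂ (Fin n)) (p.1 : EuclideanSpace ℂ (Fin n))) :=
    hsub.clog fun p => one_sub_inner_mem_slitPlane p.1 p.2
  have hf : Continuous f := by
    have h1 := hlog.comp ((hact.comp continuous_fst).prodMk (hact.comp continuous_snd))
    exact ((h1.add (g.log_continuous.comp continuous_fst)).add
      (continuous_conj.comp (g.log_continuous.comp continuous_snd))).sub hlog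
  have hexp : ∀ p, exp (f p) = 1 := by
    rintro ⟨z, w⟩
    have h := den_mul_conj_den g.base z w
    simp only [f]
    rw [exp_sub, exp_add, exp_add, exp_conj, Complex.exp_log (one_sub_inner_ne_zero _ _),
      Complex.exp_log (one_sub_inner_ne_zero _ _), g.exp_log, g.exp_log, ← h]
    rw [div_eq_one_iff_eq]
    · ring
    · rw [h]; exact one_sub_inner_ne_zero _ _
  -- On the diagonal every term is real: 1 - |z|² is positive and the two logarithms of the factor
  -- are conjugate. A real multiple of 2πi is zero.
  have h0 : f (origin n, origin n) = 0 := by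
    refine eq_zero_of_exp_eq_one_of_im (hexp _) ?_
    simp only [f, sub_im, add_im, log_one_sub_inner_self_im, conj_im]
    ring
  have := (eq_of_exp_eq hf hexp (z, w) (origin n, origin n)).trans h0
  exact sub_eq_zero.mp this

/-- The kernel `(1 - ⟨w, z⟩)^{-β}`. -/
def kernel (β : ℝ) (w z : EuclideanSpace ℂ (Fin n)) : ℂ := (1 - inner ℂ w z) ^ (-β : ℂ)

lemma kernel_eq_exp (β : ℝ) (w z : Ball n) : kernel β (w : EuclideanSpace ℂ (Fin n)) z =
    exp (-β * Complex.log (1 - inner ℂ (w : EuclideanSpace ℂ (Fin n))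
      (z : EuclideanSpace ℂ (Fin n)))) := by
  rw [kernel, cpow_def_of_ne_zero (one_sub_inner_ne_zero z w), mul_comm]

/-- For real β the power depends on the branch; exponentiating the identity between logarithms
avoids the ambiguity. -/
lemma kernel_smul (β : ℝ) (g : Gtilde n) (w z : Ball n) :
    kernel β ((g • w : Ball n) : EuclideanSpace ℂ (Fin n)) (g • z : Ball n) *
      Gtilde.j β g z * conj (Gtilde.j β g w) = kernel β (w : EuclideanSpace ℂ (Fin n)) z := by
  rw [kernel_eq_exp, kernel_eq_exp, Gtilde.j, Gtilde.j, ← exp_conj, ← exp_add, ← exp_add,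
    ← log_one_sub_inner_smul g z w]
  congr 1
  simp
  ring

lemma conj_kernel (β : ℝ) (w z : Ball n) : conj (kernel β (w : EuclideanSpace ℂ (Fin n)) z) =
    kernel β (z : EuclideanSpace ℂ (Fin n)) w := by
  rw [kernel_eq_exp, kernel_eq_exp, ← exp_conj, map_mul, map_neg, conj_ofReal, ← log_conj]
  · simp
  · exact slitPlane_arg_ne_pi (one_sub_inner_mem_slitPlane z w)

lemma kernel_zero_left (β : ℝ) (z : EuclideanSpace ℂ (Fin n)) : kernel β 0 z = 1 := by
  simp [kernel]

end Kernel

/-! ### Reproducing vectors of the Bergman space -/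

namespace Bergman

variable {n : ℕ} {lam : ℝ} [hn : Fact (1 ≤ n)] [hl : Fact ((n : ℝ) < lam)]

/-- The constant function `1`. -/
def const (n : ℕ) (lam : ℝ) [Fact (1 ≤ n)] [Fact ((n : ℝ) < lam)] : Bergman n lam :=
  ofFun (fun _ => 1) (differentiableOn_const _) (memLp_const _)

lemma inner_const (F : Bergman n lam) : inner ℂ (const n lam) F = eval F (origin n) := by
  rw [inner_eq_integral, eval_origin]
  refine integral_congr_ae ?_
  filter_upwards [ae_bergmanMeasure_mem_ball] with z hz
  have : hol (const n lam) z = 1 := eval_ofFun (lam := lam) (fun _ => 1) (differentiableOn_const _)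
    (memLp_const _) ⟨z, hz⟩
  rw [this]
  simp

lemma discreteSeries_mul_inv (g : Gtilde n) (F : Bergman n lam) :
    discreteSeries n lam g (discreteSeries n lam g⁻¹ F) = F := by
  change piFun g (piFun g⁻¹ F) = F
  rw [← piFun_mul, mul_inv_cancel, piFun_one]

/-- The point evaluations are given by the kernel functions. -/
lemma exists_reproducing (z : Ball n) : ∃ K : Bergman n lam,
    (∀ w : Ball n, eval K w = kernel lam (z : EuclideanSpace ℂ (Fin n)) w) ∧
    ∀ F : Bergman n lam, inner ℂ K F = eval F z := by
  obtain ⟨g₀, hg₀⟩ := exists_act_origin_eq z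
  obtain ⟨g, hg⟩ := Gtilde.exists_lift g₀
  have hz : g • origin n = z := by rw [Gtilde.smul_def, hg, hg₀]
  have hj : Gtilde.j lam g (origin n) ≠ 0 := exp_ne_zero _
  -- The constant 1 represents evaluation at the origin, so its translate by g represents evaluation
  -- at z = g · 0, up to the automorphy factor that is divided out.
  refine ⟨(conj (Gtilde.j lam g (origin n)))⁻¹ • discreteSeries n lam g (const n lam), fun w => ?_,
    fun F => ?_⟩
  · rw [eval_smul, eval_discreteSeries]
    have h1 : eval (const n lam) (g⁻¹ • w) = 1 := eval_ofFun _ _ _ _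
    have h2 := kernel_smul lam g (origin n) (g⁻¹ • w)
    have h3 := Gtilde.j_mul lam g g⁻¹ w
    have h4 : kernel lam ((origin n : Ball n) : EuclideanSpace ℂ (Fin n)) (g⁻¹ • w : Ball n) = 1 :=
      kernel_zero_left _ _
    rw [mul_inv_cancel, Gtilde.j_one] at h3
    rw [smul_inv_smul, hz, h4] at h2
    rw [h1, mul_one]
    have h5 : Gtilde.j lam g⁻¹ w ≠ 0 := exp_ne_zero _
    have h6 : conj (Gtilde.j lam g (origin n)) ≠ 0 := by simpa using hj
    rw [inv_mul_eq_iff_eq_mul₀ h6]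
    linear_combination (-Gtilde.j lam g⁻¹ w) * h2 -
      kernel lam (z : EuclideanSpace ℂ (Fin n)) w * conj (Gtilde.j lam g (origin n)) * h3
  · refine (inner_smul_left (𝕜 := ℂ) (E := Bergman n lam) _ _ _).trans ?_
    have h1 : inner ℂ (discreteSeries n lam g (const n lam)) F =
        inner ℂ (const n lam) (discreteSeries n lam g⁻¹ F) := by
      rw [← (discreteSeries n lam g).inner_map_map (const n lam), discreteSeries_mul_inv]
    rw [h1, inner_const, eval_discreteSeries, inv_inv, hz]
    simp only [map_inv₀, conj_conj]
    rw [inv_mul_cancel_left₀ hj]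

/-- The reproducing kernel function at `z`. -/
def repro (z : Ball n) : Bergman n lam := Classical.choose (exists_reproducing z)

lemma eval_repro (z w : Ball n) : eval (repro z : Bergman n lam) w =
    kernel lam (z : EuclideanSpace ℂ (Fin n)) w := (Classical.choose_spec (exists_reproducing z)).1 w

lemma inner_repro (z : Ball n) (F : Bergman n lam) : inner ℂ (repro z) F = eval F z :=
  (Classical.choose_spec (exists_reproducing z)).2 F

end Bergman

end BallRestriction
end

noncomputable section

namespace BallRestriction

/-! ## Integrals against the kernel are holomorphic -/

section KernelIntegral

variable {n : ℕ} {lam : ℝ}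

/-- The integral of a function against the kernel. -/
def kernelIntegral (lam β : ℝ) (G : EuclideanSpace ℂ (Fin n) → ℂ) (z : EuclideanSpace ℂ (Fin n)) :
    ℂ := ∫ w, kernel β w z * G w ∂bergmanMeasure n lam

lemma hasFDerivAt_kernel (β : ℝ) (w z : Ball n) :
    HasFDerivAt (𝕜 := ℂ) (kernel β (w : EuclideanSpace ℂ (Fin n)))
      ((β * kernel (β + 1) (w : EuclideanSpace ℂ (Fin n)) z) •
        innerSL ℂ (w : EuclideanSpace ℂ (Fin n))) z := by
  have h1 : HasFDerivAt (𝕜 := ℂ) (fun z => 1 - inner ℂ (w : EuclideanSpace ℂ (Fin n)) z)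
      (-innerSL ℂ (w : EuclideanSpace ℂ (Fin n))) (z : EuclideanSpace ℂ (Fin n)) :=
    (innerSL ℂ (w : EuclideanSpace ℂ (Fin n))).hasFDerivAt.const_sub 1
  have h2 : HasDerivAt (fun x : ℂ => x ^ (-β : ℂ)) ((-β : ℂ) *
      (1 - inner ℂ (w : EuclideanSpace ℂ (Fin n)) (z : EuclideanSpace ℂ (Fin n))) ^ ((-β : ℂ) - 1))
      (1 - inner ℂ (w : EuclideanSpace ℂ (Fin n)) (z : EuclideanSpace ℂ (Fin n))) := by
    simpa using (hasDerivAt_id _).cpow_const (c := (-β : ℂ)) (one_sub_inner_mem_slitPlane z w)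
  refine (h2.comp_hasFDerivAt (z : EuclideanSpace ℂ (Fin n)) h1).congr_fderiv ?_
  have : (-β : ℂ) - 1 = -((β + 1 : ℝ) : ℂ) := by push_cast; ring
  rw [this, kernel, smul_neg, ← neg_smul]
  congr 1
  ring

lemma norm_kernel_le {β : ℝ} (hβ : 0 ≤ β) {r : ℝ} (hr : r < 1) (w z : Ball n)
    (hz : ‖(z : EuclideanSpace ℂ (Fin n))‖ ≤ r) :
    ‖kernel β (w : EuclideanSpace ℂ (Fin n)) z‖ ≤ (1 - r) ^ (-β) := by
  have h0 : 0 < 1 - r := by linarith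
  have h1 : 1 - r ≤ ‖1 - inner ℂ (w : EuclideanSpace ℂ (Fin n))
      (z : EuclideanSpace ℂ (Fin n))‖ := by
    have h2 := norm_inner_le_norm (𝕜 := ℂ) (w : EuclideanSpace ℂ (Fin n))
      (z : EuclideanSpace ℂ (Fin n))
    have h3 := norm_sub_norm_le (1 : ℂ) (inner ℂ (w : EuclideanSpace ℂ (Fin n))
      (z : EuclideanSpace ℂ (Fin n)))
    have h4 := ball_norm_lt w
    rw [norm_one] at h3
    nlinarith [norm_nonneg (z : EuclideanSpace ℂ (Fin n)),
      norm_nonneg (w : EuclideanSpace ℂ (Fin n))]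
  rw [kernel, ← ofReal_neg, norm_cpow_real]
  exact Real.rpow_le_rpow_of_nonpos h0 h1 (by linarith)

lemma aestronglyMeasurable_kernel (β : ℝ) (z : Ball n) :
    AEStronglyMeasurable (fun w => kernel β w (z : EuclideanSpace ℂ (Fin n)))
      (bergmanMeasure n lam) := by
  refine Bergman.aestronglyMeasurable_of_continuousOn ?_
  refine ContinuousOn.cpow_const (by fun_prop) fun w hw => ?_
  exact one_sub_inner_mem_slitPlane z ⟨w, hw⟩

/-- Differentiation under the integral: on the ball of radius r = (1 + |z|)/2 the derivative of the
kernel is bounded uniformly in w. The derivative has the same shape with β + 1, so the class of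
kernel integrals is closed under directional derivatives. -/
lemma hasFDerivAt_kernelIntegral {β : ℝ} (hβ : 0 ≤ β) {G : EuclideanSpace ℂ (Fin n) → ℂ}
    (hG : Integrable G (bergmanMeasure n lam)) (z : Ball n) :
    ∃ L : EuclideanSpace ℂ (Fin n) →L[ℂ] ℂ,
      HasFDerivAt (kernelIntegral lam β G) L (z : EuclideanSpace ℂ (Fin n)) ∧
      ∀ v, L v = kernelIntegral lam (β + 1) (fun w => β * (inner ℂ w v * G w)) z := by
  set μ := bergmanMeasure n lam
  have hz := ball_norm_lt z
  set r : ℝ := (1 + ‖(z : EuclideanSpace ℂ (Fin n))‖) / 2 with hr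
  have hr1 : r < 1 := by rw [hr]; linarith
  have hs : Metric.ball (0 : EuclideanSpace ℂ (Fin n)) r ∈ nhds (z : EuclideanSpace ℂ (Fin n)) := by
    refine Metric.isOpen_ball.mem_nhds ?_
    rw [mem_ball_zero_iff, hr]
    linarith
  have hsub : ∀ x ∈ Metric.ball (0 : EuclideanSpace ℂ (Fin n)) r,
      x ∈ Metric.ball (0 : EuclideanSpace ℂ (Fin n)) 1 := fun x hx =>
    Metric.ball_subset_ball hr1.le hx
  set F' : EuclideanSpace ℂ (Fin n) → EuclideanSpace ℂ (Fin n) → EuclideanSpace ℂ (Fin n) →L[ℂ] ℂ :=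
    fun x w => (G w) • ((β * kernel (β + 1) w x) • innerSL ℂ w) with hF'
  have hF'm : AEStronglyMeasurable (F' z) μ :=
    hG.aestronglyMeasurable.smul (((aestronglyMeasurable_kernel _ z).const_mul _).smul
      (innerSL ℂ).continuous.aestronglyMeasurable)
  have hbound : ∀ᵐ w ∂μ, ∀ x ∈ Metric.ball (0 : EuclideanSpace ℂ (Fin n)) r,
      ‖F' x w‖ ≤ (β * (1 - r) ^ (-(β + 1))) * ‖G w‖ := by
    filter_upwards [ae_bergmanMeasure_mem_ball] with w hw x hx
    have h1 := norm_kernel_le (show 0 ≤ β + 1 by linarith) hr1 ⟨w, hw⟩ ⟨x, hsub x hx⟩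
      (mem_ball_zero_iff.mp hx).le
    have h2 := (mem_ball_zero_iff.mp hw).le
    rw [hF', norm_smul, norm_smul, norm_mul, innerSL_apply_norm, Complex.norm_real,
      Real.norm_of_nonneg hβ, mul_comm]
    refine mul_le_mul_of_nonneg_right ?_ (norm_nonneg _)
    calc β * ‖kernel (β + 1) w x‖ * ‖w‖ ≤ β * (1 - r) ^ (-(β + 1)) * 1 := by gcongr
      _ = _ := mul_one _
  have hint := (hG.norm.const_mul (β * (1 - r) ^ (-(β + 1))))
  have hdiff : ∀ᵐ w ∂μ, ∀ x ∈ Metric.ball (0 : EuclideanSpace ℂ (Fin n)) r,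
      HasFDerivAt (𝕜 := ℂ) (fun x => kernel β w x * G w) (F' x w) x := by
    filter_upwards [ae_bergmanMeasure_mem_ball] with w hw x hx
    exact (hasFDerivAt_kernel β ⟨w, hw⟩ ⟨x, hsub x hx⟩).mul_const (G w)
  have hmeas : ∀ᶠ x in nhds (z : EuclideanSpace ℂ (Fin n)),
      AEStronglyMeasurable (fun w => kernel β w x * G w) μ := by
    filter_upwards [hs] with x hx
    exact (aestronglyMeasurable_kernel β ⟨x, hsub x hx⟩).mul hG.aestronglyMeasurable
  have hint0 : Integrable (fun w => kernel β w (z : EuclideanSpace ℂ (Fin n)) * G w) μ := by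
    refine hG.bdd_mul (c := (1 - r) ^ (-β)) (aestronglyMeasurable_kernel β z) ?_
    filter_upwards [ae_bergmanMeasure_mem_ball] with w hw
    exact norm_kernel_le hβ hr1 ⟨w, hw⟩ z (by rw [hr]; linarith)
  refine ⟨∫ w, F' z w ∂μ, hasFDerivAt_integral_of_dominated_of_fderiv_le hs hmeas hint0 hF'm hbound
    hint hdiff, fun v => ?_⟩
  have hF'i : Integrable (F' z) μ := hint.mono' hF'm (by
    filter_upwards [hbound] with w hw using hw _ (mem_of_mem_nhds hs))
  rw [ContinuousLinearMap.integral_apply hF'i, kernelIntegral]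
  refine integral_congr_ae (Filter.Eventually.of_forall fun w => ?_)
  simp [hF']
  ring

lemma differentiableOn_kernelIntegral {β : ℝ} (hβ : 0 ≤ β) {G : EuclideanSpace ℂ (Fin n) → ℂ}
    (hG : Integrable G (bergmanMeasure n lam)) :
    DifferentiableOn ℂ (kernelIntegral lam β G) (Metric.ball 0 1) := fun z hz => by
  obtain ⟨L, hL, -⟩ := hasFDerivAt_kernelIntegral hβ hG ⟨z, hz⟩
  exact hL.differentiableAt.differentiableWithinAt

lemma integrable_inner_mul {G : EuclideanSpace ℂ (Fin n) → ℂ}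
    (hG : Integrable G (bergmanMeasure n lam)) (β : ℝ) (v : EuclideanSpace ℂ (Fin n)) :
    Integrable (fun w => (β : ℂ) * (inner ℂ w v * G w)) (bergmanMeasure n lam) := by
  refine (hG.bdd_mul (c := ‖v‖) ?_ ?_).const_mul _
  · exact (by fun_prop : Continuous fun w : EuclideanSpace ℂ (Fin n) =>
      inner ℂ w v).aestronglyMeasurable
  · filter_upwards [ae_bergmanMeasure_mem_ball] with w hw
    refine (norm_inner_le_norm _ _).trans ?_
    have h2 := (mem_ball_zero_iff.mp hw).le
    nlinarith [norm_nonneg v]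

/-- A family of holomorphic functions which is closed under directional derivatives. -/
def IsKernelIntegral (lam : ℝ) (f : EuclideanSpace ℂ (Fin n) → ℂ) : Prop :=
  ∃ β : ℝ, 0 ≤ β ∧ ∃ G, Integrable G (bergmanMeasure n lam) ∧
    Set.EqOn f (kernelIntegral lam β G) (Metric.ball 0 1)

lemma IsKernelIntegral.differentiableAt {f : EuclideanSpace ℂ (Fin n) → ℂ}
    (hf : IsKernelIntegral lam f) {z : EuclideanSpace ℂ (Fin n)} (hz : z ∈ Metric.ball 0 1) :
    DifferentiableAt ℂ f z := by
  obtain ⟨β, hβ, G, hG, h⟩ := hf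
  exact (((differentiableOn_kernelIntegral hβ hG).congr h) z hz).differentiableAt
    (Metric.isOpen_ball.mem_nhds hz)

lemma IsKernelIntegral.fderiv_apply {f : EuclideanSpace ℂ (Fin n) → ℂ}
    (hf : IsKernelIntegral lam f) (v : EuclideanSpace ℂ (Fin n)) :
    IsKernelIntegral lam (fun z => fderiv ℂ f z v) := by
  obtain ⟨β, hβ, G, hG, h⟩ := hf
  refine ⟨β + 1, by linarith, _, integrable_inner_mul hG β v, fun z hz => ?_⟩
  obtain ⟨L, hL, hL2⟩ := hasFDerivAt_kernelIntegral hβ hG ⟨z, hz⟩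
  have hev : f =ᶠ[nhds z] kernelIntegral lam β G :=
    Filter.eventuallyEq_of_mem (Metric.isOpen_ball.mem_nhds hz) h
  change fderiv ℂ f z v = _
  rw [hev.fderiv_eq, hL.fderiv, hL2]

/-- If a property forces a function in the family to vanish at `z₀` and is inherited by all
directional derivatives, then the functions with this property are zero. -/
lemma IsKernelIntegral.eq_zero (P : (EuclideanSpace ℂ (Fin n) → ℂ) → Prop) (z₀ : Ball n)
    (h0 : ∀ f, IsKernelIntegral lam f → P f → f z₀ = 0)
    (hP : ∀ f, IsKernelIntegral lam f → P f → ∀ v, P fun z => fderiv ℂ f z v)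
    {f : EuclideanSpace ℂ (Fin n) → ℂ} (hf : IsKernelIntegral lam f) (hPf : P f) (z : Ball n) :
    f z = 0 := by
  set v : EuclideanSpace ℂ (Fin n) := z - z₀ with hv
  -- The slice of the ball by the complex line through z₀ and z: open, convex, and containing the
  -- parameters 0 and 1 of the two points.
  let U : Set ℂ := (fun t : ℂ => (z₀ : EuclideanSpace ℂ (Fin n)) + t • v) ⁻¹' Metric.ball 0 1
  have hUo : IsOpen U := Metric.isOpen_ball.preimage (by fun_prop)
  have hUc : IsPreconnected U := by
    refine Convex.isPreconnected ?_
    have : Convex ℝ (Metric.ball (0 : EuclideanSpace ℂ (Fin n)) 1) := convex_ball _ _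
    intro s hs t ht a b ha hb hab
    have h1 := this hs ht ha hb hab
    have h2 : a • ((z₀ : EuclideanSpace ℂ (Fin n)) + s • v) + b • ((z₀ : EuclideanSpace ℂ (Fin n)) +
        t • v) = (z₀ : EuclideanSpace ℂ (Fin n)) + (a • s + b • t) • v := by
      have hab' : (a : ℂ) + b = 1 := by exact_mod_cast hab
      simp only [← Complex.coe_smul, smul_eq_mul]
      linear_combination (norm := module) hab' • (z₀ : EuclideanSpace ℂ (Fin n))
    rw [h2] at h1
    exact h1
  have hU0 : (0 : ℂ) ∈ U := by simp [U]
  have hU1 : (1 : ℂ) ∈ U := by simp [U, hv]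
  have hline : ∀ t : ℂ, HasDerivAt (fun t : ℂ => (z₀ : EuclideanSpace ℂ (Fin n)) + t • v) v t := by
    intro t
    simpa using ((hasDerivAt_id t).smul_const v).const_add (z₀ : EuclideanSpace ℂ (Fin n))
  have hder : ∀ f, IsKernelIntegral lam f → ∀ t ∈ U,
      HasDerivAt (fun t : ℂ => f ((z₀ : EuclideanSpace ℂ (Fin n)) + t • v))
        (fderiv ℂ f ((z₀ : EuclideanSpace ℂ (Fin n)) + t • v) v) t := fun f hf t ht =>
    (hf.differentiableAt ht).hasFDerivAt.comp_hasDerivAt t (hline t)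
  -- The induction has to quantify over all `f`, because the derivative along the line is again a
  -- function in the family with property `P`.
  have hiter : ∀ k : ℕ, ∀ f, IsKernelIntegral lam f → P f →
      iteratedDeriv k (fun t : ℂ => f ((z₀ : EuclideanSpace ℂ (Fin n)) + t • v)) 0 = 0 := by
    intro k
    induction k with
    | zero => intro f hf hPf; simpa using h0 f hf hPf
    | succ k ih =>
      intro f hf hPf
      rw [iteratedDeriv_succ']
      refine Eq.trans ?_ (ih _ (hf.fderiv_apply v) (hP f hf hPf v))
      refine Filter.EventuallyEq.iteratedDeriv_eq (𝕜 := ℂ) (x := (0 : ℂ)) k ?_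
      filter_upwards [hUo.mem_nhds hU0] with t ht
      exact (hder f hf t ht).deriv
  have hana : AnalyticOnNhd ℂ (fun t : ℂ => f ((z₀ : EuclideanSpace ℂ (Fin n)) + t • v)) U :=
    DifferentiableOn.analyticOnNhd
      (fun t ht => (hder f hf t ht).differentiableAt.differentiableWithinAt) hUo
  have hzero : (fun t : ℂ => f ((z₀ : EuclideanSpace ℂ (Fin n)) + t • v)) =ᶠ[nhds 0] 0 := by
    refine analyticOrderAt_eq_top.mp (ENat.eq_top_iff_forall_ge.mpr fun k => ?_)
    exact (natCast_le_analyticOrderAt_iff_iteratedDeriv_eq_zero (hana 0 hU0)).mpr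
      fun i _ => hiter i f hf hPf
  have := hana.eqOn_zero_of_preconnected_of_eventuallyEq_zero hUc hU0 hzero hU1
  simpa [hv] using this

end KernelIntegral

/-! ### Reproducing formula and completeness -/

namespace Bergman

variable {n : ℕ} {lam : ℝ} [hn : Fact (1 ≤ n)] [hl : Fact ((n : ℝ) < lam)]

lemma lam_pos (n : ℕ) (lam : ℝ) [hl : Fact ((n : ℝ) < lam)] : 0 < lam :=
  (Nat.cast_nonneg n).trans_lt hl.out

/-- The reproducing formula written out as an integral; it places the holomorphic representatives in
the family to which the vanishing criterion applies. -/
lemma eval_eq_kernelIntegral (F : Bergman n lam) (z : Ball n) :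
    eval F z = kernelIntegral lam lam (F : Lp ℂ 2 (bergmanMeasure n lam)) z := by
  rw [← inner_repro, Submodule.coe_inner, L2.inner_def, kernelIntegral]
  refine integral_congr_ae ?_
  filter_upwards [coeFn_ae_eq_hol (repro z : Bergman n lam), ae_bergmanMeasure_mem_ball] with w h1 h2
  rw [h1, RCLike.inner_apply, mul_comm]
  congr 1
  rw [← eval_eq_hol _ ⟨w, h2⟩, eval_repro, conj_kernel]

lemma isKernelIntegral_hol (F : Bergman n lam) : IsKernelIntegral lam (hol F) :=
  ⟨lam, (lam_pos n lam).le, _, (Lp.memLp _).integrable one_le_two,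
    fun z hz => eval_eq_kernelIntegral F ⟨z, hz⟩⟩

/-- The kernel integral of an L² limit is holomorphic. It is the limit of the evaluations, which are
inner products with a fixed vector, and along a subsequence these also converge almost everywhere to
the limit function itself. -/
lemma isClosed_bergman : IsClosed (Bergman n lam : Set (Lp ℂ 2 (bergmanMeasure n lam))) := by
  refine IsSeqClosed.isClosed fun u F hu hF => ?_
  refine ⟨kernelIntegral lam lam F, differentiableOn_kernelIntegral ((lam_pos n lam).le)
    ((Lp.memLp _).integrable one_le_two), ?_⟩
  have hpt : ∀ G : Lp ℂ 2 (bergmanMeasure n lam), ∀ z : Ball n,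
      inner ℂ ((repro z : Bergman n lam) : Lp ℂ 2 (bergmanMeasure n lam)) G =
        kernelIntegral lam lam G (z : EuclideanSpace ℂ (Fin n)) := by
    intro G z
    rw [L2.inner_def, kernelIntegral]
    refine integral_congr_ae ?_
    filter_upwards [coeFn_ae_eq_hol (repro z : Bergman n lam), ae_bergmanMeasure_mem_ball]
      with w h1 h2
    rw [h1, RCLike.inner_apply, mul_comm]
    congr 1
    rw [← eval_eq_hol _ ⟨w, h2⟩, eval_repro, conj_kernel]
  obtain ⟨ns, hmono, hns⟩ := (tendstoInMeasure_of_tendsto_Lp hF).exists_seq_tendsto_ae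
  have hall : ∀ᵐ z ∂bergmanMeasure n lam, ∀ k, (u k : Lp ℂ 2 (bergmanMeasure n lam)) z =
      hol (⟨u k, hu k⟩ : Bergman n lam) z :=
    ae_all_iff.mpr fun k => coeFn_ae_eq_hol (⟨u k, hu k⟩ : Bergman n lam)
  filter_upwards [hns, hall, ae_bergmanMeasure_mem_ball] with z h1 h2 hz
  refine tendsto_nhds_unique h1 ?_
  rw [← hpt F ⟨z, hz⟩]
  have h3 : ∀ k, (u (ns k) : Lp ℂ 2 (bergmanMeasure n lam)) z =
      inner ℂ ((repro ⟨z, hz⟩ : Bergman n lam) : Lp ℂ 2 (bergmanMeasure n lam)) (u (ns k)) :=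
    fun k => by
      rw [h2 (ns k), ← eval_eq_hol _ ⟨z, hz⟩, ← inner_repro]
      rfl
  simp only [h3]
  exact ((continuous_const.inner continuous_id).tendsto F).comp (hF.comp hmono.tendsto_atTop)

instance : CompleteSpace (Bergman n lam) := isClosed_bergman.completeSpace_coe

end Bergman

end BallRestriction
end

noncomputable section

namespace BallRestriction

/-! ## The restriction principle in coordinates -/

instance {n : ℕ} : BorelSpace (Gtilde n) := ⟨rfl⟩

instance {n : ℕ} (H : Subgroup (SU n)) : BorelSpace (Htilde H) := Subtype.borelSpace _

namespace OrbitCoordinates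

variable {n : ℕ} {H : Subgroup (SU n)} {z₀ : Ball n} {Q : Type} [AddCommGroup Q]
  [TopologicalSpace Q] {L : AddSubgroup (Q × ℝ)} {mat : Q → UnitAddCircle → Mat n} {d : Q → ℂ}
  (c : OrbitCoordinates H z₀ L mat d)

lemma pt_mul (h k : Htilde H) : c.pt (h * k) = c.pt h + c.pt k := by
  simp [pt]

lemma ht_mul (h k : Htilde H) : c.ht (h * k) = c.ht h + c.ht k := by
  simp [ht]

lemma pt_one : c.pt 1 = 0 := by simp [pt]

lemma ht_one : c.ht 1 = 0 := by simp [ht]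

lemma pt_inv (h : Htilde H) : c.pt h⁻¹ = -c.pt h := by
  rw [eq_neg_iff_add_eq_zero, ← c.pt_mul, inv_mul_cancel, c.pt_one]

lemma ht_inv (h : Htilde H) : c.ht h⁻¹ = -c.ht h := by
  rw [eq_neg_iff_add_eq_zero, ← c.ht_mul, inv_mul_cancel, c.ht_one]

lemma orb_pt (h : Htilde H) : c.orb (c.pt h) = h • z₀ := c.orb_eq h

lemma orb_zero : c.orb 0 = z₀ := by rw [← c.pt_one, c.orb_pt, one_smul]

lemma exists_pt_eq (q : Q) : ∃ h, c.pt h = q := c.surjective q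

lemma continuous_pt : Continuous c.pt :=
  continuous_fst.comp (continuous_subtype_val.comp (continuous_toAdd.comp c.iso.continuous))

lemma continuous_ht : Continuous c.ht :=
  continuous_snd.comp (continuous_subtype_val.comp (continuous_toAdd.comp c.iso.continuous))

lemma mem_stabilizer_iff (k : Htilde H) :
    k ∈ MulAction.stabilizer (Htilde H) z₀ ↔ c.pt k = 0 := by
  rw [MulAction.mem_stabilizer_iff, ← c.orb_pt, ← c.orb_injective.eq_iff (a := c.pt k),
    c.orb_zero]

/-- `descend` evaluates at some unspecified element over the orbit point, and only its
`Q`-coordinate is known. This suffices for functions that depend only on `pt`, such as moduli of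
covariant functions. -/
lemma exists_descend (g : Htilde H → ℂ) (q : Q) :
    ∃ h, c.pt h = q ∧ descend z₀ g (c.orb q) = g h := by
  have hex : ∃ h : Htilde H, h • z₀ = c.orb q := by
    obtain ⟨h, hh⟩ := c.exists_pt_eq q
    exact ⟨h, by rw [← c.orb_pt, hh]⟩
  refine ⟨hex.choose, c.orb_injective ?_, ?_⟩
  · rw [c.orb_pt, hex.choose_spec]
  · rw [descend, dif_pos hex]

lemma orb_add (h : Htilde H) (q : Q) : c.orb (c.pt h + q) = h • c.orb q := by
  obtain ⟨k, rfl⟩ := c.exists_pt_eq q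
  rw [← c.pt_mul, c.orb_pt, c.orb_pt, mul_smul]

section Character

variable (hd : ∀ q, 0 < (d q).re)

include c hd

lemma D_eq (ν : ℝ) (h : Htilde H) : D H z₀ ν h =
    exp (-2 * Real.pi * I * ν * c.ht h) * d (c.pt h) ^ (-ν : ℂ) := by
  rw [D, Gtilde.j, c.log_eq, cpow_def_of_ne_zero (slitPlane_ne_zero (Or.inl (hd _))), ← exp_add]
  congr 1
  simp only [pt, ht]
  ring

lemma d_zero : d 0 = 1 := by
  have h := c.log_eq 1
  have h1 : ((1 : Htilde H) : Gtilde n).log z₀ = 0 := rfl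
  have h2 : ((c.iso 1).toAdd : Q × ℝ) = 0 := by simp
  rw [h1, h2] at h
  simp only [Prod.fst_zero, Prod.snd_zero, ofReal_zero, mul_zero, zero_add] at h
  have h3 := Complex.exp_log (slitPlane_ne_zero (Or.inl (hd 0)))
  rw [← h3, ← h, exp_zero]

lemma inv_chi_eq (ν : ℝ) (k : Htilde H) (hk : k ∈ MulAction.stabilizer (Htilde H) z₀) :
    (chi H z₀ ν k)⁻¹ = exp (-2 * Real.pi * I * ν * c.ht k) := by
  have h := c.D_eq hd ν k
  rw [(c.mem_stabilizer_iff k).mp hk, c.d_zero hd, one_cpow, mul_one] at h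
  rw [chi, inv_inv]
  exact h

/-- Functions with the covariance property are, up to a character, functions on `Q`. -/
lemma tilde_unique {ν : ℝ} {f : Htilde H → ℂ}
    (hf : ∀ h, ∀ k ∈ MulAction.stabilizer (Htilde H) z₀, f (h * k) = (chi H z₀ ν k)⁻¹ * f h)
    {h h' : Htilde H} (e : c.pt h = c.pt h') :
    f h * exp (2 * Real.pi * I * ν * c.ht h) = f h' * exp (2 * Real.pi * I * ν * c.ht h') := by
  have hk : h⁻¹ * h' ∈ MulAction.stabilizer (Htilde H) z₀ := by
    rw [c.mem_stabilizer_iff, c.pt_mul, c.pt_inv, e, neg_add_cancel]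
  have h1 := hf h _ hk
  rw [mul_inv_cancel_left, c.inv_chi_eq hd ν _ hk, c.ht_mul, c.ht_inv] at h1
  have h2 : exp (-2 * Real.pi * I * ν * ((-c.ht h + c.ht h' : ℝ) : ℂ)) *
      exp (2 * Real.pi * I * ν * c.ht h') = exp (2 * Real.pi * I * ν * c.ht h) := by
    rw [← exp_add]
    congr 1
    push_cast
    ring
  rw [h1, ← h2]
  ring

lemma covariant_of_eq {ν : ℝ} {f : Htilde H → ℂ} {ft : Q → ℂ}
    (hf : ∀ h, f h = exp (-2 * Real.pi * I * ν * c.ht h) * ft (c.pt h)) (h k : Htilde H)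
    (hk : k ∈ MulAction.stabilizer (Htilde H) z₀) : f (h * k) = (chi H z₀ ν k)⁻¹ * f h := by
  rw [c.inv_chi_eq hd ν k hk, hf, hf, c.pt_mul, (c.mem_stabilizer_iff k).mp hk, add_zero, c.ht_mul,
    ← mul_assoc, ← exp_add]
  congr 2
  push_cast
  ring

end Character

lemma norm_exp_ht (ν : ℝ) (x : ℝ) : ‖exp (-2 * Real.pi * I * ν * x)‖ = 1 := by
  rw [norm_exp]
  simp

section Measure

variable [MeasureSpace Q] [BorelSpace Q] [PolishSpace Q]

lemma measurableEmbedding_orb : MeasurableEmbedding c.orb :=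
  c.orb_continuous.measurableEmbedding c.orb_injective

lemma lintegral_descend {f : Htilde H → ℂ} {ft : Q → ℂ} (hf : ∀ h, ‖f h‖ = ‖ft (c.pt h)‖) :
    ∫⁻ m, ‖descend z₀ f m‖ₑ ^ 2 ∂c.orbitMeasure = ∫⁻ q, ‖ft q‖ₑ ^ 2 := by
  rw [orbitMeasure, c.measurableEmbedding_orb.lintegral_map]
  refine lintegral_congr fun q => ?_
  obtain ⟨h, rfl, h2⟩ := c.exists_descend f q
  rw [h2, ← ofReal_norm, ← ofReal_norm, hf]

lemma memL2_of_eq (hd : ∀ q, 0 < (d q).re) {ν : ℝ} {f : Htilde H → ℂ} {ft : Q → ℂ}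
    (hft : Continuous ft)
    (hf : ∀ h, f h = exp (-2 * Real.pi * I * ν * c.ht h) * ft (c.pt h)) :
    MemL2 z₀ c.orbitMeasure ν f ↔ ∫⁻ q, ‖ft q‖ₑ ^ 2 < ∞ := by
  have hn : ∀ h, ‖f h‖ = ‖ft (c.pt h)‖ := fun h => by
    rw [hf, norm_mul, norm_exp_ht, one_mul]
  rw [MemL2, c.lintegral_descend hn]
  refine ⟨fun h => h.2.2, fun h => ⟨?_, c.covariant_of_eq hd hf, h⟩⟩
  have hc : Continuous f := by
    rw [funext hf]
    have h1 := c.continuous_ht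
    have h2 := c.continuous_pt
    fun_prop
  exact hc.measurable

/-- The parametrisation `orb` intertwines the action of g with a translation of Q. -/
lemma orbitMeasure_invariant [IsTopologicalAddGroup Q]
    [Measure.IsAddLeftInvariant (volume : Measure Q)] (g : SU n) (hg : g ∈ H) :
    c.orbitMeasure.map (fun z => g • z) = c.orbitMeasure := by
  obtain ⟨gt, hgt⟩ := Gtilde.exists_lift g
  let h : Htilde H := ⟨gt, by
    rw [Subgroup.mem_comap]
    change gt.base ∈ H
    rwa [hgt]⟩
  have hact : (fun z : Ball n => g • z) ∘ c.orb = c.orb ∘ fun q => c.pt h + q := by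
    funext q
    rw [Function.comp, Function.comp, c.orb_add]
    change g • c.orb q = gt.base • c.orb q
    rw [hgt]
  rw [orbitMeasure, Measure.map_map
    (show Measurable fun z : Ball n => g • z from (continuous_act g).measurable) c.orb_continuous.measurable, hact,
    ← Measure.map_map c.orb_continuous.measurable (measurable_const_add _), map_add_left_eq_self]

end Measure

end OrbitCoordinates

end BallRestriction
end

noncomputable section

namespace BallRestriction

set_option linter.unusedSectionVars false

/-! ## Frames with convolution Gram kernel -/

namespace ConvolutionFrame

/-- The constant 1 instead of 1/2 is the source of the factor 2 in the operator bound below. -/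
lemma enn_mul_le (a b : ℝ≥0∞) : a * b ≤ a ^ 2 + b ^ 2 := by
  rcases le_total a b with h | h
  · calc a * b ≤ b * b := by gcongr
      _ ≤ a ^ 2 + b ^ 2 := by rw [← sq]; exact le_add_self
  · calc a * b ≤ a * a := by gcongr
      _ ≤ a ^ 2 + b ^ 2 := by rw [← sq]; exact le_self_add

variable {E : Type*} [NormedAddCommGroup E] [InnerProductSpace ℂ E] [CompleteSpace E]
  {Q : Type} [AddCommGroup Q] [TopologicalSpace Q] [IsTopologicalAddGroup Q]
  [MeasureSpace Q] [BorelSpace Q] [PolishSpace Q] [SigmaFinite (volume : Measure Q)]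
  [Measure.IsAddLeftInvariant (volume : Measure Q)]
  {k : Q → E} {φ : Q → ℂ} (hk : Continuous k) (hφ : ∀ q q', inner ℂ (k q) (k q') = φ (q - q'))

include hk hφ

lemma continuous_gram : Continuous φ := by
  have h : φ = fun q => inner ℂ (k q) (k 0) := by
    funext q
    rw [hφ, sub_zero]
  rw [h]
  fun_prop

lemma norm_frame (q : Q) : ‖k q‖ = ‖k 0‖ := by
  have h : ‖k q‖ ^ 2 = ‖k 0‖ ^ 2 := by
    rw [← inner_self_eq_norm_sq (𝕜 := ℂ), ← inner_self_eq_norm_sq (𝕜 := ℂ), hφ, hφ, sub_self, sub_self]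
  exact (sq_eq_sq₀ (norm_nonneg _) (norm_nonneg _)).mp h

/-- A Gram kernel is Hermitian, so |φ| is even; thus translation invariance is enough and invariance
under inversion is not needed. -/
lemma lintegral_sub_right (q : Q) : ∫⁻ t, ‖φ (q - t)‖ₑ = ∫⁻ t, ‖φ t‖ₑ := by
  have h : ∀ t, ‖φ (q - t)‖ₑ = ‖φ (-q + t)‖ₑ := fun t => by
    rw [← hφ, ← inner_conj_symm, hφ, neg_add_eq_sub, ← ofReal_norm, ← ofReal_norm, RCLike.norm_conj]
  simp only [h]
  exact lintegral_add_left_eq_self (fun t => ‖φ t‖ₑ) (-q)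

/-- The synthesis operator on integrable square integrable functions. -/
lemma norm_synthesis_sq_le {g : Q → ℂ} (hg : Integrable g) :
    ENNReal.ofReal (‖∫ q, g q • k q‖ ^ 2) ≤ 2 * (∫⁻ t, ‖φ t‖ₑ) * ∫⁻ q, ‖g q‖ₑ ^ 2 := by
  set G := ∫ q, g q • k q with hG
  have hgk : Integrable fun q => g q • k q :=
    hg.smul_bdd ‖k 0‖ hk.aestronglyMeasurable (ae_of_all _ fun q => (norm_frame hk hφ q).le)
  have h1 : ∀ F : E, inner ℂ F G = ∫ q, g q * inner ℂ F (k q) := fun F => by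
    rw [hG, ← integral_inner hgk]
    simp only [inner_smul_right]
  -- The squared norm of the synthesised vector is the quadratic form of the Gram kernel in `g`.
  have h2 : (‖G‖ ^ 2 : ℝ) = ‖∫ q, g q * ∫ t, conj (g t) * φ (t - q)‖ := by
    have h3 : ∀ q, inner ℂ G (k q) = ∫ t, conj (g t) * φ (t - q) := fun q => by
      rw [← inner_conj_symm, h1, ← integral_conj]
      refine integral_congr_ae (ae_of_all _ fun t => ?_)
      simp only [map_mul]
      rw [inner_conj_symm, hφ]
    simp only [← h3]
    rw [← h1, inner_self_eq_norm_sq_to_K]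
    simp
  have hφc := continuous_gram hk hφ
  have hgm := hg.aestronglyMeasurable.enorm
  have hmeas : AEMeasurable (fun z : Q × Q => ‖g z.1‖ₑ ^ 2 * ‖φ (z.2 - z.1)‖ₑ)
      (volume.prod volume : Measure (Q × Q)) := by
    refine AEMeasurable.mul ((hgm.comp_fst).pow_const 2) ?_
    exact (hφc.comp (continuous_snd.sub continuous_fst)).enorm.measurable.aemeasurable
  have hmeas' : AEMeasurable (fun z : Q × Q => ‖g z.2‖ₑ ^ 2 * ‖φ (z.2 - z.1)‖ₑ)
      (volume.prod volume : Measure (Q × Q)) := by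
    refine AEMeasurable.mul ((hgm.comp_snd).pow_const 2) ?_
    exact (hφc.comp (continuous_snd.sub continuous_fst)).enorm.measurable.aemeasurable
  have hl : ∀ q, ∫⁻ t, ‖φ (t - q)‖ₑ = ∫⁻ t, ‖φ t‖ₑ := fun q => by
    simp only [sub_eq_neg_add]
    exact lintegral_add_left_eq_self (fun t => ‖φ t‖ₑ) (-q)
  rw [h2, ofReal_norm]
  -- Schur's test: |g(q)||g(t)| is split into squares, and in each of the two double integrals the
  -- variable on which `g` does not depend is integrated first.
  calc ‖∫ q, g q * ∫ t, conj (g t) * φ (t - q)‖ₑ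
      ≤ ∫⁻ q, ‖g q * ∫ t, conj (g t) * φ (t - q)‖ₑ := enorm_integral_le_lintegral_enorm _
    _ ≤ ∫⁻ q, ∫⁻ t, ‖g q‖ₑ ^ 2 * ‖φ (t - q)‖ₑ + ‖g t‖ₑ ^ 2 * ‖φ (t - q)‖ₑ := by
        refine lintegral_mono fun q => ?_
        rw [enorm_mul]
        calc ‖g q‖ₑ * ‖∫ t, conj (g t) * φ (t - q)‖ₑ
            ≤ ‖g q‖ₑ * ∫⁻ t, ‖conj (g t) * φ (t - q)‖ₑ := by
              gcongr; exact enorm_integral_le_lintegral_enorm _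
          _ = ∫⁻ t, ‖g q‖ₑ * ‖conj (g t) * φ (t - q)‖ₑ :=
              (lintegral_const_mul' _ _ enorm_ne_top).symm
          _ ≤ _ := by
              refine lintegral_mono fun t => ?_
              have : ‖conj (g t)‖ₑ = ‖g t‖ₑ := by
                rw [← ofReal_norm, ← ofReal_norm, RCLike.norm_conj]
              rw [enorm_mul, this, ← mul_assoc, ← add_mul]
              gcongr
              exact enn_mul_le _ _
    _ = ∫⁻ z : Q × Q, ‖g z.1‖ₑ ^ 2 * ‖φ (z.2 - z.1)‖ₑ + ‖g z.2‖ₑ ^ 2 * ‖φ (z.2 - z.1)‖ₑ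
          ∂(volume.prod volume) :=
        (lintegral_prod _ (hmeas.add hmeas')).symm
    _ = (∫⁻ z : Q × Q, ‖g z.1‖ₑ ^ 2 * ‖φ (z.2 - z.1)‖ₑ ∂(volume.prod volume)) +
          ∫⁻ z : Q × Q, ‖g z.2‖ₑ ^ 2 * ‖φ (z.2 - z.1)‖ₑ ∂(volume.prod volume) :=
        lintegral_add_left' hmeas _
    _ = (∫⁻ q, ‖g q‖ₑ ^ 2) * (∫⁻ t, ‖φ t‖ₑ) + (∫⁻ q, ‖g q‖ₑ ^ 2) * (∫⁻ t, ‖φ t‖ₑ) := by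
        congr 1
        · rw [lintegral_prod _ hmeas]
          have : ∀ q, ∫⁻ t, ‖g q‖ₑ ^ 2 * ‖φ (t - q)‖ₑ = ‖g q‖ₑ ^ 2 * ∫⁻ t, ‖φ t‖ₑ := fun q => by
            rw [lintegral_const_mul' _ _ (by simp), hl]
          simp only [this]
          exact lintegral_mul_const'' _ (hgm.pow_const 2)
        · rw [lintegral_prod_symm _ hmeas']
          have : ∀ t, ∫⁻ q, ‖g t‖ₑ ^ 2 * ‖φ (t - q)‖ₑ = ‖g t‖ₑ ^ 2 * ∫⁻ t, ‖φ t‖ₑ := fun q => by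
            rw [lintegral_const_mul' _ _ (by simp), lintegral_sub_right hk hφ]
          simp only [this]
          exact lintegral_mul_const'' _ (hgm.pow_const 2)
    _ = 2 * (∫⁻ t, ‖φ t‖ₑ) * ∫⁻ q, ‖g q‖ₑ ^ 2 := by ring

/-- The analysis operator is bounded. -/
lemma lintegral_analysis_le (hi : Integrable φ) (F : E) :
    ∫⁻ q, ‖inner ℂ (k q) F‖ₑ ^ 2 ≤ ENNReal.ofReal (2 * (∫ t, ‖φ t‖) * ‖F‖ ^ 2) := by
  have hr : Continuous fun q => inner ℂ (k q) F := by fun_prop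
  -- Restricting to sets of finite measure makes the truncated coefficient function integrable and
  -- its square integral A finite. This permits cancelling A in A² ≤ 2 p ‖F‖² A, where p is the L¹
  -- norm of φ.
  refine lintegral_le_of_forall_fin_meas_le (μ := volume) _
    fun S hS hfin => ?_
  set g : Q → ℂ := S.indicator fun q => inner ℂ (k q) F with hg
  have hb : ∀ q, ‖inner ℂ (k q) F‖ ≤ ‖k 0‖ * ‖F‖ := fun q => by
    rw [← norm_frame hk hφ q]
    exact norm_inner_le_norm _ _
  have hgi : Integrable g := by
    refine IntegrableOn.integrable_indicator ?_ hS
    exact Measure.integrableOn_of_bounded hfin hr.aestronglyMeasurable (ae_of_all _ hb)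
  have hgk : Integrable fun q => g q • k q :=
    hgi.smul_bdd ‖k 0‖ hk.aestronglyMeasurable (ae_of_all _ fun q => (norm_frame hk hφ q).le)
  have h1 := norm_synthesis_sq_le hk hφ hgi
  have h2 : ∫⁻ q, ‖g q‖ₑ ^ 2 = ∫⁻ q in S, ‖inner ℂ (k q) F‖ₑ ^ 2 := by
    rw [← lintegral_indicator hS]
    refine lintegral_congr fun q => ?_
    by_cases hq : q ∈ S <;> simp [hg, hq]
  have hint : IntegrableOn (fun q => ‖inner ℂ (k q) F‖ ^ 2) S := by
    refine Measure.integrableOn_of_bounded (M := (‖k 0‖ * ‖F‖) ^ 2) hfin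
      (by fun_prop) (ae_of_all _ fun q => ?_)
    rw [Real.norm_of_nonneg (by positivity)]
    gcongr
    exact hb q
  have h3 : ∫⁻ q in S, ‖inner ℂ (k q) F‖ₑ ^ 2 =
      ENNReal.ofReal (∫ q in S, ‖inner ℂ (k q) F‖ ^ 2) := by
    rw [ofReal_integral_eq_lintegral_ofReal hint (ae_of_all _ fun q => by positivity)]
    refine lintegral_congr fun q => ?_
    rw [ENNReal.ofReal_pow (norm_nonneg _), ofReal_norm]
  set A := ∫ q in S, ‖inner ℂ (k q) F‖ ^ 2 with hA
  have hA0 : 0 ≤ A := integral_nonneg fun q => by positivity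
  have h4 : (∫⁻ t, ‖φ t‖ₑ) = ENNReal.ofReal (∫ t, ‖φ t‖) :=
    (ofReal_integral_norm_eq_lintegral_enorm hi).symm
  set p := ∫ t, ‖φ t‖ with hp
  have hp0 : 0 ≤ p := integral_nonneg fun q => norm_nonneg _
  set G := ∫ q, g q • k q with hG
  have h5 : ‖G‖ ^ 2 ≤ 2 * p * A := by
    rw [h2, h3, h4, show (2 : ℝ≥0∞) = ENNReal.ofReal 2 by simp, ← ENNReal.ofReal_mul (by norm_num),
      ← ENNReal.ofReal_mul (by positivity)] at h1
    exact (ENNReal.ofReal_le_ofReal_iff (by positivity)).mp h1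
  have h6 : (A : ℂ) = inner ℂ F G := by
    -- A is the pairing of F with the vector synthesised from F's own truncated coefficients, so
    -- Cauchy-Schwarz and the synthesis bound close up.
    rw [hG, ← integral_inner hgk, hA, ← integral_indicator hS, ← integral_complex_ofReal]
    refine integral_congr_ae (ae_of_all _ fun q => ?_)
    by_cases hq : q ∈ S
    · simp only [hg, hq, Set.indicator_of_mem, inner_smul_right]
      rw [← inner_conj_symm F, mul_comm, ← normSq_eq_conj_mul_self, normSq_eq_norm_sq]
    · simp [hg, hq]
  have h7 : A ≤ ‖F‖ * ‖G‖ := by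
    have := norm_inner_le_norm (𝕜 := ℂ) F G
    rwa [← h6, norm_real, Real.norm_of_nonneg hA0] at this
  rw [h3]
  refine ENNReal.ofReal_le_ofReal ?_
  rcases hA0.eq_or_lt with h0 | h0
  · rw [← h0]; positivity
  have h8 : A * A ≤ (2 * p * ‖F‖ ^ 2) * A := by
    calc A * A ≤ (‖F‖ * ‖G‖) * (‖F‖ * ‖G‖) := by gcongr
      _ = ‖F‖ ^ 2 * ‖G‖ ^ 2 := by ring
      _ ≤ ‖F‖ ^ 2 * (2 * p * A) := by gcongr
      _ = _ := by ring
  exact le_of_mul_le_mul_right h8 h0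

lemma memLp_analysis (hi : Integrable φ) (F : E) : MemLp (fun q => inner ℂ (k q) F) 2 := by
  refine ⟨by fun_prop, ?_⟩
  rw [eLpNorm_lt_top_iff_lintegral_rpow_enorm_lt_top two_ne_zero ENNReal.ofNat_ne_top]
  simpa using (lintegral_analysis_le hk hφ hi F).trans_lt ENNReal.ofReal_lt_top

/-- The analysis operator. -/
def analysis (hi : Integrable φ) : E →L[ℂ] Lp ℂ 2 (volume : Measure Q) :=
  LinearMap.mkContinuous
    { toFun := fun F => (memLp_analysis hk hφ hi F).toLp
      map_add' := fun F G => by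
        rw [← MemLp.toLp_add]
        simp only [inner_add_right]
        rfl
      map_smul' := fun a F => by
        rw [RingHom.id_apply, ← MemLp.toLp_const_smul]
        simp only [inner_smul_right]
        rfl }
    (√(2 * ∫ t, ‖φ t‖)) fun F => by
      simp only [LinearMap.coe_mk, AddHom.coe_mk]
      rw [Lp.norm_toLp]
      refine ENNReal.toReal_le_of_le_ofReal (by positivity) ?_
      rw [eLpNorm_eq_lintegral_rpow_enorm_toReal two_ne_zero ENNReal.ofNat_ne_top]
      have h := lintegral_analysis_le hk hφ hi F
      have hp0 : 0 ≤ ∫ t, ‖φ t‖ := integral_nonneg fun q => norm_nonneg _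
      have h2 : (∫⁻ q, ‖inner ℂ (k q) F‖ₑ ^ (2 : ℝ≥0∞).toReal) ≤
          ENNReal.ofReal ((√(2 * ∫ t, ‖φ t‖) * ‖F‖) ^ 2) := by
        rw [mul_pow, Real.sq_sqrt (by positivity)]
        simpa using h
      calc _ ≤ (ENNReal.ofReal ((√(2 * ∫ t, ‖φ t‖) * ‖F‖) ^ 2)) ^ (1 / (2 : ℝ≥0∞).toReal) := by
            gcongr
        _ = _ := by
            rw [ENNReal.ofReal_pow (by positivity), ← ENNReal.rpow_natCast, ← ENNReal.rpow_mul]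
            simp

/-- The adjoint of the analysis operator, and the convolution formula. -/
lemma exists_synthesis (hi : Integrable φ) {g : Q → ℂ} (hg : MemLp g 2) :
    ∃ F : E, (∀ F', inner ℂ F F' = ∫ q, conj (g q) * inner ℂ (k q) F') ∧
      ∀ q, Integrable (fun t => g t * φ (q - t)) ∧ inner ℂ (k q) F = ∫ t, g t * φ (q - t) := by
  have key : ∀ F', inner ℂ ((ContinuousLinearMap.adjoint (analysis hk hφ hi)) hg.toLp) F' =
      ∫ q, conj (g q) * inner ℂ (k q) F' := fun F' => by
    rw [ContinuousLinearMap.adjoint_inner_left, L2.inner_def]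
    refine integral_congr_ae ?_
    have h2 : (analysis hk hφ hi F' : Q → ℂ) =ᵐ[volume] fun q => inner ℂ (k q) F' :=
      (memLp_analysis hk hφ hi F').coeFn_toLp
    filter_upwards [hg.coeFn_toLp, h2] with q h1 h2
    rw [h1, h2, RCLike.inner_apply, mul_comm]
  -- The convolution formula is the adjoint identity tested on the vector `k q`.
  have hconj : ∀ q t, φ (q - t) = conj (inner ℂ (k t) (k q)) := fun q t => by
    rw [inner_conj_symm, hφ]
  refine ⟨_, key, fun q => ⟨?_, ?_⟩⟩
  · simp only [hconj]
    exact hg.integrable_mul (memLp_analysis hk hφ hi (k q)).star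
  · rw [← inner_conj_symm, key, ← integral_conj]
    simp only [map_mul, conj_conj, hconj]

end ConvolutionFrame

end BallRestriction
end

noncomputable section

namespace BallRestriction

set_option linter.unusedSectionVars false

/-! ## The explicit restriction principle -/

/-! ### Norm continuity of the reproducing vectors -/

section Kernel

variable {n : ℕ} {lam : ℝ} [Fact (1 ≤ n)] [Fact ((n : ℝ) < lam)]

lemma continuous_kernel (β : ℝ) : Continuous fun p : Ball n × Ball n =>
    kernel β (p.1 : EuclideanSpace ℂ (Fin n)) p.2 := by
  unfold kernel
  refine Continuous.cpow ?_ continuous_const fun p => one_sub_inner_mem_slitPlane p.2 p.1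
  fun_prop

/-- The squared distance of two reproducing vectors is a combination of four kernel values, and the
kernel is jointly continuous. -/
lemma Bergman.continuous_repro : Continuous (Bergman.repro : Ball n → Bergman n lam) := by
  refine continuous_iff_continuousAt.mpr fun z => ?_
  rw [ContinuousAt, tendsto_iff_norm_sub_tendsto_zero]
  have h : ∀ w : Ball n, ‖(Bergman.repro w : Bergman n lam) - Bergman.repro z‖ =
      √(RCLike.re (kernel lam (w : EuclideanSpace ℂ (Fin n)) w) -
        RCLike.re (kernel lam (z : EuclideanSpace ℂ (Fin n)) w) -
        (RCLike.re (kernel lam (w : EuclideanSpace ℂ (Fin n)) z) -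
          RCLike.re (kernel lam (z : EuclideanSpace ℂ (Fin n)) z))) := fun w => by
    rw [← Real.sqrt_sq (norm_nonneg _), ← inner_self_eq_norm_sq (𝕜 := ℂ), inner_sub_left,
      inner_sub_right, inner_sub_right]
    simp only [Bergman.inner_repro, Bergman.eval_repro, map_sub]
  simp only [h]
  have hc : Continuous fun w : Ball n =>
      √(RCLike.re (kernel lam (w : EuclideanSpace ℂ (Fin n)) w) -
        RCLike.re (kernel lam (z : EuclideanSpace ℂ (Fin n)) w) -
        (RCLike.re (kernel lam (w : EuclideanSpace ℂ (Fin n)) z) -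
          RCLike.re (kernel lam (z : EuclideanSpace ℂ (Fin n)) z))) := by
    have h1 := (continuous_kernel (n := n) lam).comp (continuous_id.prodMk continuous_id)
    have h2 := (continuous_kernel (n := n) lam).comp (continuous_const (y := z).prodMk continuous_id)
    have h3 := (continuous_kernel (n := n) lam).comp (continuous_id.prodMk (continuous_const (y := z)))
    exact Real.continuous_sqrt.comp (((RCLike.continuous_re.comp h1).sub
      (RCLike.continuous_re.comp h2)).sub ((RCLike.continuous_re.comp h3).sub continuous_const))
  have := hc.tendsto z
  simpa using this

end Kernel

namespace OrbitCoordinates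

variable {n : ℕ} {lam : ℝ} [Fact (1 ≤ n)] [Fact ((n : ℝ) < lam)]
  {H : Subgroup (SU n)} {z₀ : Ball n} {Q : Type} [AddCommGroup Q]
  [TopologicalSpace Q] {L : AddSubgroup (Q × ℝ)} {mat : Q → UnitAddCircle → Mat n} {d : Q → ℂ}
  (c : OrbitCoordinates H z₀ L mat d)

/-- The restriction of `F` to the orbit, as a function on `Q`, is `q ↦ ⟪c.frame q, F⟫`. -/
def frame (lam : ℝ) [Fact ((n : ℝ) < lam)] (q : Q) : Bergman n lam :=
  conj (d q ^ (-lam : ℂ)) • Bergman.repro (c.orb q)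

lemma inner_frame (q : Q) (F : Bergman n lam) :
    inner ℂ (c.frame lam q) F = d q ^ (-lam : ℂ) * Bergman.eval F (c.orb q) := by
  rw [frame, inner_smul_left (𝕜 := ℂ) (E := Bergman n lam) _ _ _, conj_conj, Bergman.inner_repro]

lemma continuous_frame (hdc : Continuous d) (hd : ∀ q, 0 < (d q).re) :
    Continuous (c.frame lam) := by
  have h1 : Continuous fun q => d q ^ (-lam : ℂ) := hdc.cpow continuous_const fun q => Or.inl (hd q)
  have h2 : Continuous fun q => (Bergman.repro (c.orb q) : Bergman n lam) :=
    Bergman.continuous_repro.comp c.orb_continuous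
  exact (continuous_conj.comp h1).smul h2

lemma R_eq (hd : ∀ q, 0 < (d q).re) (F : Bergman n lam) (h : Htilde H) :
    R H z₀ F h = exp (-2 * Real.pi * I * lam * c.ht h) * inner ℂ (c.frame lam (c.pt h)) F := by
  rw [R, c.D_eq hd, inner_frame, c.orb_pt, mul_assoc]

/-- The key identity. With q = q' + `pt k`, the invariance of the kernel moves both orbit points
back by an element h' over q', and the cocycle identity for h'k absorbs the automorphy factors; the
unimodular characters cancel. Only the difference q - q' survives. -/
lemma inner_frame_frame (hd : ∀ q, 0 < (d q).re) {φ : Q → ℂ}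
    (hφ : ∀ q, φ q = d q ^ (-lam : ℂ) * kernel lam (z₀ : EuclideanSpace ℂ (Fin n)) (c.orb q))
    (q q' : Q) : inner ℂ (c.frame lam q) (c.frame lam q') = φ (q - q') := by
  obtain ⟨h, rfl⟩ := c.exists_pt_eq q
  obtain ⟨h', rfl⟩ := c.exists_pt_eq q'
  obtain ⟨k, rfl⟩ : ∃ k, h = h' * k := ⟨h'⁻¹ * h, by group⟩
  have hk : c.pt (h' * k) - c.pt h' = c.pt k := by rw [c.pt_mul]; abel
  have e1 : c.orb (c.pt (h' * k)) = (h' : Gtilde n) • c.orb (c.pt k) := by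
    rw [c.pt_mul, c.orb_add]; rfl
  have e2 : c.orb (c.pt h') = (h' : Gtilde n) • z₀ := by rw [c.orb_pt]; rfl
  have h1 := kernel_smul lam (h' : Gtilde n) z₀ (c.orb (c.pt k))
  have h2 : Gtilde.j lam ((h' * k : Htilde H) : Gtilde n) z₀ =
      Gtilde.j lam h' (c.orb (c.pt k)) * Gtilde.j lam k z₀ := by
    rw [c.orb_pt]; exact Gtilde.j_mul ..
  have D1 := c.D_eq hd lam (h' * k)
  have D2 := c.D_eq hd lam h'
  have D3 := c.D_eq hd lam k
  rw [D] at D1 D2 D3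
  have hne : exp (-2 * Real.pi * I * lam * c.ht (h' * k)) ≠ 0 := exp_ne_zero _
  have he : exp (-2 * Real.pi * I * lam * c.ht (h' * k)) =
      exp (-2 * Real.pi * I * lam * c.ht h') * exp (-2 * Real.pi * I * lam * c.ht k) := by
    rw [c.ht_mul, ← exp_add]
    congr 1
    push_cast
    ring
  have hu : ∀ g : Htilde H, conj (exp (-2 * Real.pi * I * lam * c.ht g)) *
      exp (-2 * Real.pi * I * lam * c.ht g) = 1 := fun g => by
    rw [← normSq_eq_conj_mul_self, normSq_eq_norm_sq, norm_exp_ht]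
    simp
  rw [inner_frame, frame, Bergman.eval_smul, Bergman.eval_repro, hk, hφ, e1, e2, ← h1]
  rw [D1, D3, he] at h2
  rw [D2, map_mul]
  have hu' := hu h'
  have hw := exp_ne_zero (-2 * Real.pi * I * lam * c.ht k)
  generalize exp (-2 * Real.pi * I * lam * c.ht h') = u at *
  generalize exp (-2 * Real.pi * I * lam * c.ht k) = w at *
  generalize kernel lam _ _ = K
  generalize Gtilde.j lam _ _ = j at *
  have h3 : u * d (c.pt (h' * k)) ^ (-lam : ℂ) = j * d (c.pt k) ^ (-lam : ℂ) :=
    mul_right_cancel₀ hw (by linear_combination h2)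
  linear_combination K * conj u * conj (d (c.pt h') ^ (-lam : ℂ)) * h3 -
    d (c.pt (h' * k)) ^ (-lam : ℂ) * conj (d (c.pt h') ^ (-lam : ℂ)) * K * hu'

variable [IsTopologicalAddGroup Q] [MeasureSpace Q] [BorelSpace Q] [PolishSpace Q]
  [SigmaFinite (volume : Measure Q)] [Measure.IsAddLeftInvariant (volume : Measure Q)]

/-- Covariance makes the twisted function constant on the fibres over Q. Its measurability comes
from composing with the measurable section q ↦ (q, x q) of the cover. -/
lemma exists_tilde (hd : ∀ q, 0 < (d q).re) {x : Q → ℝ} (hx : Measurable x)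
    (hxL : ∀ q, (q, x q) ∈ L) {f : Htilde H → ℂ} (hf : MemL2 z₀ c.orbitMeasure lam f) :
    ∃ ft : Q → ℂ, IsTilde c lam f ft ∧ MemLp ft 2 := by
  let ψ : L → Htilde H := fun p => c.iso.symm (Multiplicative.ofAdd p)
  have hψ : Continuous ψ := c.iso.symm.continuous.comp continuous_ofAdd
  let sec : Q → Htilde H := fun q => ψ ⟨(q, x q), hxL q⟩
  have hsec : Measurable sec :=
    hψ.measurable.comp (Measurable.subtype_mk (measurable_id.prodMk hx))
  have hpt : ∀ q, c.pt (sec q) = q := fun q => by simp [sec, ψ, pt]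
  have hht : ∀ q, c.ht (sec q) = x q := fun q => by simp [sec, ψ, ht]
  let ft : Q → ℂ := fun q => f (sec q) * exp (2 * Real.pi * I * lam * x q)
  have htil : IsTilde c lam f ft := fun h => by
    have := c.tilde_unique hd hf.2.1 (h := sec (c.pt h)) (h' := h) (hpt _)
    rw [hht] at this
    exact this
  have hnorm : ∀ h, ‖f h‖ = ‖ft (c.pt h)‖ := fun h => by
    have h1 : ‖exp (2 * Real.pi * I * lam * c.ht h)‖ = 1 := by
      rw [norm_exp]
      simp
    rw [htil, norm_mul, h1, mul_one]
  refine ⟨ft, htil, ?_, ?_⟩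
  · refine Measurable.aestronglyMeasurable ?_
    refine (hf.1.comp hsec).mul ?_
    fun_prop
  · rw [eLpNorm_lt_top_iff_lintegral_rpow_enorm_lt_top two_ne_zero ENNReal.ofNat_ne_top]
    have h3 := hf.2.2
    rw [c.lintegral_descend hnorm] at h3
    simpa using h3

/-- The restriction principle, with the specific information on the group as hypotheses. -/
theorem explicitRestriction {φ : ℝ → Q → ℂ} {SD SL : Set ℝ}
    (hdc : Continuous d) (hd : ∀ q, 0 < (d q).re)
    (hSD : ∀ ν : ℝ, ∫⁻ q, ‖d q ^ (-ν : ℂ)‖ₑ ^ 2 < ∞ ↔ ν ∈ SD)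
    (hSL : ∀ ν ∈ SL, Integrable (φ ν)) (hlD : lam ∈ SD) (hlL : lam ∈ SL)
    (hφ : ∀ q, φ lam q = d q ^ (-lam : ℂ) * kernel lam (z₀ : EuclideanSpace ℂ (Fin n)) (c.orb q))
    {x : Q → ℝ} (hx : Measurable x) (hxL : ∀ q, (q, x q) ∈ L)
    (hinj : ∀ f : EuclideanSpace ℂ (Fin n) → ℂ, IsKernelIntegral lam f → (∀ q, f (c.orb q) = 0) → ∀ z : Ball n, f z = 0) :
    ExplicitRestriction lam H z₀ L mat d φ SD SL := by
  have hDmem : ∀ ν : ℝ, MemL2 z₀ c.orbitMeasure ν (D H z₀ ν) ↔ ν ∈ SD := fun ν => by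
    rw [← hSD]
    exact c.memL2_of_eq hd (hdc.cpow continuous_const fun q => Or.inl (hd q)) (c.D_eq hd ν)
  have hi := hSL lam hlL
  have hk := c.continuous_frame (lam := lam) hdc hd
  have hgram := c.inner_frame_frame hd hφ
  have hRn : ∀ (F : Bergman n lam) h, ‖R H z₀ F h‖ = ‖inner ℂ (c.frame lam (c.pt h)) F‖ :=
    fun F h => by rw [c.R_eq hd, norm_mul, norm_exp_ht, one_mul]
  refine ⟨c, c.orbitMeasure_invariant, c.D_eq hd, hDmem, hSL, (hDmem lam).mpr hlD, hi,
    fun F => ?_, ⟨2 * ∫ t, ‖φ lam t‖, fun F => ?_⟩, fun F hF => ?_, fun f hf => ?_⟩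
  · have hc : Continuous fun q => inner ℂ (c.frame lam q) F :=
      Continuous.inner (𝕜 := ℂ) (E := Bergman n lam) hk continuous_const
    rw [c.memL2_of_eq hd hc (c.R_eq hd F)]
    exact (ConvolutionFrame.lintegral_analysis_le hk hgram hi F).trans_lt ENNReal.ofReal_lt_top
  · rw [c.lintegral_descend (ft := fun q => inner ℂ (c.frame lam q) F) (hRn F)]
    exact ConvolutionFrame.lintegral_analysis_le hk hgram hi F
  · refine Bergman.ext_eval fun z => ?_
    have h0 : Bergman.eval (0 : Bergman n lam) z = 0 := by
      have := Bergman.eval_smul 0 (0 : Bergman n lam) z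
      simpa using this
    rw [h0, Bergman.eval_eq_hol]
    refine hinj _ (Bergman.isKernelIntegral_hol F) (fun q => ?_) z
    obtain ⟨h, rfl⟩ := c.exists_pt_eq q
    have := hF h
    rw [R, D, Gtilde.j, mul_eq_zero, or_iff_right (exp_ne_zero _), ← c.orb_pt] at this
    exact this
  · obtain ⟨ft, htil, hft⟩ := c.exists_tilde hd hx hxL hf
    refine ⟨ft, htil, hft, ?_⟩
    obtain ⟨F, h1, h2⟩ := ConvolutionFrame.exists_synthesis hk hgram hi hft
    refine ⟨F, fun F' => ?_, fun h => ⟨(h2 (c.pt h)).1, ?_⟩⟩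
    · rw [h1, orbitMeasure, c.measurableEmbedding_orb.integral_map]
      refine integral_congr_ae (ae_of_all _ fun q => ?_)
      obtain ⟨h, rfl, hh⟩ := c.exists_descend (fun h => conj (f h) * R H z₀ F' h) q
      simp only [hh]
      rw [htil, c.R_eq hd, map_mul]
      have : conj (exp (2 * Real.pi * I * lam * c.ht h)) =
          exp (-2 * Real.pi * I * lam * c.ht h) := by
        rw [← exp_conj]
        congr 1
        simp [map_ofNat]
      rw [this]
      ring
    · rw [c.R_eq hd, (h2 (c.pt h)).2]
      rfl

end OrbitCoordinates

end BallRestriction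
end

noncomputable section

namespace BallRestriction

/-! ## Construction of orbit coordinates -/

lemma norm_expc (a : UnitAddCircle) : ‖expc a‖ = 1 := Circle.norm_coe _

lemma expc_ne_zero (a : UnitAddCircle) : expc a ≠ 0 := by
  rw [← norm_ne_zero_iff, norm_expc]
  exact one_ne_zero

lemma expc_conj_mul (a : UnitAddCircle) : conj (expc a) * expc a = 1 := by
  rw [← normSq_eq_conj_mul_self, normSq_eq_norm_sq, norm_expc]
  simp

lemma expc_mul_conj (a : UnitAddCircle) : expc a * conj (expc a) = 1 := by
  rw [mul_comm, expc_conj_mul]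

lemma expc_injective : Function.Injective expc := fun _ _ h =>
  AddCircle.injective_toCircle one_ne_zero (Subtype.ext h)

lemma expc_coe (x : ℝ) : expc (x : UnitAddCircle) = exp (2 * Real.pi * I * x) := by
  rw [expc, AddCircle.toCircle_apply_mk, Circle.coe_exp]
  congr 1
  push_cast
  ring

lemma expc_nsmul (k : ℕ) (a : UnitAddCircle) : expc (k • a) = expc a ^ k := by
  induction k with
  | zero => simp [expc_zero]
  | succ k ih => rw [succ_nsmul, expc_add, ih, pow_succ]

lemma expc_sum {ι : Type*} (s : Finset ι) (f : ι → UnitAddCircle) :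
    expc (∑ i ∈ s, f i) = ∏ i ∈ s, expc (f i) := by
  classical
  induction s using Finset.induction_on with
  | empty => simp [expc_zero]
  | insert a s ha ih => rw [Finset.sum_insert ha, Finset.prod_insert ha, expc_add, ih]

lemma continuous_expc : Continuous expc :=
  continuous_subtype_val.comp AddCircle.continuous_toCircle

lemma isInducing_expc : Topology.IsInducing expc :=
  (continuous_expc.isClosedEmbedding expc_injective).isInducing

lemma exists_expc_eq {z : ℂ} (hz : ‖z‖ = 1) : ∃ a, expc a = z := by
  obtain ⟨a, ha⟩ := (AddCircle.homeomorphCircle (T := 1) one_ne_zero).surjective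
    ⟨z, mem_sphere_zero_iff_norm.mpr hz⟩
  refine ⟨a, ?_⟩
  have := congrArg (Subtype.val) ha
  rwa [AddCircle.homeomorphCircle_apply] at this

lemma abs_log_im_lt {z : ℂ} (hz : 0 < z.re) : |(Complex.log z).im| < Real.pi / 2 := by
  rw [log_im, abs_arg_lt_pi_div_two_iff]
  exact Or.inl hz

/-- The two sides differ by 2πi m. Four arguments, each smaller than π/2 in modulus, cannot add up
to 2π, so m = 0. -/
lemma log_div_mul {A B C : ℂ} (hA : 0 < A.re) (hB : 0 < B.re) (hC : 0 < C.re)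
    (h : 0 < (C / (A * B)).re) :
    Complex.log (C / (A * B)) = Complex.log C - Complex.log A - Complex.log B := by
  have ne : ∀ {z : ℂ}, 0 < z.re → z ≠ 0 := fun h => slitPlane_ne_zero (Or.inl h)
  have h1 : exp (Complex.log C - Complex.log A - Complex.log B - Complex.log (C / (A * B))) = 1 := by
    rw [exp_sub, exp_sub, exp_sub, Complex.exp_log (ne hA), Complex.exp_log (ne hB),
      Complex.exp_log (ne hC), Complex.exp_log (ne h), div_div C A B, div_self (ne h)]
  obtain ⟨m, hm⟩ := exp_eq_one_iff.mp h1
  have h2 := congrArg Complex.im hm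
  have e1 := abs_lt.mp (abs_log_im_lt hA)
  have e2 := abs_lt.mp (abs_log_im_lt hB)
  have e3 := abs_lt.mp (abs_log_im_lt hC)
  have e4 := abs_lt.mp (abs_log_im_lt h)
  simp only [sub_im, mul_im, mul_re, intCast_re, intCast_im, re_ofNat, im_ofNat, ofReal_re,
    ofReal_im, I_re, I_im] at h2
  have hm0 : m = 0 := by
    have hp := Real.pi_pos
    have h3 : (m : ℝ) * (2 * Real.pi) < 1 * (2 * Real.pi) := by
      linarith [e1.1, e1.2, e2.1, e2.2, e3.1, e3.2, e4.1, e4.2]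
    have h4 : (-1) * (2 * Real.pi) < (m : ℝ) * (2 * Real.pi) := by
      linarith [e1.1, e1.2, e2.1, e2.2, e3.1, e3.2, e4.1, e4.2]
    have h5 := lt_of_mul_lt_mul_right h3 (by positivity)
    have h6 := lt_of_mul_lt_mul_right h4 (by positivity)
    have h5' : m < 1 := by exact_mod_cast h5
    have h6' : -1 < m := by exact_mod_cast h6
    omega
  rw [hm0] at hm
  simp only [Int.cast_zero, zero_mul] at hm
  exact (sub_eq_zero.mp hm).symm

lemma mul_cpow_of_re_pos {A B : ℂ} (hA : 0 < A.re) (hB : 0 < B.re) (s : ℂ) :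
    (A * B) ^ s = A ^ s * B ^ s := by
  have e1 := abs_lt.mp (abs_log_im_lt hA)
  have e2 := abs_lt.mp (abs_log_im_lt hB)
  have ne : ∀ {z : ℂ}, 0 < z.re → z ≠ 0 := fun h => slitPlane_ne_zero (Or.inl h)
  rw [cpow_def_of_ne_zero (mul_ne_zero (ne hA) (ne hB)), cpow_def_of_ne_zero (ne hA),
    cpow_def_of_ne_zero (ne hB), ← exp_add, (Complex.log_mul_eq_add_log_iff (ne hA) (ne hB)).mpr, add_mul]
  · rw [← log_im, ← log_im]
    constructor <;> linarith [e1.1, e1.2, e2.1, e2.2, Real.pi_pos]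

/-- A family of matrices of `U(n,1)`, depending multiplicatively on `q ∈ Q`, which together with the
scalars of modulus one acts simply transitively on the orbit of `z₀`. -/
structure OrbitModel {n : ℕ} (z₀ : Ball n) (Q : Type) [AddCommGroup Q] [TopologicalSpace Q] where
  /-- the matrices -/
  core : Q → Mat n
  /-- the logarithm of the determinant -/
  detLog : Q → UnitAddCircle
  core_add : ∀ p q, core (p + q) = core p * core q
  core_J : ∀ q, core q * J n * (core q).conjTranspose = J n
  det_core : ∀ q, (core q).det = expc (detLog q)
  continuous_core : Continuous core
  core_re : ∀ q, 0 < (core q (Sum.inr ()) (Sum.inr ())).re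
  core_row : ∀ q, ∑ i, core q (Sum.inr ()) (Sum.inl i) *
    (z₀ : EuclideanSpace ℂ (Fin n)) i = 0
  continuous_of : ∀ {X : Type} [TopologicalSpace X] {f : X → Q} {a : X → UnitAddCircle},
    Continuous (fun x => expc (a x) • core (f x)) → Continuous f
  orb_injective : ∀ q q', (∀ i, (core q).mulVec (homog (z₀ : EuclideanSpace ℂ (Fin n)))
      (Sum.inl i) / core q (Sum.inr ()) (Sum.inr ()) =
    (core q').mulVec (homog (z₀ : EuclideanSpace ℂ (Fin n))) (Sum.inl i) /
      core q' (Sum.inr ()) (Sum.inr ())) → q = q'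

namespace OrbitModel

variable {n : ℕ} {z₀ : Ball n} {Q : Type} [AddCommGroup Q] [TopologicalSpace Q]
  (m : OrbitModel z₀ Q)

/-- The automorphy factor. -/
def den (q : Q) : ℂ := m.core q (Sum.inr ()) (Sum.inr ())

lemma den_re (q : Q) : 0 < (m.den q).re := m.core_re q

lemma den_ne_zero (q : Q) : m.den q ≠ 0 := slitPlane_ne_zero (Or.inl (m.den_re q))

lemma continuous_den : Continuous m.den :=
  (continuous_apply_apply (Sum.inr ()) (Sum.inr ())).comp m.continuous_core

/-- Injectivity is already contained in `continuous_of`: if two parameters give the same matrix,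
they are the values of a continuous map from an indiscrete space. -/
lemma core_injective [T0Space Q] {q q' : Q} {a a' : UnitAddCircle}
    (h : expc a • m.core q = expc a' • m.core q') : q = q' := by
  -- The top element of the lattice of topologies is the indiscrete one; its two points are
  -- inseparable, so their images in a T0 space coincide.
  let : TopologicalSpace Bool := ⊤
  have hc : Continuous (fun b : Bool => cond b q q') := by
    refine m.continuous_of (a := fun b => cond b a a') ?_
    have : (fun b : Bool => expc (cond b a a') • m.core (cond b q q')) =
        fun _ => expc a • m.core q := by
      funext b
      cases b
      · exact h.symm
      · rfl
    rw [this]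
    exact continuous_const
  have hi : Inseparable true false := by
    rw [inseparable_iff_forall_isOpen]
    intro s hs
    rcases TopologicalSpace.isOpen_top_iff s |>.mp hs with rfl | rfl <;> simp
  exact (hi.map hc).eq

lemma mat_mul (q q' : Q) (a a' : UnitAddCircle) :
    (expc a • m.core q) * (expc a' • m.core q') = expc (a + a') • m.core (q + q') := by
  rw [m.core_add, expc_add, Matrix.smul_mul, Matrix.mul_smul, smul_smul]

/-- The element of `SU(n,1)` with given parameters. -/
def elt (q : Q) (a : UnitAddCircle) (h : (n + 1) • a + m.detLog q = 0) : SU n :=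
  ⟨⟨expc a • m.core q, by
    rw [Matrix.det_smul, m.det_core, ← expc_nsmul, ← expc_add]
    have : Fintype.card (Fin n ⊕ Unit) = n + 1 := by simp
    rw [this, h, expc_zero]⟩, by
    change (expc a • m.core q) * J n * (expc a • m.core q).conjTranspose = J n
    rw [Matrix.conjTranspose_smul, Matrix.smul_mul, Matrix.smul_mul, Matrix.mul_smul, smul_smul,
      m.core_J, RCLike.star_def, expc_mul_conj, one_smul]⟩

lemma toMat_elt (q : Q) (a : UnitAddCircle) (h : (n + 1) • a + m.detLog q = 0) :
    toMat (m.elt q a h) = expc a • m.core q := rfl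

lemma det_condition {g : SU n} {q : Q} {a : UnitAddCircle} (h : toMat g = expc a • m.core q) :
    (n + 1) • a + m.detLog q = 0 := by
  have h1 : (toMat g).det = 1 := g.1.2
  rw [h, Matrix.det_smul, m.det_core, ← expc_nsmul, ← expc_add, ← expc_zero] at h1
  have := expc_injective h1
  simpa using this

lemma den_zero_eq {g : SU n} {q : Q} {a : UnitAddCircle} (h : toMat g = expc a • m.core q) :
    BallRestriction.den g 0 = expc a * m.den q := by
  rw [BallRestriction.den_zero, h]
  rfl

lemma den_base_eq {g : SU n} {q : Q} {a : UnitAddCircle} (h : toMat g = expc a • m.core q) :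
    BallRestriction.den g z₀ = expc a * m.den q := by
  rw [BallRestriction.den_eq, h]
  have := m.core_row q
  simp only [Matrix.smul_apply, smul_eq_mul, mul_assoc, ← Finset.mul_sum, this, den]
  ring

/-- By `core_row` the denominator takes the same value at z₀ and at the origin, so the principal
correction vanishes. -/
lemma log_base_eq {g : Gtilde n} {q : Q} {a : UnitAddCircle}
    (h : toMat g.base = expc a • m.core q) : g.log z₀ = g.log (origin n) := by
  rw [Gtilde.log_eq_log_zero_add, m.den_base_eq h, m.den_zero_eq h, div_self, Complex.log_one,
    add_zero]
  exact mul_ne_zero (expc_ne_zero a) (m.den_ne_zero q)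

lemma act_base_eq {g : SU n} {q : Q} {a : UnitAddCircle} (h : toMat g = expc a • m.core q)
    (i : Fin n) : (act g z₀ : EuclideanSpace ℂ (Fin n)) i =
      (m.core q).mulVec (homog (z₀ : EuclideanSpace ℂ (Fin n))) (Sum.inl i) / m.den q := by
  have h1 : (act g z₀ : EuclideanSpace ℂ (Fin n)) i =
      (BallRestriction.den g z₀)⁻¹ * num g z₀ i := rfl
  rw [h1, m.den_base_eq h, num, h, Matrix.smul_mulVec]
  simp only [Pi.smul_apply, smul_eq_mul]
  have := expc_ne_zero a
  have := m.den_ne_zero q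
  field_simp

lemma exp_eq_den (q : Q) (x : ℝ) (hx : (n + 1) • (x : UnitAddCircle) + m.detLog q = 0) :
    exp (2 * Real.pi * I * x + Complex.log (m.den q)) =
      BallRestriction.den (m.elt q x hx) 0 := by
  rw [m.den_zero_eq (m.toMat_elt q x hx), exp_add, Complex.exp_log (m.den_ne_zero q), expc_coe]

lemma coe_mul (x : ℝ) : (((n + 1) * x : ℝ) : UnitAddCircle) = (n + 1) • (x : UnitAddCircle) := by
  rw [← AddCircle.coe_nsmul, nsmul_eq_mul]
  push_cast
  rfl

lemma exists_cover (q : Q) : ∃ x : ℝ, (n + 1) • (x : UnitAddCircle) + m.detLog q = 0 := by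
  obtain ⟨r, hr⟩ := QuotientAddGroup.mk_surjective (m.detLog q)
  refine ⟨-r / (n + 1), ?_⟩
  have h : ((n : ℝ) + 1) * (-r / (n + 1)) = -r := by field_simp
  rw [← coe_mul, h, AddCircle.coe_neg, ← hr]
  exact neg_add_cancel _

/-- The point of the orbit with parameter `q`. -/
def orb (q : Q) : Ball n :=
  act (m.elt q _ (m.exists_cover q).choose_spec) z₀

lemma orb_apply (q : Q) (i : Fin n) : (m.orb q : EuclideanSpace ℂ (Fin n)) i =
    (m.core q).mulVec (homog (z₀ : EuclideanSpace ℂ (Fin n))) (Sum.inl i) / m.den q :=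
  m.act_base_eq (m.toMat_elt _ _ _) i

lemma continuous_orb : Continuous m.orb := by
  refine Continuous.subtype_mk ?_ _
  have h : (fun q => (m.orb q : EuclideanSpace ℂ (Fin n))) = fun q => WithLp.toLp 2 fun i =>
      (m.core q).mulVec (homog (z₀ : EuclideanSpace ℂ (Fin n))) (Sum.inl i) / m.den q := by
    funext q
    ext i
    exact m.orb_apply q i
  change Continuous fun q => (m.orb q : EuclideanSpace ℂ (Fin n))
  rw [h]
  refine (PiLp.continuous_toLp 2 _).comp (continuous_pi fun i => ?_)
  exact ((continuous_apply _).comp (m.continuous_core.matrix_mulVec continuous_const)).div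
    m.continuous_den m.den_ne_zero

variable {H : Subgroup (SU n)}
  (hH : ∀ g, g ∈ H ↔ ∃ p : Q × UnitAddCircle, toMat g = expc p.2 • m.core p.1)

include hH

lemma exists_param (h : Htilde H) :
    ∃ p : Q × UnitAddCircle, toMat (h : Gtilde n).base = expc p.2 • m.core p.1 := (hH _).mp h.2

/-- The parameter in `Q` of an element of the covering group. -/
def qOf (h : Htilde H) : Q := (m.exists_param hH h).choose.1

/-- The scalar factor of an element of the covering group. -/
def aOf (h : Htilde H) : UnitAddCircle := (m.exists_param hH h).choose.2

lemma toMat_eq (h : Htilde H) :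
    toMat (h : Gtilde n).base = expc (m.aOf hH h) • m.core (m.qOf hH h) :=
  (m.exists_param hH h).choose_spec

/-- The real parameter of an element of the covering group. -/
def xOf (h : Htilde H) : ℝ :=
  ((h : Gtilde n).log (origin n) - Complex.log (m.den (m.qOf hH h))).im / (2 * Real.pi)

/-- The exponential of the left side is the scalar factor of the matrix, of modulus one. So the
difference is purely imaginary and defines the real coordinate. -/
lemma log_sub_log (h : Htilde H) :
    (h : Gtilde n).log (origin n) - Complex.log (m.den (m.qOf hH h)) =
      2 * Real.pi * I * m.xOf hH h := by
  have h1 : exp ((h : Gtilde n).log (origin n) - Complex.log (m.den (m.qOf hH h))) =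
      expc (m.aOf hH h) := by
    have h2 := m.den_zero_eq (m.toMat_eq hH h)
    have h3 := (h : Gtilde n).exp_log (origin n)
    rw [exp_sub, h3, Complex.exp_log (m.den_ne_zero _)]
    change BallRestriction.den (h : Gtilde n).base 0 / _ = _
    rw [h2, mul_div_cancel_right₀ _ (m.den_ne_zero _)]
  have h4 := congrArg norm h1
  rw [norm_exp, norm_expc, Real.exp_eq_one_iff] at h4
  apply Complex.ext
  · rw [h4]; simp
  · simp only [xOf]
    have := Real.pi_pos
    simp only [mul_im, mul_re, re_ofNat, im_ofNat, ofReal_re, ofReal_im, I_re, I_im]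
    field_simp
    ring

lemma coe_xOf (h : Htilde H) : ((m.xOf hH h : ℝ) : UnitAddCircle) = m.aOf hH h := by
  apply expc_injective
  have h2 := m.den_zero_eq (m.toMat_eq hH h)
  have h3 := (h : Gtilde n).exp_log (origin n)
  rw [expc_coe, ← m.log_sub_log hH h, exp_sub, h3, Complex.exp_log (m.den_ne_zero _)]
  change BallRestriction.den (h : Gtilde n).base 0 / _ = _
  rw [h2, mul_div_cancel_right₀ _ (m.den_ne_zero _)]

lemma qOf_mul [T0Space Q] (h k : Htilde H) :
    m.qOf hH (h * k) = m.qOf hH h + m.qOf hH k := by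
  refine m.core_injective (a := m.aOf hH (h * k)) (a' := m.aOf hH h + m.aOf hH k) ?_
  rw [← m.mat_mul, ← m.toMat_eq, ← m.toMat_eq, ← m.toMat_eq, ← toMat_mul]
  rfl

/-- The logarithm of a product involves the first logarithm at the moved point, that is, its value
at the origin plus a principal logarithm of den(q + q') / (den q · den q'). This quotient lies in
the right half-plane, so its logarithm splits without multiples of 2πi, and the real coordinates
add. -/
lemma xOf_mul [T0Space Q] (h k : Htilde H) :
    m.xOf hH (h * k) = m.xOf hH h + m.xOf hH k := by
  set g : Gtilde n := h.1
  set g' : Gtilde n := k.1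
  have e1 := m.log_sub_log hH (h * k)
  have e2 := m.log_sub_log hH h
  have e3 := m.log_sub_log hH k
  have hz : ((h * k : Htilde H) : Gtilde n).log (origin n) =
      g.log (g'.base • z₀) + g'.log (origin n) := by
    rw [← m.log_base_eq (m.toMat_eq hH (h * k)), ← m.log_base_eq (m.toMat_eq hH k)]
    rfl
  have hd1 : BallRestriction.den g.base (act g'.base z₀) =
      expc (m.aOf hH h) * (m.den (m.qOf hH h + m.qOf hH k) / m.den (m.qOf hH k)) := by
    have h1 := den_mul g.base g'.base z₀
    have h2 : toMat (g.base * g'.base) = expc (m.aOf hH h + m.aOf hH k) •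
        m.core (m.qOf hH h + m.qOf hH k) := by
      rw [toMat_mul, m.toMat_eq hH h, m.toMat_eq hH k, m.mat_mul]
    rw [m.den_base_eq h2, m.den_base_eq (m.toMat_eq hH k), expc_add] at h1
    have := expc_ne_zero (m.aOf hH k)
    have := m.den_ne_zero (m.qOf hH k)
    rw [mul_div_assoc', eq_div_iff this]
    have hk := expc_ne_zero (m.aOf hH k)
    refine mul_right_cancel₀ hk ?_
    linear_combination -h1
  have hd2 : BallRestriction.den g.base (act g'.base z₀) / BallRestriction.den g.base 0 =
      m.den (m.qOf hH h + m.qOf hH k) / (m.den (m.qOf hH h) * m.den (m.qOf hH k)) := by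
    rw [hd1, m.den_zero_eq (m.toMat_eq hH h)]
    have := expc_ne_zero (m.aOf hH h)
    have := m.den_ne_zero (m.qOf hH k)
    have := m.den_ne_zero (m.qOf hH h)
    field_simp
  have hre := den_div_re_pos g.base (act g'.base z₀)
  rw [hd2] at hre
  have hl := log_div_mul (m.den_re _) (m.den_re _) (m.den_re _) hre
  rw [← hd2] at hl
  have hlog := Gtilde.log_eq_log_zero_add g (act g'.base z₀)
  rw [hl] at hlog
  change ((h * k : Htilde H) : Gtilde n).log (origin n) =
      g.log (act g'.base z₀) + g'.log (origin n) at hz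
  rw [hz, hlog, m.qOf_mul hH] at e1
  have h5 : (2 * Real.pi * I * (m.xOf hH (h * k) : ℝ) : ℂ) =
      2 * Real.pi * I * ((m.xOf hH h + m.xOf hH k : ℝ) : ℂ) := by
    push_cast
    rw [mul_add, ← e1, ← e2, ← e3]
    ring
  have h6 : (2 * Real.pi * I : ℂ) ≠ 0 := by simp [Real.pi_ne_zero]
  exact_mod_cast mul_left_cancel₀ h6 h5

lemma continuous_qOf : Continuous (m.qOf hH) := by
  refine m.continuous_of (a := m.aOf hH) ?_
  simp only [← m.toMat_eq hH]
  exact (continuous_fst.comp Gtilde.continuous_base_log_zero).comp continuous_subtype_val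

lemma continuous_xOf : Continuous (m.xOf hH) := by
  have h1 : Continuous fun h : Htilde H => (h : Gtilde n).log (origin n) :=
    (continuous_snd.comp Gtilde.continuous_base_log_zero).comp continuous_subtype_val
  have h2 : Continuous fun h : Htilde H => Complex.log (m.den (m.qOf hH h)) :=
    (m.continuous_den.comp (m.continuous_qOf hH)).clog fun h => Or.inl (m.den_re _)
  exact (continuous_im.comp (h1.sub h2)).div_const _

/-- The element of the covering group with given parameters. -/
def lift (q : Q) (x : ℝ) (hx : (n + 1) • (x : UnitAddCircle) + m.detLog q = 0) : Htilde H :=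
  ⟨Gtilde.lift (m.elt q x hx) (2 * Real.pi * I * x + Complex.log (m.den q))
    (m.exp_eq_den q x hx), (hH _).mpr ⟨(q, x), rfl⟩⟩

lemma toMat_lift (q : Q) (x : ℝ) (hx : (n + 1) • (x : UnitAddCircle) + m.detLog q = 0) :
    toMat (m.lift hH q x hx : Gtilde n).base = expc x • m.core q := rfl

lemma log_lift (q : Q) (x : ℝ) (hx : (n + 1) • (x : UnitAddCircle) + m.detLog q = 0) :
    (m.lift hH q x hx : Gtilde n).log (origin n) = 2 * Real.pi * I * x + Complex.log (m.den q) :=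
  Gtilde.lift_log_zero _ _ (m.exp_eq_den q x hx)

lemma qOf_lift [T0Space Q] (q : Q) (x : ℝ)
    (hx : (n + 1) • (x : UnitAddCircle) + m.detLog q = 0) : m.qOf hH (m.lift hH q x hx) = q :=
  m.core_injective ((m.toMat_eq hH _).symm.trans (m.toMat_lift hH q x hx))

lemma xOf_lift [T0Space Q] (q : Q) (x : ℝ)
    (hx : (n + 1) • (x : UnitAddCircle) + m.detLog q = 0) : m.xOf hH (m.lift hH q x hx) = x := by
  rw [xOf, m.qOf_lift, m.log_lift]
  have := Real.pi_pos
  simp only [add_sub_cancel_right, mul_im, mul_re, re_ofNat, im_ofNat, ofReal_re, ofReal_im, I_re,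
    I_im]
  field_simp
  ring

lemma ext_of_params [T0Space Q] {h k : Htilde H} (h1 : m.qOf hH h = m.qOf hH k)
    (h2 : m.xOf hH h = m.xOf hH k) : h = k := by
  refine Subtype.ext (Gtilde.ext_of_log_zero (toMat_ext ?_) ?_)
  · rw [m.toMat_eq hH h, m.toMat_eq hH k, ← m.coe_xOf, ← m.coe_xOf, h1, h2]
  · have e1 := m.log_sub_log hH h
    have e2 := m.log_sub_log hH k
    rw [h1, h2, ← e2] at e1
    exact sub_left_injective e1

lemma cover_condition (h : Htilde H) :
    (n + 1) • ((m.xOf hH h : ℝ) : UnitAddCircle) + m.detLog (m.qOf hH h) = 0 := by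
  rw [m.coe_xOf]
  exact m.det_condition (m.toMat_eq hH h)

variable {L : AddSubgroup (Q × ℝ)}
  (hL : ∀ p : Q × ℝ, p ∈ L ↔ (((n + 1) * p.2 : ℝ) : UnitAddCircle) + m.detLog p.1 = 0)

include hL

/-- The isomorphism of the covering group with the group of parameters. -/
def iso [T0Space Q] : Htilde H ≃ₜ* Multiplicative L where
  toFun h := Multiplicative.ofAdd ⟨(m.qOf hH h, m.xOf hH h),
    (hL _).mpr (by rw [coe_mul]; exact m.cover_condition hH h)⟩
  invFun p := m.lift hH (p.toAdd : Q × ℝ).1 (p.toAdd : Q × ℝ).2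
    (by rw [← coe_mul]; exact (hL _).mp p.toAdd.2)
  left_inv h := m.ext_of_params hH (m.qOf_lift hH ..) (m.xOf_lift hH ..)
  right_inv p := by
    refine Multiplicative.toAdd.injective (Subtype.ext (Prod.ext ?_ ?_))
    · exact m.qOf_lift hH ..
    · exact m.xOf_lift hH ..
  map_mul' h k := by
    refine Multiplicative.toAdd.injective (Subtype.ext (Prod.ext ?_ ?_))
    · exact m.qOf_mul hH h k
    · exact m.xOf_mul hH h k
  continuous_toFun := continuous_ofAdd.comp
    (Continuous.subtype_mk ((m.continuous_qOf hH).prodMk (m.continuous_xOf hH)) _)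
  continuous_invFun := by
    have hp : Continuous fun p : Multiplicative L => (p.toAdd : Q × ℝ) :=
      continuous_subtype_val.comp continuous_toAdd
    refine Continuous.subtype_mk (Gtilde.continuous_iff.mpr ⟨?_, ?_⟩) _
    · change Continuous fun p : Multiplicative L =>
        expc ((p.toAdd : Q × ℝ).2 : ℝ) • m.core (p.toAdd : Q × ℝ).1
      have h1 : Continuous fun p : Multiplicative L => expc ((p.toAdd : Q × ℝ).2 : ℝ) :=
        continuous_expc.comp ((AddCircle.continuous_mk' 1).comp (continuous_snd.comp hp))
      exact h1.smul (m.continuous_core.comp (continuous_fst.comp hp))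
    · simp only [Gtilde.lift_log_zero]
      have h1 : Continuous fun p : Multiplicative L =>
          Complex.log (m.den (p.toAdd : Q × ℝ).1) :=
        (m.continuous_den.comp (continuous_fst.comp hp)).clog fun h => Or.inl (m.den_re _)
      have h2 := continuous_snd.comp hp
      exact (continuous_const.mul (continuous_ofReal.comp h2)).add h1

/-- The orbit coordinates of a group given by an explicit family of matrices. -/
def orbitCoordinates [T0Space Q] {mat : Q → UnitAddCircle → Mat n} {d : Q → ℂ}
    (hmat : ∀ q a, mat q a = expc a • m.core q) (hd : ∀ q, d q = m.den q) :
    OrbitCoordinates H z₀ L mat d where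
  iso := m.iso hH hL
  orb := m.orb
  mat_eq h := by
    rw [hmat]
    change _ = expc (m.xOf hH h : ℝ) • m.core (m.qOf hH h)
    rw [m.coe_xOf]
    exact m.toMat_eq hH h
  log_eq h := by
    rw [m.log_base_eq (m.toMat_eq hH h), hd]
    change _ = 2 * Real.pi * I * m.xOf hH h + Complex.log (m.den (m.qOf hH h))
    rw [← m.log_sub_log]
    ring
  surjective q := by
    obtain ⟨x, hx⟩ := m.exists_cover q
    exact ⟨m.lift hH q x hx, m.qOf_lift hH ..⟩
  orb_eq h := by
    refine Subtype.ext (PiLp.ext fun i => ?_)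
    rw [m.orb_apply]
    exact (m.act_base_eq (m.toMat_eq hH h) i).symm
  orb_continuous := m.continuous_orb
  orb_injective q q' h := m.orb_injective q q' fun i => by
    have h1 := m.orb_apply q i
    have h2 := m.orb_apply q' i
    rw [h] at h1
    exact h1.symm.trans h2

end OrbitModel

end BallRestriction
end

noncomputable section

namespace BallRestriction

/-! ### The restriction principle for an orbit model -/

namespace OrbitModel

variable {n : ℕ} {z₀ : Ball n} {Q : Type} [AddCommGroup Q] [TopologicalSpace Q]
  (m : OrbitModel z₀ Q)

/-- Both bases lie in the right half-plane, so the powers combine into one; this is how the closed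
form of φ_λ arises. -/
lemma kernel_orb (lam : ℝ) (q : Q) : m.den q ^ (-lam : ℂ) *
    kernel lam (z₀ : EuclideanSpace ℂ (Fin n)) (m.orb q) =
      (m.den q - ∑ i, conj ((z₀ : EuclideanSpace ℂ (Fin n)) i) *
        (m.core q).mulVec (homog (z₀ : EuclideanSpace ℂ (Fin n))) (Sum.inl i)) ^ (-lam : ℂ) := by
  rw [kernel, ← mul_cpow_of_re_pos (m.den_re q)]
  · congr 1
    rw [mul_sub, mul_one, PiLp.inner_apply, Finset.mul_sum]
    congr 1
    refine Finset.sum_congr rfl fun i _ => ?_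
    rw [m.orb_apply, RCLike.inner_apply]
    have := m.den_ne_zero q
    field_simp
  · exact one_sub_inner_re_pos _ _

variable {lam : ℝ} [Fact (1 ≤ n)] [Fact ((n : ℝ) < lam)]
  [IsTopologicalAddGroup Q] [MeasureSpace Q] [BorelSpace Q] [PolishSpace Q]
  [SigmaFinite (volume : Measure Q)] [Measure.IsAddLeftInvariant (volume : Measure Q)]

theorem explicitRestriction {H : Subgroup (SU n)}
    (hH : ∀ g, g ∈ H ↔ ∃ p : Q × UnitAddCircle, toMat g = expc p.2 • m.core p.1)
    {L : AddSubgroup (Q × ℝ)}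
    (hL : ∀ p : Q × ℝ, p ∈ L ↔ (((n + 1) * p.2 : ℝ) : UnitAddCircle) + m.detLog p.1 = 0)
    (hdet : Continuous m.detLog)
    {mat : Q → UnitAddCircle → Mat n} {d : Q → ℂ}
    (hmat : ∀ q a, mat q a = expc a • m.core q) (hd : ∀ q, d q = m.den q)
    {φ : ℝ → Q → ℂ} {SD SL : Set ℝ}
    (hSD : ∀ ν : ℝ, ∫⁻ q, ‖d q ^ (-ν : ℂ)‖ₑ ^ 2 < ∞ ↔ ν ∈ SD)
    (hSL : ∀ ν ∈ SL, Integrable (φ ν)) (hlD : lam ∈ SD) (hlL : lam ∈ SL)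
    (hφ : ∀ q, φ lam q = (m.den q - ∑ i, conj ((z₀ : EuclideanSpace ℂ (Fin n)) i) *
        (m.core q).mulVec (homog (z₀ : EuclideanSpace ℂ (Fin n))) (Sum.inl i)) ^ (-lam : ℂ))
    (hinj : ∀ f : EuclideanSpace ℂ (Fin n) → ℂ, IsKernelIntegral lam f →
      (∀ q, f (m.orb q) = 0) → ∀ z : Ball n, f z = 0) :
    ExplicitRestriction lam H z₀ L mat d φ SD SL := by
  have hde : d = m.den := funext hd
  subst hde
  -- The measurable section of the cover: the representative in [0, 1) of the determinant's
  -- logarithm, negated and divided by n + 1, solves the covering condition.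
  have hx : Measurable fun q =>
      -(AddCircle.measurableEquivIco 1 0 (m.detLog q) : ℝ) / (n + 1) :=
    ((measurable_subtype_coe.comp ((AddCircle.measurableEquivIco 1 0).measurable.comp
      hdet.measurable)).neg).div_const _
  refine (m.orbitCoordinates hH hL hmat hd).explicitRestriction m.continuous_den m.den_re hSD hSL
    hlD hlL (fun q => ?_) hx (fun q => ?_) hinj
  · rw [hφ, ← kernel_orb]
    rfl
  · rw [hL]
    have h : ((n : ℝ) + 1) * (-(AddCircle.measurableEquivIco 1 0 (m.detLog q) : ℝ) / (n + 1)) =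
        -(AddCircle.measurableEquivIco 1 0 (m.detLog q) : ℝ) := by field_simp
    have h2 : (((AddCircle.measurableEquivIco 1 0 (m.detLog q) : Set.Ico (0 : ℝ) (0 + 1)) : ℝ) :
        UnitAddCircle) = m.detLog q := AddCircle.coe_equivIco
    simp only [h, AddCircle.coe_neg, h2]
    exact neg_add_cancel _

end OrbitModel

/-! ### The elliptic model -/

lemma continuous_entry {X ι κ : Type*} [TopologicalSpace X] {A : X → Matrix ι κ ℂ}
    (h : Continuous A) (i : ι) (j : κ) : Continuous fun x => A x i j :=
  (continuous_apply_apply i j).comp h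

lemma continuous_apply_expc {ι : Type*} (i : ι) :
    Continuous fun t : ι → UnitAddCircle => expc (t i) :=
  continuous_expc.comp (continuous_apply i)

lemma continuous_of_expc {X ι : Type*} [TopologicalSpace X] {f : X → ι → UnitAddCircle}
    (h : ∀ i, Continuous fun x => expc (f x i)) : Continuous f :=
  continuous_pi fun i => isInducing_expc.continuous_iff.mpr (h i)

lemma continuous_expc_of_mul {X : Type*} [TopologicalSpace X] {f a : X → UnitAddCircle}
    (h : Continuous fun x => expc (a x) * expc (f x)) (ha : Continuous fun x => expc (a x)) :
    Continuous fun x => expc (f x) := by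
  have h1 : (fun x => expc (f x)) = fun x => expc (a x) * expc (f x) / expc (a x) := by
    funext x
    rw [mul_div_cancel_left₀ _ (expc_ne_zero _)]
  rw [h1]
  exact h.div ha fun x => expc_ne_zero _

lemma basePoint_apply {n k : ℕ} {β : Type} [Fintype β] (ε : Fin k ⊕ β ≃ Fin n) (i : Fin k ⊕ β) :
    (basePoint ε : EuclideanSpace ℂ (Fin n)) (ε i) =
      Sum.elim (fun _ => ((1 / √(2 * k) : ℝ) : ℂ)) (fun _ => 0) i := by
  simp [basePoint]

lemma basePoint_coord_ne_zero {k : ℕ} (i : Fin k) : ((1 / √(2 * k) : ℝ) : ℂ) ≠ 0 := by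
  have h : (0 : ℝ) < k := by exact_mod_cast i.pos
  have : (0 : ℝ) < 1 / √(2 * k) := by positivity
  exact_mod_cast this.ne'

lemma basePoint_coord_sq (k : ℕ) :
    ((1 / √(2 * k) : ℝ) : ℂ) * ((1 / √(2 * k) : ℝ) : ℂ) = 1 / (2 * k) := by
  rw [← ofReal_mul, div_mul_div_comm, Real.mul_self_sqrt (by positivity)]
  push_cast
  ring

lemma ellipticPoint_apply (n : ℕ) (i : Fin n) :
    (ellipticPoint n : EuclideanSpace ℂ (Fin n)) i = ((1 / √(2 * n) : ℝ) : ℂ) :=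
  basePoint_apply (Equiv.sumEmpty (Fin n) Empty) (Sum.inl i)

/-- The diagonal matrices. -/
def coreE {n : ℕ} (t : Fin n → UnitAddCircle) : Mat n :=
  Matrix.diagonal (Sum.elim (fun i => expc (t i)) (fun _ => 1))

/-- The orbit model of the quasi-elliptic group. -/
def ellipticModel (n : ℕ) : OrbitModel (ellipticPoint n) (Fin n → UnitAddCircle) where
  core := coreE
  detLog t := ∑ i, t i
  core_add p q := by
    rw [coreE, coreE, coreE, Matrix.diagonal_mul_diagonal]
    congr 1
    ext (i | i) <;> simp [expc_add]
  core_J q := by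
    rw [coreE, J, Matrix.diagonal_conjTranspose, Matrix.diagonal_mul_diagonal,
      Matrix.diagonal_mul_diagonal]
    congr 1
    ext (i | i)
    · simp [expc_mul_conj]
    · simp
  det_core q := by
    rw [coreE, Matrix.det_diagonal, Fintype.prod_sum_type, expc_sum]
    simp
  continuous_core := by
    refine Continuous.matrix_diagonal (continuous_pi ?_)
    rintro (i | i)
    · exact continuous_apply_expc i
    · exact continuous_const
  core_re q := by simp [coreE]
  core_row q := by simp [coreE]
  continuous_of {X _ f a} h := by
    have ha : Continuous fun x => expc (a x) := by
      simpa [coreE] using continuous_entry h (Sum.inr ()) (Sum.inr ())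
    refine continuous_of_expc fun i => continuous_expc_of_mul ?_ ha
    simpa [coreE] using continuous_entry h (Sum.inl i) (Sum.inl i)
  orb_injective q q' h := by
    funext i
    have := h i
    simp only [coreE, Matrix.mulVec_diagonal, Matrix.diagonal_apply_eq, Sum.elim_inl, Sum.elim_inr,
      div_one, homog, ellipticPoint_apply] at this
    exact expc_injective (mul_right_cancel₀ (basePoint_coord_ne_zero i) this)

/-! ### Reindexing -/

section Reindex

variable {n : ℕ} {β : Type} [Fintype β] [DecidableEq β] (ε : β ≃ Fin n)

/-- The numbering of homogeneous coordinates. -/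
def homogEquiv : Fin n ⊕ Unit ≃ β ⊕ Unit := Equiv.sumCongr ε.symm (Equiv.refl Unit)

lemma submatrix_J {A : Matrix (β ⊕ Unit) (β ⊕ Unit) ℂ}
    (h : A * Matrix.diagonal (Sum.elim (fun _ => -1) (fun _ => 1)) * A.conjTranspose =
      Matrix.diagonal (Sum.elim (fun _ => -1) (fun _ => 1))) :
    A.submatrix (homogEquiv ε) (homogEquiv ε) * J n *
      (A.submatrix (homogEquiv ε) (homogEquiv ε)).conjTranspose = J n := by
  have hJ : J n = (Matrix.diagonal (Sum.elim (fun _ => -1) (fun _ => 1)) :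
      Matrix (β ⊕ Unit) (β ⊕ Unit) ℂ).submatrix (homogEquiv ε) (homogEquiv ε) := by
    rw [J, Matrix.submatrix_diagonal_equiv]
    congr 1
    ext (i | i) <;> rfl
  rw [hJ, Matrix.conjTranspose_submatrix, Matrix.submatrix_mul_equiv, Matrix.submatrix_mul_equiv, h]

lemma submatrix_mulVec_homog (A : Matrix (β ⊕ Unit) (β ⊕ Unit) ℂ) (z : EuclideanSpace ℂ (Fin n))
    (j : β ⊕ Unit) :
    (A.submatrix (homogEquiv ε) (homogEquiv ε)).mulVec (homog z) ((homogEquiv ε).symm j) =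
      (∑ b, A j (Sum.inl b) * z (ε b)) + A j (Sum.inr ()) := by
  rw [Matrix.mulVec, dotProduct, ← (homogEquiv ε).symm.sum_comp, Fintype.sum_sum_type]
  simp only [Matrix.submatrix_apply, Equiv.apply_symm_apply]
  simp [homogEquiv, homog]

end Reindex

/-- A product with an expression for the two-by-two determinant. -/
lemma det_unit_sum_unit (A : Matrix (Unit ⊕ Unit) (Unit ⊕ Unit) ℂ) :
    A.det = A (Sum.inl ()) (Sum.inl ()) * A (Sum.inr ()) (Sum.inr ()) -
      A (Sum.inl ()) (Sum.inr ()) * A (Sum.inr ()) (Sum.inl ()) := by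
  let e : Fin 2 ≃ Unit ⊕ Unit :=
    { toFun := ![Sum.inl (), Sum.inr ()]
      invFun := Sum.elim (fun _ => 0) (fun _ => 1)
      left_inv := fun i => by fin_cases i <;> rfl
      right_inv := fun i => by rcases i with i | i <;> rfl }
  rw [← Matrix.det_submatrix_equiv_self e, Matrix.det_fin_two]
  rfl

end BallRestriction
end

noncomputable section

namespace BallRestriction

lemma homogEquiv_symm_inl {n : ℕ} {β : Type} (ε : β ≃ Fin n) (b : β) :
    (homogEquiv ε).symm (Sum.inl b) = Sum.inl (ε b) := rfl

lemma sum_conj_mulVec {n : ℕ} {β : Type} [Fintype β] (ε : β ≃ Fin n)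
    (A : Matrix (β ⊕ Unit) (β ⊕ Unit) ℂ) (z : EuclideanSpace ℂ (Fin n)) :
    ∑ i, conj (z i) * (A.submatrix (homogEquiv ε) (homogEquiv ε)).mulVec (homog z) (Sum.inl i) =
      ∑ b, conj (z (ε b)) * ((∑ b', A (Sum.inl b) (Sum.inl b') * z (ε b')) +
        A (Sum.inl b) (Sum.inr ())) := by
  classical
  rw [← ε.sum_comp]
  refine Finset.sum_congr rfl fun b _ => ?_
  rw [← homogEquiv_symm_inl, submatrix_mulVec_homog]

/-! ### The hyperbolic model -/

section Hyperbolic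

variable {n m : ℕ} (ε : Fin m ⊕ Unit ≃ Fin n)

lemma coreH_J (q : QH m) :
    coreH q * Matrix.diagonal (Sum.elim (fun _ => -1) (fun _ => 1)) * (coreH q).conjTranspose =
      Matrix.diagonal (Sum.elim (fun _ => -1) (fun _ => 1)) := by
  have hc := Complex.cosh_sq_sub_sinh_sq (q.2 : ℂ)
  have h1 : ∀ x : ℝ, conj (Complex.cosh x) = Complex.cosh x := fun x => by
    rw [← ofReal_cosh, conj_ofReal]
  have h2 : ∀ x : ℝ, conj (Complex.sinh x) = Complex.sinh x := fun x => by
    rw [← ofReal_sinh, conj_ofReal]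
  ext ((i | i) | i) ((j | j) | j) <;>
    simp [coreH, Matrix.mul_apply, Fintype.sum_sum_type, Matrix.diagonal_apply, h1, h2]
  · by_cases h : i = j
    · subst h
      simp [expc_mul_conj]
    · simp [h, Ne.symm h]
  · linear_combination -hc
  · ring
  · ring
  · linear_combination hc

lemma det_coreH (q : QH m) : (coreH q).det = expc (∑ i, q.1 i) := by
  rw [← Matrix.det_submatrix_equiv_self (Equiv.sumAssoc (Fin m) Unit Unit).symm]
  have h : (coreH q).submatrix (Equiv.sumAssoc (Fin m) Unit Unit).symm
      (Equiv.sumAssoc (Fin m) Unit Unit).symm =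
      Matrix.fromBlocks (Matrix.diagonal fun i => expc (q.1 i)) 0 0
        (Matrix.fromBlocks (Matrix.of fun _ _ => (Real.cosh q.2 : ℂ)) (Matrix.of fun _ _ => (Real.sinh q.2 : ℂ))
          (Matrix.of fun _ _ => (Real.sinh q.2 : ℂ)) (Matrix.of fun _ _ => (Real.cosh q.2 : ℂ))) := by
    ext (i | i | i) (j | j | j) <;> simp [coreH, Matrix.diagonal_apply, Equiv.sumAssoc]
  rw [h, Matrix.det_fromBlocks_zero₂₁, Matrix.det_diagonal, det_unit_sum_unit, expc_sum]
  have hc := Complex.cosh_sq_sub_sinh_sq (q.2 : ℂ)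
  simp only [Matrix.fromBlocks_apply₁₁, Matrix.fromBlocks_apply₁₂, Matrix.fromBlocks_apply₂₁,
    Matrix.fromBlocks_apply₂₂, Matrix.of_apply, ofReal_cosh, ofReal_sinh]
  linear_combination (∏ i, expc (q.1 i)) * hc

lemma continuous_coreH : Continuous (coreH (m := m)) := by
  have ht : ∀ i, Continuous fun q : QH m => expc (q.1 i) := fun i =>
    (continuous_apply_expc i).comp continuous_fst
  refine continuous_matrix ?_
  rintro ((i | i) | i) ((j | j) | j) <;> simp only [coreH] <;> try fun_prop
  split_ifs
  · exact ht i
  · exact continuous_const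

/-- The orbit model of the quasi-hyperbolic group. -/
def hyperbolicModel : OrbitModel (basePoint ε) (QH m) where
  core q := (coreH q).submatrix (homogEquiv ε) (homogEquiv ε)
  detLog q := ∑ i, q.1 i
  core_add p q := by rw [coreH_add, Matrix.submatrix_mul_equiv]
  core_J q := submatrix_J ε (coreH_J q)
  det_core q := by rw [Matrix.det_submatrix_equiv_self, det_coreH]
  continuous_core := continuous_coreH.matrix_submatrix _ _
  core_re q := by
    change 0 < ((Real.cosh q.2 : ℂ)).re
    rw [ofReal_re]
    exact Real.cosh_pos _
  core_row q := by
    rw [← ε.sum_comp, Fintype.sum_sum_type]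
    simp [basePoint_apply, homogEquiv, coreH]
  continuous_of {X _ f a} h := by
    have h1 : Continuous fun x => expc (a x) * (Real.cosh (f x).2 : ℂ) :=
      continuous_entry h (Sum.inr ()) (Sum.inr ())
    have h2 : Continuous fun x => expc (a x) * (Real.sinh (f x).2 : ℂ) := by
      have := continuous_entry h (Sum.inr ()) ((homogEquiv ε).symm (Sum.inl (Sum.inr ())))
      simpa [coreH, homogEquiv] using this
    -- The parameters are recovered from the matrix in turn: cosh s as the modulus of the corner,
    -- then the scalar, then sinh s and s = arsinh (sinh s), then the circle coordinates.
    have h3 : Continuous fun x => Real.cosh (f x).2 := by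
      have : (fun x => Real.cosh (f x).2) = fun x => ‖expc (a x) * (Real.cosh (f x).2 : ℂ)‖ := by
        funext x
        rw [norm_mul, norm_expc, one_mul, norm_real, Real.norm_of_nonneg (Real.cosh_pos _).le]
      rw [this]
      exact h1.norm
    have ha : Continuous fun x => expc (a x) := by
      have : (fun x => expc (a x)) = fun x =>
          expc (a x) * (Real.cosh (f x).2 : ℂ) / (Real.cosh (f x).2 : ℂ) := by
        funext x
        rw [mul_div_cancel_right₀]
        exact_mod_cast (Real.cosh_pos _).ne'
      rw [this]
      refine h1.div (continuous_ofReal.comp h3) fun x => ?_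
      exact_mod_cast (Real.cosh_pos _).ne'
    have h4 : Continuous fun x => Real.sinh (f x).2 := by
      have : (fun x => Real.sinh (f x).2) = fun x =>
          (expc (a x) * (Real.sinh (f x).2 : ℂ) / expc (a x)).re := by
        funext x
        rw [mul_div_cancel_left₀ _ (expc_ne_zero _), ofReal_re]
      rw [this]
      exact continuous_re.comp (h2.div ha fun x => expc_ne_zero _)
    refine Continuous.prodMk (continuous_of_expc fun i => continuous_expc_of_mul ?_ ha) ?_
    · have := continuous_entry h ((homogEquiv ε).symm (Sum.inl (Sum.inl i)))
        ((homogEquiv ε).symm (Sum.inl (Sum.inl i)))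
      simpa [coreH, homogEquiv] using this
    · have := Real.continuous_arsinh.comp h4
      simpa [Function.comp_def, Real.arsinh_sinh] using this
  orb_injective q q' h := by
    have key : ∀ b : Fin m ⊕ Unit, _ := fun b => h (ε b)
    simp only [← homogEquiv_symm_inl, submatrix_mulVec_homog, basePoint_apply,
      Fintype.sum_sum_type] at key
    have hc : ∀ x : ℝ, (Complex.cosh x) ≠ 0 := fun x => by
      rw [← ofReal_cosh]
      exact_mod_cast (Real.cosh_pos x).ne'
    have hs : q.2 = q'.2 := by
      have := key (Sum.inr ())
      simp [coreH, homogEquiv] at this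
      rw [div_eq_div_iff (hc _) (hc _)] at this
      have h2 : Complex.sinh ((q.2 - q'.2 : ℝ) : ℂ) = 0 := by
        push_cast
        rw [Complex.sinh_sub, this]
        ring
      rw [← ofReal_sinh, ofReal_eq_zero, Real.sinh_eq_zero] at h2
      linarith
    refine Prod.ext (funext fun i => ?_) hs
    have := key (Sum.inl i)
    simp [coreH, homogEquiv, hs, hc] at this
    rcases this with h1 | h1
    · exact expc_injective h1
    · exact absurd h1 i.pos.ne'

lemma hyperbolicModel_den (q : QH m) : (hyperbolicModel ε).den q = Real.cosh q.2 := rfl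

lemma hyperbolicModel_kernel (lam : ℝ) (q : QH m) : hyperbolicKernel m lam q =
    ((hyperbolicModel ε).den q - ∑ i, conj ((basePoint ε : EuclideanSpace ℂ (Fin n)) i) *
        ((hyperbolicModel ε).core q).mulVec (homog (basePoint ε : EuclideanSpace ℂ (Fin n)))
          (Sum.inl i)) ^ (-lam : ℂ) := by
  rw [hyperbolicKernel, hyperbolicModel_den]
  congr 2
  simp only [hyperbolicModel, sum_conj_mulVec, basePoint_apply, Fintype.sum_sum_type]
  have hr := basePoint_coord_sq m
  have hc : conj ((1 / √(2 * m) : ℝ) : ℂ) = ((1 / √(2 * m) : ℝ) : ℂ) := conj_ofReal _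
  rw [← hr]
  generalize ((1 / √(2 * m) : ℝ) : ℂ) = r at *
  simp only [Sum.elim_inl, Sum.elim_inr, map_zero, zero_mul, Finset.sum_const_zero, add_zero,
    coreH, mul_zero, hc, ite_mul, Finset.sum_ite_eq, Finset.mem_univ, if_true, Finset.mul_sum]
  exact Finset.sum_congr rfl fun i _ => by ring

end Hyperbolic

/-! ### The nilpotent model -/

section Nilpotent

variable {n k l : ℕ} (ε : Fin k ⊕ Fin l ⊕ Unit ≃ Fin n)

lemma shift_add_conj (q : QN k l) : shift q + conj (shift q) = ∑ j, (q.2.2 j : ℂ) * q.2.2 j := by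
  have h : ∑ j, (q.2.2 j : ℂ) * q.2.2 j = ((‖q.2.2‖ ^ 2 : ℝ) : ℂ) := by
    rw [EuclideanSpace.real_norm_sq_eq]
    push_cast
    simp only [sq]
  rw [h, shift]
  simp [map_ofNat]
  ring

lemma shift_re (q : QN k l) : (shift q).re = ‖q.2.2‖ ^ 2 / 2 := by
  simp [shift, ← ofReal_pow]

lemma shift_im (q : QN k l) : (shift q).im = -q.2.1 / 2 := by
  simp [shift, ← ofReal_pow]

lemma one_add_shift_re_pos (q : QN k l) : 0 < (1 + shift q).re := by
  rw [add_re, one_re, shift_re]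
  positivity

lemma coreN_J (q : QN k l) :
    coreN q * Matrix.diagonal (Sum.elim (fun _ => -1) (fun _ => 1)) * (coreN q).conjTranspose =
      Matrix.diagonal (Sum.elim (fun _ => -1) (fun _ => 1)) := by
  have hc := shift_add_conj q
  have hI : ∀ x y : ℂ, I * x * (I * y) = -(x * y) := by
    intro x y; rw [mul_mul_mul_comm, I_mul_I]; ring
  ext ((i | i | i) | i) ((j | j | j) | j) <;>
    simp [coreN, Matrix.mul_apply, Fintype.sum_sum_type, Matrix.diagonal_apply, hI,
      Finset.sum_neg_distrib, ← hc]
  · by_cases h : i = j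
    · subst h
      simp [expc_mul_conj]
    · simp [h, Ne.symm h]
  · split_ifs <;> simp
  all_goals ring

lemma continuous_shift : Continuous (shift (k := k) (l := l)) := by
  unfold shift
  fun_prop

lemma continuous_coreN : Continuous (coreN (k := k) (l := l)) := by
  have ht : ∀ i, Continuous fun q : QN k l => expc (q.1 i) := fun i =>
    (continuous_apply_expc i).comp continuous_fst
  have hs := continuous_shift (k := k) (l := l)
  refine continuous_matrix ?_
  rintro ((i | i | i) | i) ((j | j | j) | j) <;> simp only [coreN] <;> try fun_prop
  split_ifs
  · exact ht i
  · exact continuous_const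

/-- Schur complement with respect to the identity block: the products of the border entries sum to
|b|², which is twice the real part of `shift`, and the remaining two-by-two determinant is 1. -/
lemma det_coreN (q : QN k l) : (coreN q).det = expc (∑ i, q.1 i) := by
  let e : (Fin k ⊕ Fin l ⊕ Unit) ⊕ Unit ≃ Fin k ⊕ Fin l ⊕ Unit ⊕ Unit :=
    (Equiv.sumAssoc (Fin k) (Fin l ⊕ Unit) Unit).trans
      (Equiv.sumCongr (Equiv.refl _) (Equiv.sumAssoc (Fin l) Unit Unit))
  rw [← Matrix.det_submatrix_equiv_self e.symm]
  have h : (coreN q).submatrix e.symm e.symm =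
      Matrix.fromBlocks (Matrix.diagonal fun i => expc (q.1 i)) 0 0
        (Matrix.fromBlocks 1 (Matrix.of fun i _ => -I * q.2.2 i)
          (Matrix.of fun u i => Sum.elim (fun _ => -I * q.2.2 i) (fun _ => I * q.2.2 i) u)
          (Matrix.fromBlocks (Matrix.of fun _ _ => 1 - shift q) (Matrix.of fun _ _ => -shift q)
            (Matrix.of fun _ _ => shift q) (Matrix.of fun _ _ => 1 + shift q))) := by
    ext (i | i | i | i) (j | j | j | j) <;>
      simp [e, coreN, Matrix.diagonal_apply, Matrix.one_apply, Equiv.sumAssoc]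
  rw [h, Matrix.det_fromBlocks_zero₂₁, Matrix.det_diagonal, Matrix.det_fromBlocks_one₁₁,
    det_unit_sum_unit, expc_sum]
  have hI : ∀ x y : ℂ, I * x * (I * y) = -(x * y) := by
    intro x y; rw [mul_mul_mul_comm, I_mul_I]; ring
  simp [Matrix.mul_apply, hI, Finset.sum_neg_distrib, ← shift_add_conj]
  ring

/-- The orbit model of the quasi-nilpotent group. -/
def nilpotentModel : OrbitModel (basePoint ε) (QN k l) where
  core q := (coreN q).submatrix (homogEquiv ε) (homogEquiv ε)
  detLog q := ∑ i, q.1 i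
  core_add p q := by rw [coreN_add, Matrix.submatrix_mul_equiv]
  core_J q := submatrix_J ε (coreN_J q)
  det_core q := by rw [Matrix.det_submatrix_equiv_self, det_coreN]
  continuous_core := continuous_coreN.matrix_submatrix _ _
  core_re q := one_add_shift_re_pos q
  core_row q := by
    rw [← ε.sum_comp, Fintype.sum_sum_type]
    simp [basePoint_apply, homogEquiv, coreN]
  continuous_of {X _ f a} h := by
    have h1 : Continuous fun x => expc (a x) * (1 + shift (f x)) :=
      continuous_entry h (Sum.inr ()) (Sum.inr ())
    have h2 : Continuous fun x => expc (a x) * (-shift (f x)) := by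
      have := continuous_entry h ((homogEquiv ε).symm (Sum.inl (Sum.inr (Sum.inr ()))))
        (Sum.inr ())
      simpa [coreN, homogEquiv] using this
    -- In the sum of the two entries of the last column that contain `shift`, the shift cancels and
    -- only the scalar is left.
    have ha : Continuous fun x => expc (a x) := by
      have : (fun x => expc (a x)) =
          fun x => expc (a x) * (1 + shift (f x)) + expc (a x) * (-shift (f x)) := by
        funext x
        ring
      rw [this]
      exact h1.add h2
    have h3 : Continuous fun x => shift (f x) := by
      have : (fun x => shift (f x)) = fun x => -(expc (a x) * (-shift (f x)) / expc (a x)) := by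
        funext x
        rw [mul_div_cancel_left₀ _ (expc_ne_zero _), neg_neg]
      rw [this]
      exact (h2.div ha fun x => expc_ne_zero _).neg
    have hs : Continuous fun x => (f x).2.1 := by
      have : (fun x => (f x).2.1) = fun x => -2 * (shift (f x)).im := by
        funext x
        rw [shift_im]
        ring
      rw [this]
      exact continuous_const.mul (continuous_im.comp h3)
    have hb : Continuous fun x => (f x).2.2 := by
      refine (PiLp.continuous_toLp 2 _).comp (g := fun x => WithLp.toLp 2 x)
        (f := fun x i => (f x).2.2 i) (continuous_pi fun j => ?_)
      have h4 : Continuous fun x => expc (a x) * (I * (f x).2.2 j) := by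
        have := continuous_entry h (Sum.inr ()) ((homogEquiv ε).symm (Sum.inl (Sum.inr (Sum.inl j))))
        simpa [coreN, homogEquiv] using this
      have : (fun x => (f x).2.2 j) = fun x => (expc (a x) * (I * (f x).2.2 j) / expc (a x)).im := by
        funext x
        rw [mul_div_cancel_left₀ _ (expc_ne_zero _)]
        simp
      rw [this]
      exact continuous_im.comp (h4.div ha fun x => expc_ne_zero _)
    refine Continuous.prodMk (continuous_of_expc fun i => continuous_expc_of_mul ?_ ha)
      (hs.prodMk hb)
    have := continuous_entry h ((homogEquiv ε).symm (Sum.inl (Sum.inl i)))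
        ((homogEquiv ε).symm (Sum.inl (Sum.inl i)))
    simpa [coreN, homogEquiv] using this
  orb_injective q q' h := by
    have key : ∀ b : Fin k ⊕ Fin l ⊕ Unit, _ := fun b => h (ε b)
    simp only [← homogEquiv_symm_inl, submatrix_mulVec_homog, basePoint_apply,
      Fintype.sum_sum_type] at key
    have hne : ∀ q : QN k l, 1 + shift q ≠ 0 := fun q =>
      slitPlane_ne_zero (Or.inl (one_add_shift_re_pos q))
    -- The last coordinate of the orbit point is 1/(1 + shift) - 1, an injective function of the
    -- shift; once the shift is known, the other coordinates determine t and b.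
    have hs : shift q = shift q' := by
      have := key (Sum.inr (Sum.inr ()))
      simp [coreN, homogEquiv] at this
      rw [div_eq_div_iff (hne _) (hne _)] at this
      linear_combination -this
    refine Prod.ext (funext fun i => ?_) (Prod.ext ?_ (PiLp.ext fun j => ?_))
    · have := key (Sum.inl i)
      simp [coreN, homogEquiv, hs, hne] at this
      rcases this with h1 | h1
      · exact expc_injective h1
      · exact absurd h1 i.pos.ne'
    · have := congrArg Complex.im hs
      rw [shift_im, shift_im] at this
      linarith
    · have := key (Sum.inr (Sum.inl j))
      simp [coreN, homogEquiv, hs, hne] at this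
      exact this

lemma nilpotentModel_den (q : QN k l) : (nilpotentModel ε).den q = 1 + shift q := rfl

/-- The bound 1/2 keeps the bases of all kernels in the half-plane of real part at least 1/2. For k
= 0 the sum is empty and division by zero is harmless. -/
lemma norm_sum_expc_le (t : Fin k → UnitAddCircle) : ‖1 / (2 * k) * ∑ i, expc (t i)‖ ≤ 1 / 2 := by
  have h : ‖∑ i, expc (t i)‖ ≤ k := (norm_sum_le _ _).trans (by simp [norm_expc])
  rw [norm_mul]
  rcases Nat.eq_zero_or_pos k with rfl | hk
  · simp
  · have hk' : (0 : ℝ) < k := by exact_mod_cast hk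
    simp only [one_div, norm_inv, norm_mul, norm_natCast, norm_ofNat]
    calc (2 * (k : ℝ))⁻¹ * ‖∑ i, expc (t i)‖ ≤ (2 * (k : ℝ))⁻¹ * k := by gcongr
      _ = 2⁻¹ := by field_simp

lemma one_le_one_add_shift_re (q : QN k l) : 1 ≤ (1 + shift q).re := by
  rw [add_re, one_re, shift_re]
  have := sq_nonneg ‖q.2.2‖
  linarith

/-- The factor 2^λ is absorbed into the base, which is legitimate on the right half-plane and gives
the three kernels a common shape. -/
lemma nilpotentKernel_eq (lam : ℝ) (q : QN k l) : nilpotentKernel k l lam q =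
    (1 + shift q - 1 / (2 * k) * ∑ i, expc (q.1 i)) ^ (-lam : ℂ) := by
  have h : -I * q.2.1 + ((‖q.2.2‖ ^ 2 : ℝ) : ℂ) + 2 - 1 / k * ∑ i, expc (q.1 i) =
      ((2 : ℝ) : ℂ) * (1 + shift q - 1 / (2 * k) * ∑ i, expc (q.1 i)) := by
    rw [shift]
    push_cast
    ring
  rw [nilpotentKernel, h, mul_cpow_of_re_pos (by simp), ← mul_assoc, ofReal_cpow (by norm_num),
    ofReal_ofNat, ← cpow_add _ _ two_ne_zero]
  · simp
  · have h1 := one_le_one_add_shift_re q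
    have h2 := (re_le_norm _).trans (norm_sum_expc_le q.1)
    rw [sub_re]
    linarith

lemma nilpotentModel_kernel (lam : ℝ) (q : QN k l) : nilpotentKernel k l lam q =
    ((nilpotentModel ε).den q - ∑ i, conj ((basePoint ε : EuclideanSpace ℂ (Fin n)) i) *
        ((nilpotentModel ε).core q).mulVec (homog (basePoint ε : EuclideanSpace ℂ (Fin n)))
          (Sum.inl i)) ^ (-lam : ℂ) := by
  rw [nilpotentKernel_eq, nilpotentModel_den]
  congr 2
  simp only [nilpotentModel, sum_conj_mulVec, basePoint_apply, Fintype.sum_sum_type]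
  have hr := basePoint_coord_sq k
  have hc : conj ((1 / √(2 * k) : ℝ) : ℂ) = ((1 / √(2 * k) : ℝ) : ℂ) := conj_ofReal _
  rw [← hr]
  generalize ((1 / √(2 * k) : ℝ) : ℂ) = r at *
  simp only [Sum.elim_inl, Sum.elim_inr, map_zero, zero_mul, Finset.sum_const_zero, add_zero,
    coreN, mul_zero, hc, ite_mul, Finset.sum_ite_eq, Finset.mem_univ, if_true, Finset.mul_sum]
  exact Finset.sum_congr rfl fun i _ => by ring

end Nilpotent

end BallRestriction
end

noncomputable section

namespace BallRestriction

/-! ### Functions of the Bergman space vanishing on an orbit -/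

section Curves

variable {n : ℕ}

lemma fderiv_eq_zero_of_curve {f : EuclideanSpace ℂ (Fin n) → ℂ} {z v : EuclideanSpace ℂ (Fin n)}
    (hf : DifferentiableAt ℂ f z) {γ : ℝ → EuclideanSpace ℂ (Fin n)} (hγ : HasDerivAt γ v 0)
    (h0 : γ 0 = z) (h : ∀ τ, f (γ τ) = 0) : fderiv ℂ f z v = 0 := by
  subst h0
  have h1 := (hf.hasFDerivAt.restrictScalars ℝ).comp_hasDerivAt 0 hγ
  have h2 : f ∘ γ = fun _ => 0 := funext h
  rw [h2] at h1
  exact h1.unique (hasDerivAt_const 0 0)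

lemma fderiv_eq_zero_of_basis {β : Type} (ε : β ≃ Fin n) {f : EuclideanSpace ℂ (Fin n) → ℂ}
    {z : EuclideanSpace ℂ (Fin n)}
    (h : ∀ b, fderiv ℂ f z (EuclideanSpace.single (ε b) 1) = 0) (v : EuclideanSpace ℂ (Fin n)) :
    fderiv ℂ f z v = 0 := by
  have h1 : (fderiv ℂ f z : EuclideanSpace ℂ (Fin n) →ₗ[ℂ] ℂ) = 0 := by
    refine (EuclideanSpace.basisFun (Fin n) ℂ).toBasis.ext fun i => ?_
    obtain ⟨b, rfl⟩ := ε.surjective i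
    simpa using h b
  exact LinearMap.congr_fun h1 v

lemma hasDerivAt_exp_two_pi : HasDerivAt (fun τ : ℝ => exp (2 * Real.pi * I * τ))
    (2 * Real.pi * I) 0 := by
  have h := ((hasDerivAt_id (0 : ℝ)).ofReal_comp.const_mul (2 * Real.pi * I)).cexp
  simpa using h

/-- Rotation of one coordinate. -/
lemma fderiv_single_eq_zero {f : EuclideanSpace ℂ (Fin n) → ℂ} {z : EuclideanSpace ℂ (Fin n)}
    (hf : DifferentiableAt ℂ f z) (i : Fin n) (hi : z i ≠ 0)
    (h : ∀ τ : ℝ, f (z + (exp (2 * Real.pi * I * τ) - 1) • EuclideanSpace.single i (z i)) = 0) :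
    fderiv ℂ f z (EuclideanSpace.single i 1) = 0 := by
  have h1 := fderiv_eq_zero_of_curve hf (((hasDerivAt_exp_two_pi.sub_const 1).smul_const
    (EuclideanSpace.single i (z i))).const_add z) (by simp) h
  have h2 : (2 * Real.pi * I) • EuclideanSpace.single i (z i) =
      (2 * Real.pi * I * z i) • EuclideanSpace.single i (1 : ℂ) := by
    ext j
    by_cases hj : j = i <;> simp [hj]
  rw [h2, map_smul, smul_eq_mul] at h1
  refine (mul_eq_zero.mp h1).resolve_left ?_
  simp [Real.pi_ne_zero, hi]

end Curves

/-- The property fed to the criterion is vanishing on the entire orbit. It is inherited by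
directional derivatives because, as `hm` demands, the orbit directions at each of its points span ℂⁿ
over ℂ. -/
lemma OrbitModel.eq_zero_of_orb {n : ℕ} {z₀ : Ball n} {Q : Type} [AddCommGroup Q]
    [TopologicalSpace Q] (m : OrbitModel z₀ Q) {lam : ℝ} [Fact (1 ≤ n)] [Fact ((n : ℝ) < lam)]
    (hm : ∀ f : EuclideanSpace ℂ (Fin n) → ℂ, IsKernelIntegral lam f →
      (∀ q, f (m.orb q) = 0) → ∀ q, ∀ v, fderiv ℂ f (m.orb q) v = 0)
    (f : EuclideanSpace ℂ (Fin n) → ℂ) (hf : IsKernelIntegral lam f) (h : ∀ q, f (m.orb q) = 0)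
    (z : Ball n) : f z = 0 :=
  IsKernelIntegral.eq_zero (fun f => ∀ q, f (m.orb q) = 0) (m.orb 0) (fun _ _ h => h 0)
    (fun f hf h v q => hm f hf h q v) hf h z

lemma expc_add_single {ι : Type*} [DecidableEq ι] (t : ι → UnitAddCircle) (i : ι) (τ : ℝ) (j : ι) :
    expc ((t + (Pi.single i (τ : UnitAddCircle) : ι → UnitAddCircle)) j) =
      expc (t j) + (exp (2 * Real.pi * I * τ) - 1) * if j = i then expc (t j) else 0 := by
  by_cases h : j = i
  · subst h
    rw [Pi.add_apply, Pi.single_eq_same, expc_add, expc_coe, if_pos rfl]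
    ring
  · rw [Pi.add_apply, Pi.single_eq_of_ne h, add_zero, if_neg h, mul_zero, add_zero]

section Elliptic

variable {n : ℕ}

lemma ellipticModel_orb (t : Fin n → UnitAddCircle) (i : Fin n) :
    ((ellipticModel n).orb t : EuclideanSpace ℂ (Fin n)) i =
      expc (t i) * ((1 / √(2 * n) : ℝ) : ℂ) := by
  rw [OrbitModel.orb_apply]
  simp only [ellipticModel, OrbitModel.den, coreE, Matrix.mulVec_diagonal, Matrix.diagonal_apply_eq,
    Sum.elim_inl, Sum.elim_inr, div_one, homog, ellipticPoint_apply]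

lemma ellipticModel_eq_zero {lam : ℝ} [Fact (1 ≤ n)] [Fact ((n : ℝ) < lam)]
    (f : EuclideanSpace ℂ (Fin n) → ℂ) (hf : IsKernelIntegral lam f)
    (h : ∀ q, f ((ellipticModel n).orb q) = 0) (z : Ball n) : f z = 0 := by
  refine (ellipticModel n).eq_zero_of_orb (fun f hf h t v => ?_) f hf h z
  refine fderiv_eq_zero_of_basis (Equiv.refl _) (fun i => ?_) v
  refine fderiv_single_eq_zero (hf.differentiableAt ((ellipticModel n).orb t).2) i ?_ fun τ => ?_
  · rw [ellipticModel_orb]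
    exact mul_ne_zero (expc_ne_zero _) (basePoint_coord_ne_zero i)
  · rw [← h (t + Pi.single i (τ : UnitAddCircle))]
    congr 1
    ext j
    simp only [PiLp.add_apply, PiLp.smul_apply, ellipticModel_orb, expc_add_single, smul_eq_mul,
      PiLp.single_apply]
    split_ifs with hj
    · subst hj; ring
    · ring

end Elliptic

section Hyperbolic

variable {n m : ℕ} (ε : Fin m ⊕ Unit ≃ Fin n)

lemma hyperbolicModel_orb_inl (q : QH m) (i : Fin m) :
    ((hyperbolicModel ε).orb q : EuclideanSpace ℂ (Fin n)) (ε (Sum.inl i)) =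
      expc (q.1 i) * ((1 / √(2 * m) : ℝ) : ℂ) / Real.cosh q.2 := by
  rw [OrbitModel.orb_apply, hyperbolicModel_den]
  simp only [hyperbolicModel, ← homogEquiv_symm_inl, submatrix_mulVec_homog, basePoint_apply,
      Fintype.sum_sum_type]
  simp [coreH]

lemma hyperbolicModel_orb_inr (q : QH m) (u : Unit) :
    ((hyperbolicModel ε).orb q : EuclideanSpace ℂ (Fin n)) (ε (Sum.inr u)) =
      Real.sinh q.2 / Real.cosh q.2 := by
  rw [OrbitModel.orb_apply, hyperbolicModel_den]
  simp only [hyperbolicModel, ← homogEquiv_symm_inl, submatrix_mulVec_homog, basePoint_apply,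
      Fintype.sum_sum_type]
  simp [coreH]

/-- Rotations kill the derivative in the torus directions. The velocity in s is a torus vector plus
1/cosh² s times the last basis vector, so that direction is killed too. -/
lemma hyperbolicModel_eq_zero {lam : ℝ} [Fact (1 ≤ n)] [Fact ((n : ℝ) < lam)]
    (f : EuclideanSpace ℂ (Fin n) → ℂ) (hf : IsKernelIntegral lam f)
    (h : ∀ q, f ((hyperbolicModel ε).orb q) = 0) (z : Ball n) : f z = 0 := by
  refine (hyperbolicModel ε).eq_zero_of_orb (fun f hf h q v => ?_) f hf h z
  have hch : ∀ x : ℝ, (Real.cosh x : ℂ) ≠ 0 := fun x => by exact_mod_cast (Real.cosh_pos x).ne'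
  have hd := hf.differentiableAt ((hyperbolicModel ε).orb q).2
  have h1 : ∀ i, fderiv ℂ f ((hyperbolicModel ε).orb q)
      (EuclideanSpace.single (ε (Sum.inl i)) 1) = 0 := fun i => by
    refine fderiv_single_eq_zero hd _ ?_ fun τ => ?_
    · rw [hyperbolicModel_orb_inl]
      exact div_ne_zero (mul_ne_zero (expc_ne_zero _) (basePoint_coord_ne_zero i)) (hch _)
    · rw [← h (q.1 + Pi.single i (τ : UnitAddCircle), q.2)]
      congr 1
      ext j
      obtain ⟨b, rfl⟩ := ε.surjective j
      rcases b with b | u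
      · simp only [PiLp.add_apply, PiLp.smul_apply, hyperbolicModel_orb_inl, expc_add_single,
          smul_eq_mul, PiLp.single_apply, ε.injective.eq_iff, Sum.inl.injEq]
        split_ifs with hj
        · subst hj; ring
        · ring
      · simp [hyperbolicModel_orb_inr]
  set U : EuclideanSpace ℂ (Fin n) := ∑ i, (expc (q.1 i) * ((1 / √(2 * m) : ℝ) : ℂ)) •
    EuclideanSpace.single (ε (Sum.inl i)) (1 : ℂ) with hU
  have hLU : fderiv ℂ f ((hyperbolicModel ε).orb q) U = 0 := by
    rw [hU, map_sum]
    refine Finset.sum_eq_zero fun i _ => ?_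
    rw [map_smul, h1, smul_zero]
  have horb : ∀ s, ((hyperbolicModel ε).orb (q.1, s) : EuclideanSpace ℂ (Fin n)) =
      (1 / Real.cosh s : ℝ) • U + (Real.sinh s / Real.cosh s : ℝ) •
        EuclideanSpace.single (ε (Sum.inr ())) (1 : ℂ) := fun s => by
    ext j
    obtain ⟨b, rfl⟩ := ε.surjective j
    rcases b with b | u
    · simp [hyperbolicModel_orb_inl, hU, Pi.single_apply, ε.injective.eq_iff]
      field_simp
    · simp [hyperbolicModel_orb_inr, hU, ε.injective.eq_iff]
  refine fderiv_eq_zero_of_basis ε (fun b => ?_) v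
  rcases b with b | u
  · exact h1 b
  · have hcpos := Real.cosh_pos q.2
    have hτ : HasDerivAt (fun τ : ℝ => q.2 + τ) 1 0 := (hasDerivAt_id 0).const_add _
    have e1 := (hτ.cosh).fun_inv (by simpa using hcpos.ne')
    have e2 := (hτ.sinh).fun_div hτ.cosh (by simpa using hcpos.ne')
    have hγ := ((e1.smul_const U).add (e2.smul_const
      (EuclideanSpace.single (ε (Sum.inr ())) (1 : ℂ))))
    have h3 := fderiv_eq_zero_of_curve hd hγ (by
      simp only [Pi.add_apply, add_zero]
      rw [← one_div, ← horb]) (fun τ => by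
        rw [← h (q.1, q.2 + τ), horb]
        simp)
    rw [map_add, ← coe_smul, map_smul, ← coe_smul, map_smul, hLU, smul_zero, zero_add, smul_eq_mul] at h3
    refine (mul_eq_zero.mp h3).resolve_left ?_
    have hc := Real.cosh_sq_sub_sinh_sq q.2
    have : (Real.cosh (q.2 + 0) * 1 * Real.cosh (q.2 + 0) - Real.sinh (q.2 + 0) *
      (Real.sinh (q.2 + 0) * 1)) / Real.cosh (q.2 + 0) ^ 2 = 1 / Real.cosh q.2 ^ 2 := by
      rw [add_zero]
      congr 1
      linarith
    rw [this]
    exact_mod_cast (by positivity : (0 : ℝ) < 1 / Real.cosh q.2 ^ 2).ne'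

end Hyperbolic

section Nilpotent

variable {n k l : ℕ} (ε : Fin k ⊕ Fin l ⊕ Unit ≃ Fin n)

lemma nilpotentModel_orb_torus (q : QN k l) (i : Fin k) :
    ((nilpotentModel ε).orb q : EuclideanSpace ℂ (Fin n)) (ε (Sum.inl i)) =
      expc (q.1 i) * ((1 / √(2 * k) : ℝ) : ℂ) / (1 + shift q) := by
  rw [OrbitModel.orb_apply, nilpotentModel_den]
  simp only [nilpotentModel, ← homogEquiv_symm_inl, submatrix_mulVec_homog, basePoint_apply,
      Fintype.sum_sum_type]
  simp [coreN]

lemma nilpotentModel_orb_real (q : QN k l) (j : Fin l) :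
    ((nilpotentModel ε).orb q : EuclideanSpace ℂ (Fin n)) (ε (Sum.inr (Sum.inl j))) =
      -I * q.2.2 j / (1 + shift q) := by
  rw [OrbitModel.orb_apply, nilpotentModel_den]
  simp only [nilpotentModel, ← homogEquiv_symm_inl, submatrix_mulVec_homog, basePoint_apply,
      Fintype.sum_sum_type]
  simp [coreN]

lemma one_add_shift_ne_zero (q : QN k l) : 1 + shift q ≠ 0 :=
  slitPlane_ne_zero (Or.inl (one_add_shift_re_pos q))

lemma nilpotentModel_orb_last (q : QN k l) (u : Unit) :
    ((nilpotentModel ε).orb q : EuclideanSpace ℂ (Fin n)) (ε (Sum.inr (Sum.inr u))) =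
      1 / (1 + shift q) - 1 := by
  rw [OrbitModel.orb_apply, nilpotentModel_den]
  simp only [nilpotentModel, ← homogEquiv_symm_inl, submatrix_mulVec_homog, basePoint_apply,
      Fintype.sum_sum_type]
  have := one_add_shift_ne_zero q
  simp [coreN]
  field_simp
  ring

/-- The orbit point is (T + B + e)/(1 + shift) - e, with T and B the torus and real parts and e the
last basis vector. Moving s changes only the scalar and kills T + B + e; moving b then kills the
directions of B, rotations kill T, and so e is killed as well. -/
lemma nilpotentModel_eq_zero {lam : ℝ} [Fact (1 ≤ n)] [Fact ((n : ℝ) < lam)]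
    (f : EuclideanSpace ℂ (Fin n) → ℂ) (hf : IsKernelIntegral lam f)
    (h : ∀ q, f ((nilpotentModel ε).orb q) = 0) (z : Ball n) : f z = 0 := by
  refine (nilpotentModel ε).eq_zero_of_orb (fun f hf h q v => ?_) f hf h z
  have hd := hf.differentiableAt ((nilpotentModel ε).orb q).2
  have h1 : ∀ i, fderiv ℂ f ((nilpotentModel ε).orb q)
      (EuclideanSpace.single (ε (Sum.inl i)) 1) = 0 := fun i => by
    refine fderiv_single_eq_zero hd _ ?_ fun τ => ?_
    · rw [nilpotentModel_orb_torus]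
      exact div_ne_zero (mul_ne_zero (expc_ne_zero _) (basePoint_coord_ne_zero i))
        (one_add_shift_ne_zero q)
    · rw [← h (q.1 + Pi.single i (τ : UnitAddCircle), q.2)]
      have hsh : shift ((q.1 + Pi.single i (τ : UnitAddCircle), q.2) : QN k l) = shift q := rfl
      congr 1
      ext j
      obtain ⟨b, rfl⟩ := ε.surjective j
      rcases b with b | b | u
      · simp only [PiLp.add_apply, PiLp.smul_apply, nilpotentModel_orb_torus, expc_add_single,
          smul_eq_mul, PiLp.single_apply, ε.injective.eq_iff, Sum.inl.injEq, hsh]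
        split_ifs with hj
        · subst hj; ring
        · ring
      · simp [nilpotentModel_orb_real, hsh]
      · simp [nilpotentModel_orb_last, hsh]
  set T : EuclideanSpace ℂ (Fin n) := ∑ i, (expc (q.1 i) * ((1 / √(2 * k) : ℝ) : ℂ)) •
    EuclideanSpace.single (ε (Sum.inl i)) (1 : ℂ) with hT
  set e := EuclideanSpace.single (ε (Sum.inr (Sum.inr ()))) (1 : ℂ) with he
  let B : EuclideanSpace ℝ (Fin l) → EuclideanSpace ℂ (Fin n) := fun b => ∑ j, (-I * b j) •
    EuclideanSpace.single (ε (Sum.inr (Sum.inl j))) (1 : ℂ)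
  have hLT : fderiv ℂ f ((nilpotentModel ε).orb q) T = 0 := by
    rw [hT, map_sum]
    refine Finset.sum_eq_zero fun i _ => ?_
    rw [map_smul, h1, smul_zero]
  have horb : ∀ p : ℝ × EuclideanSpace ℝ (Fin l),
      ((nilpotentModel ε).orb (q.1, p) : EuclideanSpace ℂ (Fin n)) =
      (1 + shift ((q.1, p) : QN k l))⁻¹ • (T + B p.2 + e) - e := fun p => by
    ext j
    obtain ⟨b, rfl⟩ := ε.surjective j
    rcases b with b | b | u
    · simp [nilpotentModel_orb_torus, hT, he, B, Pi.single_apply, ε.injective.eq_iff]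
      field_simp
    · simp [nilpotentModel_orb_real, hT, he, B, Pi.single_apply, ε.injective.eq_iff]
      field_simp
    · simp [nilpotentModel_orb_last, hT, he, B, ε.injective.eq_iff]
  have hne := one_add_shift_ne_zero q
  have hLU : fderiv ℂ f ((nilpotentModel ε).orb q) (T + B q.2.2 + e) = 0 := by
    have hder : HasDerivAt (fun τ : ℝ => 1 + shift ((q.1, q.2.1 + τ, q.2.2) : QN k l))
        (-I / 2) 0 := by
      have h0 : (fun τ : ℝ => 1 + shift ((q.1, q.2.1 + τ, q.2.2) : QN k l)) =
          fun τ : ℝ => (1 + shift q) + (τ : ℂ) * (-I / 2) := by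
        funext τ
        simp only [shift]
        push_cast
        ring
      rw [h0]
      simpa using ((hasDerivAt_id (0 : ℝ)).ofReal_comp.mul_const (-I / 2)).const_add (1 + shift q)
    have hγ := ((hder.fun_inv (by simpa using hne)).smul_const (T + B q.2.2 + e)).sub_const e
    have h3 := fderiv_eq_zero_of_curve hd hγ (by rw [← horb]; simp) (fun τ => by
      rw [← horb (q.2.1 + τ, q.2.2)]; exact h _)
    rw [map_smul, smul_eq_mul] at h3
    refine (mul_eq_zero.mp h3).resolve_left ?_
    have h4 : 1 + shift ((q.1, q.2.1 + 0, q.2.2) : QN k l) ≠ 0 := one_add_shift_ne_zero _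
    exact div_ne_zero (by simp) (pow_ne_zero 2 h4)
  have h2 : ∀ j, fderiv ℂ f ((nilpotentModel ε).orb q)
      (EuclideanSpace.single (ε (Sum.inr (Sum.inl j))) 1) = 0 := fun j => by
    set w : EuclideanSpace ℂ (Fin n) := EuclideanSpace.single (ε (Sum.inr (Sum.inl j))) 1 with hw
    let c : ℝ → EuclideanSpace ℝ (Fin l) := fun τ => q.2.2 + τ • EuclideanSpace.single j 1
    have hB : ∀ τ, B (c τ) = B q.2.2 + (τ : ℂ) • (-I • w) := fun τ => by
      ext i
      obtain ⟨b, rfl⟩ := ε.surjective i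
      rcases b with b | b | u
      · simp [B, c, hw, ε.injective.eq_iff]
      · simp [B, c, hw, Pi.single_apply, ε.injective.eq_iff]
        split_ifs
        · ring
        · simp
      · simp [B, c, hw, ε.injective.eq_iff]
    have hder : HasDerivAt (fun τ : ℝ => 1 + shift ((q.1, q.2.1, c τ) : QN k l))
        (q.2.2 j) 0 := by
      have h0 : (fun τ : ℝ => 1 + shift ((q.1, q.2.1, c τ) : QN k l)) =
          fun τ : ℝ => (1 + shift q) + ((τ : ℂ) * (q.2.2 j) + (τ : ℂ) ^ 2 / 2) := by
        funext τ
        have h5 : ‖c τ‖ ^ 2 = ‖q.2.2‖ ^ 2 + 2 * (τ * q.2.2 j) + τ ^ 2 := by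
          rw [norm_add_sq_real, real_inner_smul_right, EuclideanSpace.inner_single_right, norm_smul]
          simp
        simp only [shift, h5]
        push_cast
        ring
      rw [h0]
      have h6 := (hasDerivAt_id (0 : ℝ)).ofReal_comp
      simpa using ((h6.mul_const (q.2.2 j : ℂ)).add ((h6.pow 2).div_const 2)).const_add (1 + shift q)
    have hγ := ((hder.fun_inv (by simpa [c] using hne)).smul
      (((hasDerivAt_id (0 : ℝ)).ofReal_comp.smul_const (-I • w)).const_add
        (T + B q.2.2 + e))).sub_const e
    have h3 := fderiv_eq_zero_of_curve hd hγ (by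
        have := horb q.2
        simp [c, this]) (fun τ => by
      have h7 := horb (q.2.1, c τ)
      rw [hB] at h7
      have h8 := h (q.1, q.2.1, c τ)
      rw [h7] at h8
      rw [← h8]
      simp only [Pi.smul_apply', id]
      congr 3
      abel)
    have h9 : (1 + shift ((q.1, q.2.1, c 0) : QN k l)) ≠ 0 := one_add_shift_ne_zero _
    simp only [id, ofReal_zero, ofReal_one, zero_smul, add_zero, one_smul] at h3
    rw [map_add, map_smul, map_smul, map_smul, hLU, smul_zero, add_zero, smul_eq_mul,
      smul_eq_mul] at h3
    exact ((mul_eq_zero.mp ((mul_eq_zero.mp h3).resolve_left (inv_ne_zero h9))).resolve_left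
      (by simp))
  refine fderiv_eq_zero_of_basis ε (fun b => ?_) v
  rcases b with b | b | u
  · exact h1 b
  · exact h2 b
  · have hB : fderiv ℂ f ((nilpotentModel ε).orb q) (B q.2.2) = 0 := by
      simp only [B, map_sum]
      refine Finset.sum_eq_zero fun i _ => ?_
      rw [map_smul, h2, smul_zero]
    rw [map_add, map_add, hLT, hB, zero_add, zero_add] at hLU
    exact hLU

end Nilpotent

end BallRestriction
end

noncomputable section

namespace BallRestriction

/-! ## Integrability -/

section Measures

lemma isProbabilityMeasure_torus (k : ℕ) :
    IsProbabilityMeasure (volume : Measure (Fin k → UnitAddCircle)) := by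
  refine ⟨?_⟩
  rw [volume_pi, Measure.pi_univ]
  simp

attribute [instance] isProbabilityMeasure_torus

instance isAddHaarMeasure_QH (m : ℕ) : Measure.IsAddHaarMeasure (volume : Measure (QH m)) :=
  Measure.prod.instIsAddHaarMeasure _ _

instance isAddHaarMeasure_real_prod (l : ℕ) :
    Measure.IsAddHaarMeasure (volume : Measure (ℝ × EuclideanSpace ℝ (Fin l))) :=
  Measure.prod.instIsAddHaarMeasure _ _

instance isAddHaarMeasure_QN (k l : ℕ) : Measure.IsAddHaarMeasure (volume : Measure (QN k l)) :=
  Measure.prod.instIsAddHaarMeasure _ _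

lemma lintegral_torus_prod {k : ℕ} {Y : Type*} [MeasureSpace Y] [SFinite (volume : Measure Y)]
    {g : Y → ℝ≥0∞} (hg : Measurable g) :
    ∫⁻ q : (Fin k → UnitAddCircle) × Y, g q.2 = ∫⁻ y, g y := by
  rw [Measure.volume_eq_prod, ← lintegral_map hg measurable_snd]
  congr 1
  exact Measure.snd_prod

lemma integrable_torus_prod {k : ℕ} {Y : Type*} [MeasureSpace Y] [TopologicalSpace Y]
    [SecondCountableTopology Y] [BorelSpace Y] [SFinite (volume : Measure Y)]
    {f : (Fin k → UnitAddCircle) × Y → ℂ} {g : Y → ℝ} (hf : Continuous f) (hg : Integrable g)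
    (h : ∀ q, ‖f q‖ ≤ g q.2) : Integrable f := by
  refine Integrable.mono' (g := fun q => g q.2) ?_ hf.aestronglyMeasurable (ae_of_all _ h)
  rw [Measure.volume_eq_prod]
  exact hg.comp_snd _

lemma norm_cpow_neg {z : ℂ} (ν : ℝ) : ‖z ^ (-ν : ℂ)‖ = ‖z‖ ^ (-ν) := by
  rw [← ofReal_neg, norm_cpow_real]

/-- Since |w| ≤ |d|/2, the perturbation at most halves the base. So the torus variables do not
affect integrability, which is decided by the automorphy factor alone. -/
lemma norm_cpow_sub_le {d w : ℂ} {ν : ℝ} (hν : 0 ≤ ν) (hd : 1 ≤ d.re) (hw : ‖w‖ ≤ 1 / 2) :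
    ‖(d - w) ^ (-ν : ℂ)‖ ≤ 2 ^ ν * ‖d‖ ^ (-ν) := by
  have h1 : 1 ≤ ‖d‖ := hd.trans (re_le_norm d)
  have h2 : ‖d‖ / 2 ≤ ‖d - w‖ := by
    have := norm_sub_norm_le d w
    linarith
  rw [norm_cpow_neg]
  calc ‖d - w‖ ^ (-ν) ≤ (‖d‖ / 2) ^ (-ν) :=
        Real.rpow_le_rpow_of_nonpos (by positivity) h2 (by linarith)
    _ = 2 ^ ν * ‖d‖ ^ (-ν) := by
        rw [Real.div_rpow (by positivity) (by positivity), Real.rpow_neg (by norm_num : (0:ℝ) ≤ 2)]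
        field_simp

lemma sub_re_pos {d w : ℂ} (hd : 1 ≤ d.re) (hw : ‖w‖ ≤ 1 / 2) : 0 < (d - w).re := by
  have := (re_le_norm w).trans hw
  rw [sub_re]
  linarith

lemma continuous_cpow_sub {X : Type*} [TopologicalSpace X] {d w : X → ℂ} (ν : ℝ)
    (hdc : Continuous d) (hwc : Continuous w) (hd : ∀ x, 1 ≤ (d x).re) (hw : ∀ x, ‖w x‖ ≤ 1 / 2) :
    Continuous fun x => (d x - w x) ^ (-ν : ℂ) :=
  (hdc.sub hwc).cpow continuous_const fun x => Or.inl (sub_re_pos (hd x) (hw x))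

lemma continuous_sum_expc (k : ℕ) :
    Continuous fun t : Fin k → UnitAddCircle => (1 / (2 * k) : ℂ) * ∑ i, expc (t i) :=
  continuous_const.mul (continuous_finsetSum _ fun i _ => continuous_apply_expc i)

lemma enorm_cpow_sq (z : ℂ) (ν : ℝ) :
    ‖z ^ (-ν : ℂ)‖ₑ ^ 2 = ENNReal.ofReal (‖z‖ ^ (-(2 * ν))) := by
  rw [← ofReal_norm, norm_cpow_neg, ← ENNReal.ofReal_pow (by positivity), ← Real.rpow_natCast,
    ← Real.rpow_mul (by positivity)]
  congr 2
  push_cast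
  ring

lemma lintegral_lt_top_iff_integrable {Y : Type*} [MeasurableSpace Y] {μ : Measure Y} {g : Y → ℝ}
    (hm : AEStronglyMeasurable g μ) (h0 : ∀ y, 0 ≤ g y) :
    ∫⁻ y, ENNReal.ofReal (g y) ∂μ < ∞ ↔ Integrable g μ := by
  rw [Integrable, and_iff_right hm, hasFiniteIntegral_iff_ofReal (ae_of_all _ h0)]

end Measures

section Elliptic

variable (n : ℕ)

lemma integrable_ellipticKernel (ν : ℝ) : Integrable (ellipticKernel n ν) := by
  have h : Continuous (ellipticKernel n ν) :=
    continuous_cpow_sub ν continuous_const (continuous_sum_expc n) (by simp)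
      fun t => norm_sum_expc_le t
  exact h.integrable_of_hasCompactSupport (HasCompactSupport.of_compactSpace _)

theorem elliptic_explicitRestriction {lam : ℝ} [Fact (1 ≤ n)] [Fact ((n : ℝ) < lam)] :
    ExplicitRestriction lam (ellipticGroup n) (ellipticPoint n) (ellipticCover n) matE
        (fun _ => 1) (ellipticKernel n) Set.univ Set.univ := by
  refine (ellipticModel n).explicitRestriction (fun g => Iff.rfl) (fun p => Iff.rfl)
    (show Continuous fun q : Fin n → UnitAddCircle => ∑ i, q i by fun_prop) (fun q a => rfl) (fun q => ?_)
    (fun ν => ?_) (fun ν _ => integrable_ellipticKernel n ν) trivial trivial (fun q => ?_)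
    ellipticModel_eq_zero
  · simp [OrbitModel.den, ellipticModel, coreE]
  · simp
  · have hc : conj ((1 / √(2 * n) : ℝ) : ℂ) = ((1 / √(2 * n) : ℝ) : ℂ) := conj_ofReal _
    have hr := basePoint_coord_sq n
    rw [ellipticKernel]
    congr 1
    simp only [OrbitModel.den, ellipticModel, coreE, Matrix.mulVec_diagonal,
      Matrix.diagonal_apply_eq, Sum.elim_inl, Sum.elim_inr, homog, ellipticPoint_apply, hc]
    rw [← hr, Finset.mul_sum]
    congr 1
    exact Finset.sum_congr rfl fun i _ => by ring

end Elliptic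

section Hyperbolic

variable {n m : ℕ} (ε : Fin m ⊕ Unit ≃ Fin n)

lemma integrable_cosh_rpow_iff (p : ℝ) :
    Integrable (fun s : ℝ => Real.cosh s ^ (-p)) ↔ 0 < p := by
  have hc : Continuous fun s : ℝ => Real.cosh s ^ (-p) :=
    Real.continuous_cosh.rpow_const fun s => Or.inl (Real.cosh_pos s).ne'
  constructor
  · intro h
    by_contra! hp
    have h1 : Integrable (fun _ : ℝ => (1 : ℝ)) := by
      refine h.mono' aestronglyMeasurable_const (ae_of_all _ fun s => ?_)
      rw [norm_one]
      exact Real.one_le_rpow (Real.one_le_cosh s) (by linarith)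
    rw [integrable_const_iff] at h1
    simp [isFiniteMeasure_iff] at h1
  · intro hp
    have h1 : Integrable (fun s : ℝ => 2 ^ p * Real.exp (-p * |s|)) := by
      refine Integrable.const_mul ?_ _
      have h2 : IntegrableOn (fun s : ℝ => Real.exp (-p * |s|)) (Set.Ioi 0) := by
        refine (integrableOn_exp_mul_Ioi (neg_lt_zero.mpr hp) 0).congr_fun (fun s hs => ?_)
          measurableSet_Ioi
        simp only
        rw [abs_of_pos hs]
      have h3 : IntegrableOn (fun s : ℝ => Real.exp (-p * |s|)) (Set.Iic 0) := by
        refine (integrableOn_exp_mul_Iic hp 0).congr_fun (fun s hs => ?_) measurableSet_Iic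
        simp only
        rw [abs_of_nonpos hs]
        congr 1
        ring
      rw [← integrableOn_univ, ← Set.Iic_union_Ioi (a := (0 : ℝ))]
      exact h3.union h2
    refine h1.mono' hc.aestronglyMeasurable (ae_of_all _ fun s => ?_)
    rw [Real.norm_of_nonneg (by have := Real.cosh_pos s; positivity)]
    have h3 : Real.exp |s| / 2 ≤ Real.cosh s := by
      rw [← Real.cosh_abs, Real.cosh_eq]
      have := Real.exp_pos (-|s|)
      linarith
    calc Real.cosh s ^ (-p) ≤ (Real.exp |s| / 2) ^ (-p) :=
          Real.rpow_le_rpow_of_nonpos (by positivity) h3 (by linarith)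
      _ = 2 ^ p * Real.exp (-p * |s|) := by
          rw [Real.div_rpow (by positivity) (by positivity), ← Real.exp_mul,
            Real.rpow_neg (by norm_num : (0:ℝ) ≤ 2), div_inv_eq_mul, mul_comm, mul_comm |s|]

lemma norm_cosh (s : ℝ) : ‖(Real.cosh s : ℂ)‖ = Real.cosh s := by
  rw [norm_real, Real.norm_of_nonneg (Real.cosh_pos s).le]

lemma continuous_hyperbolicKernel (ν : ℝ) : Continuous (hyperbolicKernel m ν) :=
  continuous_cpow_sub ν (by fun_prop) ((continuous_sum_expc m).comp continuous_fst)
    (fun q => by rw [ofReal_re]; exact Real.one_le_cosh _) fun q => norm_sum_expc_le q.1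

lemma integrable_hyperbolicKernel {ν : ℝ} (hν : 0 < ν) : Integrable (hyperbolicKernel m ν) := by
  refine integrable_torus_prod (continuous_hyperbolicKernel ν)
    (((integrable_cosh_rpow_iff ν).mpr hν).const_mul (2 ^ ν)) fun q => ?_
  have := norm_cpow_sub_le hν.le (d := Real.cosh q.2)
    (by rw [ofReal_re]; exact Real.one_le_cosh _) (norm_sum_expc_le q.1)
  rwa [norm_cosh] at this

theorem hyperbolic_explicitRestriction {lam : ℝ} [Fact (1 ≤ n)] [Fact ((n : ℝ) < lam)] :
    ExplicitRestriction lam (hyperbolicGroup ε) (basePoint ε) (hyperbolicCover n m) (matH ε)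
        (fun q => Real.cosh q.2) (hyperbolicKernel m) (Set.Ioi 0) (Set.Ioi 0) := by
  have hl := Bergman.lam_pos n lam
  refine (hyperbolicModel ε).explicitRestriction (fun g => Iff.rfl) (fun p => Iff.rfl)
    (show Continuous fun q : QH m => ∑ i, q.1 i by fun_prop)
    (fun q a => rfl) (fun q => rfl)
    (fun ν => ?_) (fun ν hν => integrable_hyperbolicKernel hν) hl hl
    (hyperbolicModel_kernel ε lam) (hyperbolicModel_eq_zero ε)
  have hc : Continuous fun s : ℝ => Real.cosh s ^ (-(2 * ν)) :=
    Real.continuous_cosh.rpow_const fun s => Or.inl (Real.cosh_pos s).ne'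
  simp only [enorm_cpow_sq, hyperbolicModel_den, norm_cosh]
  rw [lintegral_torus_prod (g := fun s : ℝ => ENNReal.ofReal (Real.cosh s ^ (-(2 * ν))))
    (by fun_prop), lintegral_lt_top_iff_integrable hc.aestronglyMeasurable
    (fun s => Real.rpow_nonneg (Real.cosh_pos s).le _), integrable_cosh_rpow_iff]
  simp

end Hyperbolic

section Nilpotent

variable {n k l : ℕ} (ε : Fin k ⊕ Fin l ⊕ Unit ≃ Fin n)

/-- The automorphy factor of the nilpotent groups as a function of `(s, b)`. -/
def heisenbergDen (p : ℝ × EuclideanSpace ℝ (Fin l)) : ℂ :=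
  1 + (((‖p.2‖ ^ 2 : ℝ) : ℂ) - I * (p.1 : ℂ)) / 2

lemma one_add_shift_eq (q : QN k l) : 1 + shift q = heisenbergDen q.2 := rfl

lemma continuous_heisenbergDen : Continuous (heisenbergDen (l := l)) := by
  unfold heisenbergDen
  fun_prop

lemma heisenbergDen_re (p : ℝ × EuclideanSpace ℝ (Fin l)) :
    (heisenbergDen p).re = 1 + ‖p.2‖ ^ 2 / 2 := by
  simp [heisenbergDen, ← ofReal_pow]

lemma heisenbergDen_im (p : ℝ × EuclideanSpace ℝ (Fin l)) :
    (heisenbergDen p).im = -p.1 / 2 := by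
  simp [heisenbergDen, ← ofReal_pow]

lemma one_le_heisenbergDen_re (p : ℝ × EuclideanSpace ℝ (Fin l)) : 1 ≤ (heisenbergDen p).re := by
  rw [heisenbergDen_re]
  have := sq_nonneg ‖p.2‖
  linarith

lemma one_le_norm_heisenbergDen (p : ℝ × EuclideanSpace ℝ (Fin l)) : 1 ≤ ‖heisenbergDen p‖ :=
  (one_le_heisenbergDen_re p).trans (re_le_norm _)

lemma one_add_norm_le_heisenbergDen (p : ℝ × EuclideanSpace ℝ (Fin l)) :
    1 + ‖p.1‖ ≤ 3 * ‖heisenbergDen p‖ := by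
  have h1 := one_le_norm_heisenbergDen p
  have h2 := abs_im_le_norm (heisenbergDen p)
  rw [heisenbergDen_im, abs_div, abs_neg, abs_two] at h2
  rw [Real.norm_eq_abs]
  linarith

lemma one_add_norm_sq_le_heisenbergDen (p : ℝ × EuclideanSpace ℝ (Fin l)) :
    (1 + ‖p.2‖) ^ 2 ≤ 4 * ‖heisenbergDen p‖ := by
  have h2 := re_le_norm (heisenbergDen p)
  rw [heisenbergDen_re] at h2
  nlinarith [sq_nonneg (‖p.2‖ - 1)]

lemma continuous_norm_heisenbergDen_rpow (p : ℝ) :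
    Continuous fun x : ℝ × EuclideanSpace ℝ (Fin l) => ‖heisenbergDen x‖ ^ (-p) :=
  continuous_heisenbergDen.norm.rpow_const fun x =>
    Or.inl (by have := one_le_norm_heisenbergDen x; linarith)

/-- The modulus of the factor dominates both 1 + |s| and (1 + |b|)². The exponent splits as p = (1 +
δ/2) + (l + δ)/2: the first part pays for the line, the second for the l-dimensional space. -/
lemma integrable_heisenbergDen {p : ℝ} (hp : ((l : ℝ) + 2) / 2 < p) :
    Integrable fun x : ℝ × EuclideanSpace ℝ (Fin l) => ‖heisenbergDen x‖ ^ (-p) := by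
  set δ := p - l / 2 - 1 with hδ
  have hδ0 : 0 < δ := by rw [hδ]; linarith
  have h1 : Integrable fun s : ℝ => (1 + ‖s‖) ^ (-(1 + δ / 2)) :=
    integrable_one_add_norm (by simp [hδ0])
  have h2 : Integrable fun b : EuclideanSpace ℝ (Fin l) => (1 + ‖b‖) ^ (-((l : ℝ) + δ)) :=
    integrable_one_add_norm (by simp [hδ0])
  have h3 := (h1.mul_prod h2).const_mul (3 ^ (1 + δ / 2) * 4 ^ (((l : ℝ) + δ) / 2))
  rw [← Measure.volume_eq_prod] at h3
  refine h3.mono' (continuous_norm_heisenbergDen_rpow p).aestronglyMeasurable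
    (ae_of_all _ fun x => ?_)
  have hN := one_le_norm_heisenbergDen x
  set N := ‖heisenbergDen x‖
  rw [Real.norm_of_nonneg (by positivity)]
  have e1 : N ^ (-(1 + δ / 2)) ≤ 3 ^ (1 + δ / 2) * (1 + ‖x.1‖) ^ (-(1 + δ / 2)) := by
    have := Real.rpow_le_rpow_of_nonpos (z := -(1 + δ / 2)) (by positivity)
      (one_add_norm_le_heisenbergDen x) (by linarith)
    rw [Real.mul_rpow (by norm_num) (by positivity), Real.rpow_neg (by norm_num : (0 : ℝ) ≤ 3),
      inv_mul_le_iff₀ (by positivity)] at this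
    exact this
  have e2 : N ^ (-(((l : ℝ) + δ) / 2)) ≤
      4 ^ (((l : ℝ) + δ) / 2) * (1 + ‖x.2‖) ^ (-((l : ℝ) + δ)) := by
    have := Real.rpow_le_rpow_of_nonpos (z := -(((l : ℝ) + δ) / 2)) (by positivity)
      (one_add_norm_sq_le_heisenbergDen x) (by have : (0:ℝ) ≤ l := by positivity
                                               linarith)
    rw [Real.mul_rpow (by norm_num) (by positivity), Real.rpow_neg (by norm_num : (0 : ℝ) ≤ 4),
      inv_mul_le_iff₀ (by positivity), ← Real.rpow_natCast, ← Real.rpow_mul (by positivity)] at this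
    refine this.trans_eq ?_
    congr 2
    push_cast
    ring
  calc N ^ (-p) = N ^ (-(1 + δ / 2)) * N ^ (-(((l : ℝ) + δ) / 2)) := by
        rw [← Real.rpow_add (by linarith)]
        congr 1
        rw [hδ]
        ring
    _ ≤ (3 ^ (1 + δ / 2) * (1 + ‖x.1‖) ^ (-(1 + δ / 2))) *
          (4 ^ (((l : ℝ) + δ) / 2) * (1 + ‖x.2‖) ^ (-((l : ℝ) + δ))) := by gcongr
    _ = _ := by ring

/-- It is enough to treat the critical exponent. For s > 1 and |b| ≤ √s the modulus is at most 2s,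
and the ball has volume proportional to s^{l/2}; the slice integral is at least a constant times
1/s, which diverges logarithmically. -/
lemma not_integrable_heisenbergDen {p : ℝ} (hp : p ≤ ((l : ℝ) + 2) / 2) :
    ¬ Integrable fun x : ℝ × EuclideanSpace ℝ (Fin l) => ‖heisenbergDen x‖ ^ (-p) := by
  intro h
  set p₀ := ((l : ℝ) + 2) / 2 with hp₀
  have h0 : Integrable fun x : ℝ × EuclideanSpace ℝ (Fin l) => ‖heisenbergDen x‖ ^ (-p₀) := by
    refine h.mono' (continuous_norm_heisenbergDen_rpow p₀).aestronglyMeasurable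
      (ae_of_all _ fun x => ?_)
    rw [Real.norm_of_nonneg (by positivity)]
    exact Real.rpow_le_rpow_of_exponent_le (one_le_norm_heisenbergDen x) (by linarith)
  have hc := continuous_norm_heisenbergDen_rpow (l := l) p₀
  rw [← lintegral_lt_top_iff_integrable hc.aestronglyMeasurable (fun x => by positivity),
    Measure.volume_eq_prod, lintegral_prod _
      hc.measurable.ennreal_ofReal.aemeasurable] at h0
  set c := volume (Metric.ball (0 : EuclideanSpace ℝ (Fin l)) 1) with hcdef
  have hc0 : 0 < c := Metric.measure_ball_pos _ _ one_pos
  have hctop : c ≠ ∞ := measure_ball_lt_top.ne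
  have hkey : ∀ s ∈ Set.Ioi (1 : ℝ), ENNReal.ofReal (s⁻¹) * (ENNReal.ofReal (2 ^ (-p₀)) * c) ≤
      ∫⁻ b : EuclideanSpace ℝ (Fin l), ENNReal.ofReal (‖heisenbergDen (s, b)‖ ^ (-p₀)) := by
    intro s hs
    have hs1 : (1 : ℝ) < s := hs
    have hs0 : 0 < s := by linarith
    have hle : ∀ b ∈ Metric.closedBall (0 : EuclideanSpace ℝ (Fin l)) (√s),
        ENNReal.ofReal ((2 * s) ^ (-p₀)) ≤
          ENNReal.ofReal (‖heisenbergDen (s, b)‖ ^ (-p₀)) := by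
      intro b hb
      refine ENNReal.ofReal_le_ofReal (Real.rpow_le_rpow_of_nonpos ?_ ?_ ?_)
      · linarith [one_le_norm_heisenbergDen (s, b)]
      · have h1 := norm_le_abs_re_add_abs_im (heisenbergDen (s, b))
        have h2 : ‖b‖ ^ 2 ≤ s := by
          have := mem_closedBall_zero_iff.mp hb
          calc ‖b‖ ^ 2 ≤ √s ^ 2 := by gcongr
            _ = s := Real.sq_sqrt hs0.le
        rw [heisenbergDen_re, heisenbergDen_im, abs_of_pos (by positivity), abs_div, abs_neg,
          abs_two, abs_of_pos hs0] at h1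
        simp only at h1
        linarith
      · rw [hp₀]
        have : (0 : ℝ) ≤ l := by positivity
        linarith
    calc ENNReal.ofReal (s⁻¹) * (ENNReal.ofReal (2 ^ (-p₀)) * c)
        = ENNReal.ofReal ((2 * s) ^ (-p₀)) *
            volume (Metric.closedBall (0 : EuclideanSpace ℝ (Fin l)) (√s)) := by
          rw [Measure.addHaar_closedBall _ _ (Real.sqrt_nonneg s), finrank_euclideanSpace_fin,
            ← mul_assoc, ← mul_assoc, ← ENNReal.ofReal_mul (by positivity),
            ← ENNReal.ofReal_mul (by positivity)]
          congr 2
          rw [Real.mul_rpow (by norm_num) hs0.le, Real.sqrt_eq_rpow, ← Real.rpow_natCast,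
            ← Real.rpow_mul hs0.le, mul_assoc, ← Real.rpow_add hs0, mul_comm, ← Real.rpow_neg_one]
          congr 2
          rw [hp₀]
          ring
      _ = ∫⁻ b in Metric.closedBall (0 : EuclideanSpace ℝ (Fin l)) (√s),
            ENNReal.ofReal ((2 * s) ^ (-p₀)) := by rw [setLIntegral_const]
      _ ≤ ∫⁻ b in Metric.closedBall (0 : EuclideanSpace ℝ (Fin l)) (√s),
            ENNReal.ofReal (‖heisenbergDen (s, b)‖ ^ (-p₀)) :=
          setLIntegral_mono' Metric.isClosed_closedBall.measurableSet hle
      _ ≤ _ := setLIntegral_le_lintegral _ _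
  have h3 : ∫⁻ s in Set.Ioi (1 : ℝ),
      ENNReal.ofReal (s⁻¹) * (ENNReal.ofReal (2 ^ (-p₀)) * c) < ∞ :=
    ((setLIntegral_mono' measurableSet_Ioi hkey).trans (setLIntegral_le_lintegral _ _)).trans_lt h0
  have hC0 : ENNReal.ofReal (2 ^ (-p₀)) * c ≠ 0 :=
    mul_ne_zero (by rw [Ne, ENNReal.ofReal_eq_zero, not_le]; positivity) hc0.ne'
  rw [lintegral_mul_const _ (by fun_prop)] at h3
  have h4 : ∫⁻ s in Set.Ioi (1 : ℝ), ENNReal.ofReal (s⁻¹) < ∞ := by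
    by_contra! h5
    rw [top_le_iff.mp h5, ENNReal.top_mul hC0] at h3
    exact lt_irrefl _ h3
  refine not_integrableOn_Ioi_inv (a := 1) ⟨by fun_prop, ?_⟩
  rw [hasFiniteIntegral_iff_ofReal]
  · exact h4
  · filter_upwards [ae_restrict_mem measurableSet_Ioi] with s hs
    have : (1 : ℝ) < s := hs
    simp only [Pi.zero_apply]
    positivity

lemma nilpotentKernel_bound {ν : ℝ} (hν : 0 ≤ ν) (q : QN k l) :
    ‖nilpotentKernel k l ν q‖ ≤ 2 ^ ν * ‖heisenbergDen q.2‖ ^ (-ν) := by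
  rw [nilpotentKernel_eq]
  exact norm_cpow_sub_le hν (one_le_one_add_shift_re q) (norm_sum_expc_le q.1)

lemma continuous_nilpotentKernel (ν : ℝ) : Continuous (nilpotentKernel k l ν) := by
  rw [funext (nilpotentKernel_eq ν)]
  exact continuous_cpow_sub ν (continuous_const.add continuous_shift)
    ((continuous_sum_expc k).comp continuous_fst) one_le_one_add_shift_re
    fun q => norm_sum_expc_le q.1

lemma integrable_nilpotentKernel {ν : ℝ} (hν : ((l : ℝ) + 2) / 2 < ν) :
    Integrable (nilpotentKernel k l ν) := by
  have h0 : 0 ≤ ν := by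
    have : (0 : ℝ) ≤ l := by positivity
    linarith
  exact integrable_torus_prod (continuous_nilpotentKernel ν)
    ((integrable_heisenbergDen hν).const_mul (2 ^ ν)) (nilpotentKernel_bound h0)

lemma half_add_two_lt {n k l : ℕ} (ε : Fin k ⊕ Fin l ⊕ Unit ≃ Fin n) {lam : ℝ}
    (hlam : (n : ℝ) < lam) : ((l : ℝ) + 2) / 2 < lam := by
  have hcard : k + (l + 1) = n := by simpa using Fintype.card_congr ε
  have h1 : ((k + (l + 1) : ℕ) : ℝ) < lam := by rwa [hcard]
  push_cast at h1
  have : (0 : ℝ) ≤ l := by positivity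
  have : (0 : ℝ) ≤ k := by positivity
  linarith

theorem nilpotent_explicitRestriction {lam : ℝ} [Fact (1 ≤ n)] [hl : Fact ((n : ℝ) < lam)] :
    ExplicitRestriction lam (nilpotentGroup ε) (basePoint ε) (nilpotentCover n k l) (matN ε)
        (fun q => 1 + shift q) (nilpotentKernel k l) (Set.Ioi (((l : ℝ) + 2) / 4))
        (Set.Ioi (((l : ℝ) + 2) / 2)) := by
  have hlam : ((l : ℝ) + 2) / 2 < lam := half_add_two_lt ε hl.out
  refine (nilpotentModel ε).explicitRestriction (fun g => Iff.rfl) (fun p => Iff.rfl)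
    (show Continuous fun q : QN k l => ∑ i, q.1 i by fun_prop)
    (fun q a => rfl) (fun q => rfl)
    (fun ν => ?_) (fun ν hν => integrable_nilpotentKernel hν) ?_ hlam
    (nilpotentModel_kernel ε lam) (nilpotentModel_eq_zero ε)
  · have hc := continuous_norm_heisenbergDen_rpow (l := l) (2 * ν)
    simp only [enorm_cpow_sq, nilpotentModel_den, one_add_shift_eq]
    rw [lintegral_torus_prod (g := fun x => ENNReal.ofReal (‖heisenbergDen x‖ ^ (-(2 * ν))))
      hc.measurable.ennreal_ofReal, lintegral_lt_top_iff_integrable hc.aestronglyMeasurable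
      (fun s => by positivity), Set.mem_Ioi]
    constructor
    · intro h
      by_contra! h1
      exact not_integrable_heisenbergDen (by linarith) h
    · intro h
      exact integrable_heisenbergDen (by linarith)
  · rw [Set.mem_Ioi]
    have : (0 : ℝ) ≤ l := by positivity
    linarith

end Nilpotent

end BallRestriction
end

noncomputable section

namespace BallRestriction

/-! ## Fourier transforms of the kernels -/

/-! ### Gamma integrals with complex parameter -/

section GammaIntegral

lemma integrableOn_rpow_mul_exp_neg {s b : ℝ} (hs : 0 < s) (hb : 0 < b) :
    IntegrableOn (fun y : ℝ => y ^ (s - 1) * Real.exp (-(b * y))) (Set.Ioi 0) := by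
  have := integrableOn_rpow_mul_exp_neg_mul_rpow (p := 1) (s := s - 1) (by linarith) one_pos hb
  simpa using this

lemma norm_rpow_mul_exp_neg (s : ℝ) (B : ℂ) {y : ℝ} (hy : 0 < y) :
    ‖((y ^ (s - 1) : ℝ) : ℂ) * exp (-(B * y))‖ = y ^ (s - 1) * Real.exp (-(B.re * y)) := by
  rw [norm_mul, norm_real, Real.norm_of_nonneg (Real.rpow_nonneg hy.le _), norm_exp]
  simp

lemma measurable_rpow_mul_exp_neg (s : ℝ) (B : ℂ) :
    Measurable fun y : ℝ => ((y ^ (s - 1) : ℝ) : ℂ) * exp (-(B * y)) :=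
  (Complex.measurable_ofReal.comp (measurable_id.pow_const _)).mul (by fun_prop)

lemma integrableOn_rpow_mul_cexp_neg {s : ℝ} (hs : 0 < s) {B : ℂ} (hB : 0 < B.re) :
    IntegrableOn (fun y : ℝ => ((y ^ (s - 1) : ℝ) : ℂ) * exp (-(B * y))) (Set.Ioi 0) := by
  refine Integrable.mono' (integrableOn_rpow_mul_exp_neg hs hB)
    (measurable_rpow_mul_exp_neg s B).aestronglyMeasurable ?_
  filter_upwards [ae_restrict_mem measurableSet_Ioi] with y hy
  exact (norm_rpow_mul_exp_neg s B hy).le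

/-- The Gamma integral with a complex parameter in the exponential. -/
lemma integral_rpow_mul_cexp_neg {s : ℝ} (hs : 0 < s) {B : ℂ} (hB : 0 < B.re) :
    ∫ y in Set.Ioi (0 : ℝ), ((y ^ (s - 1) : ℝ) : ℂ) * exp (-(B * y)) =
      Real.Gamma s * B ^ (-s : ℂ) := by
  have hopen : IsOpen {B : ℂ | 0 < B.re} := isOpen_lt continuous_const continuous_re
  have hd : DifferentiableOn ℂ
      (fun B : ℂ => ∫ y in Set.Ioi (0 : ℝ), ((y ^ (s - 1) : ℝ) : ℂ) * exp (-(B * y)))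
      {B | 0 < B.re} := by
    intro B hB
    simp only [Set.mem_ofPred_eq] at hB
    refine DifferentiableAt.differentiableWithinAt (HasDerivAt.differentiableAt
      (hasDerivAt_integral_of_dominated_loc_of_deriv_le (𝕜 := ℂ) (s := {C | B.re / 2 < C.re})
        (μ := volume.restrict (Set.Ioi 0))
        (F := fun C y => ((y ^ (s - 1) : ℝ) : ℂ) * exp (-(C * y)))
        (F' := fun C y => ((y ^ (s - 1) : ℝ) : ℂ) * (exp (-(C * y)) * (-(1 * y))))
        (bound := fun y => y ^ (s + 1 - 1) * Real.exp (-(B.re / 2 * y)))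
        ((isOpen_lt continuous_const continuous_re).mem_nhds (by
          simp only [Set.mem_ofPred_eq]; linarith)) ?_
        (integrableOn_rpow_mul_cexp_neg hs hB) ?_ ?_
        (integrableOn_rpow_mul_exp_neg (by linarith) (by linarith)) ?_).2)
    · exact .of_forall fun C => (measurable_rpow_mul_exp_neg s C).aestronglyMeasurable
    · exact Measurable.aestronglyMeasurable ((Complex.measurable_ofReal.comp
        (measurable_id.pow_const _)).mul (by fun_prop))
    · filter_upwards [ae_restrict_mem measurableSet_Ioi] with y hy C hC
      replace hy : 0 < y := hy
      replace hC : B.re / 2 < C.re := hC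
      rw [← mul_assoc, norm_mul, norm_rpow_mul_exp_neg s C hy, one_mul, norm_neg, norm_real,
        Real.norm_of_nonneg hy.le, mul_right_comm, ← Real.rpow_add_one hy.ne']
      rw [show s - 1 + 1 = s + 1 - 1 by ring]
      gcongr
    · filter_upwards with y C _
      exact ((((hasDerivAt_id C).mul_const (y : ℂ)).neg).cexp).const_mul _
  have hd2 : DifferentiableOn ℂ (fun B : ℂ => (Real.Gamma s : ℂ) * B ^ (-s : ℂ))
      {B | 0 < B.re} := fun B hB =>
    ((differentiableAt_id.cpow_const (Or.inl hB)).const_mul _).differentiableWithinAt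
  -- Both sides are holomorphic in the right half-plane, and the formula is classical for positive
  -- real parameters, which accumulate at 1; the identity theorem does the rest.
  refine (hd.analyticOnNhd hopen).eqOn_of_preconnected_of_frequently_eq (hd2.analyticOnNhd hopen)
    (convex_halfSpace_re_gt 0).isPreconnected (z₀ := 1) (by simp) ?_ hB
  have hreal : ∀ r : ℝ, 0 < r →
      ∫ y in Set.Ioi (0 : ℝ), ((y ^ (s - 1) : ℝ) : ℂ) * exp (-(r * y)) =
        Real.Gamma s * (r : ℂ) ^ (-s : ℂ) := by
    intro r hr
    have h := Real.integral_rpow_mul_exp_neg_mul_Ioi hs hr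
    rw [← ofReal_neg, ← ofReal_cpow hr.le, ← ofReal_mul, Real.rpow_neg hr.le, mul_comm,
      ← Real.inv_rpow hr.le, ← one_div, ← h, ← integral_complex_ofReal]
    push_cast
    rfl
  have ht : Filter.Tendsto (fun r : ℝ => (r : ℂ)) (nhdsWithin 1 {1}ᶜ) (nhdsWithin 1 {1}ᶜ) :=
    tendsto_nhdsWithin_of_tendsto_nhds_of_eventually_within _
      ((continuous_ofReal.tendsto' 1 1 ofReal_one).mono_left nhdsWithin_le_nhds) (by
        filter_upwards [self_mem_nhdsWithin] with r hr
        simpa using hr)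
  refine ht.frequently (Filter.Eventually.frequently ?_)
  filter_upwards [nhdsWithin_le_nhds (lt_mem_nhds (one_pos : (0 : ℝ) < 1))] with r hr
  exact hreal r hr

end GammaIntegral

/-! ### Integrals over the torus -/

section Torus

lemma integral_fourier (j : ℤ) :
    ∫ θ : UnitAddCircle, fourier j θ = if j = 0 then 1 else 0 := by
  have h := congrFun (fourierCoeff_fourier (T := 1) j) 0
  rw [fourierCoeff, AddCircle.integral_haarAddCircle] at h
  simp only [neg_zero, fourier_zero, one_smul, inv_one] at h
  rw [h, Pi.single_apply]
  simp [eq_comm]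

lemma expc_eq_fourier (θ : UnitAddCircle) : expc θ = fourier 1 θ := by
  rw [fourier_one]; rfl

lemma expc_pow_mul_fourier (j : ℕ) (a : ℤ) (θ : UnitAddCircle) :
    expc θ ^ j * fourier a θ = fourier (j + a) θ := by
  rw [fourier_add, expc_eq_fourier]
  congr 1
  induction j with
  | zero => simp
  | succ j ih => rw [pow_succ, ih, Nat.cast_succ, fourier_add]

lemma norm_fourier_apply (a : ℤ) (θ : UnitAddCircle) : ‖(fourier a θ : ℂ)‖ = 1 := by
  rw [fourier_apply]; exact Circle.norm_coe _

/-- The exponential series may be integrated term by term, and orthogonality of the characters keeps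
only the power j = a, if there is one; so negative frequencies give 0. -/
lemma hasSum_integral_exp_expc (c : ℂ) (a : ℤ) :
    HasSum (fun j : ℕ => if (j : ℤ) = a then c ^ j / j.factorial else 0)
      (∫ θ : UnitAddCircle, exp (c * expc θ) * fourier (-a) θ) := by
  have hF : ∀ (j : ℕ) (θ : UnitAddCircle),
      (c * expc θ) ^ j / j.factorial * fourier (-a) θ =
        c ^ j / j.factorial * fourier (j + -a) θ := by
    intro j θ
    rw [mul_pow, ← expc_pow_mul_fourier]
    ring
  have h := hasSum_integral_of_summable_integral_norm (μ := (volume : Measure UnitAddCircle))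
    (F := fun (j : ℕ) (θ : UnitAddCircle) => c ^ j / j.factorial * fourier (j + -a) θ)
    (fun j => Continuous.integrable_of_hasCompactSupport (by fun_prop)
      (HasCompactSupport.of_compactSpace _)) (by
      simp only [norm_mul, norm_fourier_apply, mul_one, integral_const, norm_div, norm_pow,
        Complex.norm_natCast]
      exact (Real.summable_pow_div_factorial ‖c‖).const_smul _)
  have h1 : ∀ j : ℕ, ∫ θ : UnitAddCircle, c ^ j / j.factorial * fourier (j + -a) θ =
      if (j : ℤ) = a then c ^ j / j.factorial else 0 := by
    intro j
    rw [integral_const_mul, integral_fourier]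
    simp only [← sub_eq_add_neg, sub_eq_zero]
    split_ifs <;> simp
  have h2 : ∀ θ : UnitAddCircle, ∑' j : ℕ, c ^ j / j.factorial * fourier (j + -a) θ =
      exp (c * expc θ) * fourier (-a) θ := by
    intro θ
    simp only [← hF]
    rw [tsum_mul_right, exp_eq_exp_ℂ, NormedSpace.exp_eq_tsum_div]
  simpa only [h1, h2] using h

lemma integral_exp_expc (c : ℂ) (a : ℕ) :
    ∫ θ : UnitAddCircle, exp (c * expc θ) * fourier (-(a : ℤ)) θ = c ^ a / a.factorial := by
  refine (hasSum_integral_exp_expc c a).unique ?_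
  convert hasSum_ite_eq a (c ^ a / (a.factorial : ℂ)) using 2 with j
  by_cases h : j = a
  · simp [h]
  · simp [h]

lemma integral_exp_expc_of_neg (c : ℂ) {a : ℤ} (ha : a < 0) :
    ∫ θ : UnitAddCircle, exp (c * expc θ) * fourier (-a) θ = 0 := by
  refine (hasSum_integral_exp_expc c a).unique ?_
  convert hasSum_zero using 2 with j
  rw [if_neg (by omega)]

variable {k : ℕ}

lemma continuous_prod_fourier (α : Fin k → ℤ) :
    Continuous fun t : Fin k → UnitAddCircle => ∏ i, (fourier (-α i) (t i) : ℂ) :=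
  continuous_finsetProd _ fun i _ => (fourier (-α i)).continuous.comp (continuous_apply i)

lemma norm_prod_fourier (α : Fin k → ℤ) (t : Fin k → UnitAddCircle) :
    ‖∏ i, (fourier (-α i) (t i) : ℂ)‖ = 1 := by
  rw [norm_prod]
  exact Finset.prod_eq_one fun i _ => norm_fourier_apply _ _

lemma integral_exp_sum_expc (c : ℂ) (α : Fin k → ℤ) :
    ∫ t : Fin k → UnitAddCircle, exp (c * ∑ i, expc (t i)) * ∏ i, fourier (-α i) (t i) =
      ∏ i, ∫ θ : UnitAddCircle, exp (c * expc θ) * fourier (-α i) θ := by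
  rw [← integral_fintype_prod_volume_eq_prod]
  refine integral_congr_ae (ae_of_all _ fun t => ?_)
  simp only [Finset.mul_sum, exp_sum, Finset.prod_mul_distrib]

/-- Expansion of a power of `A - (1/2k) ∑ tᵢ` as a Gamma integral, integrated over the torus. -/
lemma gamma_mul_integral_cpow_sub (lam : ℝ) (hlam : 0 < lam) {A : ℂ} (hA : 1 / 2 < A.re)
    (α : Fin k → ℤ) :
    Real.Gamma lam * ∫ t : Fin k → UnitAddCircle,
        (A - 1 / (2 * k) * ∑ i, expc (t i)) ^ (-lam : ℂ) * ∏ i, fourier (-α i) (t i) =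
      ∫ y in Set.Ioi (0 : ℝ), ((y ^ (lam - 1) : ℝ) : ℂ) * exp (-(A * y)) *
        ∏ i, ∫ θ : UnitAddCircle, exp ((1 / (2 * k) * y : ℂ) * expc θ) * fourier (-α i) θ := by
  -- A lower bound for the real part, uniform in `t` and positive, supplies the integrable majorant
  -- for exchanging the integrals.
  have hre : ∀ t : Fin k → UnitAddCircle,
      A.re - 1 / 2 ≤ (A - 1 / (2 * k) * ∑ i, expc (t i)).re := by
    intro t
    have := (abs_re_le_norm _).trans (norm_sum_expc_le t)
    have := le_abs_self (1 / (2 * k) * ∑ i, expc (t i) : ℂ).re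
    rw [sub_re]
    linarith
  have hint : Integrable (Function.uncurry fun (t : Fin k → UnitAddCircle) (y : ℝ) =>
      (((y ^ (lam - 1) : ℝ) : ℂ) * exp (-((A - 1 / (2 * k) * ∑ i, expc (t i)) * y))) *
        ∏ i, fourier (-α i) (t i)) (volume.prod (volume.restrict (Set.Ioi 0))) := by
    have hb : Integrable (fun y : ℝ => y ^ (lam - 1) * Real.exp (-((A.re - 1 / 2) * y)))
      (volume.restrict (Set.Ioi 0)) := integrableOn_rpow_mul_exp_neg hlam (by linarith)
    have hm : Measurable (Function.uncurry fun (t : Fin k → UnitAddCircle) (y : ℝ) =>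
      (((y ^ (lam - 1) : ℝ) : ℂ) * exp (-((A - 1 / (2 * k) * ∑ i, expc (t i)) * y))) *
        ∏ i, (fourier (-α i) (t i) : ℂ)) := by
      refine ((Complex.measurable_ofReal.comp (measurable_snd.pow_const _)).mul
        (Continuous.measurable ?_)).mul
        ((continuous_prod_fourier α).measurable.comp measurable_fst)
      exact continuous_exp.comp (((continuous_const.sub
        ((continuous_sum_expc k).comp continuous_fst)).mul
          (continuous_ofReal.comp continuous_snd)).neg)
    refine Integrable.mono' (hb.comp_snd _) hm.aestronglyMeasurable ?_
    have : ∀ᵐ p : (Fin k → UnitAddCircle) × ℝ ∂(volume.prod (volume.restrict (Set.Ioi 0))),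
        p.2 ∈ Set.Ioi (0 : ℝ) := by
      rw [← Measure.restrict_univ (μ := (volume : Measure (Fin k → UnitAddCircle))),
        Measure.prod_restrict]
      filter_upwards [ae_restrict_mem (MeasurableSet.univ.prod measurableSet_Ioi)] with p hp
      exact hp.2
    filter_upwards [this] with p hp
    simp only [Function.uncurry]
    rw [norm_mul, norm_prod_fourier, mul_one, norm_rpow_mul_exp_neg lam _ hp]
    have := Real.rpow_nonneg (le_of_lt hp) (lam - 1)
    gcongr
    · exact le_of_lt hp
    · exact hre p.1
  have h1 : ∀ t : Fin k → UnitAddCircle,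
      (Real.Gamma lam : ℂ) * ((A - 1 / (2 * k) * ∑ i, expc (t i)) ^ (-lam : ℂ) *
        ∏ i, fourier (-α i) (t i)) =
      ∫ y in Set.Ioi (0 : ℝ), (((y ^ (lam - 1) : ℝ) : ℂ) *
        exp (-((A - 1 / (2 * k) * ∑ i, expc (t i)) * y))) * ∏ i, fourier (-α i) (t i) := by
    intro t
    rw [integral_mul_const, integral_rpow_mul_cexp_neg hlam (by linarith [hre t]), mul_assoc]
  rw [← integral_const_mul]
  simp only [h1]
  rw [integral_integral_swap hint]
  refine integral_congr_ae (ae_of_all _ fun y => ?_)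
  simp only
  rw [← integral_exp_sum_expc, ← integral_const_mul]
  refine integral_congr_ae (ae_of_all _ fun t => ?_)
  simp only
  rw [← mul_assoc, mul_assoc (_ : ℂ) (exp _) (exp _), ← exp_add]
  congr 3
  ring

/-- Each circle contributes (y/2k)^{α_i}/α_i!, so the Gamma integral in y is taken again with λ +
|α| in place of λ. -/
lemma integral_cpow_sub {lam : ℝ} (hlam : 0 < lam) {A : ℂ} (hA : 1 / 2 < A.re)
    (α : Fin k → ℕ) :
    ∫ t : Fin k → UnitAddCircle,
        (A - 1 / (2 * k) * ∑ i, expc (t i)) ^ (-lam : ℂ) * ∏ i, fourier (-(α i : ℤ)) (t i) =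
      ((((2 * k : ℝ) ^ (∑ i, α i))⁻¹ * (Real.Gamma (lam + (∑ i, α i : ℕ)) / Real.Gamma lam) *
        (1 / ∏ i, ((α i).factorial : ℝ)) : ℝ) : ℂ) *
        A ^ (-(lam + (∑ i, α i : ℕ) : ℝ) : ℂ) := by
  have hG : (Real.Gamma lam : ℂ) ≠ 0 := ofReal_ne_zero.mpr (Real.Gamma_pos_of_pos hlam).ne'
  refine mul_left_cancel₀ hG ?_
  rw [gamma_mul_integral_cpow_sub lam hlam hA]
  simp only [integral_exp_expc]
  have h : ∀ y ∈ Set.Ioi (0 : ℝ), ((y ^ (lam - 1) : ℝ) : ℂ) * exp (-(A * y)) *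
        ∏ i, (1 / (2 * k) * y : ℂ) ^ α i / ((α i).factorial : ℂ) =
      ((((2 * k : ℝ) ^ (∑ i, α i))⁻¹ * (1 / ∏ i, ((α i).factorial : ℝ)) : ℝ) : ℂ) *
        (((y ^ (lam + (∑ i, α i : ℕ) - 1) : ℝ) : ℂ) * exp (-(A * y))) := by
    intro y hy
    have hy' : y ^ (lam + (∑ i, α i : ℕ) - 1) = y ^ (lam - 1) * y ^ (∑ i, α i) := by
      rw [← Real.rpow_add_natCast (ne_of_gt hy)]
      congr 1; ring
    rw [Finset.prod_div_distrib, Finset.prod_pow_eq_pow_sum, hy', mul_pow]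
    push_cast
    rw [one_div, inv_pow]
    ring
  rw [setIntegral_congr_fun measurableSet_Ioi h, integral_const_mul,
    integral_rpow_mul_cexp_neg (by positivity) (by linarith)]
  push_cast
  field_simp

lemma integral_cpow_sub_of_neg {lam : ℝ} (hlam : 0 < lam) {A : ℂ} (hA : 1 / 2 < A.re)
    {α : Fin k → ℤ} (hα : ∃ i, α i < 0) :
    ∫ t : Fin k → UnitAddCircle,
        (A - 1 / (2 * k) * ∑ i, expc (t i)) ^ (-lam : ℂ) * ∏ i, fourier (-α i) (t i) = 0 := by
  obtain ⟨i, hi⟩ := hα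
  have hG : (Real.Gamma lam : ℂ) ≠ 0 := ofReal_ne_zero.mpr (Real.Gamma_pos_of_pos hlam).ne'
  refine (mul_eq_zero.mp ?_).resolve_left hG
  rw [gamma_mul_integral_cpow_sub lam hlam hA]
  have : ∀ y : ℝ, ∏ i, ∫ θ : UnitAddCircle,
      exp ((1 / (2 * k) * y : ℂ) * expc θ) * fourier (-α i) θ = 0 := fun y =>
    Finset.prod_eq_zero (Finset.mem_univ i) (integral_exp_expc_of_neg _ hi)
  simp only [this, mul_zero, integral_zero]

end Torus

section Elliptic

theorem fourierE_ellipticKernel {n : ℕ} {lam : ℝ} (hlam : 0 < lam) (α : Fin n → ℕ) :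
    fourierE (ellipticKernel n lam) (fun i => (α i : ℤ)) =
      (((2 * n : ℝ) ^ (∑ i, α i))⁻¹ * (Real.Gamma (lam + ∑ i, α i) / Real.Gamma lam) *
        (1 / ∏ i, ((α i).factorial : ℝ)) : ℝ) := by
  have h := integral_cpow_sub (k := n) hlam (A := 1) (by norm_num) α
  rw [one_cpow, mul_one] at h
  rw [fourierE]
  simp only [ellipticKernel]
  rw [h]

theorem fourierE_ellipticKernel_of_neg {n : ℕ} {lam : ℝ} (hlam : 0 < lam) {α : Fin n → ℤ}
    (hα : ∃ i, α i < 0) : fourierE (ellipticKernel n lam) α = 0 :=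
  integral_cpow_sub_of_neg (k := n) hlam (A := 1) (by norm_num) hα

end Elliptic

end BallRestriction
end

noncomputable section

namespace BallRestriction

/-! ### The Fourier transform of powers of cosh -/

section CoshIntegral

/-- The substitution x = 1/(1 + e^{2s}) maps ℝ onto (0, 1) with x = e^{-s}/(2 cosh s) and 1 - x =
e^{s}/(2 cosh s). It turns the Beta integral into the transform of a power of cosh. -/
lemma logistic_image :
    (fun s : ℝ => (1 + Real.exp (2 * s))⁻¹) '' Set.univ = Set.Ioo 0 1 := by
  ext x
  simp only [Set.image_univ, Set.mem_range, Set.mem_Ioo]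
  constructor
  · rintro ⟨s, rfl⟩
    have := Real.exp_pos (2 * s)
    exact ⟨by positivity, inv_lt_one_of_one_lt₀ (by linarith)⟩
  · rintro ⟨h0, h1⟩
    have h2 : 0 < x⁻¹ - 1 := by
      have := (one_lt_inv₀ h0).mpr h1
      linarith
    refine ⟨Real.log (x⁻¹ - 1) / 2, ?_⟩
    rw [mul_div_cancel₀ _ two_ne_zero, Real.exp_log h2]
    simp

lemma logistic_eq (s : ℝ) :
    (1 + Real.exp (2 * s))⁻¹ = Real.exp (-s) * (2 * Real.cosh s)⁻¹ := by
  have h : 1 + Real.exp (2 * s) = Real.exp s * (2 * Real.cosh s) := by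
    rw [Real.cosh_eq, mul_div_cancel₀ _ two_ne_zero, mul_add, ← Real.exp_add, ← Real.exp_add]
    simp [two_mul, add_comm]
  rw [h, mul_inv, Real.exp_neg]

lemma one_sub_logistic_eq (s : ℝ) :
    1 - (1 + Real.exp (2 * s))⁻¹ = Real.exp s * (2 * Real.cosh s)⁻¹ := by
  rw [logistic_eq]
  have := Real.cosh_pos s
  field_simp
  rw [Real.cosh_eq]
  ring

lemma hasDerivAt_logistic (s : ℝ) :
    HasDerivAt (fun s : ℝ => (1 + Real.exp (2 * s))⁻¹)
      (-(2 * ((2 * Real.cosh s)⁻¹ * (2 * Real.cosh s)⁻¹))) s := by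
  have h1 : HasDerivAt (fun s : ℝ => 1 + Real.exp (2 * s)) (Real.exp (2 * s) * (2 * 1)) s :=
    (((hasDerivAt_id s).const_mul 2).exp).const_add 1
  have h0 : 1 + Real.exp (2 * s) ≠ 0 := by positivity
  refine (h1.inv h0).congr_deriv (Eq.symm ?_)
  have hsq : (1 + Real.exp (2 * s)) ^ 2 = ((1 + Real.exp (2 * s))⁻¹ ^ 2)⁻¹ := by simp
  rw [hsq, logistic_eq, div_inv_eq_mul, mul_pow, ← Real.exp_nat_mul]
  rw [show Real.exp (2 * s) = (Real.exp ((2 : ℕ) * -s))⁻¹ by rw [← Real.exp_neg]; congr 1; push_cast; ring]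
  field_simp

/-- The Fourier transform of a power of the hyperbolic cosine. -/
lemma gamma_mul_integral_cosh {μ : ℝ} (hμ : 0 < μ) (ξ : ℝ) :
    Real.Gamma μ * ∫ s : ℝ, (Real.cosh s : ℂ) ^ (-μ : ℂ) * exp (-I * (s * ξ : ℝ)) =
      (2 ^ (μ - 1) : ℝ) *
        (Complex.Gamma ((μ + I * ξ) / 2) * Complex.Gamma ((μ - I * ξ) / 2)) := by
  have hu : 0 < ((μ + I * ξ) / 2 : ℂ).re := by
    rw [show ((μ + I * ξ) / 2 : ℂ) = ((1 / 2 : ℝ) : ℂ) * (μ + I * ξ) by push_cast; ring, re_ofReal_mul]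
    simp; linarith
  have hv : 0 < ((μ - I * ξ) / 2 : ℂ).re := by
    rw [show ((μ - I * ξ) / 2 : ℂ) = ((1 / 2 : ℝ) : ℂ) * (μ - I * ξ) by push_cast; ring, re_ofReal_mul]
    simp; linarith
  rw [Complex.Gamma_mul_Gamma_eq_betaIntegral hu hv]
  rw [show ((μ + I * ξ) / 2 + (μ - I * ξ) / 2 : ℂ) = μ by ring, Complex.Gamma_ofReal]
  rw [mul_left_comm]
  congr 1
  rw [Complex.betaIntegral, intervalIntegral.integral_of_le zero_le_one,
    integral_Ioc_eq_integral_Ioo, ← logistic_image,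
    integral_image_eq_integral_abs_deriv_smul MeasurableSet.univ
      (fun s _ => (hasDerivAt_logistic s).hasDerivWithinAt), setIntegral_univ, ← integral_const_mul]
  · refine integral_congr_ae (ae_of_all _ fun s => ?_)
    simp only
    have hc := Real.cosh_pos s
    have hc2 : (0 : ℝ) < 2 * Real.cosh s := by positivity
    -- Every factor is written as an exponential of s, log 2 and log (2 cosh s); the integrands then
    -- agree by comparing exponents.
    have e1 : (((1 + Real.exp (2 * s))⁻¹ : ℝ) : ℂ) =
        exp ((-s + -Real.log (2 * Real.cosh s) : ℝ) : ℂ) := by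
      rw [ofReal_add, ofReal_neg, ofReal_neg, logistic_eq, exp_add, exp_neg (Real.log _ : ℂ), ← ofReal_exp, Real.exp_log hc2]
      push_cast; rfl
    have e2 : (1 - ((1 + Real.exp (2 * s))⁻¹ : ℝ) : ℂ) =
        exp ((s + -Real.log (2 * Real.cosh s) : ℝ) : ℂ) := by
      rw [ofReal_add, ofReal_neg, ← ofReal_one, ← ofReal_sub, one_sub_logistic_eq, exp_add, exp_neg (Real.log _ : ℂ),
        ← ofReal_exp (Real.log _), Real.exp_log hc2]
      push_cast; rfl
    have e3 : (Real.cosh s : ℂ) ^ (-μ : ℂ) =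
        exp ((Real.log (2 * Real.cosh s) - Real.log 2) * (-μ)) := by
      rw [cpow_def_of_ne_zero (ofReal_ne_zero.mpr hc.ne'), ← ofReal_log hc.le,
        Real.log_mul two_ne_zero hc.ne']
      push_cast; congr 1; ring
    have e4 : ((2 ^ (μ - 1) : ℝ) : ℂ) = exp (Real.log 2 * (μ - 1)) := by
      rw [Real.rpow_def_of_pos two_pos]; push_cast; rfl
    have e5 : ((|-(2 * ((2 * Real.cosh s)⁻¹ * (2 * Real.cosh s)⁻¹))| : ℝ) : ℂ) =
        exp (Real.log 2 + -Real.log (2 * Real.cosh s) + -Real.log (2 * Real.cosh s)) := by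
      rw [abs_neg, abs_of_pos (by positivity), exp_add, exp_add, exp_neg, ← ofReal_exp, ← ofReal_exp,
        Real.exp_log hc2, Real.exp_log two_pos]
      push_cast; ring
    have cp : ∀ (x : ℝ) (w : ℂ), exp (x : ℂ) ^ w = exp (x * w) := by
      intro x w
      rw [cpow_def_of_ne_zero (exp_ne_zero _), ← ofReal_exp, ← ofReal_log (Real.exp_pos _).le,
        Real.log_exp]
    rw [real_smul, e2, e1, e3, e4, e5, cp, cp, ← exp_add, ← exp_add, ← exp_add, ← exp_add]
    congr 1
    push_cast
    ring
  · intro s _ t _ h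
    simpa using h

end CoshIntegral

section Hyperbolic

variable {m : ℕ}

lemma norm_exp_neg_I_mul (x : ℝ) : ‖exp (-I * (x : ℂ))‖ = 1 := by
  rw [show -I * (x : ℂ) = ((-x : ℝ) : ℂ) * I by push_cast; ring, norm_exp_ofReal_mul_I]

/-- Integrating first over the torus in a Fourier transform. -/
lemma integral_torus_prod_mul {k : ℕ} {Y : Type*} [MeasureSpace Y] [TopologicalSpace Y]
    [SecondCountableTopology Y] [BorelSpace Y] [SFinite (volume : Measure Y)]
    {φ : (Fin k → UnitAddCircle) × Y → ℂ} (hφ : Integrable φ) (α : Fin k → ℤ) {u : Y → ℝ}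
    (hu : Continuous u) :
    Integrable (fun q : (Fin k → UnitAddCircle) × Y =>
      φ q * ((∏ i, fourier (-α i) (q.1 i)) * exp (-I * u q.2))) ∧
    ∫ q : (Fin k → UnitAddCircle) × Y,
      φ q * ((∏ i, fourier (-α i) (q.1 i)) * exp (-I * u q.2)) =
    ∫ y : Y, (∫ t : Fin k → UnitAddCircle, φ (t, y) * ∏ i, fourier (-α i) (t i)) *
      exp (-I * u y) := by
  have hc : Continuous fun q : (Fin k → UnitAddCircle) × Y =>
      (∏ i, (fourier (-α i) (q.1 i) : ℂ)) * exp (-I * u q.2) := by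
    refine ((continuous_prod_fourier α).comp continuous_fst).mul (continuous_exp.comp ?_)
    exact continuous_const.mul (continuous_ofReal.comp (hu.comp continuous_snd))
  have hi : Integrable (fun q : (Fin k → UnitAddCircle) × Y =>
      φ q * ((∏ i, fourier (-α i) (q.1 i)) * exp (-I * u q.2))) :=
    hφ.mul_bdd (c := 1) hc.aestronglyMeasurable (ae_of_all _ fun q => by
      rw [norm_mul, norm_prod_fourier, norm_exp_neg_I_mul, mul_one])
  refine ⟨hi, ?_⟩
  rw [Measure.volume_eq_prod, integral_prod_symm _ hi]
  refine integral_congr_ae (ae_of_all _ fun y => ?_)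
  simp only
  rw [← integral_mul_const]
  simp only [mul_assoc]

theorem fourierH_hyperbolicKernel {lam : ℝ} (hlam : 0 < lam) (α : Fin m → ℕ) (ξ : ℝ) :
    fourierH (hyperbolicKernel m lam) (fun i => (α i : ℤ)) ξ =
      ((2 ^ (lam - 1) / (√(2 * Real.pi) * (m : ℝ) ^ (∑ i, α i)) : ℝ) : ℂ) *
        (Complex.Gamma ((lam + (∑ i, α i : ℕ) + Complex.I * ξ) / 2) *
          Complex.Gamma ((lam + (∑ i, α i : ℕ) - Complex.I * ξ) / 2) / Real.Gamma lam) *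
        (1 / ∏ i, ((α i).factorial : ℝ) : ℝ) := by
  rw [fourierH, (integral_torus_prod_mul (integrable_hyperbolicKernel hlam) _
    (u := fun s : ℝ => s * ξ) (by fun_prop)).2]
  have hμ : 0 < lam + (∑ i, α i : ℕ) := by positivity
  have hG : (Real.Gamma lam : ℂ) ≠ 0 := ofReal_ne_zero.mpr (Real.Gamma_pos_of_pos hlam).ne'
  have hG2 : (Real.Gamma (lam + (∑ i, α i : ℕ)) : ℂ) ≠ 0 :=
    ofReal_ne_zero.mpr (Real.Gamma_pos_of_pos hμ).ne'
  have h1 : ∀ s : ℝ, (∫ t : Fin m → UnitAddCircle, hyperbolicKernel m lam (t, s) *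
      ∏ i, fourier (-(α i : ℤ)) (t i)) = _ := fun s =>
    integral_cpow_sub (k := m) hlam (A := Real.cosh s)
      (by rw [ofReal_re]; linarith [Real.one_le_cosh s]) α
  simp only [h1]
  simp only [mul_assoc]
  rw [integral_const_mul]
  have h2 := gamma_mul_integral_cosh hμ ξ
  rw [mul_comm, ← eq_div_iff hG2] at h2
  -- The surplus 2^{|α|} cancels the 2 in (2m)^{|α|}, and the Gamma function of λ + |α| cancels as
  -- well.
  rw [h2, show lam + (∑ i, α i : ℕ) - 1 = lam - 1 + (∑ i, α i : ℕ) by ring,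
    Real.rpow_add_natCast two_ne_zero]
  push_cast at hG2 ⊢
  rw [mul_pow]
  field_simp

theorem fourierH_hyperbolicKernel_of_neg {lam : ℝ} (hlam : 0 < lam) {α : Fin m → ℤ} (ξ : ℝ)
    (hα : ∃ i, α i < 0) : fourierH (hyperbolicKernel m lam) α ξ = 0 := by
  rw [fourierH, (integral_torus_prod_mul (integrable_hyperbolicKernel hlam) _
    (u := fun s : ℝ => s * ξ) (by fun_prop)).2]
  have h1 : ∀ s : ℝ, (∫ t : Fin m → UnitAddCircle, hyperbolicKernel m lam (t, s) *
      ∏ i, fourier (-α i) (t i)) = 0 := fun s =>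
    integral_cpow_sub_of_neg (k := m) hlam (A := Real.cosh s)
      (by rw [ofReal_re]; linarith [Real.one_le_cosh s]) hα
  simp only [h1, zero_mul, integral_zero, mul_zero]

end Hyperbolic

/-! ### Fourier inversion for the Gamma density -/

section FourierInversion

/-- The base has modulus at least min(c, 1) √(1 + s²), so the power decays like |s|^{-μ}; here μ > 1
is essential. -/
lemma integrable_cpow_neg_vertical {μ c : ℝ} (hμ : 1 < μ) (hc : 0 < c) :
    Integrable fun s : ℝ => (c + 2 * Real.pi * s * I : ℂ) ^ (-μ : ℂ) := by
  have hcont : Continuous fun s : ℝ => (c + 2 * Real.pi * s * I : ℂ) ^ (-μ : ℂ) := by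
    refine Continuous.cpow (by fun_prop) continuous_const fun s => Or.inl ?_
    simpa using hc
  have hi := (integrable_rpow_neg_one_add_norm_sq (E := ℝ) (μ := volume) (r := μ) (by simpa)).const_mul
    ((min c 1) ^ (-μ))
  refine hi.mono' hcont.aestronglyMeasurable (ae_of_all _ fun s => ?_)
  have hm : 0 < min c 1 := lt_min hc one_pos
  have hle : min c 1 * √(1 + ‖s‖ ^ 2) ≤ ‖(c + 2 * Real.pi * s * I : ℂ)‖ := by
    refine abs_le_of_sq_le_sq' ?_ (norm_nonneg _) |>.2
    rw [mul_pow, Real.sq_sqrt (by positivity), ← normSq_eq_norm_sq, normSq_apply]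
    have e1 : (c + 2 * Real.pi * s * I : ℂ).re = c := by simp
    have e2 : (c + 2 * Real.pi * s * I : ℂ).im = 2 * Real.pi * s := by simp
    rw [e1, e2, Real.norm_eq_abs, sq_abs]
    have h1 : min c 1 ^ 2 ≤ c ^ 2 := by gcongr; exact min_le_left _ _
    have h2 : min c 1 ^ 2 ≤ 1 ^ 2 := by gcongr; exact min_le_right _ _
    have h3 : (1 : ℝ) ≤ (2 * Real.pi) ^ 2 := by nlinarith [Real.pi_gt_three]
    have h4 : min c 1 ^ 2 * s ^ 2 ≤ (2 * Real.pi) ^ 2 * s ^ 2 := by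
      gcongr ?_ * s ^ 2
      linarith
    nlinarith
  rw [norm_cpow_neg]
  calc _ ≤ (min c 1 * √(1 + ‖s‖ ^ 2)) ^ (-μ) :=
        Real.rpow_le_rpow_of_nonpos (by positivity) hle (by linarith)
    _ = _ := by
        rw [Real.mul_rpow hm.le (Real.sqrt_nonneg _), Real.sqrt_eq_rpow, ← Real.rpow_mul (by positivity)]
        congr 2; ring

/-- The density of the Gamma distribution, up to normalisation. -/
def gammaDensity (μ c : ℝ) (y : ℝ) : ℂ :=
  (Set.Ioi (0 : ℝ)).indicator (fun y => ((y ^ (μ - 1) : ℝ) : ℂ) * exp (-(c * y))) y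

/-- For μ > 1 the density tends to 0 at the origin. Replacing y by max(y, 0) extends the formula to
the negative axis, since 0 to a nonzero power is 0. -/
lemma continuous_gammaDensity {μ : ℝ} (c : ℝ) (hμ : 1 < μ) : Continuous (gammaDensity μ c) := by
  have h : gammaDensity μ c = fun y => ((max y 0 ^ (μ - 1) : ℝ) : ℂ) * exp (-(c * y)) := by
    ext y
    rw [gammaDensity]
    by_cases hy : 0 < y
    · rw [Set.indicator_of_mem (Set.mem_Ioi.mpr hy), max_eq_left hy.le]
    · rw [Set.indicator_of_notMem (by simpa using hy), max_eq_right (not_lt.mp hy),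
        Real.zero_rpow (by linarith)]
      simp
  rw [h]
  refine (continuous_ofReal.comp ?_).mul (by fun_prop)
  exact (continuous_id.max continuous_const).rpow_const fun y => Or.inr (by linarith)

lemma integrable_gammaDensity {μ c : ℝ} (hμ : 0 < μ) (hc : 0 < c) :
    Integrable (gammaDensity μ c) :=
  (integrable_indicator_iff measurableSet_Ioi).mpr
    (integrableOn_rpow_mul_cexp_neg hμ (by rwa [ofReal_re]))

open FourierTransform in
lemma fourier_gammaDensity {μ c : ℝ} (hμ : 0 < μ) (hc : 0 < c) (v : ℝ) :
    𝓕 (gammaDensity μ c) v = Real.Gamma μ * (c + 2 * Real.pi * v * I : ℂ) ^ (-μ : ℂ) := by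
  rw [Real.fourier_real_eq, ← integral_rpow_mul_cexp_neg hμ (by simpa using hc),
    ← integral_indicator measurableSet_Ioi]
  refine integral_congr_ae (ae_of_all _ fun y => ?_)
  simp only [gammaDensity]
  by_cases hy : y ∈ Set.Ioi (0 : ℝ)
  · rw [Set.indicator_of_mem hy, Set.indicator_of_mem hy, Circle.smul_def, Real.fourierChar_apply,
      smul_eq_mul, mul_left_comm, ← exp_add]
    congr 2
    push_cast
    ring
  · rw [Set.indicator_of_notMem hy, Set.indicator_of_notMem hy, smul_zero]

open FourierTransform in
/-- Fourier inversion for the Gamma distribution. -/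
lemma gamma_mul_integral_cpow_vertical {μ c : ℝ} (hμ : 1 < μ) (hc : 0 < c) (y : ℝ) :
    Real.Gamma μ * ∫ s : ℝ, (c - I * s : ℂ) ^ (-μ : ℂ) * exp (-I * (s * y : ℝ)) =
      2 * Real.pi * gammaDensity μ c y := by
  have hF : 𝓕 (gammaDensity μ c) =
      fun v : ℝ => Real.Gamma μ * (c + 2 * Real.pi * v * I : ℂ) ^ (-μ : ℂ) :=
    funext (fourier_gammaDensity (by linarith) hc)
  have h := congrFun (Continuous.fourierInv_fourier_eq (continuous_gammaDensity c hμ)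
    (integrable_gammaDensity (by linarith) hc)
    (by rw [hF]; exact (integrable_cpow_neg_vertical hμ hc).const_mul _)) y
  rw [← h, Real.fourierInv_eq', hF]
  -- The substitution s = -2πv passes from the normalisation with 2π in the exponent, and from c +
  -- 2πiv to c - is.
  have h2 := Measure.integral_comp_mul_left
    (fun s : ℝ => (c - I * s : ℂ) ^ (-μ : ℂ) * exp (-I * (s * y : ℝ))) (-(2 * Real.pi))
  have hpi : 0 < 2 * Real.pi := by positivity
  rw [abs_inv, abs_neg, abs_of_pos hpi, eq_inv_smul_iff₀ hpi.ne'] at h2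
  rw [← h2, real_smul, mul_left_comm, ← integral_const_mul]
  push_cast
  congr 1
  refine integral_congr_ae (ae_of_all _ fun v => ?_)
  simp only [smul_eq_mul]
  rw [← mul_assoc, mul_comm]
  congr 2
  · simp; ring
  · congr 2; ring

end FourierInversion

/-! ### The Fourier transform of the nilpotent kernels -/

section Nilpotent

variable {k l : ℕ}

lemma integrable_heisenbergDen_cpow {μ : ℝ} (hμ : ((l : ℝ) + 2) / 2 < μ) (y : ℝ)
    (ξ : EuclideanSpace ℝ (Fin l)) :
    Integrable fun p : ℝ × EuclideanSpace ℝ (Fin l) => heisenbergDen p ^ (-μ : ℂ) *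
      exp (-I * (p.1 * y + inner ℝ p.2 ξ : ℝ)) := by
  have hc : Continuous fun p : ℝ × EuclideanSpace ℝ (Fin l) => heisenbergDen p ^ (-μ : ℂ) :=
    continuous_heisenbergDen.cpow continuous_const fun p =>
      Or.inl (one_pos.trans_le (one_le_heisenbergDen_re p))
  refine (integrable_heisenbergDen hμ).mono' (hc.mul (by fun_prop)).aestronglyMeasurable
    (ae_of_all _ fun p => ?_)
  rw [norm_mul, norm_exp_neg_I_mul, mul_one, norm_cpow_neg]

lemma heisenbergDen_cpow (μ : ℝ) (s : ℝ) (b : EuclideanSpace ℝ (Fin l)) :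
    heisenbergDen (s, b) ^ (-μ : ℂ) =
      ((2 ^ μ : ℝ) : ℂ) * (((2 + ‖b‖ ^ 2 : ℝ) : ℂ) - I * s) ^ (-μ : ℂ) := by
  have h : (((2 + ‖b‖ ^ 2 : ℝ) : ℂ) - I * s) = ((2 : ℝ) : ℂ) * heisenbergDen (s, b) := by
    rw [heisenbergDen]; push_cast; ring
  rw [h, mul_cpow_of_re_pos (by simp)
    (one_pos.trans_le (one_le_heisenbergDen_re _)), ← mul_assoc, ofReal_cpow (by norm_num),
    ofReal_ofNat, ← cpow_add _ _ two_ne_zero]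
  simp

/-- The Fourier transform of a power of the automorphy factor of the Heisenberg group. -/
lemma integral_heisenbergDen_cpow {μ : ℝ} (hμ : ((l : ℝ) + 2) / 2 < μ) (hμ1 : 1 < μ) (y : ℝ)
    (ξ : EuclideanSpace ℝ (Fin l)) :
    Real.Gamma μ * ∫ p : ℝ × EuclideanSpace ℝ (Fin l), heisenbergDen p ^ (-μ : ℂ) *
      exp (-I * (p.1 * y + inner ℝ p.2 ξ : ℝ)) =
    if 0 < y then ((2 ^ μ * (2 * Real.pi) * y ^ (μ - 1) * Real.exp (-2 * y) *
      (Real.pi / y) ^ ((l : ℝ) / 2) * Real.exp (-‖ξ‖ ^ 2 / (4 * y)) : ℝ) : ℂ) else 0 := by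
  rw [Measure.volume_eq_prod, integral_prod_symm _ (integrable_heisenbergDen_cpow hμ y ξ),
    ← integral_const_mul]
  -- For fixed b the integral over s is the inversion formula with c = 2 + |b|². For y > 0 it leaves
  -- the Gaussian e^{-y|b|²} to be integrated over b; for y ≤ 0 it vanishes.
  have h1 : ∀ b : EuclideanSpace ℝ (Fin l),
      Real.Gamma μ * ∫ s : ℝ, heisenbergDen (s, b) ^ (-μ : ℂ) *
        exp (-I * (s * y + inner ℝ b ξ : ℝ)) =
      ((2 ^ μ : ℝ) : ℂ) * (2 * Real.pi * gammaDensity μ (2 + ‖b‖ ^ 2) y) *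
        exp (-I * inner ℝ ξ b) := by
    intro b
    rw [← gamma_mul_integral_cpow_vertical hμ1 (by positivity)]
    simp only [heisenbergDen_cpow]
    rw [← integral_const_mul, ← integral_const_mul, ← integral_const_mul, ← integral_mul_const]
    refine integral_congr_ae (ae_of_all _ fun s => ?_)
    simp only
    rw [ofReal_add (s * y), mul_add (-I), exp_add, real_inner_comm]
    ring
  simp only [h1]
  split_ifs with hy
  · have h2 : ∀ b : EuclideanSpace ℝ (Fin l),
        ((2 ^ μ : ℝ) : ℂ) * (2 * Real.pi * gammaDensity μ (2 + ‖b‖ ^ 2) y) *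
          exp (-I * inner ℝ ξ b) =
        ((2 ^ μ * (2 * Real.pi) * y ^ (μ - 1) * Real.exp (-2 * y) : ℝ) : ℂ) *
          exp (-y * ‖b‖ ^ 2 + -I * inner ℝ ξ b) := by
      intro b
      rw [gammaDensity, Set.indicator_of_mem (Set.mem_Ioi.mpr hy), exp_add,
        show -(((2 + ‖b‖ ^ 2 : ℝ) : ℂ) * y) = ((-2 * y : ℝ) : ℂ) + -y * ‖b‖ ^ 2 by push_cast; ring,
        exp_add, ← ofReal_exp]
      push_cast
      ring
    simp only [h2]
    rw [integral_const_mul, GaussianFourier.integral_cexp_neg_mul_sq_norm_add (by simpa using hy)]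
    rw [finrank_euclideanSpace_fin, neg_sq, I_sq,
      show (Real.pi / y : ℂ) = ((Real.pi / y : ℝ) : ℂ) by push_cast; rfl,
      show ((l : ℂ) / 2) = ((l / 2 : ℝ) : ℂ) by push_cast; rfl,
      ← ofReal_cpow (by positivity),
      show (-1 * ‖ξ‖ ^ 2 / (4 * y) : ℂ) = ((-‖ξ‖ ^ 2 / (4 * y) : ℝ) : ℂ) by push_cast; ring,
      ← ofReal_exp, ← ofReal_mul, ← ofReal_mul, ← mul_assoc]
  · have h0 : ∀ c : ℝ, gammaDensity μ c y = 0 := fun c =>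
      Set.indicator_of_notMem (by simpa using hy) _
    simp [h0]

lemma nilpotentKernel_integral_torus {lam : ℝ} (hlam : 0 < lam) (α : Fin k → ℕ)
    (p : ℝ × EuclideanSpace ℝ (Fin l)) :
    ∫ t : Fin k → UnitAddCircle, nilpotentKernel k l lam (t, p) *
      ∏ i, fourier (-(α i : ℤ)) (t i) =
      ((((2 * k : ℝ) ^ (∑ i, α i))⁻¹ * (Real.Gamma (lam + (∑ i, α i : ℕ)) / Real.Gamma lam) *
        (1 / ∏ i, ((α i).factorial : ℝ)) : ℝ) : ℂ) *
        heisenbergDen p ^ (-(lam + (∑ i, α i : ℕ) : ℝ) : ℂ) := by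
  simp only [nilpotentKernel_eq, one_add_shift_eq]
  exact integral_cpow_sub hlam (by linarith [one_le_heisenbergDen_re p]) α

theorem fourierN_nilpotentKernel {lam : ℝ} (h1 : 1 < lam) (hl : ((l : ℝ) + 2) / 2 < lam)
    (α : Fin k → ℕ) {y : ℝ} (ξ : EuclideanSpace ℝ (Fin l)) (hy : 0 < y) :
    fourierN (nilpotentKernel k l lam) (fun i => (α i : ℤ)) y ξ =
      (√(2 * Real.pi) * 2 ^ lam / (Real.Gamma lam * (k : ℝ) ^ (∑ i, α i)) *
        y ^ (lam + (∑ i, α i : ℕ) - 1) * (1 / (2 * y)) ^ ((l : ℝ) / 2) *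
        Real.exp (-2 * y) * Real.exp (-‖ξ‖ ^ 2 / (4 * y)) *
        (1 / ∏ i, ((α i).factorial : ℝ)) : ℝ) := by
  have hlam : 0 < lam := by linarith
  have ha : (0 : ℝ) ≤ (∑ i, α i : ℕ) := Nat.cast_nonneg _
  have hG : Real.Gamma lam ≠ 0 := (Real.Gamma_pos_of_pos hlam).ne'
  have hG2 : Real.Gamma (lam + (∑ i, α i : ℕ)) ≠ 0 :=
    (Real.Gamma_pos_of_pos (by linarith)).ne'
  have h2 := integral_heisenbergDen_cpow (l := l) (μ := lam + (∑ i, α i : ℕ)) (by linarith)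
    (by linarith) y ξ
  rw [if_pos hy, mul_comm, ← eq_div_iff (ofReal_ne_zero.mpr hG2)] at h2
  rw [fourierN, (integral_torus_prod_mul (integrable_nilpotentKernel hl) _
    (u := fun p : ℝ × EuclideanSpace ℝ (Fin l) => p.1 * y + inner ℝ p.2 ξ) (by fun_prop)).2]
  simp only [nilpotentKernel_integral_torus hlam, mul_assoc]
  rw [integral_const_mul, h2, ← ofReal_div, ← ofReal_mul, ← ofReal_mul]
  congr 1
  -- The powers of 2π come from three sources: (2π)^{-(l+1)/2} from the normalisation, 2π from the
  -- inversion, and (π/y)^{l/2} from the Gaussian.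
  have e1 : (1 / (2 * y)) ^ ((l : ℝ) / 2) =
      (2 * Real.pi) ^ (-(l : ℝ) / 2) * (Real.pi / y) ^ ((l : ℝ) / 2) := by
    rw [neg_div, Real.rpow_neg (by positivity), ← Real.inv_rpow (by positivity),
      ← Real.mul_rpow (by positivity) (by positivity)]
    congr 1
    field_simp
  have e2 : (2 * Real.pi) ^ (-((l : ℝ) + 1) / 2) * (2 * Real.pi) =
      √(2 * Real.pi) * (2 * Real.pi) ^ (-(l : ℝ) / 2) := by
    rw [Real.sqrt_eq_rpow, ← Real.rpow_add (by positivity),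
      ← Real.rpow_add_one (by positivity)]
    congr 1; ring
  rw [e1, Real.rpow_add_natCast two_ne_zero, mul_pow]
  have hpi : (2 * Real.pi) ≠ 0 := by positivity
  rw [← eq_div_iff hpi] at e2
  rw [e2]
  field_simp

/-- Two independent reasons: a negative frequency annihilates the inner torus integral, and y ≤ 0
lies outside the support of the Gamma density. -/
theorem fourierN_nilpotentKernel_of_nonpos {lam : ℝ} (h1 : 1 < lam)
    (hl : ((l : ℝ) + 2) / 2 < lam) (α : Fin k → ℤ) (y : ℝ) (ξ : EuclideanSpace ℝ (Fin l))
    (h : y ≤ 0 ∨ ∃ i, α i < 0) : fourierN (nilpotentKernel k l lam) α y ξ = 0 := by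
  have hlam : 0 < lam := by linarith
  rw [fourierN, (integral_torus_prod_mul (integrable_nilpotentKernel hl) _
    (u := fun p : ℝ × EuclideanSpace ℝ (Fin l) => p.1 * y + inner ℝ p.2 ξ) (by fun_prop)).2]
  by_cases hα : ∃ i, α i < 0
  · have : ∀ p : ℝ × EuclideanSpace ℝ (Fin l),
        ∫ t : Fin k → UnitAddCircle, nilpotentKernel k l lam (t, p) *
          ∏ i, fourier (-α i) (t i) = 0 := by
      intro p
      simp only [nilpotentKernel_eq, one_add_shift_eq]
      exact integral_cpow_sub_of_neg hlam (by linarith [one_le_heisenbergDen_re p]) hα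
    simp only [this, zero_mul, integral_zero, mul_zero]
  · have hy := h.resolve_right hα
    push Not at hα
    lift α to Fin k → ℕ using hα
    have ha : (0 : ℝ) ≤ (∑ i, α i : ℕ) := Nat.cast_nonneg _
    have hG2 : (Real.Gamma (lam + (∑ i, α i : ℕ)) : ℂ) ≠ 0 :=
      ofReal_ne_zero.mpr (Real.Gamma_pos_of_pos (by linarith)).ne'
    have h2 := integral_heisenbergDen_cpow (l := l) (μ := lam + (∑ i, α i : ℕ)) (by linarith)
      (by linarith) y ξ
    rw [if_neg (not_lt.mpr hy)] at h2
    simp only [nilpotentKernel_integral_torus hlam, mul_assoc]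
    rw [integral_const_mul, (mul_eq_zero.mp h2).resolve_left hG2, mul_zero, mul_zero]

end Nilpotent

end BallRestriction
end

noncomputable section

namespace BallRestriction

/-! ## Multiplicity free restrictions -/

section Cyclic

variable {Γ E : Type*} [Group Γ] [NormedAddCommGroup E] [InnerProductSpace ℂ E]

/-- The operators of a unitary representation. -/
def repOp (π : Γ →* (E ≃ₗᵢ[ℂ] E)) (γ : Γ) : E →L[ℂ] E := (π γ).toContinuousLinearEquiv

lemma repOp_apply (π : Γ →* (E ≃ₗᵢ[ℂ] E)) (γ : Γ) (v : E) : repOp π γ v = π γ v := rfl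

variable {π : Γ →* (E ≃ₗᵢ[ℂ] E)}

lemma rep_mul_apply (a b : Γ) (v : E) : π (a * b) v = π a (π b v) := by
  rw [map_mul]; rfl

lemma rep_mul_inv_apply (γ : Γ) (v : E) : π γ (π γ⁻¹ v) = v := by
  rw [← rep_mul_apply, mul_inv_cancel, map_one]; rfl

lemma inner_rep_left (γ : Γ) (v w : E) : inner ℂ (π γ v) w = inner ℂ v (π γ⁻¹ w) := by
  rw [← (π γ).inner_map_map v, rep_mul_inv_apply]

lemma span_repOp_commute {A S : E →L[ℂ] E} (hA : A ∈ Submodule.span ℂ (Set.range (repOp π)))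
    (hS : ∀ γ v, S (π γ v) = π γ (S v)) (v : E) : A (S v) = S (A v) := by
  induction hA using Submodule.span_induction with
  | mem A h => obtain ⟨γ, rfl⟩ := h; exact (hS γ v).symm
  | zero => simp
  | add A B _ _ h1 h2 => simp [h1, h2]
  | smul c A _ h => simp [h]

variable [CompleteSpace E]

open ContinuousLinearMap in
lemma adjoint_repOp (γ : Γ) : adjoint (repOp π γ) = repOp π γ⁻¹ := by
  refine ext fun v => ext_inner_left ℂ fun w => ?_
  rw [adjoint_inner_right, repOp_apply, repOp_apply, inner_rep_left]

open ContinuousLinearMap in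
lemma adjoint_mem_span_repOp {A : E →L[ℂ] E}
    (hA : A ∈ Submodule.span ℂ (Set.range (repOp π))) :
    adjoint A ∈ Submodule.span ℂ (Set.range (repOp π)) := by
  induction hA using Submodule.span_induction with
  | mem A h =>
    obtain ⟨γ, rfl⟩ := h
    rw [adjoint_repOp]
    exact Submodule.subset_span ⟨γ⁻¹, rfl⟩
  | zero => simp
  | add A B _ _ h1 h2 => rw [map_add]; exact add_mem h1 h2
  | smul c A _ h => rw [LinearIsometryEquiv.map_smulₛₗ]; exact Submodule.smul_mem _ _ h

open ContinuousLinearMap in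
lemma adjoint_commute_rep {S : E →L[ℂ] E} (hS : ∀ γ v, S (π γ v) = π γ (S v)) (γ : Γ) (v : E) :
    adjoint S (π γ v) = π γ (adjoint S v) := by
  refine ext_inner_right ℂ fun w => ?_
  rw [adjoint_inner_left, inner_rep_left, inner_rep_left, adjoint_inner_left, hS]

open ContinuousLinearMap in
/-- A representation of an abelian group with a cyclic vector is multiplicity free. -/
theorem multiplicityFree_of_cyclic (hcomm : ∀ a b : Γ, a * b = b * a) (v : E)
    (hv : ∀ x, (∀ γ, inner ℂ (π γ v) x = 0) → x = 0) : MultiplicityFree π := by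
  set N := Submodule.span ℂ (Set.range (repOp π)) with hN
  have hNπ : ∀ A ∈ N, ∀ γ w, A (π γ w) = π γ (A w) := by
    intro A hA γ w
    refine span_repOp_commute (S := repOp π γ) hA (fun γ' w' => ?_) w
    rw [repOp_apply, repOp_apply, ← rep_mul_apply, ← rep_mul_apply, hcomm]
  -- The span of the group operators is commutative and closed under adjoints, so its members are
  -- normal.
  have hnorm : ∀ A ∈ N, ∀ w, ‖adjoint A w‖ = ‖A w‖ := by
    intro A hA w
    have h : A (adjoint A w) = adjoint A (A w) :=
      span_repOp_commute hA (hNπ _ (adjoint_mem_span_repOp hA)) w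
    have h2 : inner ℂ (adjoint A w) (adjoint A w) = inner ℂ (A w) (A w) := by
      rw [adjoint_inner_left, h, adjoint_inner_right]
    rw [inner_self_eq_norm_sq_to_K, inner_self_eq_norm_sq_to_K] at h2
    exact (sq_eq_sq₀ (norm_nonneg _) (norm_nonneg _)).mp (by exact_mod_cast h2)
  let ev : (E →L[ℂ] E) →ₗ[ℂ] E := (apply ℂ E v).toLinearMap
  have hdense : (N.map ev).topologicalClosure = ⊤ := by
    rw [Submodule.topologicalClosure_eq_top_iff, Submodule.eq_bot_iff]
    intro x hx
    refine hv x fun γ => ?_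
    exact hx _ ⟨repOp π γ, Submodule.subset_span ⟨γ, rfl⟩, rfl⟩
  -- Cyclicity approximates S v by vectors A_i v with A_i in the span. Normality makes the adjoints
  -- A_i* v Cauchy as well, and testing against the orbit of `v` identifies their limit as S* v.
  have happ : ∀ S : E →L[ℂ] E, (∀ γ v, S (π γ v) = π γ (S v)) →
      ∃ A : ℕ → (E →L[ℂ] E), (∀ i, A i ∈ N) ∧
        Filter.Tendsto (fun i => A i v) Filter.atTop (nhds (S v)) ∧
        Filter.Tendsto (fun i => adjoint (A i) v) Filter.atTop (nhds (adjoint S v)) := by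
    intro S hS
    have hmem : S v ∈ closure ((N.map ev : Submodule ℂ E) : Set E) := by
      rw [← Submodule.topologicalClosure_coe, hdense]; trivial
    obtain ⟨x, hx, hlim⟩ := mem_closure_iff_seq_limit.mp hmem
    choose A hA hAx using hx
    have hlim' : Filter.Tendsto (fun i => A i v) Filter.atTop (nhds (S v)) := by
      convert hlim using 1
      exact funext fun i => hAx i
    have hcau : CauchySeq fun i => adjoint (A i) v := by
      rw [Metric.cauchySeq_iff']
      intro ε hε
      obtain ⟨K, hK⟩ := Metric.cauchySeq_iff'.mp hlim'.cauchySeq ε hε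
      refine ⟨K, fun i hi => ?_⟩
      have := hK i hi
      rw [dist_eq_norm, ← sub_apply] at this ⊢
      rwa [← map_sub, hnorm _ (sub_mem (hA i) (hA K))]
    obtain ⟨u, hu⟩ := cauchySeq_tendsto_of_complete hcau
    refine ⟨A, hA, hlim', ?_⟩
    convert hu using 2
    rw [← sub_eq_zero]
    refine hv _ fun γ => ?_
    rw [inner_sub_right, sub_eq_zero, adjoint_inner_right, hS]
    have l1 : Filter.Tendsto (fun i => inner ℂ (π γ (A i v)) v) Filter.atTop
        (nhds (inner ℂ (π γ (S v)) v)) :=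
      (((π γ).continuous.tendsto _).comp hlim').inner tendsto_const_nhds
    have l2 : Filter.Tendsto (fun i => inner ℂ (π γ v) (adjoint (A i) v)) Filter.atTop
        (nhds (inner ℂ (π γ v) u)) := tendsto_const_nhds.inner hu
    refine tendsto_nhds_unique l1 (l2.congr fun i => ?_)
    rw [adjoint_inner_right, hNπ _ (hA i)]
  -- The cyclic vector separates the commutant, so it remains to compare S T and T S on `v`.
  have hext : ∀ S T : E →L[ℂ] E, (∀ γ v, S (π γ v) = π γ (S v)) →
      (∀ γ v, T (π γ v) = π γ (T v)) → S v = T v → S = T := by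
    intro S T hS hT h
    have hcl : N.map ev ≤ (LinearMap.eqLocus (S : E →ₗ[ℂ] E) (T : E →ₗ[ℂ] E) : Submodule ℂ E) := by
      rintro _ ⟨A, hA, rfl⟩
      change S (A v) = T (A v)
      rw [← span_repOp_commute hA hS, ← span_repOp_commute hA hT, h]
    have hclosed : IsClosed ((LinearMap.eqLocus (S : E →ₗ[ℂ] E) (T : E →ₗ[ℂ] E) : Submodule ℂ E) : Set E) :=
      isClosed_eq S.continuous T.continuous
    have := Submodule.topologicalClosure_minimal _ hcl hclosed
    rw [hdense] at this
    exact ContinuousLinearMap.ext fun x => this (Submodule.mem_top (x := x))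
  intro S T hS hT w
  obtain ⟨A, hA, hlim, hadj⟩ := happ S hS
  suffices h : S ∘L T = T ∘L S from congrArg (fun B => B w) h
  refine hext _ _ (fun γ x => ?_) (fun γ x => ?_) ?_
  · rw [comp_apply, comp_apply, hT, hS]
  · rw [comp_apply, comp_apply, hS, hT]
  rw [comp_apply, comp_apply, ← sub_eq_zero]
  refine hv _ fun γ => ?_
  rw [inner_sub_right, sub_eq_zero]
  -- T commutes with each A_i, so ⟨π(γ)v, T A_i v⟩ = ⟨π(γ) A_i* v, T v⟩; the two sides converge to
  -- the matrix coefficients of T S and of S T.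
  have l1 : Filter.Tendsto (fun i => inner ℂ (π γ v) (T (A i v))) Filter.atTop
      (nhds (inner ℂ (π γ v) (T (S v)))) :=
    tendsto_const_nhds.inner ((T.continuous.tendsto _).comp hlim)
  have l2 : Filter.Tendsto (fun i => inner ℂ (π γ (adjoint (A i) v)) (T v)) Filter.atTop
      (nhds (inner ℂ (π γ (adjoint S v)) (T v))) :=
    (((π γ).continuous.tendsto _).comp hadj).inner tendsto_const_nhds
  have e : inner ℂ (π γ v) (S (T v)) = inner ℂ (π γ (adjoint S v)) (T v) := by
    rw [← adjoint_commute_rep hS, adjoint_inner_left]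
  rw [e]
  refine tendsto_nhds_unique l2 (l1.congr fun i => ?_)
  rw [← hNπ _ (adjoint_mem_span_repOp (hA i)), adjoint_inner_left, span_repOp_commute (hA i) hT]

end Cyclic

section DiscreteSeries

variable {n : ℕ} {lam : ℝ} [Fact (1 ≤ n)] [Fact ((n : ℝ) < lam)]

/-- The restriction of the holomorphic discrete series to a group for which the restriction
principle holds is multiplicity free. -/
theorem ExplicitRestriction.multiplicityFree {H : Subgroup (SU n)} {z₀ : Ball n} {Q : Type}
    [AddCommGroup Q] [TopologicalSpace Q] [MeasureSpace Q] {L : AddSubgroup (Q × ℝ)}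
    {mat : Q → UnitAddCircle → Mat n} {d : Q → ℂ} {φ : ℝ → Q → ℂ} {SD SL : Set ℝ}
    (h : ExplicitRestriction lam H z₀ L mat d φ SD SL) :
    MultiplicityFree ((Bergman.discreteSeries n lam).comp (Htilde H).subtype) := by
  obtain ⟨c, -, -, -, -, -, -, -, -, hinj, -⟩ := h
  refine multiplicityFree_of_cyclic (fun a b => c.iso.injective ?_) (Bergman.repro z₀)
    fun F hF => hinj F fun k => ?_
  · rw [map_mul, map_mul, mul_comm]
  -- The coefficient ⟨π(h) K_{z₀}, F⟩ is the value of π(h⁻¹)F at z₀, which is RF(h). Hence cyclicity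
  -- of K_{z₀} is injectivity of R.
  · have := hF k
    rw [inner_rep_left, Bergman.inner_repro] at this
    rw [R, D, ← this]
    simp only [MonoidHom.comp_apply, Subgroup.coe_subtype, Bergman.eval_discreteSeries,
      Subgroup.coe_inv, inv_inv]
    rfl

/-- Conjugation by π(γ), for a lift γ of g, carries the commutant for H into the one for the
conjugate group, preserving commutation. -/
lemma multiplicityFree_of_conj {H K : Subgroup (SU n)} (g : SU n)
    (hK : H.map (MulAut.conj g).toMonoidHom = K)
    (h : MultiplicityFree ((Bergman.discreteSeries n lam).comp (Htilde K).subtype)) :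
    MultiplicityFree ((Bergman.discreteSeries n lam).comp (Htilde H).subtype) := by
  obtain ⟨γ, hγ⟩ := Gtilde.exists_lift g
  set π := Bergman.discreteSeries n lam
  intro S T hS hT v
  let conjBy : (Bergman n lam →L[ℂ] Bergman n lam) → (Bergman n lam →L[ℂ] Bergman n lam) :=
    fun A => repOp π γ ∘L A ∘L repOp π γ⁻¹
  have hc : ∀ A w, conjBy A w = π γ (A (π γ⁻¹ w)) := fun A w => rfl
  have hinv : ∀ w, π γ⁻¹ (π γ w) = w := fun w => by
    rw [← rep_mul_apply, inv_mul_cancel, map_one]; rfl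
  have key : ∀ A : Bergman n lam →L[ℂ] Bergman n lam,
      (∀ k w, A ((π.comp (Htilde H).subtype) k w) = (π.comp (Htilde H).subtype) k (A w)) →
      ∀ k w, conjBy A ((π.comp (Htilde K).subtype) k w) =
        (π.comp (Htilde K).subtype) k (conjBy A w) := by
    rintro A hA ⟨k, hk⟩ w
    have hmem : γ⁻¹ * k * γ ∈ Htilde H := by
      have hk' : Gtilde.proj n k ∈ K := hk
      rw [← hK] at hk'
      obtain ⟨x, hx, hxk⟩ := hk'
      change Gtilde.proj n (γ⁻¹ * k * γ) ∈ H
      have hγ' : Gtilde.proj n γ = g := hγ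
      rw [map_mul, map_mul, map_inv, hγ', ← hxk]
      simpa [mul_assoc] using hx
    have h2 := hA ⟨_, hmem⟩ (π γ⁻¹ w)
    simp only [MonoidHom.comp_apply, Subgroup.coe_subtype, rep_mul_apply,
      rep_mul_inv_apply] at h2 ⊢
    rw [hc, hc, h2, rep_mul_inv_apply]
  have := h (conjBy S) (conjBy T) (key S hS) (key T hT) (π γ v)
  simp only [hc, hinv] at this
  exact (π γ).injective this

end DiscreteSeries

end BallRestriction
end

noncomputable section

namespace BallRestriction

/-! ## The Hermitian form of signature `(n,1)` -/

/-! ### Joint eigenvectors of commuting operators -/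

section JointEigenvectors

variable {V : Type*} [AddCommGroup V] [Module ℂ V] [FiniteDimensional ℂ V]

/-- A commuting family of operators has a joint eigenvector in every nonzero invariant subspace. -/
lemma exists_joint_eigenvector (S : Set (Module.End ℂ V))
    (hS : ∀ a ∈ S, ∀ b ∈ S, ∀ x, a (b x) = b (a x)) :
    ∀ U : Submodule ℂ V, U ≠ ⊥ → (∀ a ∈ S, ∀ x ∈ U, a x ∈ U) →
      ∃ x ∈ U, x ≠ 0 ∧ ∀ a ∈ S, ∃ c : ℂ, a x = c • x := by
  suffices h : ∀ N : ℕ, ∀ U : Submodule ℂ V, Module.finrank ℂ U = N → U ≠ ⊥ →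
      (∀ a ∈ S, ∀ x ∈ U, a x ∈ U) → ∃ x ∈ U, x ≠ 0 ∧ ∀ a ∈ S, ∃ c : ℂ, a x = c • x from
    fun U => h _ U rfl
  intro N
  induction N using Nat.strong_induction_on with
  | _ N ih =>
  intro U hN hU hinv
  by_cases hsc : ∀ a ∈ S, ∃ c : ℂ, ∀ x ∈ U, a x = c • x
  · obtain ⟨x, hx, hx0⟩ := Submodule.exists_mem_ne_zero_of_ne_bot hU
    exact ⟨x, hx, hx0, fun a ha => (hsc a ha).imp fun c hc => hc x hx⟩
  · push Not at hsc
    obtain ⟨a, ha, hc⟩ := hsc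
    have : Nontrivial U := Submodule.nontrivial_iff_ne_bot.mpr hU
    obtain ⟨μ, hμ⟩ := Module.End.exists_eigenvalue (a.restrict (hinv a ha))
    obtain ⟨y, hy, hy0⟩ := hμ.exists_hasEigenvector
    have hay : a y = μ • (y : V) := by
      have := Module.End.mem_eigenspace_iff.mp hy
      simpa using congrArg Subtype.val this
    -- An operator that is not scalar on U has an eigenspace there which is nonzero, proper, and
    -- invariant under everything commuting with it; the induction is on the dimension.
    let U' : Submodule ℂ V := U ⊓ LinearMap.ker (a - μ • LinearMap.id)
    have hmem : ∀ x, x ∈ U' ↔ x ∈ U ∧ a x = μ • x := fun x => by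
      simp [U', sub_eq_zero]
    have hlt : U' < U := by
      refine lt_of_le_of_ne inf_le_left fun h => ?_
      obtain ⟨x, hx, hne⟩ := hc μ
      rw [← h] at hx
      exact hne ((hmem x).mp hx).2
    obtain ⟨x, hx, h⟩ := ih _ (hN ▸ Submodule.finrank_lt_finrank_of_lt hlt) U' rfl
      (fun h => hy0 (by
        have : (y : V) ∈ U' := (hmem y).mpr ⟨y.2, hay⟩
        rw [h, Submodule.mem_bot] at this
        exact Subtype.ext this))
      (fun b hb x hx => by
        rw [hmem] at hx ⊢
        exact ⟨hinv b hb x hx.1, by rw [hS a ha b hb, hx.2, map_smul]⟩)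
    exact ⟨x, hlt.le hx, h⟩

/-- An operator with a single eigenvalue on an invariant subspace is nilpotent there up to a
scalar. -/
lemma exists_pow_sub_eq_zero (T : Module.End ℂ V) (U : Submodule ℂ V) (hU : ∀ x ∈ U, T x ∈ U)
    (c : ℂ) (h : ∀ μ, ∀ x ∈ U, x ≠ 0 → T x = μ • x → μ = c) {x : V} (hx : x ∈ U) :
    ∃ j : ℕ, ((T - c • 1) ^ j) x = 0 := by
  set T' : Module.End ℂ U := T.restrict hU with hT'
  have hbot : ∀ μ, μ ≠ c → T'.maxGenEigenspace μ = ⊥ := by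
    intro μ hμ
    by_contra hne
    have h1 : T'.HasEigenvalue μ := Module.End.HasUnifEigenvalue.lt (by simp)
      (show T'.HasUnifEigenvalue μ ⊤ from hne)
    obtain ⟨y, hy, hy0⟩ := h1.exists_hasEigenvector
    have := Module.End.mem_eigenspace_iff.mp hy
    exact hμ (h μ y y.2 (fun h => hy0 (Subtype.ext h)) (by simpa [hT'] using congrArg Subtype.val this))
  have htop : T'.maxGenEigenspace c = ⊤ := by
    rw [← Module.End.iSup_maxGenEigenspace_eq_top T']
    refine le_antisymm (le_iSup T'.maxGenEigenspace c) (iSup_le fun μ => ?_)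
    by_cases hμ : μ = c
    · rw [hμ]
    · rw [hbot μ hμ]; exact bot_le
  have hxm : (⟨x, hx⟩ : U) ∈ T'.maxGenEigenspace c := by rw [htop]; trivial
  obtain ⟨j, hj⟩ := Module.End.mem_maxGenEigenspace _ _ _ |>.mp hxm
  refine ⟨j, ?_⟩
  have hp : ∀ (j : ℕ) (y : U), (((T' - c • 1) ^ j) y : V) = ((T - c • 1) ^ j) (y : V) := by
    intro j
    induction j with
    | zero => intro y; simp
    | succ j ih => intro y; rw [pow_succ, pow_succ, Module.End.mul_apply, Module.End.mul_apply, ih]; simp [hT']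
  rw [← hp j ⟨x, hx⟩, hj]
  rfl

end JointEigenvectors

/-! ### Non-negative vectors and negative orthonormal families -/

section Form

variable {n : ℕ}

/-- The Hermitian form of signature `(n,1)`, linear in the second variable. -/
def hform (n : ℕ) : (Fin n ⊕ Unit → ℂ) →ₗ⋆[ℂ] (Fin n ⊕ Unit → ℂ) →ₗ[ℂ] ℂ :=
  LinearMap.mk₂'ₛₗ (starRingEnd ℂ) (RingHom.id ℂ)
    (fun x y => conj (x (.inr ())) * y (.inr ()) - ∑ i, conj (x (.inl i)) * y (.inl i))
    (fun x x' y => by simp [add_mul, Finset.sum_add_distrib]; ring)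
    (fun c x y => by simp [Finset.mul_sum, mul_sub, mul_assoc])
    (fun x y y' => by simp [mul_add, Finset.sum_add_distrib]; ring)
    (fun c x y => by simp [Finset.mul_sum, mul_sub, mul_left_comm])

lemma hform_apply (x y : Fin n ⊕ Unit → ℂ) : hform n x y =
    conj (x (.inr ())) * y (.inr ()) - ∑ i, conj (x (.inl i)) * y (.inl i) := rfl

lemma hform_eq_dotProduct (x y : Fin n ⊕ Unit → ℂ) :
    hform n x y = star x ⬝ᵥ (J n).mulVec y := by
  simp [hform_apply, J, Matrix.mulVec_diagonal, dotProduct, Fintype.sum_sum_type]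
  ring

lemma hform_smul_left (c : ℂ) (x y : Fin n ⊕ Unit → ℂ) :
    hform n (c • x) y = conj c * hform n x y := by
  rw [LinearMap.map_smulₛₗ, LinearMap.smul_apply, smul_eq_mul]

lemma hform_smul_right (c : ℂ) (x y : Fin n ⊕ Unit → ℂ) :
    hform n x (c • y) = c * hform n x y := map_smul _ _ _

lemma conj_hform (x y : Fin n ⊕ Unit → ℂ) : conj (hform n x y) = hform n y x := by
  simp [hform_apply, mul_comm]

lemma hform_self_eq (x : Fin n ⊕ Unit → ℂ) : hform n x x = ((hform n x x).re : ℂ) :=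
  (conj_eq_iff_re.mp (conj_hform x x)).symm

lemma hform_self_re (x : Fin n ⊕ Unit → ℂ) :
    (hform n x x).re = ‖x (.inr ())‖ ^ 2 - ∑ i, ‖x (.inl i)‖ ^ 2 := by
  have h : hform n x x = ((‖x (.inr ())‖ ^ 2 - ∑ i, ‖x (.inl i)‖ ^ 2 : ℝ) : ℂ) := by
    rw [hform_eq_dotProduct, form_eq]
  rw [h, ofReal_re]

lemma hform_self_smul (c : ℂ) (x : Fin n ⊕ Unit → ℂ) :
    (hform n (c • x) (c • x)).re = ‖c‖ ^ 2 * (hform n x x).re := by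
  rw [map_smul, LinearMap.map_smulₛₗ, LinearMap.smul_apply, smul_smul, smul_eq_mul,
    mul_conj, re_ofReal_mul, normSq_eq_norm_sq]

/-- The reverse Cauchy-Schwarz inequality: orthogonal non-negative vectors are proportional. -/
lemma exists_smul_of_hform_nonneg {x y : Fin n ⊕ Unit → ℂ} (hx : 0 ≤ (hform n x x).re)
    (hy : 0 ≤ (hform n y y).re) (hxy : hform n x y = 0) (hx0 : x ≠ 0) : ∃ c : ℂ, y = c • x := by
  have hzero : ∀ z : Fin n ⊕ Unit → ℂ, z (.inr ()) = 0 → 0 ≤ (hform n z z).re → z = 0 := by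
    intro z hz h
    rw [hform_self_re, hz, norm_zero] at h
    have hs : ∑ i, ‖z (.inl i)‖ ^ 2 = 0 :=
      le_antisymm (by linarith) (Finset.sum_nonneg fun i _ => sq_nonneg _)
    rw [Finset.sum_eq_zero_iff_of_nonneg fun i _ => sq_nonneg _] at hs
    ext (i | i)
    · simpa using hs i (Finset.mem_univ i)
    · exact hz
  have hx1 : x (.inr ()) ≠ 0 := fun h => hx0 (hzero x h hx)
  -- The multiple of x is chosen to cancel the last coordinate. By orthogonality the difference has
  -- non-negative length, and such a vector with last coordinate 0 is zero.
  refine ⟨y (.inr ()) / x (.inr ()), sub_eq_zero.mp (hzero _ ?_ ?_)⟩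
  · simp [hx1]
  · have hyx : hform n y x = 0 := by rw [← conj_hform, hxy, map_zero]
    generalize y (.inr ()) / x (.inr ()) = c
    have h1 : hform n (y - c • x) (y - c • x) = hform n y y + hform n (c • x) (c • x) := by
      simp [map_sub, LinearMap.sub_apply, hxy, hyx]
    rw [h1, add_re, hform_self_smul]
    positivity

lemma eq_zero_of_hform_nonneg {x y : Fin n ⊕ Unit → ℂ} (hx : 0 < (hform n x x).re)
    (hy : 0 ≤ (hform n y y).re) (hxy : hform n x y = 0) : y = 0 := by
  obtain ⟨c, rfl⟩ := exists_smul_of_hform_nonneg hx.le hy hxy (by rintro rfl; simp at hx)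
  rw [map_smul, smul_eq_mul, hform_self_eq x, mul_eq_zero, ofReal_eq_zero] at hxy
  rw [hxy.resolve_right hx.ne', zero_smul]

/-- A null vector has a nonzero last coordinate. -/
lemma apply_inr_ne_zero {x : Fin n ⊕ Unit → ℂ} (hx : 0 ≤ (hform n x x).re) (hx0 : x ≠ 0) :
    x (.inr ()) ≠ 0 := by
  intro h
  have h2 : hform n (Pi.single (.inr ()) 1) x = 0 := by simp [hform_apply, h]
  exact hx0 (eq_zero_of_hform_nonneg (by simp [hform_apply]) hx h2)

/-- The action of `SU(n,1)` on column vectors. -/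
def vecAct (g : SU n) : Module.End ℂ (Fin n ⊕ Unit → ℂ) := (toMat g).mulVecLin

lemma vecAct_apply (g : SU n) (x : Fin n ⊕ Unit → ℂ) : vecAct g x = (toMat g).mulVec x := rfl

lemma vecAct_mul (g h : SU n) (x : Fin n ⊕ Unit → ℂ) :
    vecAct (g * h) x = vecAct g (vecAct h x) := by
  rw [vecAct_apply, toMat_mul, ← Matrix.mulVec_mulVec]; rfl

lemma vecAct_one (x : Fin n ⊕ Unit → ℂ) : vecAct 1 x = x := by
  rw [vecAct_apply, toMat_one, Matrix.one_mulVec]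

lemma vecAct_injective (g : SU n) {x : Fin n ⊕ Unit → ℂ} (h : vecAct g x = 0) : x = 0 := by
  rw [← vecAct_one x, ← inv_mul_cancel g, vecAct_mul, h, map_zero]

lemma hform_vecAct (g : SU n) (x y : Fin n ⊕ Unit → ℂ) :
    hform n (vecAct g x) (vecAct g y) = hform n x y := by
  rw [hform_eq_dotProduct, hform_eq_dotProduct, vecAct_apply, vecAct_apply, Matrix.star_mulVec,
    Matrix.mulVec_mulVec, ← Matrix.dotProduct_mulVec, Matrix.mulVec_mulVec, ← Matrix.mul_assoc,
    SU.conj_left]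

/-- A family of vectors of length `-1` which are orthogonal to each other. -/
def IsNegOrtho {ι : Type*} [DecidableEq ι] (f : ι → (Fin n ⊕ Unit → ℂ)) : Prop :=
  ∀ i j, hform n (f i) (f j) = if i = j then -1 else 0

lemma IsNegOrtho.sum_left {ι : Type*} [DecidableEq ι] [Fintype ι] {f : ι → (Fin n ⊕ Unit → ℂ)}
    (hf : IsNegOrtho f) (c : ι → ℂ) (i : ι) : hform n (f i) (∑ j, c j • f j) = -c i := by
  simp [map_sum, hf i]

/-- Such a family is linearly independent. This bound is what makes maximal families exist. -/
lemma IsNegOrtho.card_le {ι : Type*} [DecidableEq ι] [Fintype ι] {f : ι → (Fin n ⊕ Unit → ℂ)}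
    (hf : IsNegOrtho f) : Fintype.card ι ≤ n + 1 := by
  have hli : LinearIndependent ℂ f := by
    rw [Fintype.linearIndependent_iff]
    intro c hc i
    have := hf.sum_left c i
    rw [hc, map_zero] at this
    exact neg_eq_zero.mp this.symm
  simpa using hli.fintype_card_le_finrank

/-- There are maximal orthonormal families of negative vectors with a given property. -/
lemma exists_maximal_negOrtho (Q : (Fin n ⊕ Unit → ℂ) → Prop)
    (hQ : ∀ (r : ℝ) x, Q x → Q ((r : ℂ) • x)) :
    ∃ (k : ℕ) (f : Fin k → (Fin n ⊕ Unit → ℂ)), (∀ i, Q (f i)) ∧ IsNegOrtho f ∧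
      ∀ x, Q x → (∀ i, hform n (f i) x = 0) → 0 ≤ (hform n x x).re := by
  -- Otherwise every family can be enlarged by a normalised negative vector, and a family of n + 2
  -- vectors would exceed the dimension. Only real rescaling is used, so `Q` need not be stable
  -- under complex scalars.
  by_contra hcon
  push Not at hcon
  have key : ∀ k : ℕ, ∃ f : Fin k → (Fin n ⊕ Unit → ℂ), (∀ i, Q (f i)) ∧ IsNegOrtho f := by
    intro k
    induction k with
    | zero => exact ⟨Fin.elim0, fun i => i.elim0, fun i => i.elim0⟩
    | succ k ih =>
      obtain ⟨f, hf, ho⟩ := ih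
      obtain ⟨x, hx, hxo, hneg⟩ := hcon k f hf ho
      set r : ℝ := 1 / √(-(hform n x x).re) with hr
      have hr2 : r ^ 2 * (hform n x x).re = -1 := by
        rw [hr, div_pow, Real.sq_sqrt (by linarith)]
        field_simp
        rw [div_self hneg.ne]
      have hself : hform n ((r : ℂ) • x) ((r : ℂ) • x) = -1 := by
        rw [hform_self_eq, hform_self_smul, norm_real, Real.norm_eq_abs, sq_abs, hr2]
        simp
      refine ⟨Fin.cons ((r : ℂ) • x) f, fun i => ?_, fun i j => ?_⟩
      · refine Fin.cases ?_ (fun i => ?_) i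
        · exact hQ r x hx
        · exact hf i
      · have hz : ∀ i, hform n (f i) ((r : ℂ) • x) = 0 := fun i => by rw [map_smul, hxo, smul_zero]
        refine Fin.cases ?_ (fun i => ?_) i <;> refine Fin.cases ?_ (fun j => ?_) j
        · simpa using hself
        · rw [Fin.cons_zero, Fin.cons_succ, ← conj_hform, hz, map_zero, if_neg (Fin.succ_ne_zero j).symm]
        · rw [Fin.cons_zero, Fin.cons_succ, hz, if_neg (Fin.succ_ne_zero i)]
        · simpa [Fin.succ_inj] using ho i j
  obtain ⟨f, -, ho⟩ := key (n + 2)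
  have := ho.card_le
  simp at this

end Form

/-! ### Orthonormal frames and conjugation -/

section Frame

variable {n : ℕ} {κ : Type*} [Fintype κ] [DecidableEq κ]

/-- An orthonormal frame of type `(-, …, -, +)`. -/
def IsFrame (F : κ ⊕ Unit → (Fin n ⊕ Unit → ℂ)) : Prop :=
  (∀ i j, hform n (F (.inl i)) (F (.inl j)) = if i = j then -1 else 0) ∧
  (∀ i, hform n (F (.inl i)) (F (.inr ())) = 0) ∧ hform n (F (.inr ())) (F (.inr ())) = 1

/-- A complete frame has `n + 1` elements. -/
lemma IsFrame.card_eq {F : κ ⊕ Unit → (Fin n ⊕ Unit → ℂ)} (hF : IsFrame F)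
    (hc : ∀ x, (∀ i, hform n (F i) x = 0) → x = 0) : Fintype.card κ = n := by
  have hr : ∀ i, hform n (F (.inr ())) (F (.inl i)) = 0 := fun i => by
    rw [← conj_hform, hF.2.1, map_zero]
  have hl : ∀ (c : κ ⊕ Unit → ℂ) (i : κ), hform n (F (.inl i)) (∑ j, c j • F j) = -c (.inl i) := by
    intro c i
    simp [Fintype.sum_sum_type, map_add, map_sum, hF.1, hF.2.1]
  have hr' : ∀ c : κ ⊕ Unit → ℂ, hform n (F (.inr ())) (∑ j, c j • F j) = c (.inr ()) := by
    intro c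
    simp [Fintype.sum_sum_type, map_add, map_sum, hr, hF.2.2]
  have hli : LinearIndependent ℂ F := by
    rw [Fintype.linearIndependent_iff]
    rintro c h (i | i)
    · have := hl c i
      rw [h, map_zero] at this
      exact neg_eq_zero.mp this.symm
    · have := hr' c
      rw [h, map_zero] at this
      exact this.symm
  have hspan : ⊤ ≤ Submodule.span ℂ (Set.range F) := by
    intro x _
    let c : κ ⊕ Unit → ℂ := Sum.elim (fun i => -hform n (F (.inl i)) x)
      (fun _ => hform n (F (.inr ())) x)
    have : x = ∑ j, c j • F j := by
      rw [← sub_eq_zero]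
      refine hc _ ?_
      rintro (i | i)
      · rw [map_sub, hl]; simp [c]
      · rw [map_sub, hr']; simp [c]
    rw [this]
    exact Submodule.sum_mem _ fun j _ => Submodule.smul_mem _ _ (Submodule.subset_span ⟨j, rfl⟩)
  have h1 := Module.finrank_eq_card_basis (Module.Basis.mk hli hspan)
  simp at h1
  exact h1.symm

/-- The change of basis given by a frame, as an element of `SU(n,1)`. -/
lemma IsFrame.exists_conj {F : κ ⊕ Unit → (Fin n ⊕ Unit → ℂ)} (hF : IsFrame F)
    (ε : κ ≃ Fin n) : ∃ g : SU n, ∀ (h : SU n) (C : Matrix (κ ⊕ Unit) (κ ⊕ Unit) ℂ),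
      (∀ j, vecAct h (F j) = ∑ i, C i j • F i) →
        toMat (g * h * g⁻¹) = C.submatrix (Sum.map ε.symm id) (Sum.map ε.symm id) := by
  set σ : Fin n ⊕ Unit → κ ⊕ Unit := Sum.map ε.symm id with hσ
  have hσb : Function.Bijective σ := (Equiv.sumCongr ε.symm (Equiv.refl Unit)).bijective
  let P : Mat n := Matrix.of fun a b => F (σ b) a
  have hPJ : P.conjTranspose * J n * P = J n := by
    ext a b
    have : (P.conjTranspose * J n * P) a b = hform n (F (σ a)) (F (σ b)) := by
      rw [hform_eq_dotProduct, Matrix.mul_assoc, Matrix.mul_apply]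
      rfl
    rw [this, J]
    rcases a with a | a <;> rcases b with b | b
    · rw [hσ]
      simp only [Sum.map_inl, hF.1, EmbeddingLike.apply_eq_iff_eq, Matrix.diagonal_apply,
        Sum.inl.injEq, Sum.elim_inl]
    · simp [hσ, hF.2.1]
    · rw [← conj_hform]; simp [hσ, hF.2.1]
    · simp [hσ, hF.2.2]
  have hdet : ‖P.det‖ = 1 := by
    have h1 := congrArg Matrix.det hPJ
    have hJ : (J n).det ≠ 0 := by
      have := congrArg Matrix.det (J_mul_J n)
      rw [Matrix.det_mul, Matrix.det_one] at this
      exact left_ne_zero_of_mul_eq_one this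
    rw [Matrix.det_mul, Matrix.det_mul, Matrix.det_conjTranspose, mul_right_comm,
      mul_eq_right₀ hJ, RCLike.star_def, mul_comm, mul_conj, normSq_eq_norm_sq] at h1
    have h2 : ‖P.det‖ ^ 2 = 1 := by exact_mod_cast h1
    exact (pow_eq_one_iff_of_nonneg (norm_nonneg _) two_ne_zero).mp h2
  have hP0 : P.det ≠ 0 := norm_ne_zero_iff.mp (by rw [hdet]; exact one_ne_zero)
  -- The frame matrix preserves the form but may have any determinant of modulus one. An (n+1)-st
  -- root corrects it; the root is unimodular, so the form is still preserved, and conjugation does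
  -- not notice the scalar.
  obtain ⟨μ, hμ⟩ := IsAlgClosed.exists_pow_nat_eq (P.det)⁻¹ n.succ_pos
  have hμ1 : ‖μ‖ = 1 := by
    have := congrArg norm hμ
    rw [norm_pow, norm_inv, hdet, inv_one] at this
    exact (pow_eq_one_iff_of_nonneg (norm_nonneg _) n.succ_ne_zero).mp this
  have hμ2 : star μ * μ = 1 := by
    rw [RCLike.star_def, mul_comm, mul_conj, normSq_eq_norm_sq, hμ1]; simp
  have hAJ : (μ • P).conjTranspose * J n * (μ • P) = J n := by
    rw [Matrix.conjTranspose_smul, Matrix.smul_mul, Matrix.smul_mul, Matrix.mul_smul, smul_smul,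
      hμ2, one_smul, hPJ]
  have hAJ' : (μ • P) * J n * (μ • P).conjTranspose = J n := by
    have h1 : (J n * (μ • P).conjTranspose * J n) * (μ • P) = 1 := by
      rw [Matrix.mul_assoc, Matrix.mul_assoc, ← Matrix.mul_assoc _ (J n), hAJ, J_mul_J]
    have h2 := mul_eq_one_comm.mp h1
    calc _ = (μ • P) * (J n * (μ • P).conjTranspose * J n) * J n := by
          simp only [Matrix.mul_assoc, J_mul_J, Matrix.mul_one]
      _ = J n := by rw [h2, Matrix.one_mul]
  let g₀ : SU n := ⟨⟨μ • P, by
    rw [Matrix.det_smul, Fintype.card_sum, Fintype.card_fin, Fintype.card_unit]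
    exact (congrArg (· * P.det) hμ).trans (inv_mul_cancel₀ hP0)⟩, hAJ'⟩
  have hg₀ : toMat g₀ = μ • P := rfl
  refine ⟨g₀⁻¹, fun h C hC => ?_⟩
  have hmul : toMat h * P = P * C.submatrix σ σ := by
    ext a b
    have h1 := congrFun (hC (σ b)) a
    rw [Finset.sum_apply] at h1
    rw [Matrix.mul_apply, Matrix.mul_apply]
    refine h1.trans ?_
    rw [← hσb.sum_comp]
    exact Finset.sum_congr rfl fun c _ => mul_comm _ _
  have h2 : toMat g₀ * toMat (g₀⁻¹ * h * g₀⁻¹⁻¹) = toMat g₀ * C.submatrix σ σ := by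
    rw [← toMat_mul, inv_inv, ← mul_assoc, mul_inv_cancel_left, toMat_mul, hg₀, Matrix.mul_smul,
      hmul, Matrix.smul_mul]
  have h3 : toMat g₀⁻¹ * toMat g₀ = 1 := by rw [← toMat_mul, inv_mul_cancel, toMat_one]
  calc _ = toMat g₀⁻¹ * toMat g₀ * toMat (g₀⁻¹ * h * g₀⁻¹⁻¹) := by rw [h3, Matrix.one_mul]
    _ = C.submatrix σ σ := by rw [Matrix.mul_assoc, h2, ← Matrix.mul_assoc, h3, Matrix.one_mul]

end Frame

end BallRestriction
end

noncomputable section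

namespace BallRestriction

/-! ## Conjugation of abelian subgroups into the model groups -/

variable {n : ℕ}

/-- A joint eigenvector of the elements of a subgroup. -/
def IsJointEigenvector (H : Subgroup (SU n)) (x : Fin n ⊕ Unit → ℂ) : Prop :=
  ∀ h ∈ H, ∃ c : ℂ, vecAct h x = c • x

/-- The orthogonal complement of a set of vectors. -/
def perp (S : Set (Fin n ⊕ Unit → ℂ)) : Submodule ℂ (Fin n ⊕ Unit → ℂ) where
  carrier := {x | ∀ y ∈ S, hform n y x = 0}
  zero_mem' := fun y _ => map_zero _
  add_mem' := fun {a b} ha hb y hy => by rw [map_add, ha y hy, hb y hy, add_zero]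
  smul_mem' := fun c x hx y hy => by rw [map_smul, hx y hy, smul_zero]

variable {H : Subgroup (SU n)}

lemma IsJointEigenvector.smul {x : Fin n ⊕ Unit → ℂ} (hx : IsJointEigenvector H x) (r : ℂ) :
    IsJointEigenvector H (r • x) := fun h hh => by
  obtain ⟨c, hc⟩ := hx h hh
  exact ⟨c, by rw [map_smul, hc, smul_comm]⟩

/-- If hy = cy, invariance of the form gives conj(c) ⟨y, hx⟩ = ⟨y, x⟩ = 0. The eigenvalue can vanish
only for y = 0. -/
lemma perp_invariant {S : Set (Fin n ⊕ Unit → ℂ)} (hS : ∀ y ∈ S, IsJointEigenvector H y) {h : SU n}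
    (hh : h ∈ H) {x : Fin n ⊕ Unit → ℂ} (hx : x ∈ perp S) : vecAct h x ∈ perp S := by
  intro y hy
  obtain ⟨c, hc⟩ := hS y hy h hh
  by_cases hc0 : c = 0
  · rw [hc0, zero_smul] at hc
    rw [vecAct_injective h hc, map_zero, LinearMap.zero_apply]
  · have h1 := hform_vecAct h y x
    rw [hc, LinearMap.map_smulₛₗ, LinearMap.smul_apply, hx y hy, smul_eq_mul, mul_eq_zero] at h1
    exact h1.resolve_left (by simpa using hc0)

/-- An invariant subspace of the space of column vectors contains a joint eigenvector of an
abelian group. -/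
lemma exists_isJointEigenvector (hH : ∀ x ∈ H, ∀ y ∈ H, x * y = y * x)
    (U : Submodule ℂ (Fin n ⊕ Unit → ℂ)) (hU : U ≠ ⊥)
    (hinv : ∀ h ∈ H, ∀ x ∈ U, vecAct h x ∈ U) : ∃ x ∈ U, x ≠ 0 ∧ IsJointEigenvector H x := by
  obtain ⟨x, hx, hx0, h⟩ := exists_joint_eigenvector (vecAct '' (H : Set (SU n)))
    (by
      rintro _ ⟨a, ha, rfl⟩ _ ⟨b, hb, rfl⟩ x
      rw [← vecAct_mul, ← vecAct_mul, hH a ha b hb]) U hU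
    (by rintro _ ⟨a, ha, rfl⟩ x hx; exact hinv a ha x hx)
  exact ⟨x, hx, hx0, fun g hg => h _ ⟨g, hg, rfl⟩⟩

/-- The complement of joint eigenvectors vanishes if it contains no joint eigenvectors. -/
lemma eq_zero_of_mem_perp (hH : ∀ x ∈ H, ∀ y ∈ H, x * y = y * x)
    {S : Set (Fin n ⊕ Unit → ℂ)} (hS : ∀ y ∈ S, IsJointEigenvector H y)
    (h0 : ∀ y ∈ perp S, IsJointEigenvector H y → y = 0) {x : Fin n ⊕ Unit → ℂ}
    (hx : x ∈ perp S) : x = 0 := by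
  by_contra hx0
  obtain ⟨y, hy, hy0, hj⟩ := exists_isJointEigenvector hH (perp S)
    (fun h => hx0 (by rwa [h, Submodule.mem_bot] at hx)) (fun h hh x hx => perp_invariant hS hh hx)
  exact hy0 (h0 y hy hj)

lemma norm_eigenvalue {h : SU n} {x : Fin n ⊕ Unit → ℂ} {c : ℂ} (hc : vecAct h x = c • x)
    (hx : (hform n x x).re ≠ 0) : ‖c‖ = 1 := by
  have h1 := congrArg re (hform_vecAct h x x)
  rw [hc, hform_self_smul] at h1
  exact (pow_eq_one_iff_of_nonneg (norm_nonneg _) two_ne_zero).mp (mul_right_cancel₀ hx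
    (h1.trans (one_mul _).symm))

/-! ### A frame of joint eigenvectors -/

section Elliptic

lemma exists_conj_le_ellipticGroup (F : Fin n ⊕ Unit → (Fin n ⊕ Unit → ℂ)) (hF : IsFrame F)
    (hJ : ∀ i, IsJointEigenvector H (F i)) :
    ∃ g : SU n, H.map (MulAut.conj g).toMonoidHom ≤ ellipticGroup n := by
  obtain ⟨g, hg⟩ := hF.exists_conj (Equiv.refl _)
  refine ⟨g, ?_⟩
  rintro _ ⟨h, hh, rfl⟩
  choose c hc using fun i => hJ i h hh
  have hn : ∀ i, ‖c i‖ = 1 := by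
    rintro (i | i)
    · exact norm_eigenvalue (hc _) (by rw [hF.1]; simp)
    · exact norm_eigenvalue (hc _) (by rw [hF.2.2]; simp)
  have h0 : c (.inr ()) ≠ 0 := norm_ne_zero_iff.mp (by rw [hn]; exact one_ne_zero)
  obtain ⟨a, ha⟩ := exists_expc_eq (hn (.inr ()))
  choose t ht using fun i : Fin n => exists_expc_eq (z := c (.inl i) / c (.inr ()))
    (by rw [norm_div, hn, hn, div_one])
  refine ⟨(t, a), ?_⟩
  refine (hg h (matE t a) ?_).trans ?_
  · rintro (j | j)
    · rw [hc]
      simp [matE, Matrix.diagonal_apply, ht, ha, mul_div_cancel₀ _ h0]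
    · rw [hc]
      simp [matE, Matrix.diagonal_apply, ha]
  · ext i j
    simp

end Elliptic

/-! ### A pair of null joint eigenvectors -/

section HyperbolicFrame

set_option linter.unusedSectionVars false

variable {ι : Type*} [Fintype ι] [DecidableEq ι]

/-- The frame obtained from negative vectors and a hyperbolic pair. -/
def pairFrame (f : ι → (Fin n ⊕ Unit → ℂ)) (v w : Fin n ⊕ Unit → ℂ) :
    (ι ⊕ Unit) ⊕ Unit → (Fin n ⊕ Unit → ℂ) :=
  Sum.elim (Sum.elim f fun _ => (2⁻¹ : ℂ) • (v - w)) fun _ => (2⁻¹ : ℂ) • (v + w)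

variable {f : ι → (Fin n ⊕ Unit → ℂ)} {v w : Fin n ⊕ Unit → ℂ}

lemma conj_two : conj (2 : ℂ) = 2 := conj_ofNat 2

/-- The normalisation ⟨w, v⟩ = 2 is chosen so that the half difference and half sum of v and w have
lengths -1 and 1. -/
lemma isFrame_pairFrame (hf : IsNegOrtho f) (hfv : ∀ i, hform n (f i) v = 0)
    (hfw : ∀ i, hform n (f i) w = 0) (hvv : hform n v v = 0) (hww : hform n w w = 0)
    (hwv : hform n w v = 2) : IsFrame (pairFrame f v w) := by
  have hvf : ∀ i, hform n v (f i) = 0 := fun i => by rw [← conj_hform, hfv, map_zero]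
  have hwf : ∀ i, hform n w (f i) = 0 := fun i => by rw [← conj_hform, hfw, map_zero]
  have hvw : hform n v w = 2 := by rw [← conj_hform, hwv]; exact conj_ofNat 2
  refine ⟨?_, ?_, ?_⟩
  · rintro (i | i) (j | j)
    · simpa [pairFrame] using hf i j
    · simp [pairFrame, hfv, hfw]
    · simp [pairFrame, hvf, hwf]
    · simp [pairFrame, hvv, hww, hwv, hvw, conj_two]; norm_num
  · rintro (i | i)
    · simp [pairFrame, hfv, hfw]
    · simp [pairFrame, hvv, hww, hwv, hvw]
  · simp [pairFrame, hvv, hww, hwv, hvw, conj_two]; norm_num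

lemma pairFrame_complete
    (h : ∀ x, (∀ i, hform n (f i) x = 0) → hform n v x = 0 → hform n w x = 0 → x = 0)
    (x : Fin n ⊕ Unit → ℂ) (hx : ∀ i, hform n (pairFrame f v w i) x = 0) : x = 0 := by
  have h1 := hx (.inl (.inr ()))
  have h2 := hx (.inr ())
  simp only [pairFrame, Sum.elim_inl, Sum.elim_inr, LinearMap.map_smulₛₗ, map_sub, map_add,
    LinearMap.smul_apply, LinearMap.sub_apply, LinearMap.add_apply, smul_eq_mul, mul_eq_zero] at h1 h2
  have h1' := h1.resolve_left (by simp)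
  have h2' := h2.resolve_left (by simp)
  refine h x (fun i => hx (.inl (.inl i))) ?_ ?_
  · linear_combination (1 / 2 : ℂ) * h1' + (1 / 2 : ℂ) * h2'
  · linear_combination (-1 / 2 : ℂ) * h1' + (1 / 2 : ℂ) * h2'

/-- The eigenvalues on v and w satisfy conj(c_w) c_v = 1: they have equal phase, which is the scalar
a, and reciprocal moduli e^{s} and e^{-s}. In the half sum and half difference of v and w this is
the hyperbolic rotation by s. -/
lemma exists_conj_le_hyperbolicGroup {m : ℕ} {f : Fin m → (Fin n ⊕ Unit → ℂ)}
    (hf : IsNegOrtho f) (hfv : ∀ i, hform n (f i) v = 0)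
    (hfw : ∀ i, hform n (f i) w = 0) (hvv : hform n v v = 0) (hww : hform n w w = 0)
    (hwv : hform n w v = 2)
    (hc : ∀ x, (∀ i, hform n (f i) x = 0) → hform n v x = 0 → hform n w x = 0 → x = 0)
    (hJf : ∀ i, IsJointEigenvector H (f i)) (hJv : IsJointEigenvector H v)
    (hJw : IsJointEigenvector H w) :
    ∃ (ε : Fin m ⊕ Unit ≃ Fin n) (g : SU n),
      H.map (MulAut.conj g).toMonoidHom ≤ hyperbolicGroup ε := by
  have hF := isFrame_pairFrame hf hfv hfw hvv hww hwv
  let ε := Fintype.equivFinOfCardEq (hF.card_eq (pairFrame_complete hc))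
  obtain ⟨g, hg⟩ := hF.exists_conj ε
  refine ⟨ε, g, ?_⟩
  rintro _ ⟨h, hh, rfl⟩
  choose c hc using fun i => hJf i h hh
  obtain ⟨cv, hcv⟩ := hJv h hh
  obtain ⟨cw, hcw⟩ := hJw h hh
  have hprod : conj cw * cv = 1 := by
    have h1 := hform_vecAct h w v
    rw [hcv, hcw, hform_smul_left, hform_smul_right, hwv] at h1
    linear_combination (1 / 2 : ℂ) * h1
  have hw0 : cw ≠ 0 := by rintro rfl; simp at hprod
  have hnw : 0 < ‖cw‖ := norm_pos_iff.mpr hw0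
  have hnw' : (‖cw‖ : ℂ) ≠ 0 := ofReal_ne_zero.mpr hnw.ne'
  obtain ⟨a, ha⟩ := exists_expc_eq (z := cw / ‖cw‖) (by
    rw [norm_div, norm_real, norm_norm, div_self hnw.ne'])
  choose t ht using fun i : Fin m => exists_expc_eq (z := c i / (cw / ‖cw‖))
    (by rw [norm_div, norm_eigenvalue (hc i) (by rw [hf]; simp), norm_div, norm_real, norm_norm,
      div_self hnw.ne', div_one])
  have e1 : cw = expc a * exp (-(-Real.log ‖cw‖ : ℝ)) := by
    rw [ha, ofReal_neg, neg_neg, ← ofReal_exp, Real.exp_log hnw, div_mul_cancel₀ _ hnw']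
  have e2 : cv = expc a * exp (-Real.log ‖cw‖ : ℝ) := by
    have h3 : conj cw * cw = (‖cw‖ : ℂ) ^ 2 := by
      rw [mul_comm, mul_conj, normSq_eq_norm_sq]; push_cast; rfl
    have h4 : conj cw ≠ 0 := by simpa using hw0
    refine mul_left_cancel₀ h4 ?_
    rw [hprod, ha, ofReal_neg, exp_neg, ← ofReal_exp, Real.exp_log hnw]
    field_simp
    rw [h3]
  set s := -Real.log ‖cw‖ with hs
  refine ⟨((t, s), a), ?_⟩
  refine hg h (expc a • coreH (t, s)) ?_
  have hca : expc a ≠ 0 := expc_ne_zero a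
  rintro ((j | j) | j)
  · have : vecAct h (f j) = (expc a * expc (t j)) • f j := by
      rw [hc, ht, ← ha, mul_div_cancel₀ _ hca]
    simpa [pairFrame, Fintype.sum_sum_type, coreH, ite_smul] using this
  · have : vecAct h ((2⁻¹ : ℂ) • (v - w)) = (expc a * Complex.cosh s) • ((2⁻¹ : ℂ) • (v - w)) +
        (expc a * Complex.sinh s) • ((2⁻¹ : ℂ) • (v + w)) := by
      rw [map_smul, map_sub, hcv, hcw, e1, e2, Complex.cosh, Complex.sinh]
      module
    simpa [pairFrame, Fintype.sum_sum_type, coreH, ite_smul] using this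
  · have : vecAct h ((2⁻¹ : ℂ) • (v + w)) = (expc a * Complex.sinh s) • ((2⁻¹ : ℂ) • (v - w)) +
        (expc a * Complex.cosh s) • ((2⁻¹ : ℂ) • (v + w)) := by
      rw [map_smul, map_add, hcv, hcw, e1, e2, Complex.cosh, Complex.sinh]
      module
    simpa [pairFrame, Fintype.sum_sum_type, coreH, ite_smul] using this

end HyperbolicFrame

end BallRestriction
end

noncomputable section

namespace BallRestriction

/-! ### From Heisenberg translations to the nilpotent matrices -/

section ParabolicFrame

variable {n : ℕ} {H : Subgroup (SU n)}

lemma IsFrame.comp_equiv {κ κ' : Type*} [Fintype κ] [DecidableEq κ] [Fintype κ'] [DecidableEq κ']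
    {F : κ ⊕ Unit → (Fin n ⊕ Unit → ℂ)} (hF : IsFrame F) (e : κ' ≃ κ) :
    IsFrame (F ∘ Sum.map e id) :=
  ⟨fun i j => by simpa using hF.1 (e i) (e j), fun i => hF.2.1 (e i), hF.2.2⟩

/-- The data describe a Heisenberg translation in the basis containing the null vectors v and w;
passing to (v ± w)/2 gives exactly the columns of `coreN`. -/
lemma exists_conj_le_nilpotentGroup {k l : ℕ} {f : Fin k → (Fin n ⊕ Unit → ℂ)}
    {g : Fin l → (Fin n ⊕ Unit → ℂ)} {v w : Fin n ⊕ Unit → ℂ} (hF : IsFrame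
      (pairFrame (Sum.elim f g) v w))
    (hc : ∀ x, (∀ i, hform n (pairFrame (Sum.elim f g) v w i) x = 0) → x = 0)
    (hJf : ∀ i, IsJointEigenvector H (f i))
    (hdata : ∀ h ∈ H, ∃ (χ : ℂ) (b : Fin l → ℝ) (s : ℝ), ‖χ‖ = 1 ∧ vecAct h w = χ • w ∧
      (∀ j, vecAct h (g j) = χ • (g j + (I * b j) • w)) ∧
      vecAct h v = χ • (v + (-(2 * I)) • ∑ j, (b j : ℂ) • g j +
        (((∑ j, b j ^ 2 : ℝ) : ℂ) - I * s) • w)) :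
    ∃ (ε : Fin k ⊕ Fin l ⊕ Unit ≃ Fin n) (γ : SU n),
      H.map (MulAut.conj γ).toMonoidHom ≤ nilpotentGroup ε := by
  let e := (Equiv.sumAssoc (Fin k) (Fin l) Unit).symm
  have hF' := hF.comp_equiv e
  let ε : Fin k ⊕ Fin l ⊕ Unit ≃ Fin n := e.trans (Fintype.equivFinOfCardEq (hF.card_eq hc))
  obtain ⟨γ, hγ⟩ := hF'.exists_conj ε
  refine ⟨ε, γ, ?_⟩
  rintro _ ⟨h, hh, rfl⟩
  obtain ⟨χ, b, s, hχ, hw, hg, hv⟩ := hdata h hh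
  choose c hc using fun i => hJf i h hh
  obtain ⟨a, ha⟩ := exists_expc_eq hχ
  choose t ht using fun i : Fin k => exists_expc_eq (z := c i / χ)
    (by rw [norm_div, hχ, norm_eigenvalue (hc i) (by
      have := hF.1 (.inl (.inl i)) (.inl (.inl i))
      simp only [pairFrame, Sum.elim_inl, if_true] at this
      rw [this]; simp), div_one])
  have hχ0 : χ ≠ 0 := norm_ne_zero_iff.mp (by rw [hχ]; exact one_ne_zero)
  set q : QN k l := (t, s, WithLp.toLp 2 b) with hq
  have hsh : ((∑ j, b j ^ 2 : ℝ) : ℂ) - I * s = 2 * shift q := by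
    rw [shift, mul_div_cancel₀ _ two_ne_zero, EuclideanSpace.real_norm_sq_eq]
  rw [hsh] at hv
  have hsum : ∀ d : ℂ, ∑ j, (χ * (d * b j)) • g j = (χ * d) • ∑ j, (b j : ℂ) • g j := by
    intro d
    rw [Finset.smul_sum]
    exact Finset.sum_congr rfl fun j _ => by rw [smul_smul, mul_assoc]
  refine ⟨(q, a), hγ h (expc a • coreN q) ?_⟩
  rintro ((j | j | j) | j)
  · have : vecAct h (f j) = (χ * expc (t j)) • f j := by
      rw [hc, ht, mul_div_cancel₀ _ hχ0]
    simpa [pairFrame, e, Fintype.sum_sum_type, coreN, ite_smul, ha] using this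
  · have : vecAct h (g j) = χ • g j + ((χ * (-I * b j)) • ((2⁻¹ : ℂ) • (v - w)) +
        (χ * (I * b j)) • ((2⁻¹ : ℂ) • (v + w))) := by
      rw [hg]; module
    simpa [pairFrame, e, Fintype.sum_sum_type, coreN, ite_smul, ha, add_assoc] using this
  · have : vecAct h ((2⁻¹ : ℂ) • (v - w)) = ∑ j, (χ * (-I * b j)) • g j +
        (χ * (1 - shift q)) • ((2⁻¹ : ℂ) • (v - w)) +
        (χ * shift q) • ((2⁻¹ : ℂ) • (v + w)) := by
      rw [hsum, map_smul, map_sub, hv, hw]; module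
    simpa [pairFrame, e, Fintype.sum_sum_type, coreN, ite_smul, ha, add_assoc] using this
  · have : vecAct h ((2⁻¹ : ℂ) • (v + w)) = ∑ j, (χ * (-I * b j)) • g j +
        (χ * (-shift q)) • ((2⁻¹ : ℂ) • (v - w)) +
        (χ * (1 + shift q)) • ((2⁻¹ : ℂ) • (v + w)) := by
      rw [hsum, map_smul, map_add, hv, hw]; module
    simpa [pairFrame, e, Fintype.sum_sum_type, coreN, ite_smul, ha, add_assoc] using this

end ParabolicFrame

/-! ### A single null joint eigenvector -/

section Parabolic

variable {n : ℕ}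

/-- The situation of an abelian group with a unique null joint eigenvector `w` in the complement of
a family `f` of negative joint eigenvectors. -/
structure IsParabolic (H : Subgroup (SU n)) {k : ℕ} (f : Fin k → (Fin n ⊕ Unit → ℂ))
    (w : Fin n ⊕ Unit → ℂ) : Prop where
  comm : ∀ x ∈ H, ∀ y ∈ H, x * y = y * x
  negOrtho : IsNegOrtho f
  joint : ∀ i, IsJointEigenvector H (f i)
  ne_zero : w ≠ 0
  null : hform n w w = 0
  mem : w ∈ perp (Set.range f)
  joint_null : IsJointEigenvector H w
  unique : ∀ y ∈ perp (Set.range f), IsJointEigenvector H y → ∃ c : ℂ, y = c • w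

namespace IsParabolic

variable {H : Subgroup (SU n)} {k : ℕ} {f : Fin k → (Fin n ⊕ Unit → ℂ)} {w : Fin n ⊕ Unit → ℂ}

lemma invariant (P : IsParabolic H f w) {h : SU n} (hh : h ∈ H) {x : Fin n ⊕ Unit → ℂ}
    (hx : x ∈ perp (Set.range f)) : vecAct h x ∈ perp (Set.range f) :=
  perp_invariant (by rintro _ ⟨i, rfl⟩; exact P.joint i) hh hx

/-- An eigenspace of h in the complement is invariant under the abelian group, hence contains a
joint eigenvector, which can only be a multiple of w. -/
lemma eigenvalue_eq (P : IsParabolic H f w) {h : SU n} (hh : h ∈ H) {χ : ℂ}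
    (hχ : vecAct h w = χ • w) (μ : ℂ) {x : Fin n ⊕ Unit → ℂ} (hx : x ∈ perp (Set.range f))
    (hx0 : x ≠ 0) (hμ : vecAct h x = μ • x) : μ = χ := by
  let U : Submodule ℂ (Fin n ⊕ Unit → ℂ) :=
    perp (Set.range f) ⊓ LinearMap.ker (vecAct h - μ • LinearMap.id)
  have hmem : ∀ x, x ∈ U ↔ x ∈ perp (Set.range f) ∧ vecAct h x = μ • x := fun x => by
    simp [U, sub_eq_zero]
  obtain ⟨y, hy, hy0, hj⟩ := exists_isJointEigenvector P.comm U
    (fun h0 => hx0 (by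
      have := (hmem x).mpr ⟨hx, hμ⟩
      rwa [h0, Submodule.mem_bot] at this))
    (fun a ha x hx => by
      rw [hmem] at hx ⊢
      exact ⟨P.invariant ha hx.1, by
        rw [← vecAct_mul, P.comm h hh a ha, vecAct_mul, hx.2, map_smul]⟩)
  rw [hmem] at hy
  obtain ⟨c, rfl⟩ := P.unique y hy.1 hj
  have h1 := hy.2
  rw [map_smul, hχ, smul_comm] at h1
  exact (smul_left_injective ℂ hy0 h1).symm

lemma hform_f (P : IsParabolic H f w) (i : Fin k) : hform n (f i) w = 0 := P.mem _ ⟨i, rfl⟩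

lemma f_hform (P : IsParabolic H f w) (i : Fin k) : hform n w (f i) = 0 := by
  rw [← conj_hform, P.hform_f, map_zero]

/-- A null vector in the complement which is not orthogonal to `w`. -/
lemma exists_pair (P : IsParabolic H f w) :
    ∃ v ∈ perp (Set.range f), hform n v v = 0 ∧ hform n w v = 2 := by
  let e : Fin n ⊕ Unit → ℂ := Pi.single (.inr ()) 1
  -- The positive basis vector projected to the complement of the family. Its product with w is the
  -- conjugate of the last coordinate of w, which is nonzero since w is null.
  let v₀ := e + ∑ i, hform n (f i) e • f i
  have hv₀ : v₀ ∈ perp (Set.range f) := by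
    rintro _ ⟨i, rfl⟩
    rw [map_add, P.negOrtho.sum_left, add_neg_cancel]
  have hwv₀ : hform n w v₀ = conj (w (.inr ())) := by
    simp [v₀, map_add, map_sum, P.f_hform, e, hform_apply]
  have hne : hform n w v₀ ≠ 0 := by
    rw [hwv₀]
    simpa using apply_inr_ne_zero (by rw [P.null]; simp) P.ne_zero
  obtain ⟨v₁, hv₁, hwv₁⟩ : ∃ v₁ ∈ perp (Set.range f), hform n w v₁ = 2 :=
    ⟨(2 / hform n w v₀) • v₀, Submodule.smul_mem _ _ hv₀, by
      rw [hform_smul_right, div_mul_cancel₀ _ hne]⟩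
  have hv₁w : hform n v₁ w = 2 := by rw [← conj_hform, hwv₁, conj_two]
  have hself := hform_self_eq v₁
  generalize (hform n v₁ v₁).re = r at hself
  -- With ⟨w, v₁⟩ = 2, adding c w for real c changes the length by 4c, so c = -r/4 makes the vector
  -- null.
  refine ⟨v₁ + ((-r / 4 : ℝ) : ℂ) • w,
    add_mem hv₁ (Submodule.smul_mem _ _ P.mem), ?_, ?_⟩
  · rw [map_add, map_add, LinearMap.add_apply, LinearMap.add_apply, hform_smul_right,
      hform_smul_left, hform_smul_left, hform_smul_right, conj_ofReal, hself, hv₁w, hwv₁, P.null]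
    push_cast
    ring
  · rw [map_add, hform_smul_right, P.null, hwv₁]
    ring

variable {v : Fin n ⊕ Unit → ℂ}

lemma conj_mul_hform {h : SU n} {χ : ℂ} (hχ : vecAct h w = χ • w) (x : Fin n ⊕ Unit → ℂ) :
    conj χ * hform n w (vecAct h x) = hform n w x := by
  rw [← hform_vecAct h w x, hχ, hform_smul_left]

/-- On the functional ⟨w, ·⟩ the element h acts by the inverse of conj(χ), while h - χ is nilpotent
on the complement. As ⟨w, v⟩ ≠ 0, the two scalars coincide. -/
lemma norm_eq_one (P : IsParabolic H f w) (hv : v ∈ perp (Set.range f)) (hwv : hform n w v = 2)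
    {h : SU n} (hh : h ∈ H) {χ : ℂ} (hχ : vecAct h w = χ • w) : ‖χ‖ = 1 := by
  have hχ0 : χ ≠ 0 := by
    rintro rfl
    rw [zero_smul] at hχ
    exact P.ne_zero (vecAct_injective h hχ)
  have hχ0' : conj χ ≠ 0 := by simpa using hχ0
  obtain ⟨j, hj⟩ := exists_pow_sub_eq_zero (vecAct h) (perp (Set.range f))
    (fun x hx => P.invariant hh hx) χ (fun μ x hx hx0 hμ => P.eigenvalue_eq hh hχ μ hx hx0 hμ) hv
  have hpow : ∀ (j : ℕ) (x : Fin n ⊕ Unit → ℂ),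
      hform n w (((vecAct h - χ • 1) ^ j) x) = ((conj χ)⁻¹ - χ) ^ j * hform n w x := by
    intro j
    induction j with
    | zero => intro x; simp
    | succ j ih =>
      intro x
      rw [pow_succ, Module.End.mul_apply, ih]
      have : hform n w ((vecAct h - χ • 1) x) = ((conj χ)⁻¹ - χ) * hform n w x := by
        rw [← conj_mul_hform hχ x]
        simp only [LinearMap.sub_apply, LinearMap.smul_apply, Module.End.one_apply, map_sub, map_smul,
          smul_eq_mul]
        rw [← conj_mul_hform hχ x]
        field_simp
      rw [this]
      ring
  have h1 := hpow j v
  rw [hj, map_zero, hwv] at h1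
  have h2 : (conj χ)⁻¹ - χ = 0 := eq_zero_of_pow_eq_zero
    ((mul_eq_zero.mp h1.symm).resolve_right two_ne_zero)
  rw [sub_eq_zero, inv_eq_iff_eq_inv] at h2
  have h3 : ‖χ‖ ^ 2 = 1 := by
    have : χ * conj χ = 1 := by rw [h2, mul_inv_cancel₀ hχ0]
    rw [mul_conj, normSq_eq_norm_sq] at this
    exact_mod_cast this
  exact (pow_eq_one_iff_of_nonneg (norm_nonneg _) two_ne_zero).mp h3

lemma conj_mul_self {χ : ℂ} (h : ‖χ‖ = 1) : conj χ * χ = 1 := by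
  rw [mul_comm, mul_conj, normSq_eq_norm_sq, h]; simp

/-- The elements of the group act as scalars on the quotient of `w^⊥` by `w`. -/
lemma exists_sub_eq (P : IsParabolic H f w) {h : SU n} (hh : h ∈ H) {χ : ℂ}
    (hχ : vecAct h w = χ • w) (hn : ‖χ‖ = 1) {x : Fin n ⊕ Unit → ℂ}
    (hx : x ∈ perp (Set.range f)) (hwx : hform n w x = 0) :
    ∃ c : ℂ, (vecAct h - χ • 1) x = c • w := by
  obtain ⟨j, hj⟩ := exists_pow_sub_eq_zero (vecAct h) (perp (Set.range f))
    (fun x hx => P.invariant hh hx) χ (fun μ x hx hx0 hμ => P.eigenvalue_eq hh hχ μ hx hx0 hμ) hx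
  have hcc := conj_mul_self hn
  have hχ0 : conj χ ≠ 0 := left_ne_zero_of_mul_eq_one hcc
  set N := vecAct h - χ • (1 : Module.End ℂ (Fin n ⊕ Unit → ℂ)) with hN
  have hNx : ∀ x, vecAct h x = χ • x + N x := fun x => by simp [hN]
  have hmem : ∀ x ∈ perp (Set.range f), N x ∈ perp (Set.range f) := fun x hx =>
    sub_mem (P.invariant hh hx) (Submodule.smul_mem _ _ hx)
  have hperp : ∀ x, hform n w x = 0 → hform n w (N x) = 0 := by
    intro x hx
    have := conj_mul_hform hχ x
    rw [hx, mul_eq_zero] at this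
    have h2 := this.resolve_left hχ0
    rw [hNx, map_add, hform_smul_right, hx, mul_zero, zero_add] at h2
    exact h2
  -- If N²x lies on the line of w, comparing ⟨hx, hNx⟩ with ⟨x, Nx⟩ gives ⟨Nx, Nx⟩ = 0. A null
  -- vector orthogonal to w is a multiple of w. Thus nilpotency of any order collapses to one step.
  have hstep : ∀ x, hform n w x = 0 → (∃ c : ℂ, N (N x) = c • w) → ∃ c : ℂ, N x = c • w := by
    rintro x hx ⟨c, hc⟩
    have h1 := hform_vecAct h x (N x)
    have hxw : hform n x w = 0 := by rw [← conj_hform, hx, map_zero]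
    have hNxw : hform n (N x) w = 0 := by rw [← conj_hform, hperp x hx, map_zero]
    rw [hNx x, hNx (N x), hc] at h1
    simp only [map_add, LinearMap.add_apply, hform_smul_left, hform_smul_right, hxw, hNxw, mul_zero,
      add_zero] at h1
    have h2 : χ * hform n (N x) (N x) = 0 := by
      linear_combination h1 - hcc * hform n x (N x)
    have h3 := (mul_eq_zero.mp h2).resolve_left (right_ne_zero_of_mul_eq_one hcc)
    exact exists_smul_of_hform_nonneg (by rw [P.null]; simp) (by rw [h3]; simp) (hperp x hx) P.ne_zero
  have key : ∀ (j : ℕ) (x : Fin n ⊕ Unit → ℂ), hform n w x = 0 → (N ^ (j + 1)) x = 0 →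
      ∃ c : ℂ, N x = c • w := by
    intro j
    induction j with
    | zero => intro x _ h; exact ⟨0, by simpa using h⟩
    | succ j ih =>
      intro x hx h
      rw [pow_succ, Module.End.mul_apply] at h
      exact hstep x hx (ih _ (hperp x hx) h)
  refine key j x hwx ?_
  rw [pow_succ', Module.End.mul_apply, hj, map_zero]

/-- The translation parts of the elements of the group. -/
def translations (H : Subgroup (SU n)) (v w : Fin n ⊕ Unit → ℂ) : Set (Fin n ⊕ Unit → ℂ) :=
  {Y | ∃ h ∈ H, ∃ χ : ℂ, ‖χ‖ = 1 ∧ vecAct h w = χ • w ∧ vecAct h v = χ • (v + Y)}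

lemma exists_translation (P : IsParabolic H f w) (hv : v ∈ perp (Set.range f))
    (hwv : hform n w v = 2) {h : SU n} (hh : h ∈ H) :
    ∃ χ : ℂ, ‖χ‖ = 1 ∧ vecAct h w = χ • w ∧ ∃ Y, vecAct h v = χ • (v + Y) := by
  obtain ⟨χ, hχ⟩ := P.joint_null h hh
  have hn := P.norm_eq_one hv hwv hh hχ
  have hχ0 : χ ≠ 0 := norm_ne_zero_iff.mp (by rw [hn]; exact one_ne_zero)
  exact ⟨χ, hn, hχ, χ⁻¹ • vecAct h v - v, by rw [add_sub_cancel, smul_inv_smul₀ hχ0]⟩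

lemma translation_mem (P : IsParabolic H f w) (hv : v ∈ perp (Set.range f))
    {Y : Fin n ⊕ Unit → ℂ} (hY : Y ∈ translations H v w) :
    Y ∈ perp (Set.range f) ∧ hform n w Y = 0 := by
  obtain ⟨h, hh, χ, hn, hχ, hvY⟩ := hY
  have hcc := conj_mul_self hn
  have hχ0 : χ ≠ 0 := right_ne_zero_of_mul_eq_one hcc
  have hYe : Y = χ⁻¹ • vecAct h v - v := by rw [hvY, inv_smul_smul₀ hχ0, add_sub_cancel_left]
  refine ⟨?_, ?_⟩
  · rw [hYe]
    exact sub_mem (Submodule.smul_mem _ _ (P.invariant hh hv)) hv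
  · have h1 := conj_mul_hform hχ v
    rw [hvY, hform_smul_right, ← mul_assoc, hcc, one_mul, map_add] at h1
    exact add_eq_left.mp h1

/-- On vectors orthogonal to w the action is scalar up to a multiple of w, and that multiple is
forced by invariance of ⟨v, x⟩. -/
lemma vecAct_eq (P : IsParabolic H f w) (hv : v ∈ perp (Set.range f)) (hwv : hform n w v = 2)
    {h : SU n} (hh : h ∈ H) {χ : ℂ} (hn : ‖χ‖ = 1) (hχ : vecAct h w = χ • w)
    {Y : Fin n ⊕ Unit → ℂ} (hY : vecAct h v = χ • (v + Y)) {x : Fin n ⊕ Unit → ℂ}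
    (hx : x ∈ perp (Set.range f)) (hwx : hform n w x = 0) :
    vecAct h x = χ • (x + (-(hform n Y x / 2)) • w) := by
  have hcc := conj_mul_self hn
  have hχ0 : χ ≠ 0 := right_ne_zero_of_mul_eq_one hcc
  obtain ⟨c, hc⟩ := P.exists_sub_eq hh hχ hn hx hwx
  have hx' : vecAct h x = χ • (x + (χ⁻¹ * c) • w) := by
    rw [smul_add, smul_smul, mul_inv_cancel_left₀ hχ0, ← hc]; simp
  generalize χ⁻¹ * c = β at hx'
  have hwY := (P.translation_mem hv ⟨h, hh, χ, hn, hχ, hY⟩).2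
  have h1 := hform_vecAct h v x
  have hvw : hform n v w = 2 := by rw [← conj_hform, hwv, conj_two]
  have hYw : hform n Y w = 0 := by rw [← conj_hform, hwY, map_zero]
  rw [hY, hx', hform_smul_left, hform_smul_right, ← mul_assoc, hcc, one_mul] at h1
  simp only [map_add, LinearMap.add_apply, hform_smul_right, hvw, hYw, mul_zero, add_zero] at h1
  have : β = -(hform n Y x / 2) := by linear_combination (1 / 2 : ℂ) * h1
  rw [hx', this]

/-- The form is real on translation parts. -/
lemma hform_translations (P : IsParabolic H f w) (hv : v ∈ perp (Set.range f))
    (hwv : hform n w v = 2) {Y Y' : Fin n ⊕ Unit → ℂ} (hY : Y ∈ translations H v w)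
    (hY' : Y' ∈ translations H v w) : (hform n Y Y').im = 0 := by
  obtain ⟨hm, hw1⟩ := P.translation_mem hv hY
  obtain ⟨hm', hw1'⟩ := P.translation_mem hv hY'
  obtain ⟨h, hh, χ, hn, hχ, hvY⟩ := hY
  obtain ⟨h', hh', χ', hn', hχ', hvY'⟩ := hY'
  have hχ0 : χ ≠ 0 := norm_ne_zero_iff.mp (by rw [hn]; exact one_ne_zero)
  have hχ0' : χ' ≠ 0 := norm_ne_zero_iff.mp (by rw [hn']; exact one_ne_zero)
  -- The images of v under hh' and h'h differ only in their coefficient of w. Commutativity makes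
  -- ⟨Y, Y'⟩ symmetric, hence real.
  have h1 : vecAct h (vecAct h' v) = (χ' * χ) • (v + Y + (Y' + (-(hform n Y Y' / 2)) • w)) := by
    rw [hvY', map_smul, map_add, hvY, P.vecAct_eq hv hwv hh hn hχ hvY hm' hw1', ← smul_add, smul_smul]
  have h2 : vecAct h' (vecAct h v) = (χ * χ') • (v + Y' + (Y + (-(hform n Y' Y / 2)) • w)) := by
    rw [hvY, map_smul, map_add, hvY', P.vecAct_eq hv hwv hh' hn' hχ' hvY' hm hw1, ← smul_add,
      smul_smul]
  rw [← vecAct_mul, P.comm h hh h' hh', vecAct_mul, h2, mul_comm χ χ'] at h1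
  have h3 : v + Y' + (Y + (-(hform n Y' Y / 2)) • w) = v + Y + (Y' + (-(hform n Y Y' / 2)) • w) :=
    smul_right_injective _ (mul_ne_zero hχ0' hχ0) h1
  have h4 : (-(hform n Y' Y / 2)) • w = (-(hform n Y Y' / 2)) • w := by
    rw [show v + Y' + (Y + (-(hform n Y' Y / 2)) • w) =
      v + Y + (Y' + (-(hform n Y' Y / 2)) • w) by abel] at h3
    exact add_left_cancel (add_left_cancel h3)
  have h5 : hform n Y' Y = hform n Y Y' := by
    have h6 : -(hform n Y' Y / 2) = -(hform n Y Y' / 2) := smul_left_injective ℂ P.ne_zero h4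
    linear_combination (-2 : ℂ) * h6
  rw [← conj_hform] at h5
  exact conj_eq_iff_im.mp h5

end IsParabolic

end Parabolic

end BallRestriction
end

noncomputable section

namespace BallRestriction

namespace IsParabolic

variable {n : ℕ} {H : Subgroup (SU n)} {k : ℕ} {f : Fin k → (Fin n ⊕ Unit → ℂ)}
  {w : Fin n ⊕ Unit → ℂ}

/-- The form is real on the translation parts. An orthonormal family g is chosen maximal among
vectors orthogonal to f, v, w and having purely imaginary products with all translations; in it
every translation has imaginary coefficients, which gives the real parameter b. Isometry fixes the
real part of the remaining coefficient of w, and its imaginary part is the parameter s. -/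
theorem exists_conj_le (P : IsParabolic H f w) :
    ∃ (k l : ℕ) (ε : Fin k ⊕ Fin l ⊕ Unit ≃ Fin n) (γ : SU n),
      H.map (MulAut.conj γ).toMonoidHom ≤ nilpotentGroup ε := by
  obtain ⟨v, hv, hvv, hwv⟩ := P.exists_pair
  have hvw : hform n v w = 2 := by rw [← conj_hform, hwv, conj_two]
  have hv2 : ∀ i, hform n (f i) v = 0 := fun i => hv _ ⟨i, rfl⟩
  let T := translations H v w
  have hT : ∀ Y ∈ T, Y ∈ perp (Set.range f) ∧ hform n w Y = 0 := fun Y hY =>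
    P.translation_mem hv hY
  -- The last condition is only real linear in x, which the maximality lemma tolerates.
  let Q : (Fin n ⊕ Unit → ℂ) → Prop := fun x => x ∈ perp (Set.range f) ∧ hform n w x = 0 ∧
    hform n v x = 0 ∧ ∀ Y ∈ T, (hform n x Y).re = 0
  obtain ⟨l, g, hgQ, hg, hmax⟩ := exists_maximal_negOrtho Q (by
    rintro r x ⟨h1, h2, h3, h4⟩
    refine ⟨Submodule.smul_mem _ _ h1, by rw [map_smul, h2, smul_zero],
      by rw [map_smul, h3, smul_zero], fun Y hY => ?_⟩
    rw [hform_smul_left, conj_ofReal, re_ofReal_mul, h4 Y hY, mul_zero])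
  have hwg : ∀ j, hform n w (g j) = 0 := fun j => (hgQ j).2.1
  have hvg : ∀ j, hform n v (g j) = 0 := fun j => (hgQ j).2.2.1
  have hgw : ∀ j, hform n (g j) w = 0 := fun j => by rw [← conj_hform, hwg, map_zero]
  have hgv : ∀ j, hform n (g j) v = 0 := fun j => by rw [← conj_hform, hvg, map_zero]
  have hgre : ∀ j, ∀ Y ∈ T, (hform n (g j) Y).re = 0 := fun j => (hgQ j).2.2.2
  have hnonneg : ∀ x, hform n w x = 0 → hform n v x = 0 → 0 ≤ (hform n x x).re → x = 0 := by
    intro x hwx hvx hx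
    obtain ⟨c, rfl⟩ := exists_smul_of_hform_nonneg (by rw [P.null]; simp) hx hwx P.ne_zero
    rw [hform_smul_right, hvw, mul_eq_zero] at hvx
    rw [hvx.resolve_right two_ne_zero, zero_smul]
  -- the translation parts are combinations of the vectors of the family and `w`
  have hdecomp : ∀ Y ∈ T, Y = -∑ j, hform n (g j) Y • g j + (hform n v Y / 2) • w := by
    intro Y hY
    set p := Y + ∑ j, hform n (g j) Y • g j + (-(hform n v Y / 2)) • w with hp
    suffices p = 0 by
      calc Y = p - ∑ j, hform n (g j) Y • g j + (hform n v Y / 2) • w := by rw [hp]; module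
        _ = _ := by rw [this, zero_sub]
    have hp1 : p ∈ perp (Set.range f) :=
      add_mem (add_mem (hT Y hY).1 (Submodule.sum_mem _ fun j _ =>
        Submodule.smul_mem _ _ (hgQ j).1)) (Submodule.smul_mem _ _ P.mem)
    have hp2 : hform n w p = 0 := by
      simp [hp, map_add, map_sum, (hT Y hY).2, hwg, P.null]
    have hp3 : hform n v p = 0 := by
      simp [hp, map_add, map_sum, hvg, hvw]
    have hp4 : ∀ j, hform n (g j) p = 0 := by
      intro j
      rw [hp, map_add, map_add, hg.sum_left, hform_smul_right, hgw]
      ring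
    refine hnonneg p hp2 hp3 ?_
    -- The remainder p has real products with all translations, so i p satisfies `Q`. By maximality
    -- p is non-negative, and a non-negative vector orthogonal to v and w is zero.
    have h1 := hmax (I • p) ⟨Submodule.smul_mem _ _ hp1, by rw [map_smul, hp2, smul_zero],
      by rw [map_smul, hp3, smul_zero], fun Y' hY' => ?_⟩
      (fun j => by rw [map_smul, hp4, smul_zero])
    · rwa [hform_self_smul, norm_I, one_pow, one_mul] at h1
    · have him := P.hform_translations hv hwv hY hY'
      have hre : ∀ j, (conj (hform n (g j) Y) * hform n (g j) Y').im = 0 := by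
        intro j
        rw [mul_im, conj_re, conj_im, hgre j Y hY, hgre j Y' hY']
        ring
      have h2 : hform n p Y' = hform n Y Y' + ∑ j, conj (hform n (g j) Y) * hform n (g j) Y' := by
        simp [hp, map_add, map_sum, LinearMap.add_apply, LinearMap.sum_apply, (hT Y' hY').2]
      rw [hform_smul_left, h2, conj_I]
      simp only [neg_mul, neg_re, I_mul_re, neg_neg, add_im, im_sum, him, hre, Finset.sum_const_zero,
        add_zero]
  -- By the decomposition, a vector orthogonal to f, g, v and w is orthogonal to every translation,
  -- so it satisfies `Q` trivially and maximality applies.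
  have hcomplete : ∀ x, (∀ i, hform n (Sum.elim f g i) x = 0) → hform n v x = 0 →
      hform n w x = 0 → x = 0 := by
    intro x hfg hvx hwx
    have hxg : ∀ j, hform n x (g j) = 0 := fun j => by
      rw [← conj_hform, show hform n (g j) x = 0 from hfg (.inr j), map_zero]
    have hxw : hform n x w = 0 := by rw [← conj_hform, hwx, map_zero]
    refine hnonneg x hwx hvx (hmax x ⟨?_, hwx, hvx, fun Y hY => ?_⟩ fun j => hfg (.inr j))
    · rintro _ ⟨i, rfl⟩
      exact hfg (.inl i)
    · rw [hdecomp Y hY]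
      simp [map_add, map_sum, hxg, hxw]
  have hfg : IsNegOrtho (Sum.elim f g) := by
    have h1 : ∀ i j, hform n (f i) (g j) = 0 := fun i j => (hgQ j).1 _ ⟨i, rfl⟩
    rintro (i | i) (j | j)
    · simpa using P.negOrtho i j
    · simpa using h1 i j
    · rw [← conj_hform]; simpa using h1 j i
    · simpa using hg i j
  have hF := isFrame_pairFrame (v := v) (w := w) hfg
    (by rintro (i | i); exacts [hv2 i, hgv i]) (by rintro (i | i); exacts [P.hform_f i, hgw i])
    hvv P.null hwv
  obtain ⟨ε, γ, h⟩ := exists_conj_le_nilpotentGroup hF (pairFrame_complete hcomplete) P.joint (by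
    intro h hh
    obtain ⟨χ, hn, hχ, Y, hY⟩ := P.exists_translation hv hwv hh
    have hYT : Y ∈ T := ⟨h, hh, χ, hn, hχ, hY⟩
    have hb : ∀ j, hform n (g j) Y = 2 * I * (((hform n (g j) Y).im / 2 : ℝ) : ℂ) := by
      intro j
      apply Complex.ext
      · simp [hgre j Y hYT]
      · simp [mul_div_cancel₀]
    have hb' : ∀ j, hform n Y (g j) = -(2 * I * (((hform n (g j) Y).im / 2 : ℝ) : ℂ)) := by
      intro j
      rw [← conj_hform, hb j, map_mul, map_mul, conj_I, conj_two, conj_ofReal]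
      simp
    have hYw : hform n Y w = 0 := by rw [← conj_hform, (hT Y hYT).2, map_zero]
    generalize hbj : (fun j => (hform n (g j) Y).im / 2) = b at *
    have hbj' : ∀ j, (hform n (g j) Y).im / 2 = b j := fun j => congrFun hbj j
    simp only [hbj'] at hb hb'
    have hYY : hform n Y Y = ((-4 * ∑ j, b j ^ 2 : ℝ) : ℂ) := by
      have h1 := congrArg (hform n Y) (hdecomp Y hYT)
      rw [map_add, map_neg, map_sum, hform_smul_right, hYw, mul_zero, add_zero] at h1
      rw [h1, ofReal_mul, ofReal_sum, Finset.mul_sum, ← Finset.sum_neg_distrib]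
      refine Finset.sum_congr rfl fun j _ => ?_
      rw [hform_smul_right, hb j, hb' j, ofReal_pow]
      push_cast
      linear_combination (4 * (b j : ℂ) ^ 2) * I_sq
    have hre : (hform n v Y).re = 2 * ∑ j, b j ^ 2 := by
      have h1 := hform_vecAct h v v
      rw [hY, hform_self_eq, hform_self_smul, hn, one_pow, one_mul, hvv] at h1
      have h2 : (hform n (v + Y) (v + Y)).re = 0 := ofReal_eq_zero.mp h1
      have h3 : hform n (v + Y) (v + Y) = hform n v Y + conj (hform n v Y) + hform n Y Y := by
        simp [map_add, LinearMap.add_apply, hvv, conj_hform]; ring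
      rw [h3, add_re, add_re, conj_re, hYY, ofReal_re] at h2
      linarith
    refine ⟨χ, b, -(hform n v Y).im / 2, hn, hχ, fun j => ?_, ?_⟩
    · rw [P.vecAct_eq hv hwv hh hn hχ hY (hgQ j).1 (hwg j), hb' j]
      congr 3
      ring
    · rw [hY, add_assoc]
      congr 2
      conv_lhs => rw [hdecomp Y hYT]
      congr 1
      · rw [Finset.smul_sum, ← Finset.sum_neg_distrib]
        refine Finset.sum_congr rfl fun j _ => ?_
        rw [hb j, smul_smul, ← neg_smul]
        congr 1
        ring
      · congr 1
        generalize ∑ j, b j ^ 2 = S at hre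
        apply Complex.ext
        · simp [hre]
        · simp [neg_div])
  exact ⟨k, l, ε, γ, h⟩

end IsParabolic

/-- Every abelian subgroup of `SU(n,1)` is conjugate to a subgroup of one of the model groups. -/
theorem exists_conj_le_model {n : ℕ} {H : Subgroup (SU n)} (hH : ∀ x ∈ H, ∀ y ∈ H, x * y = y * x) :
    ∃ g : SU n, H.map (MulAut.conj g).toMonoidHom ≤ ellipticGroup n ∨
      (∃ (m : ℕ) (ε : Fin m ⊕ Unit ≃ Fin n),
        H.map (MulAut.conj g).toMonoidHom ≤ hyperbolicGroup ε) ∨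
      ∃ (k l : ℕ) (ε : Fin k ⊕ Fin l ⊕ Unit ≃ Fin n),
        H.map (MulAut.conj g).toMonoidHom ≤ nilpotentGroup ε := by
  obtain ⟨k, f, hJf, hf, hmax⟩ := exists_maximal_negOrtho (IsJointEigenvector H)
    (fun r x hx => hx.smul r)
  have hmax' : ∀ x ∈ perp (Set.range f), IsJointEigenvector H x → 0 ≤ (hform n x x).re :=
    fun x hx hj => hmax x hj fun i => hx _ ⟨i, rfl⟩
  have hJ : ∀ y ∈ Set.range f, IsJointEigenvector H y := by rintro _ ⟨i, rfl⟩; exact hJf i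
  -- The trichotomy. By maximality every joint eigenvector in the complement is non-negative; a
  -- positive one completes the family to a frame, otherwise all of them are null.
  by_cases hpos : ∃ w ∈ perp (Set.range f), IsJointEigenvector H w ∧ 0 < (hform n w w).re
  · obtain ⟨w, hw, hjw, hpos⟩ := hpos
    have hc : ∀ x, (∀ i, hform n (f i) x = 0) → hform n w x = 0 → x = 0 := by
      intro x hx hwx
      refine eq_zero_of_mem_perp hH (S := insert w (Set.range f)) ?_ ?_ ?_
      · rintro y (rfl | hy)
        exacts [hjw, hJ y hy]
      · intro y hy hj
        exact eq_zero_of_hform_nonneg hpos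
          (hmax' y (fun z hz => hy z (Set.mem_insert_of_mem _ hz)) hj) (hy w (Set.mem_insert _ _))
      · rintro y (rfl | ⟨i, rfl⟩)
        exacts [hwx, hx i]
    set r : ℝ := 1 / √(hform n w w).re with hr
    have hr0 : (r : ℂ) ≠ 0 := ofReal_ne_zero.mpr (by positivity)
    let F : Fin k ⊕ Unit → (Fin n ⊕ Unit → ℂ) := Sum.elim f fun _ => (r : ℂ) • w
    have hF : IsFrame F := by
      refine ⟨fun i j => hf i j, fun i => ?_, ?_⟩
      · change hform n (f i) ((r : ℂ) • w) = 0
        rw [map_smul, hw _ ⟨i, rfl⟩, smul_zero]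
      · change hform n ((r : ℂ) • w) ((r : ℂ) • w) = 1
        rw [hform_self_eq, hform_self_smul, norm_real, Real.norm_eq_abs, sq_abs, hr, div_pow,
          Real.sq_sqrt hpos.le, one_pow, one_div, inv_mul_cancel₀ hpos.ne', ofReal_one]
    have hk : k = n := by
      have := hF.card_eq fun x hx => hc x (fun i => hx (.inl i)) (by
        have h := hx (.inr ())
        change hform n ((r : ℂ) • w) x = 0 at h
        rw [hform_smul_left, conj_ofReal, mul_eq_zero] at h
        exact h.resolve_left hr0)
      simpa using this
    subst hk
    obtain ⟨g, hg⟩ := exists_conj_le_ellipticGroup F hF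
      (by rintro (i | i); exacts [hJf i, hjw.smul r])
    exact ⟨g, Or.inl hg⟩
  · push Not at hpos
    have hnull : ∀ x ∈ perp (Set.range f), IsJointEigenvector H x → hform n x x = 0 := by
      intro x hx hj
      rw [hform_self_eq, le_antisymm (hpos x hx hj) (hmax' x hx hj), ofReal_zero]
    -- The complement is nonzero: otherwise the positive basis vector would be a combination of
    -- negative orthonormal vectors and have non-positive length.
    obtain ⟨w, hw, hw0, hjw⟩ := exists_isJointEigenvector hH (perp (Set.range f))
      (fun hbot => by
        let e : Fin n ⊕ Unit → ℂ := Pi.single (.inr ()) 1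
        have he : hform n e e = 1 := by simp [e, hform_apply]
        have hx : e + ∑ i, hform n (f i) e • f i ∈ perp (Set.range f) := by
          rintro _ ⟨i, rfl⟩
          rw [map_add, hf.sum_left, add_neg_cancel]
        rw [hbot, Submodule.mem_bot, add_eq_zero_iff_eq_neg] at hx
        have h2 : hform n e e = -∑ i, hform n (f i) e * conj (hform n (f i) e) := by
          have h1 := congrArg (hform n e) hx
          rw [map_neg, map_sum] at h1
          rw [h1]
          congr 1
          refine Finset.sum_congr rfl fun i _ => ?_
          rw [hform_smul_right, conj_hform]
        have h3 := congrArg re h2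
        rw [he, neg_re, re_sum] at h3
        have h4 : 0 ≤ ∑ i, (hform n (f i) e * conj (hform n (f i) e)).re :=
          Finset.sum_nonneg fun i _ => by
            rw [mul_conj, ofReal_re]; exact normSq_nonneg _
        rw [one_re] at h3
        linarith)
      (fun h hh x hx => perp_invariant hJ hh hx)
    have hww := hnull w hw hjw
    by_cases hun : ∀ y ∈ perp (Set.range f), IsJointEigenvector H y → ∃ c : ℂ, y = c • w
    · obtain ⟨k', l, ε, γ, h⟩ := IsParabolic.exists_conj_le
        (⟨hH, hf, hJf, hw0, hww, hw, hjw, hun⟩ : IsParabolic H f w)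
      exact ⟨γ, Or.inr (Or.inr ⟨k', l, ε, h⟩)⟩
    · push Not at hun
      obtain ⟨y, hy, hjy, hne⟩ := hun
      -- Orthogonal null vectors are proportional, so two independent null joint eigenvectors pair
      -- nontrivially and can be normalised to 2.
      have hwy : hform n w y ≠ 0 := fun h0 => by
        obtain ⟨c, hc⟩ := exists_smul_of_hform_nonneg (by rw [hww]; simp)
          (by rw [hnull y hy hjy]; simp) h0 hw0
        exact hne c hc
      obtain ⟨v, hv, hjv, hwv⟩ : ∃ v ∈ perp (Set.range f), IsJointEigenvector H v ∧
          hform n w v = 2 :=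
        ⟨(2 / hform n w y) • y, Submodule.smul_mem _ _ hy, hjy.smul _, by
          rw [hform_smul_right, div_mul_cancel₀ _ hwy]⟩
      have hvw : hform n v w = 2 := by rw [← conj_hform, hwv, conj_two]
      obtain ⟨ε, g, hg⟩ := exists_conj_le_hyperbolicGroup (H := H) (v := v) (w := w) hf
        (fun i => hv _ ⟨i, rfl⟩) (fun i => hw _ ⟨i, rfl⟩) (hnull v hv hjv) hww hwv (by
          intro x hfx hvx hwx
          refine eq_zero_of_mem_perp hH (S := insert v (insert w (Set.range f))) ?_ ?_ ?_
          · rintro z (rfl | rfl | hz)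
            exacts [hjv, hjw, hJ z hz]
          · intro z hz hj
            obtain ⟨c, rfl⟩ := exists_smul_of_hform_nonneg (by rw [hww]; simp)
              (hmax' z (fun u hu => hz u (Set.mem_insert_of_mem _ (Set.mem_insert_of_mem _ hu))) hj)
              (hz w (Set.mem_insert_of_mem _ (Set.mem_insert _ _))) hw0
            have h1 := hz v (Set.mem_insert _ _)
            rw [hform_smul_right, hvw, mul_eq_zero] at h1
            rw [h1.resolve_right two_ne_zero, zero_smul]
          · rintro z (rfl | rfl | ⟨i, rfl⟩)
            exacts [hvx, hwx, hfx i]) hJf hjv hjw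
      exact ⟨g, Or.inr (Or.inl ⟨k, ε, hg⟩)⟩

end BallRestriction
end

noncomputable section

namespace BallRestriction

/-! ## Maximality of the model groups -/

lemma expc_half : expc ((1 / 2 : ℝ) : UnitAddCircle) = -1 := by
  rw [expc_coe, ← Complex.exp_pi_mul_I]
  congr 1
  push_cast
  ring

lemma OrbitModel.abelian {n : ℕ} {z₀ : Ball n} {Q : Type} [AddCommGroup Q] [TopologicalSpace Q]
    (m : OrbitModel z₀ Q) {H : Subgroup (SU n)}
    (hH : ∀ g, g ∈ H ↔ ∃ p : Q × UnitAddCircle, toMat g = expc p.2 • m.core p.1) :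
    ∀ x ∈ H, ∀ y ∈ H, x * y = y * x := by
  intro x hx y hy
  obtain ⟨p, hp⟩ := (hH x).mp hx
  obtain ⟨q, hq⟩ := (hH y).mp hy
  apply toMat_ext
  rw [toMat_mul, toMat_mul, hp, hq, m.mat_mul, m.mat_mul, add_comm p.2, add_comm p.1]

/-- Every core matrix becomes an element of the group after multiplication by a scalar, and scalars
do not affect commutation; so maximality reduces to the centraliser of the cores in the unitary
group of the form. -/
lemma OrbitModel.isMaximalAbelian {n : ℕ} {z₀ : Ball n} {Q : Type} [AddCommGroup Q]
    [TopologicalSpace Q] (m : OrbitModel z₀ Q) {H : Subgroup (SU n)}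
    (hH : ∀ g, g ∈ H ↔ ∃ p : Q × UnitAddCircle, toMat g = expc p.2 • m.core p.1)
    (hc : ∀ A : Mat n, A * J n * A.conjTranspose = J n → (∀ q, A * m.core q = m.core q * A) →
      ∃ p : Q × UnitAddCircle, A = expc p.2 • m.core p.1) : IsMaximalAbelian H := by
  refine ⟨m.abelian hH, fun K hK hHK g hg => (hH g).mpr (hc _ g.2 fun q => ?_)⟩
  obtain ⟨x, hx⟩ := m.exists_cover q
  have h1 := congrArg toMat (hK g hg _ (hHK ((hH _).mpr ⟨(q, x), m.toMat_elt q x hx⟩)))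
  rw [toMat_mul, toMat_mul, m.toMat_elt, Matrix.mul_smul, Matrix.smul_mul] at h1
  exact smul_right_injective _ (expc_ne_zero x) h1

lemma submatrix_J_symm {n : ℕ} {β : Type} [Fintype β] [DecidableEq β] (ε : β ≃ Fin n) {A : Mat n}
    (h : A * J n * A.conjTranspose = J n) :
    A.submatrix (homogEquiv ε).symm (homogEquiv ε).symm *
        Matrix.diagonal (Sum.elim (fun _ => -1) (fun _ => 1)) *
        (A.submatrix (homogEquiv ε).symm (homogEquiv ε).symm).conjTranspose =
      Matrix.diagonal (Sum.elim (fun _ => -1) (fun _ => 1)) := by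
  have hJ : (Matrix.diagonal (Sum.elim (fun _ => -1) (fun _ => 1)) :
      Matrix (β ⊕ Unit) (β ⊕ Unit) ℂ) =
      (J n).submatrix (homogEquiv ε).symm (homogEquiv ε).symm := by
    rw [J, Matrix.submatrix_diagonal_equiv]
    congr 1
    ext (i | i) <;> rfl
  rw [hJ, Matrix.conjTranspose_submatrix, Matrix.submatrix_mul_equiv, Matrix.submatrix_mul_equiv, h]

lemma submatrix_commute {n : ℕ} {β : Type} [Fintype β] [DecidableEq β] (ε : β ≃ Fin n) {A : Mat n}
    {B : Matrix (β ⊕ Unit) (β ⊕ Unit) ℂ}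
    (h : A * B.submatrix (homogEquiv ε) (homogEquiv ε) =
      B.submatrix (homogEquiv ε) (homogEquiv ε) * A) :
    A.submatrix (homogEquiv ε).symm (homogEquiv ε).symm * B =
      B * A.submatrix (homogEquiv ε).symm (homogEquiv ε).symm := by
  have h1 := congrArg (fun C : Mat n => C.submatrix (homogEquiv ε).symm (homogEquiv ε).symm) h
  simp only [← Matrix.submatrix_mul_equiv _ _ _ (homogEquiv ε).symm, Matrix.submatrix_submatrix,
    Equiv.self_comp_symm, Matrix.submatrix_id_id] at h1
  exact h1

lemma eq_submatrix_symm {n : ℕ} {β : Type} (ε : β ≃ Fin n) {A : Mat n}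
    {B : Matrix (β ⊕ Unit) (β ⊕ Unit) ℂ} {c : ℂ}
    (h : A.submatrix (homogEquiv ε).symm (homogEquiv ε).symm = c • B) :
    A = c • B.submatrix (homogEquiv ε) (homogEquiv ε) := by
  have h1 := congrArg (fun C => C.submatrix (homogEquiv ε) (homogEquiv ε)) h
  rw [Matrix.submatrix_submatrix, Equiv.symm_comp_self, Matrix.submatrix_id_id] at h1
  exact h1

lemma entry_eq_zero_of_commute {κ : Type*} [Fintype κ] [DecidableEq κ] {A : Matrix κ κ ℂ}
    {d : κ → ℂ} (h : A * Matrix.diagonal d = Matrix.diagonal d * A) {a b : κ} (hab : d a ≠ d b) :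
    A a b = 0 := by
  have h1 := congrFun (congrFun h a) b
  rw [Matrix.mul_diagonal, Matrix.diagonal_mul, mul_comm, ← sub_eq_zero, ← sub_mul,
    mul_eq_zero] at h1
  exact h1.resolve_left (sub_ne_zero.mpr hab.symm)

lemma expc_single_half {m : ℕ} (i j : Fin m) :
    expc ((Pi.single i ((1 / 2 : ℝ) : UnitAddCircle) : Fin m → UnitAddCircle) j) =
      if j = i then -1 else 1 := by
  split_ifs with h
  · rw [h, Pi.single_eq_same, expc_half]
  · rw [Pi.single_eq_of_ne h, expc_zero]

lemma norm_eq_one_of_mul_conj {z : ℂ} (h : z * conj z = 1) : ‖z‖ = 1 := by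
  rw [mul_conj, normSq_eq_norm_sq] at h
  have h1 : ‖z‖ ^ 2 = 1 := by exact_mod_cast h
  nlinarith [norm_nonneg z]

theorem isMaximalAbelian_ellipticGroup (n : ℕ) : IsMaximalAbelian (ellipticGroup n) := by
  refine (ellipticModel n).isMaximalAbelian (fun g => Iff.rfl) fun A hJ hc => ?_
  have h0 : ∀ a b, a ≠ b → ∀ i : Fin n, a = .inl i ∨ b = .inl i → A a b = 0 := by
    intro a b hab i hi
    refine entry_eq_zero_of_commute (hc (Pi.single i ((1 / 2 : ℝ) : UnitAddCircle))) ?_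
    rcases hi with rfl | rfl
    · rcases b with j | j
      · have : j ≠ i := fun h => hab (by rw [h])
        simp only [Sum.elim_inl, expc_single_half, if_neg this, if_true]
        norm_num
      · simp only [Sum.elim_inl, Sum.elim_inr, expc_single_half, if_true]
        norm_num
    · rcases a with j | j
      · have : j ≠ i := fun h => hab (by rw [h])
        simp only [Sum.elim_inl, expc_single_half, if_neg this, if_true]
        norm_num
      · simp only [Sum.elim_inl, Sum.elim_inr, expc_single_half, if_true]
        norm_num
  have hd : A = Matrix.diagonal fun a => A a a := by
    ext a b
    by_cases hab : a = b
    · rw [hab, Matrix.diagonal_apply_eq]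
    · rw [Matrix.diagonal_apply_ne _ hab]
      rcases a with i | i
      · exact h0 _ _ hab i (Or.inl rfl)
      · rcases b with j | j
        · exact h0 _ _ hab j (Or.inr rfl)
        · exact absurd rfl hab
  have hn : ∀ a, ‖A a a‖ = 1 := by
    intro a
    have h1 := congrFun (congrFun hJ a) a
    rw [hd, J, Matrix.diagonal_conjTranspose, Matrix.diagonal_mul_diagonal,
      Matrix.diagonal_mul_diagonal, Matrix.diagonal_apply_eq, Matrix.diagonal_apply_eq] at h1
    apply norm_eq_one_of_mul_conj
    rcases a with i | i <;> simp at h1 <;> linear_combination h1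
  have hne : A (.inr ()) (.inr ()) ≠ 0 := norm_ne_zero_iff.mp (by rw [hn]; exact one_ne_zero)
  obtain ⟨a, ha⟩ := exists_expc_eq (hn (.inr ()))
  choose t ht using fun i : Fin n => exists_expc_eq
    (z := A (.inl i) (.inl i) / A (.inr ()) (.inr ())) (by rw [norm_div, hn, hn, div_one])
  refine ⟨(t, a), ?_⟩
  rw [hd]
  ext (i | i) (j | j)
  · simp [ellipticModel, coreE, Matrix.diagonal_apply, ht, ha, mul_div_cancel₀ _ hne]
  · simp [ellipticModel, coreE]
  · simp [ellipticModel, coreE]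
  · simp [ellipticModel, coreE, ha]

lemma coreH_zero_right {m : ℕ} (t : Fin m → UnitAddCircle) : coreH (t, 0) =
    Matrix.diagonal (Sum.elim (Sum.elim (fun i => expc (t i)) (fun _ => 1)) (fun _ => 1)) := by
  ext ((i | i) | i) ((j | j) | j) <;> simp [coreH, Matrix.diagonal_apply]

lemma coreN_zero_right {k l : ℕ} (t : Fin k → UnitAddCircle) :
    coreN ((t, 0) : QN k l) =
    Matrix.diagonal (Sum.elim (Sum.elim (fun i => expc (t i)) (fun _ => 1)) (fun _ => 1)) := by
  ext ((i | i | i) | i) ((j | j | j) | j) <;> simp [coreN, shift, Matrix.diagonal_apply]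

/-- The torus element equal to -1 in one circle coordinate and 1 elsewhere isolates that coordinate,
so a commuting matrix splits it off. -/
lemma entry_eq_zero_of_commute_single {m : ℕ} {β : Type} [Fintype β] [DecidableEq β]
    {A : Matrix ((Fin m ⊕ β) ⊕ Unit) ((Fin m ⊕ β) ⊕ Unit) ℂ}
    (h : ∀ t : Fin m → UnitAddCircle,
      A * Matrix.diagonal (Sum.elim (Sum.elim (fun i => expc (t i)) (fun _ => 1)) (fun _ => 1)) =
      Matrix.diagonal (Sum.elim (Sum.elim (fun i => expc (t i)) (fun _ => 1)) (fun _ => 1)) * A)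
    (i : Fin m) {a : (Fin m ⊕ β) ⊕ Unit} (ha : a ≠ .inl (.inl i)) :
    A a (.inl (.inl i)) = 0 ∧ A (.inl (.inl i)) a = 0 := by
  have h1 : (Sum.elim (Sum.elim (fun j => expc ((Pi.single i ((1 / 2 : ℝ) : UnitAddCircle) :
      Fin m → UnitAddCircle) j)) (fun _ => 1)) (fun _ => 1) : (Fin m ⊕ β) ⊕ Unit → ℂ) a = 1 := by
    rcases a with (j | j) | j
    · have : j ≠ i := fun h => ha (by rw [h])
      simp only [Sum.elim_inl, expc_single_half, if_neg this]
    · rfl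
    · rfl
  have h2 : (Sum.elim (Sum.elim (fun j => expc ((Pi.single i ((1 / 2 : ℝ) : UnitAddCircle) :
      Fin m → UnitAddCircle) j)) (fun _ => 1)) (fun _ => 1) : (Fin m ⊕ β) ⊕ Unit → ℂ)
      (.inl (.inl i)) = -1 := by
    simp only [Sum.elim_inl, expc_single_half, if_true]
  constructor <;> refine entry_eq_zero_of_commute
    (h (Pi.single i ((1 / 2 : ℝ) : UnitAddCircle))) ?_ <;> rw [h1, h2] <;> norm_num

lemma norm_entry_eq_one {β : Type} [Fintype β] [DecidableEq β]
    {A : Matrix (β ⊕ Unit) (β ⊕ Unit) ℂ}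
    (hJ : A * Matrix.diagonal (Sum.elim (fun _ => -1) (fun _ => 1)) * A.conjTranspose =
      Matrix.diagonal (Sum.elim (fun _ => -1) (fun _ => 1))) {i : β}
    (h0 : ∀ a, a ≠ .inl i → A (.inl i) a = 0) : ‖A (.inl i) (.inl i)‖ = 1 := by
  apply norm_eq_one_of_mul_conj
  have h1 := congrFun (congrFun hJ (.inl i)) (.inl i)
  rw [Matrix.mul_apply, Finset.sum_eq_single (.inl i)
    (fun b _ hb => by rw [Matrix.mul_diagonal, h0 b hb, zero_mul, zero_mul])
    (fun h => absurd (Finset.mem_univ _) h)] at h1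
  simp at h1
  exact h1

/-- A parametrisation of the pairs with `|p|² - |q|² = 1` and real quotient. -/
lemma exists_expc_mul_cosh_sinh {p q : ℂ} (h1 : p * conj p - q * conj q = 1)
    (h2 : q * conj p = p * conj q) :
    ∃ (a : UnitAddCircle) (s : ℝ), p = expc a * Real.cosh s ∧ q = expc a * Real.sinh s := by
  have hp : ‖p‖ ^ 2 = 1 + ‖q‖ ^ 2 := by
    rw [mul_conj, mul_conj, normSq_eq_norm_sq, normSq_eq_norm_sq] at h1
    have : ‖p‖ ^ 2 - ‖q‖ ^ 2 = 1 := by exact_mod_cast h1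
    linarith
  have hp0 : 0 < ‖p‖ := by
    rcases (norm_nonneg p).eq_or_lt with h | h
    · rw [← h] at hp
      nlinarith [sq_nonneg ‖q‖]
    · exact h
  have hpc : (‖p‖ : ℂ) ≠ 0 := ofReal_ne_zero.mpr hp0.ne'
  have hpp : p * conj p = (‖p‖ : ℂ) ^ 2 := mul_conj' p
  obtain ⟨a, ha⟩ := exists_expc_eq (z := p / ‖p‖) (by
    rw [norm_div, norm_real, norm_norm, div_self hp0.ne'])
  obtain ⟨x, hx⟩ : ∃ x : ℝ, (x : ℂ) = q * conj p := by
    have : conj (q * conj p) = q * conj p := by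
      rw [map_mul, conj_conj, mul_comm, h2]
    obtain ⟨x, hx⟩ := conj_eq_iff_real.mp this
    exact ⟨x, hx.symm⟩
  have hx2 : (x / ‖p‖) ^ 2 = ‖q‖ ^ 2 := by
    have h3 : |x| = ‖q‖ * ‖p‖ := by
      rw [← Real.norm_eq_abs, ← norm_real, hx, norm_mul, norm_conj]
    rw [div_pow, ← sq_abs x, h3, mul_pow, mul_div_cancel_right₀ _ (by positivity)]
  refine ⟨a, Real.arsinh (x / ‖p‖), ?_, ?_⟩
  · rw [Real.cosh_arsinh, hx2, ← hp, Real.sqrt_sq hp0.le, ha, div_mul_cancel₀ _ hpc]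
  · rw [Real.sinh_arsinh, ha, ofReal_div, hx]
    field_simp
    linear_combination -q * hpp

/-- The torus splits off its coordinates. Commuting with the single element s = 1 forces the
remaining block to be symmetric with equal diagonal entries, and the form then makes it a scalar
times a hyperbolic rotation. -/
theorem isMaximalAbelian_hyperbolicGroup {n m : ℕ} (ε : Fin m ⊕ Unit ≃ Fin n) :
    IsMaximalAbelian (hyperbolicGroup ε) := by
  refine (hyperbolicModel ε).isMaximalAbelian (fun g => Iff.rfl) fun A hJ hc => ?_
  suffices ∃ p : QH m × UnitAddCircle,
      A.submatrix (homogEquiv ε).symm (homogEquiv ε).symm = expc p.2 • coreH p.1 by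
    obtain ⟨p, hp⟩ := this
    exact ⟨p, eq_submatrix_symm ε hp⟩
  replace hJ := submatrix_J_symm ε hJ
  replace hc := fun q => submatrix_commute ε (hc q)
  generalize A.submatrix (homogEquiv ε).symm (homogEquiv ε).symm = B at hJ hc
  have h0 := fun i => @entry_eq_zero_of_commute_single _ _ _ _ B
    (fun t => by rw [← coreH_zero_right]; exact hc _) i
  have e1 := congrFun (congrFun (hc (0, 1)) (.inl (.inr ()))) (.inl (.inr ()))
  have e2 := congrFun (congrFun (hc (0, 1)) (.inl (.inr ()))) (.inr ())
  have hs : Complex.sinh 1 ≠ 0 := by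
    rw [← ofReal_one, ← ofReal_sinh]
    exact_mod_cast (Real.sinh_pos_iff.mpr one_pos).ne'
  simp [Matrix.mul_apply, Fintype.sum_sum_type, coreH] at e1 e2
  have hpr : B (.inl (.inr ())) (.inr ()) = B (.inr ()) (.inl (.inr ())) :=
    mul_right_cancel₀ hs (by linear_combination e1)
  have hpp : B (.inl (.inr ())) (.inl (.inr ())) = B (.inr ()) (.inr ()) :=
    mul_right_cancel₀ hs (by linear_combination e2)
  have hz : ∀ i, B (.inr ()) (.inl (.inl i)) = 0 := fun i => (h0 i (by simp)).1
  have hz' : ∀ i, B (.inl (.inr ())) (.inl (.inl i)) = 0 := fun i => (h0 i (by simp)).1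
  have j1 := congrFun (congrFun hJ (.inr ())) (.inr ())
  have j2 := congrFun (congrFun hJ (.inl (.inr ()))) (.inr ())
  simp [Matrix.mul_apply, Fintype.sum_sum_type, Matrix.diagonal_apply, hz, hz'] at j1 j2
  rw [hpp, hpr] at j2
  obtain ⟨a, s, hp, hq⟩ := exists_expc_mul_cosh_sinh
    (p := B (.inr ()) (.inr ())) (q := B (.inr ()) (.inl (.inr ())))
    (by linear_combination j1) (by linear_combination j2)
  choose t ht using fun i => exists_expc_eq (z := B (.inl (.inl i)) (.inl (.inl i)) / expc a) (by
    rw [norm_div, norm_expc, div_one, norm_entry_eq_one hJ fun b hb => (h0 i hb).2])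
  refine ⟨((t, s), a), ?_⟩
  have hz1 : ∀ i j, i ≠ j → B (.inl (.inl i)) (.inl (.inl j)) = 0 := fun i j hj =>
    (h0 i (by simpa using hj.symm)).2
  have hz2 : ∀ i, B (.inl (.inl i)) (.inl (.inr ())) = 0 := fun i => (h0 i (by simp)).2
  have hz3 : ∀ i, B (.inl (.inl i)) (.inr ()) = 0 := fun i => (h0 i (by simp)).2
  ext ((i | i) | i) ((j | j) | j)
  · by_cases h : i = j
    · subst h
      simp [coreH, ht, mul_div_cancel₀ _ (expc_ne_zero a)]
    · simp [coreH, h, hz1 i j h]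
  · simp [coreH, hz2]
  · simp [coreH, hz3]
  · simp [coreH, hz']
  · simpa [coreH, hpp] using hp
  · simpa [coreH, hpr] using hq
  · simp [coreH, hz]
  · simpa [coreH] using hq
  · simpa [coreH] using hp

/-- The hypotheses are form relations between rows of a commuting matrix. Half the difference of the
first two gives |χ| = 1, the third makes γ_j conj(χ) imaginary and defines b, and then twice the
real part of r conj(χ) is |b|²; its imaginary part is free and defines s. -/
lemma exists_expc_mul_shift {k l : ℕ} {χ r : ℂ} {γ : Fin l → ℂ}
    (h1 : -(r * conj r) - ∑ j, γ j * conj (γ j) + (χ + r) * conj (χ + r) = 1)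
    (h2 : -((χ - r) * conj (χ - r)) - ∑ j, γ j * conj (γ j) + r * conj r = -1)
    (h3 : ∀ j, χ * conj (γ j) - γ j * conj r + γ j * conj (χ + r) = 0) :
    ∃ (a : UnitAddCircle) (s : ℝ) (b : EuclideanSpace ℝ (Fin l)), χ = expc a ∧
      (∀ j, γ j = expc a * (-I * b j)) ∧
      ∀ {t : Fin k → UnitAddCircle}, r = expc a * shift ((t, s, b) : QN k l) := by
  simp only [map_add, map_sub] at h1 h2 h3
  have hχ : χ * conj χ = 1 := by linear_combination (h1 - h2) / 2
  obtain ⟨a, ha⟩ := exists_expc_eq (norm_eq_one_of_mul_conj hχ)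
  have hγ : ∀ j, γ j = χ * (-I * ((-(γ j * conj χ).im : ℝ) : ℂ)) := by
    intro j
    have h4 : conj (γ j * conj χ) = -(γ j * conj χ) := by
      rw [map_mul, conj_conj]
      linear_combination h3 j
    have h5 : (γ j * conj χ).re = 0 := by
      have := congrArg re h4
      rw [conj_re, neg_re] at this
      linarith
    have h6 : γ j * conj χ = I * ((γ j * conj χ).im : ℂ) := by
      apply Complex.ext <;> simp only [I_mul_re, I_mul_im, ofReal_re, ofReal_im, h5, neg_zero]
    push_cast
    linear_combination χ * h6 - γ j * hχ
  let b : EuclideanSpace ℝ (Fin l) := WithLp.toLp 2 fun j => -(γ j * conj χ).im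
  have hsum : ∑ j, γ j * conj (γ j) = ((‖b‖ ^ 2 : ℝ) : ℂ) := by
    rw [EuclideanSpace.real_norm_sq_eq, ofReal_sum]
    refine Finset.sum_congr rfl fun j _ => ?_
    have h7 : b j = -(γ j * conj χ).im := rfl
    rw [h7]
    conv_lhs => rw [hγ j]
    generalize -(γ j * conj χ).im = y
    rw [map_mul, map_mul, map_neg, conj_I, conj_ofReal, ofReal_pow]
    linear_combination (y : ℂ) ^ 2 * hχ - (y : ℂ) ^ 2 * (χ * conj χ) * I_sq
  refine ⟨a, -2 * (r * conj χ).im, b, ha.symm, fun j => by rw [ha]; exact hγ j, fun {t} => ?_⟩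
  have h8 : r * conj χ = shift ((t, -2 * (r * conj χ).im, b) : QN k l) := by
    have h9 : 2 * (r * conj χ).re = ‖b‖ ^ 2 := by
      have : r * conj χ + conj (r * conj χ) = ((‖b‖ ^ 2 : ℝ) : ℂ) := by
        rw [← hsum, map_mul, conj_conj]
        linear_combination h1 - hχ
      have := congrArg re this
      rw [add_re, conj_re, ofReal_re] at this
      linarith
    rw [shift, ← h9]
    apply Complex.ext
    · simp
    · simp
  rw [ha, ← h8]
  linear_combination -r * hχ

/-- Besides the torus, it suffices to commute with one translation in s and the unit translations in
the coordinates of b. The linear relations so obtained leave three unknowns, a scalar, a shift and a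
vector, which the form turns into the parameters. -/
theorem isMaximalAbelian_nilpotentGroup {n k l : ℕ} (ε : Fin k ⊕ Fin l ⊕ Unit ≃ Fin n) :
    IsMaximalAbelian (nilpotentGroup ε) := by
  refine (nilpotentModel ε).isMaximalAbelian (fun g => Iff.rfl) fun A hJ hc => ?_
  suffices ∃ p : QN k l × UnitAddCircle,
      A.submatrix (homogEquiv ε).symm (homogEquiv ε).symm = expc p.2 • coreN p.1 by
    obtain ⟨p, hp⟩ := this
    exact ⟨p, eq_submatrix_symm ε hp⟩
  replace hJ := submatrix_J_symm ε hJ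
  replace hc := fun q => submatrix_commute ε (hc q)
  generalize A.submatrix (homogEquiv ε).symm (homogEquiv ε).symm = B at hJ hc
  have h0 := fun i => @entry_eq_zero_of_commute_single _ _ _ _ B
    (fun t => by rw [← coreN_zero_right]; exact hc _) i
  -- The value s = 2 is chosen so that the shift is a unit and can be cancelled.
  have hsh : shift ((0, 2, 0) : QN k l) = -I := by
    simp [shift]
    ring
  have c : ∀ a b, (B * coreN ((0, 2, 0) : QN k l)) a b = (coreN ((0, 2, 0) : QN k l) * B) a b :=
    fun a b => congrFun (congrFun (hc (0, 2, 0)) a) b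
  have c1 := c (.inl (.inr (.inr ()))) (.inl (.inr (.inr ())))
  have c2 := c (.inl (.inr (.inr ()))) (.inr ())
  have c3 := fun j => c (.inl (.inr (.inl j))) (.inr ())
  have c4 := fun j => c (.inr ()) (.inl (.inr (.inl j)))
  simp [Matrix.mul_apply, Fintype.sum_sum_type, coreN, hsh] at c1 c2 c3 c4
  let ej : Fin l → QN k l := fun j => (0, 0, EuclideanSpace.single j 1)
  have hsj : ∀ j, shift (ej j) = 1 / 2 := fun j => by simp [shift, ej]
  have hej : ∀ j i, ((ej j).2.2 i : ℂ) = if i = j then 1 else 0 := fun j i => by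
    simp [ej, apply_ite Complex.ofReal]
  have d : ∀ j a b, (B * coreN (ej j)) a b = (coreN (ej j) * B) a b :=
    fun j a b => congrFun (congrFun (hc (ej j)) a) b
  have d1 := fun i j => d j (.inl (.inr (.inl i))) (.inr ())
  have d2 := fun j => d j (.inr ()) (.inr ())
  simp [Matrix.mul_apply, Fintype.sum_sum_type, coreN, hsj, hej] at d1 d2
  set pp := B (.inl (.inr (.inr ()))) (.inl (.inr (.inr ()))) with hpp
  set pr := B (.inl (.inr (.inr ()))) (.inr ()) with hpr
  set rp := B (.inr ()) (.inl (.inr (.inr ()))) with hrp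
  set rr := B (.inr ()) (.inr ()) with hrr
  have e1 : pr = -rp := mul_left_cancel₀ I_ne_zero (by linear_combination -c1)
  have e2 : rr - rp = pp + rp := mul_left_cancel₀ I_ne_zero
    (by linear_combination -c2 - 2 * I * e1)
  have e3 : ∀ j, B (.inl (.inr (.inl j))) (.inl (.inr (.inr ()))) =
      B (.inl (.inr (.inl j))) (.inr ()) := fun j =>
    mul_left_cancel₀ I_ne_zero (by linear_combination c3 j)
  have e4 : ∀ j, B (.inl (.inr (.inr ()))) (.inl (.inr (.inl j))) =
      -B (.inr ()) (.inl (.inr (.inl j))) := fun j =>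
    mul_left_cancel₀ I_ne_zero (by linear_combination c4 j)
  have e5 : ∀ i j, B (.inl (.inr (.inl i))) (.inl (.inr (.inl j))) =
      if i = j then rr - rp else 0 := by
    intro i j
    have := d1 i j
    rw [e3] at this
    split_ifs at this ⊢ with h <;> refine mul_left_cancel₀ I_ne_zero ?_
    · linear_combination -this + I * e1
    · linear_combination -this
  have e6 : ∀ j, B (.inr ()) (.inl (.inr (.inl j))) = -B (.inl (.inr (.inl j))) (.inr ()) :=
    fun j => mul_left_cancel₀ I_ne_zero (by linear_combination -d2 j - 2⁻¹ * e1)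
  have hz : ∀ i, B (.inr ()) (.inl (.inl i)) = 0 := fun i => (h0 i (by simp)).1
  have hz' : ∀ i, B (.inl (.inr (.inr ()))) (.inl (.inl i)) = 0 := fun i => (h0 i (by simp)).1
  have hz'' : ∀ j i, B (.inl (.inr (.inl j))) (.inl (.inl i)) = 0 := fun j i =>
    (h0 i (by simp)).1
  have j1 := congrFun (congrFun hJ (.inr ())) (.inr ())
  have j2 := congrFun (congrFun hJ (.inl (.inr (.inr ())))) (.inl (.inr (.inr ())))
  have j3 := fun j => congrFun (congrFun hJ (.inl (.inr (.inl j)))) (.inr ())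
  simp [Matrix.mul_apply, Fintype.sum_sum_type, Matrix.diagonal_apply, hz, hz', hz'', e3, e4, e5, e6]
    at j1 j2 j3
  obtain ⟨a, s, b, hχ, hb, hr⟩ := exists_expc_mul_shift (χ := rr - rp) (r := rp)
    (γ := fun j => B (.inl (.inr (.inl j))) (.inr ()))
    (by rw [sub_add_cancel]; linear_combination j1)
    (by rw [show rr - rp - rp = pp by linear_combination e2]; rw [← hpr, e1, map_neg] at j2
        linear_combination j2)
    (fun j => by rw [sub_add_cancel]; linear_combination j3 j)
  choose t ht using fun i => exists_expc_eq (z := B (.inl (.inl i)) (.inl (.inl i)) / expc a) (by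
    rw [norm_div, norm_expc, div_one, norm_entry_eq_one hJ fun b hb => (h0 i hb).2])
  refine ⟨((t, s, b), a), ?_⟩
  have hr' : rp = expc a * shift ((t, s, b) : QN k l) := hr
  have hz1 : ∀ i j, i ≠ j → B (.inl (.inl i)) (.inl (.inl j)) = 0 := fun i j hj =>
    (h0 i (by simpa using hj.symm)).2
  have hz2 : ∀ i j, B (.inl (.inl i)) (.inl (.inr j)) = 0 := fun i j => (h0 i (by simp)).2
  have hz3 : ∀ i, B (.inl (.inl i)) (.inr ()) = 0 := fun i => (h0 i (by simp)).2
  ext ((i | i | i) | i) ((j | j | j) | j)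
  · by_cases h : i = j
    · subst h
      simp [coreN, ht, mul_div_cancel₀ _ (expc_ne_zero a)]
    · simp [coreN, h, hz1 i j h]
  · simp [coreN, hz2]
  · simp [coreN, hz2]
  · simp [coreN, hz3]
  · simp [coreN, hz'']
  · simp [coreN, e5, hχ]
  · simp [coreN, e3, hb]
  · simp [coreN, hb]
  · simp [coreN, hz']
  · simp [coreN, e4, e6, hb]
  · simp [coreN]
    linear_combination hχ - hr' - e2
  · simp [coreN]
    linear_combination e1 - hr'
  · simp [coreN, hz]
  · simp [coreN, e6, hb]
  · simp [coreN]
    linear_combination hr'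
  · simp [coreN]
    linear_combination hr' + hχ

/-- Inclusion becomes equality: the preimage of the model group under the conjugation is abelian and
contains H, hence is contained in H. -/
theorem exists_conj_eq_model {n : ℕ} {H : Subgroup (SU n)} (hH : IsMaximalAbelian H) :
    ∃ g : SU n, H.map (MulAut.conj g).toMonoidHom = ellipticGroup n ∨
      (∃ (m : ℕ) (ε : Fin m ⊕ Unit ≃ Fin n),
        H.map (MulAut.conj g).toMonoidHom = hyperbolicGroup ε) ∨
      ∃ (k l : ℕ) (ε : Fin k ⊕ Fin l ⊕ Unit ≃ Fin n),
        H.map (MulAut.conj g).toMonoidHom = nilpotentGroup ε := by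
  have key : ∀ (g : SU n) {K : Subgroup (SU n)}, IsMaximalAbelian K →
      H.map (MulAut.conj g).toMonoidHom ≤ K → H.map (MulAut.conj g).toMonoidHom = K := by
    intro g K hK h
    refine le_antisymm h ?_
    rw [Subgroup.map_le_iff_le_comap] at h
    have h1 : K.comap (MulAut.conj g).toMonoidHom ≤ H := hH.2 (fun x hx y hy =>
      (MulAut.conj g).injective (by
        rw [map_mul, map_mul]
        exact hK.1 _ hx _ hy)) h
    intro y hy
    obtain ⟨x, rfl⟩ := (MulAut.conj g).surjective y
    exact ⟨x, h1 hy, rfl⟩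
  obtain ⟨g, h | ⟨m, ε, h⟩ | ⟨k, l, ε, h⟩⟩ := exists_conj_le_model hH.1
  · exact ⟨g, Or.inl (key g (isMaximalAbelian_ellipticGroup n) h)⟩
  · exact ⟨g, Or.inr (Or.inl ⟨m, ε, key g (isMaximalAbelian_hyperbolicGroup ε) h⟩)⟩
  · exact ⟨g, Or.inr (Or.inr ⟨k, l, ε, key g (isMaximalAbelian_nilpotentGroup ε) h⟩)⟩

end BallRestriction
end

/-! ### The main theorem -/

theorem mainTheorem3 (n : ℕ) (hn : 1 ≤ n) (lam : ℝ) (hlam : (n : ℝ) < lam) :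
    -- the conjugacy classes of maximal abelian subgroups
    (IsMaximalAbelian (ellipticGroup n) ∧
      (∀ (m : ℕ) (ε : Fin m ⊕ Unit ≃ Fin n), IsMaximalAbelian (hyperbolicGroup ε)) ∧
      (∀ (k l : ℕ) (ε : Fin k ⊕ Fin l ⊕ Unit ≃ Fin n), IsMaximalAbelian (nilpotentGroup ε)) ∧
      ∀ H : Subgroup (SU n), IsMaximalAbelian H →
        ∃ g : SU n, H.map (MulAut.conj g).toMonoidHom = ellipticGroup n ∨
          (∃ (m : ℕ) (ε : Fin m ⊕ Unit ≃ Fin n),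
            H.map (MulAut.conj g).toMonoidHom = hyperbolicGroup ε) ∨
          ∃ (k l : ℕ) (ε : Fin k ⊕ Fin l ⊕ Unit ≃ Fin n),
            H.map (MulAut.conj g).toMonoidHom = nilpotentGroup ε) ∧
    -- the quasi-elliptic group
    (ExplicitRestriction lam (ellipticGroup n) (ellipticPoint n) (ellipticCover n) matE
        (fun _ => 1) (ellipticKernel n) Set.univ Set.univ ∧
      (∀ α : Fin n → ℕ, fourierE (ellipticKernel n lam) (fun i => (α i : ℤ)) =
        (((2 * n : ℝ) ^ (∑ i, α i))⁻¹ * (Real.Gamma (lam + ∑ i, α i) / Real.Gamma lam) *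
          (1 / ∏ i, ((α i).factorial : ℝ)) : ℝ)) ∧
      ∀ α : Fin n → ℤ, (∃ i, α i < 0) → fourierE (ellipticKernel n lam) α = 0) ∧
    -- the quasi-hyperbolic group
    (∀ (m : ℕ) (ε : Fin m ⊕ Unit ≃ Fin n),
      ExplicitRestriction lam (hyperbolicGroup ε) (basePoint ε) (hyperbolicCover n m) (matH ε)
        (fun q => Real.cosh q.2) (hyperbolicKernel m) (Set.Ioi 0) (Set.Ioi 0) ∧
      (∀ (α : Fin m → ℕ) (ξ : ℝ),
        fourierH (hyperbolicKernel m lam) (fun i => (α i : ℤ)) ξ =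
          ((2 ^ (lam - 1) / (√(2 * Real.pi) * (m : ℝ) ^ (∑ i, α i)) : ℝ) : ℂ) *
            (Complex.Gamma ((lam + (∑ i, α i : ℕ) + Complex.I * ξ) / 2) *
              Complex.Gamma ((lam + (∑ i, α i : ℕ) - Complex.I * ξ) / 2) / Real.Gamma lam) *
            (1 / ∏ i, ((α i).factorial : ℝ) : ℝ)) ∧
      ∀ (α : Fin m → ℤ) (ξ : ℝ), (∃ i, α i < 0) →
        fourierH (hyperbolicKernel m lam) α ξ = 0) ∧
    -- the quasi-parabolic, nilpotent and quasi-nilpotent groups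
    (∀ (k l : ℕ) (ε : Fin k ⊕ Fin l ⊕ Unit ≃ Fin n),
      ExplicitRestriction lam (nilpotentGroup ε) (basePoint ε) (nilpotentCover n k l) (matN ε)
        (fun q => 1 + shift q) (nilpotentKernel k l) (Set.Ioi (((l : ℝ) + 2) / 4))
        (Set.Ioi (((l : ℝ) + 2) / 2)) ∧
      (∀ (α : Fin k → ℕ) (y : ℝ) (ξ : EuclideanSpace ℝ (Fin l)), 0 < y →
        fourierN (nilpotentKernel k l lam) (fun i => (α i : ℤ)) y ξ =
          (√(2 * Real.pi) * 2 ^ lam / (Real.Gamma lam * (k : ℝ) ^ (∑ i, α i)) *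
            y ^ (lam + (∑ i, α i : ℕ) - 1) * (1 / (2 * y)) ^ ((l : ℝ) / 2) *
            Real.exp (-2 * y) * Real.exp (-‖ξ‖ ^ 2 / (4 * y)) *
            (1 / ∏ i, ((α i).factorial : ℝ)) : ℝ)) ∧
      ∀ (α : Fin k → ℤ) (y : ℝ) (ξ : EuclideanSpace ℝ (Fin l)), (y ≤ 0 ∨ ∃ i, α i < 0) →
        fourierN (nilpotentKernel k l lam) α y ξ = 0) ∧
    -- multiplicity-free restriction of the holomorphic discrete series
    ∃ π : Gtilde n →* (Bergman n lam ≃ₗᵢ[ℂ] Bergman n lam),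
      (∀ (g : Gtilde n) (F : Bergman n lam) (z : Ball n),
        Bergman.eval (π g F) z = Gtilde.j lam g⁻¹ z * Bergman.eval F (g⁻¹ • z)) ∧
      ∀ H : Subgroup (SU n), IsMaximalAbelian H →
        MultiplicityFree (π.comp (Htilde H).subtype) := by
  have hn' : Fact (1 ≤ n) := ⟨hn⟩
  have hlam' : Fact ((n : ℝ) < lam) := ⟨hlam⟩
  have h1n : (1 : ℝ) ≤ n := by exact_mod_cast hn
  have h1 : 1 < lam := h1n.trans_lt hlam
  have h0 : 0 < lam := one_pos.trans h1
  refine ⟨⟨isMaximalAbelian_ellipticGroup n, fun m ε => isMaximalAbelian_hyperbolicGroup ε,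
      fun k l ε => isMaximalAbelian_nilpotentGroup ε, fun H hH => exists_conj_eq_model hH⟩,
    ⟨elliptic_explicitRestriction n, fun α => fourierE_ellipticKernel h0 α,
      fun α hα => fourierE_ellipticKernel_of_neg h0 hα⟩,
    fun m ε => ⟨hyperbolic_explicitRestriction ε, fun α ξ => fourierH_hyperbolicKernel h0 α ξ,
      fun α ξ hα => fourierH_hyperbolicKernel_of_neg h0 ξ hα⟩,
    fun k l ε => ?_,
    Bergman.discreteSeries n lam, Bergman.eval_discreteSeries, fun H hH => ?_⟩
  · have hl : ((l : ℝ) + 2) / 2 < lam := half_add_two_lt ε hlam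
    exact ⟨nilpotent_explicitRestriction ε,
      fun α y ξ hy => fourierN_nilpotentKernel h1 hl α ξ hy,
      fun α y ξ h => fourierN_nilpotentKernel_of_nonpos h1 hl α y ξ h⟩
  · obtain ⟨g, h | ⟨m, ε, h⟩ | ⟨k, l, ε, h⟩⟩ := exists_conj_eq_model hH
    · exact multiplicityFree_of_conj g h (elliptic_explicitRestriction n).multiplicityFree
    · exact multiplicityFree_of_conj g h (hyperbolic_explicitRestriction ε).multiplicityFree
    · exact multiplicityFree_of_conj g h (nilpotent_explicitRestriction ε).multiplicityFree
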